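/- **Setting.** Let $l\ge 2$, $G=SO_o(1,l)$ (identity component of the group of real matrices of determinant one preserving $x_0y_0-x_1y_1-\dots-x_ly_l$), with Lie algebra $\mathfrak g$, Cartan involution $\theta X=JXJ$, $J=\mathrm{diag}(-1,1,\dots,1)$, Killing form $B(X,Y)=(l-1)\mathrm{Tr}(XY)$, inner product $B_\theta(X,Y)=-B(X,\theta Y)$. Let $K=\{1\}\times SO(l)$, $X=G/K$ (real hyperbolic space of dimension $l$), $H_0=E_{0l}+E_{l0}$, $a_t=\exp tH_0$, $A=\{a_t\}$, $A^+=\{a_t:t>0\}$, $M=Z_K(A)$ with Lie algebra $\mathfrak m$ and normalized Haar measure $dm$, $\mathfrak n=\{X\in\mathfrak g:[H_0,X]=X\}$, $\rho_0=\frac{l-1}{2}$, $H_1=H_0/\sqrt{2(l-1)}$. Elements of $\mathfrak g$ act on functions by $(Yf)(g)=\frac{d}{dt}|_{t=0}f(g\exp tY)$, and $\Omega=\sum_jQ_jQ^j$ is the Casimir operator ($(Q_j)$ a basis of $\mathfrak g$, $(Q^j)$ the dual basis for $B$). Functions on $X$ are right-$K$-invariant functions on $G$, and $m\cdot x=mx$.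 Let $\widehat M$ be the set of equivalence classes of irreducible representations $(\pi,V_\pi)$ of $M$, $d_\pi=\dim V_\pi$, $\chi_\pi=\mathrm{Tr}\,\pi$, $\check\pi$ the contragredient representation, and for $f\in C^\infty(X)$ $$(\chi_\pi*f)(x)=\int_Mf(m\cdot x)\chi_\pi(m^{-1})\,dm,\qquad f^\pi(x)=d_\pi\int_Mf(m\cdot x)\pi(m^{-1})\,dm .$$ Let $C^\infty(X)_{\check\pi}$ be the space of $f\in C^\infty(X)$ for which the span of $\{f(m^{-1}\,\cdot):m\in M\}$ is a direct sum of finitely many copies of $\check\pi$. Let $\Gamma\subset G$ be a discrete, cocompact, torsion-free subgroup, $1\ne\gamma\in\Gamma$, and let $\varphi\in C^\infty(\Gamma\backslash G/K)$ satisfy $\Omega\varphi=\mu\varphi$, $\mu=-\frac1{4\rho_0}(\rho_0^2+r^2)$, $r\in\mathbb C$. Let $\gamma_0\in\Gamma$ be the primitive element of $\gamma$: $\gamma=\gamma_0^{n}$, $n\geq 1$, and $\gamma_0$ generates the centralizer of $\gamma$ in $\Gamma$. Let $\gamma_0$ be conjugate in $G$ to an element of $a_{L_0}M$, $L_0>0$,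 and $\alpha_\gamma\gamma\alpha_\gamma^{-1}=a_\gamma m_\gamma\in A^+M$ with $\alpha_\gamma\in G$. The centralizer of $\delta=a_\gamma m_\gamma$ in $G$ is $G_\delta=AM_{m_\gamma}$, with $M_{m_\gamma}$ the centralizer of $m_\gamma$ in $M$, and the weight is $$I_\gamma(\varphi)(x)=\int_{\langle\alpha_\gamma\gamma_0\alpha_\gamma^{-1}\rangle\backslash G_\delta}\varphi(\alpha_\gamma^{-1}yx)\,dy=\int_{M_{m_\gamma}}\int_0^{L_0}\varphi(\alpha_\gamma^{-1}a_tzx)\,dt\,dz ,$$ where $dz$ is the normalized Haar measure. Put $\int_{c_{\gamma_0}}f=\int_0^{\sqrt{2(l-1)}L_0}f(\alpha_\gamma^{-1}\exp tH_1)\,dt$. **Theorem.** (i) With $I=I_\gamma(\varphi)$, $$I=\sum_{\pi\in\widehat M}d_\pi(\chi_\pi*I),$$ with absolute convergence in $C^\infty(X)$. For each $\pi$, $d_\pi(\chi_\pi*I)=\mathrm{Tr}(I^\pi)\in C^\infty(X)_{\check\pi}$ and $\Omega\big(d_\pi(\chi_\pi*I)\big)=\mu\, d_\pi(\chi_\pi*I)$.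 (ii) Let $X_1\in\mathfrak n$, $B_\theta(X_1,X_1)=1$, $S=\exp\mathbb R^+X_1$, $F(s)=d_\pi(\chi_\pi*I)(\exp sX_1)$, and let $Z_M(S)$ be the centralizer of $S$ in $M$. If $V_\pi^{Z_M(S)}=0$, then $F(s)=0$ for $s>0$. Otherwise let $Z_2,\dots,Z_{l-1}$ lie in the orthogonal complement in $\mathfrak m$ of the centralizer of $X_1$, with $[Z_j,X_1]$ orthonormal. Then $\sum_j\pi(Z_j)^2$ acts on $V_\pi^{Z_M(S)}$ as a real scalar $E\le0$, and for $s>0$ $$\Big(\big(\tfrac{s^2}{2(l-1)}+2\big)\tfrac{d^2}{ds^2}+\big((\tfrac1{2(l-1)}+\tfrac12)s+\tfrac{2(l-2)}s\big)\tfrac d{ds}+\tfrac{2E}{s^2}-\mu\Big)F(s)=0 .$$ Let $a=\frac12(\rho_0+ir)$, $b=\frac12(\rho_0-ir)$, $d=E/4$, $w=\sqrt{\frac{(1-\rho_0)^2}4-d}$, $p=\frac{1-\rho_0}2+w$. If $l\ge3$ and $V_\pi^{Z_M(S)}\neq 0$, then $2p\in\mathbb N_0$, and for $s>0$ $$F(2\sqrt{l-1}\,s)=\frac{(4(l-1))^p}{(2p)!}\,d_\pi\big(X_1^{2p}(\chi_\pi*I)\big)(e)\cdot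 s^{2p}\cdot{}_2F_1(a+p,b+p,1+2w;-s^2).$$ If $l=2$, then for $s>0$ $$F(2s)=\tfrac1{\sqrt2}\Big(\int_{c_{\gamma_0}}\varphi\Big)\,{}_2F_1(a,b,\tfrac12;-s^2)+\sqrt2\Big(\int_{c_{\gamma_0}}X_1\varphi\Big)\,s\;{}_2F_1(a+\tfrac12,b+\tfrac12,\tfrac32;-s^2).$$ Here ${}_2F_1$ is the analytic continuation of the hypergeometric series to $\mathbb C\setminus[1,\infty)$. (iii) Part (i) also holds for $I(x)=\int_0^{L_0}\varphi(\alpha_\gamma^{-1}a_tx)\,dt$, and so does part (ii) if for every $x$ the integrand $\varphi(\alpha_\gamma^{-1}ax)$ depends only on the class of $a$ in $A/\langle a_{L_0}\rangle$, i.e. if $I(x)=\int_{A/\langle a_{L_0}\rangle}\varphi(\alpha_\gamma^{-1}ax)\,da$. -/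

import Mathlib

open MeasureTheory

noncomputable section

namespace RealHyp

/-! ### The group `G = SO_o(1,l)`, its Lie algebra and its subgroups -/

/-- Real matrices of size `l + 1`, with rows and columns `0, …, l`. -/
abbrev Mat (l : ℕ) : Type := Matrix (Fin (l + 1)) (Fin (l + 1)) ℝ

/-- `J = diag(-1, 1, …, 1)`; the Cartan involution is `θ X = J X J`. -/
def J (l : ℕ) : Mat l := Matrix.diagonal (fun i => if i = 0 then -1 else 1)

lemma J_mul_J (l : ℕ) : J l * J l = 1 := by
  rw [J, Matrix.diagonal_mul_diagonal, ← Matrix.diagonal_one]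
  congr 1
  funext i
  split_ifs <;> norm_num

lemma J_transpose (l : ℕ) : (J l).transpose = J l := Matrix.diagonal_transpose _

/-- `SO(1,l)`: the matrices of determinant one that preserve the form given by `J`. -/
def SO1 (l : ℕ) : Subgroup (GL (Fin (l + 1)) ℝ) where
  carrier := {g | (g : Mat l).transpose * J l * (g : Mat l) = J l ∧ (g : Mat l).det = 1}
  one_mem' := by simp
  mul_mem' := by
    rintro g h ⟨hg, hg'⟩ ⟨hh, hh'⟩
    refine ⟨?_, by simp [hg', hh']⟩
    calc ((g * h : GL (Fin (l + 1)) ℝ) : Mat l).transpose * J l * ((g * h : GL _ ℝ) : Mat l)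
        = (h : Mat l).transpose * ((g : Mat l).transpose * J l * (g : Mat l)) * (h : Mat l) := by
          simp only [Units.val_mul, Matrix.transpose_mul, Matrix.mul_assoc]
      _ = J l := by rw [hg, hh]
  inv_mem' := by
    rintro g ⟨hg, hg'⟩
    have h1 : (g : Mat l) * ((g⁻¹ : GL (Fin (l + 1)) ℝ) : Mat l) = 1 := by
      rw [← Units.val_mul, mul_inv_cancel, Units.val_one]
    refine ⟨?_, ?_⟩
    · calc ((g⁻¹ : GL (Fin (l + 1)) ℝ) : Mat l).transpose * J l * ((g⁻¹ : GL _ ℝ) : Mat l)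
          = ((g⁻¹ : GL (Fin (l + 1)) ℝ) : Mat l).transpose *
              ((g : Mat l).transpose * J l * (g : Mat l)) * ((g⁻¹ : GL _ ℝ) : Mat l) := by rw [hg]
        _ = ((g : Mat l) * ((g⁻¹ : GL (Fin (l + 1)) ℝ) : Mat l)).transpose * J l *
              ((g : Mat l) * ((g⁻¹ : GL (Fin (l + 1)) ℝ) : Mat l)) := by
            simp only [Matrix.transpose_mul, Matrix.mul_assoc]
        _ = J l := by rw [h1]; simp
    · have h2 := congrArg Matrix.det h1
      rw [Matrix.det_mul, hg', one_mul, Matrix.det_one] at h2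
      exact h2

/-- `G = SO_o(1,l)`: the connected component of the identity in `SO(1,l)`. -/
def SOo (l : ℕ) : Subgroup (GL (Fin (l + 1)) ℝ) :=
  (Subgroup.connectedComponentOfOne (SO1 l)).map (SO1 l).subtype

/-- `G` and its subgroups carry their Borel σ-algebras. -/
instance (l : ℕ) : MeasurableSpace (SOo l) := borel _

instance (l : ℕ) : BorelSpace (SOo l) := ⟨rfl⟩

/-- The underlying matrix of an element of `G`. -/
def mat {l : ℕ} (g : SOo l) : Mat l := ((g : GL (Fin (l + 1)) ℝ) : Mat l)

/-- The Lie algebra `𝔤 = 𝔰𝔬(1,l)`: the matrices `X` with `Xᵀ J = -J X`. -/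
def so1 (l : ℕ) : Submodule ℝ (Mat l) := skewAdjointMatricesSubmodule (J l)

lemma mem_so1 {l : ℕ} {X : Mat l} : X ∈ so1 l ↔ X.transpose * J l = J l * (-X) :=
  mem_skewAdjointMatricesSubmodule ..

/-- The exponential of a matrix as an invertible matrix. -/
def expGL {l : ℕ} (X : Mat l) : GL (Fin (l + 1)) ℝ where
  val := NormedSpace.exp X
  inv := NormedSpace.exp (-X)
  val_inv := by
    rw [← Matrix.exp_add_of_commute _ _ (Commute.neg_right (Commute.refl X))]; simp
  inv_val := by
    rw [← Matrix.exp_add_of_commute _ _ (Commute.neg_left (Commute.refl X))]; simp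

lemma exp_preserves {l : ℕ} {X : Mat l} (hX : X ∈ so1 l) :
    (NormedSpace.exp X).transpose * J l * NormedSpace.exp X = J l := by
  have hJ : IsUnit (J l) := IsUnit.of_mul_eq_one _ (J_mul_J l)
  have hJi : (J l)⁻¹ = J l := Matrix.inv_eq_right_inv (J_mul_J l)
  have h1 : X.transpose = J l * (-X) * (J l)⁻¹ := by
    rw [← mem_so1.1 hX, hJi, Matrix.mul_assoc, J_mul_J, Matrix.mul_one]
  rw [← Matrix.exp_transpose, h1, Matrix.exp_conj _ _ hJ, hJi]
  calc J l * NormedSpace.exp (-X) * J l * J l * NormedSpace.exp X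
      = J l * (NormedSpace.exp (-X) * (J l * J l) * NormedSpace.exp X) := by
        simp only [Matrix.mul_assoc]
    _ = J l := by
        rw [J_mul_J, Matrix.mul_one,
          ← Matrix.exp_add_of_commute _ _ (Commute.neg_left (Commute.refl X))]
        simp

lemma exp_det {l : ℕ} {X : Mat l} (hX : X ∈ so1 l) : (NormedSpace.exp X).det = 1 := by
  have hY : (2⁻¹ : ℝ) • X ∈ so1 l := (so1 l).smul_mem _ hX
  have hJ : (J l).det ≠ 0 := by
    have h := congrArg Matrix.det (J_mul_J l)
    rw [Matrix.det_mul, Matrix.det_one] at h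
    intro h0
    rw [h0] at h
    norm_num at h
  have h := congrArg Matrix.det (exp_preserves hY)
  rw [Matrix.det_mul, Matrix.det_mul, Matrix.det_transpose] at h
  have h2 : (NormedSpace.exp ((2⁻¹ : ℝ) • X)).det * (NormedSpace.exp ((2⁻¹ : ℝ) • X)).det = 1 := by
    apply mul_right_cancel₀ hJ
    linarith
  have h3 : X = (2⁻¹ : ℝ) • X + (2⁻¹ : ℝ) • X := by
    rw [← add_smul]; norm_num
  rw [h3, Matrix.exp_add_of_commute _ _ (Commute.refl _), Matrix.det_mul, h2]

lemma expGL_mem_SO1 {l : ℕ} {X : Mat l} (hX : X ∈ so1 l) : expGL X ∈ SO1 l :=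
  ⟨exp_preserves hX, exp_det hX⟩

lemma continuous_expGL (l : ℕ) : Continuous (fun X : Mat l => expGL X) := by
  have h : Continuous (fun X : Mat l => NormedSpace.exp X) := by
    open scoped Matrix.Norms.Operator in exact NormedSpace.exp_continuous
  exact Units.continuous_iff.2 ⟨h, h.comp continuous_neg⟩

lemma expGL_mem {l : ℕ} {X : Mat l} (hX : X ∈ so1 l) : expGL X ∈ SOo l := by
  let c : ℝ → SO1 l := fun t => ⟨expGL (t • X), expGL_mem_SO1 ((so1 l).smul_mem t hX)⟩
  have hc : Continuous c := by
    apply Continuous.subtype_mk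
    exact (continuous_expGL l).comp (continuous_id.smul continuous_const)
  have h0 : c 0 = 1 := by
    apply Subtype.ext
    apply Units.ext
    simp [c, expGL]
  refine ⟨c 1, ?_, ?_⟩
  · have hp : IsPreconnected (Set.range c) := isPreconnected_range hc
    exact hp.subset_connectedComponent ⟨0, h0⟩ ⟨1, rfl⟩
  · simp [c]

/-- The exponential map `exp : 𝔤 → G`. -/
def expG {l : ℕ} (X : so1 l) : SOo l := ⟨expGL (X : Mat l), expGL_mem X.2⟩

/-- The elements `(E_ij - E_ji) J` of `𝔤`: for `1 ≤ j` the boosts `E_0j + E_j0` (with `i = 0`), for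
`1 ≤ i, j` the rotations `E_ij - E_ji`. -/
def gen {l : ℕ} (i j : Fin (l + 1)) : so1 l :=
  ⟨(Matrix.single i j 1 - Matrix.single j i 1) * J l, by
    rw [mem_so1, Matrix.transpose_mul, J_transpose, Matrix.transpose_sub, Matrix.transpose_single,
      Matrix.transpose_single, Matrix.mul_assoc, ← Matrix.neg_mul, neg_sub]⟩

/-- `H_0 = E_0l + E_l0`, which spans `𝔞`; the positive root `α` has `α(H_0) = 1`. -/
def H0 (l : ℕ) : so1 l := gen 0 (Fin.last l)

/-- `a_t = exp (t H_0)`; the group `A` is `{a_t : t ∈ ℝ}`. -/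
def a {l : ℕ} (t : ℝ) : SOo l := expG (t • H0 l)

/-- The unit vector `H_1 = H_0 / √(2(l-1))` of `𝔞`. -/
def H1 (l : ℕ) : so1 l := (Real.sqrt (2 * ((l : ℝ) - 1)))⁻¹ • H0 l

/-- `K`: the fixed points in `G` of the Cartan involution, i.e. `{1} × SO(l)`. -/
def K (l : ℕ) : Subgroup (SOo l) where
  carrier := {k | J l * mat k = mat k * J l}
  one_mem' := by simp [mat]
  mul_mem' := by
    intro g h hg hh
    change J l * mat (g * h) = mat (g * h) * J l
    have e : mat (g * h) = mat g * mat h := rfl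
    rw [e, ← Matrix.mul_assoc, show J l * mat g = mat g * J l from hg, Matrix.mul_assoc,
      show J l * mat h = mat h * J l from hh, Matrix.mul_assoc]
  inv_mem' := by
    intro g hg
    change J l * mat g⁻¹ = mat g⁻¹ * J l
    have e1 : mat g * mat g⁻¹ = 1 := by
      change mat (g * g⁻¹) = 1
      rw [mul_inv_cancel]; rfl
    have e2 : mat g⁻¹ * mat g = 1 := by
      change mat (g⁻¹ * g) = 1
      rw [inv_mul_cancel]; rfl
    calc J l * mat g⁻¹ = mat g⁻¹ * mat g * (J l * mat g⁻¹) := by rw [e2, Matrix.one_mul]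
      _ = mat g⁻¹ * (mat g * J l) * mat g⁻¹ := by simp only [Matrix.mul_assoc]
      _ = mat g⁻¹ * (J l * mat g) * mat g⁻¹ := by
          rw [show J l * mat g = mat g * J l from hg]
      _ = mat g⁻¹ * J l * (mat g * mat g⁻¹) := by simp only [Matrix.mul_assoc]
      _ = mat g⁻¹ * J l := by rw [e1, Matrix.mul_one]

/-- `M = Z_K(A)`. -/
def M (l : ℕ) : Subgroup (SOo l) := K l ⊓ Subgroup.centralizer (Set.range (a : ℝ → SOo l))

/-- `𝔫 = 𝔤_α = {X ∈ 𝔤 : [H_0, X] = X}`; `N = exp 𝔫`. -/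
def nLie (l : ℕ) : Submodule ℝ (so1 l) where
  carrier := {X | (H0 l : Mat l) * X - X * (H0 l : Mat l) = X}
  zero_mem' := by simp
  add_mem' := by
    intro X Y hX hY
    simp only [Set.mem_ofPred_eq, Submodule.coe_add] at *
    rw [Matrix.mul_add, Matrix.add_mul, add_sub_add_comm, hX, hY]
  smul_mem' := by
    intro c X hX
    simp only [Set.mem_ofPred_eq, Submodule.coe_smul] at *
    rw [Matrix.mul_smul, Matrix.smul_mul, ← smul_sub, hX]

/-- `𝔪`, the centralizer of `𝔞` in `𝔨 = {Z ∈ 𝔤 : θ Z = Z}`: the Lie algebra of `M`. -/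
def mLie (l : ℕ) : Submodule ℝ (so1 l) where
  carrier := {Z | J l * (Z : Mat l) = Z * J l ∧ (H0 l : Mat l) * Z = Z * (H0 l : Mat l)}
  zero_mem' := by simp
  add_mem' := by
    rintro X Y ⟨hX, hX'⟩ ⟨hY, hY'⟩
    simp only [Set.mem_ofPred_eq, Submodule.coe_add]
    rw [Matrix.mul_add, Matrix.add_mul, hX, hY, Matrix.mul_add, Matrix.add_mul, hX', hY']
    exact ⟨rfl, rfl⟩
  smul_mem' := by
    rintro c X ⟨hX, hX'⟩
    simp only [Set.mem_ofPred_eq, Submodule.coe_smul]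
    rw [Matrix.mul_smul, Matrix.smul_mul, hX, Matrix.mul_smul, Matrix.smul_mul, hX']
    exact ⟨rfl, rfl⟩

lemma commute_exp {l : ℕ} {X Y : Mat l} (h : Commute X Y) : Commute X (NormedSpace.exp Y) := by
  open scoped Matrix.Norms.Operator in exact h.exp_right

lemma expG_mem_M {l : ℕ} (Z : mLie l) : expG (Z : so1 l) ∈ M l := by
  obtain ⟨h1, h2⟩ := Z.2
  refine ⟨commute_exp (X := J l) h1, ?_⟩
  refine Subgroup.mem_centralizer_iff.2 ?_
  rintro _ ⟨t, rfl⟩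
  apply Subtype.ext
  apply Units.ext
  have h3 : Commute (t • (H0 l : Mat l)) ((Z : so1 l) : Mat l) := Commute.smul_left h2 t
  have h4 := commute_exp h3
  exact (commute_exp h4.symm).symm

/-- The exponential map `exp : 𝔪 → M`. -/
def expM {l : ℕ} (Z : mLie l) : M l := ⟨expG (Z : so1 l), expG_mem_M Z⟩

/-- The Killing form `B(X,Y) = (l-1) Tr(XY)` of `𝔤`. -/
def killing {l : ℕ} (X Y : Mat l) : ℝ := ((l : ℝ) - 1) * (X * Y).trace

/-- The inner product `B_θ(X,Y) = -B(X, θ Y)`. -/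
def Btheta {l : ℕ} (X Y : Mat l) : ℝ := -killing X (J l * Y * J l)

/-! ### Functions on `G` and on `X = G/K`

Functions on `X` are treated as right-`K`-invariant functions on `G`; then `M` acts on `X` by
left translation. -/

/-- `f : G → ℂ` is of class `C^∞`: in exponential coordinates around each point all partial
derivatives exist and are continuous. (Coordinates are taken with respect to an arbitrary finite
family of vectors in `𝔤`, in particular with respect to a basis.) -/
def IsSmooth {l : ℕ} (f : SOo l → ℂ) : Prop :=
  ∀ (g : SOo l) (k : ℕ) (X : Fin k → so1 l),
    ContDiffAt ℝ (⊤ : ℕ∞) (fun t : Fin k → ℝ => f (g * expG (∑ i, t i • X i))) 0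

/-- `f ∈ C^∞(X)`, `X = G/K`. -/
def IsSmoothOnX {l : ℕ} (f : SOo l → ℂ) : Prop :=
  IsSmooth f ∧ ∀ g : SOo l, ∀ k ∈ K l, f (g * k) = f g

/-- The left-invariant vector field of `X ∈ 𝔤`: `(X f)(g) = d/dt|_{t=0} f(g exp tX)`. -/
def lieD {l : ℕ} (X : so1 l) (f : SOo l → ℂ) : SOo l → ℂ :=
  fun g => deriv (fun t : ℝ => f (g * expG (t • X))) 0

/-- The Casimir operator `Ω = ∑ Q_j Q^j`, with `(Q_j)` the basis of `𝔤` consisting of the boosts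
`E_0j + E_j0` and the rotations `E_ij - E_ji`, `1 ≤ i < j ≤ l`. This basis is orthogonal for the
Killing form `B`, with `B(Q,Q) = 2(l-1)` for boosts and `B(Q,Q) = -2(l-1)` for rotations, which
gives the dual basis. -/
def casimir {l : ℕ} (f : SOo l → ℂ) : SOo l → ℂ := fun g =>
  ((2 * ((l : ℝ) - 1))⁻¹ : ℝ) *
    ((∑ j : Fin l, lieD (gen 0 j.succ) (lieD (gen 0 j.succ) f) g) -
      ∑ i : Fin l, ∑ j : Fin l,
        if i < j then lieD (gen i.succ j.succ) (lieD (gen i.succ j.succ) f) g else 0)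

/-! ### Representations of `M` -/

/-- An irreducible (continuous, finite dimensional, complex) representation of the compact group
`M`, realized on some `ℂ^dim`. -/
structure IrrRep (l : ℕ) where
  dim : ℕ
  rep : Representation ℂ (M l) (Fin dim → ℂ)
  cont : ∀ v, Continuous fun m => rep m v
  irr : rep.IsIrreducible

/-- Equivalence of representations. -/
instance irrSetoid (l : ℕ) : Setoid (IrrRep l) where
  r π σ := Nonempty (π.rep.Equiv σ.rep)
  iseqv :=
    { refl := fun _ => ⟨Representation.Equiv.refl _⟩
      symm := fun ⟨e⟩ => ⟨e.symm⟩
      trans := fun ⟨e⟩ ⟨f⟩ => ⟨e.trans f⟩ }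

/-- `M̂`: the equivalence classes of irreducible representations of `M`. -/
def MHat (l : ℕ) : Type := Quotient (irrSetoid l)

/-- `(χ_π * f)(x) = ∫_M f(m·x) χ_π(m⁻¹) dm`. -/
def charConv {l : ℕ} (dm : Measure (M l)) (π : IrrRep l) (f : SOo l → ℂ) : SOo l → ℂ :=
  fun x => ∫ m : M l, f ((m : SOo l) * x) * π.rep.character m⁻¹ ∂dm

/-- The component `d_π (χ_π * f)`. -/
def comp {l : ℕ} (dm : Measure (M l)) (π : IrrRep l) (f : SOo l → ℂ) : SOo l → ℂ :=
  fun x => (π.dim : ℂ) * charConv dm π f x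

lemma comp_congr {l : ℕ} (dm : Measure (M l)) (f : SOo l → ℂ) (π σ : IrrRep l)
    (h : Nonempty (π.rep.Equiv σ.rep)) : comp dm π f = comp dm σ f := by
  obtain ⟨e⟩ := h
  have hd : π.dim = σ.dim := by
    have := e.toLinearEquiv.finrank_eq
    simpa using this
  have hc : π.rep.character = σ.rep.character := Representation.char_iso e
  have hd' : (π.dim : ℂ) = (σ.dim : ℂ) := by rw [hd]
  unfold comp charConv
  rw [hd', hc]

/-- The component `d_π (χ_π * f)` as a function of the class `π ∈ M̂`. -/
def compHat {l : ℕ} (dm : Measure (M l)) (f : SOo l → ℂ) (π : MHat l) : SOo l → ℂ :=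
  Quotient.lift (fun π : IrrRep l => comp dm π f) (fun π σ h => comp_congr dm f π σ h) π

/-- The `End(V_π)`-valued function `f^π(x) = d_π ∫_M f(m·x) π(m⁻¹) dm`, written as a matrix. -/
def piProj {l : ℕ} (dm : Measure (M l)) (π : IrrRep l) (f : SOo l → ℂ) (x : SOo l) :
    Matrix (Fin π.dim) (Fin π.dim) ℂ :=
  Matrix.of fun i j =>
    (π.dim : ℂ) * ∫ m : M l, f ((m : SOo l) * x) * LinearMap.toMatrix' (π.rep m⁻¹) i j ∂dm

/-- `f` is `M`-finite of type `ρ`: the span of the translates `m·f = f(m⁻¹ ·)`, `m ∈ M`, is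
isomorphic as an `M`-module to a direct sum of finitely many copies of `ρ`. -/
def IsOfType {l : ℕ} {V : Type} [AddCommGroup V] [Module ℂ V] (f : SOo l → ℂ)
    (ρ : Representation ℂ (M l) V) : Prop :=
  ∃ (k : ℕ) (Φ : (Fin k → V) →ₗ[ℂ] (SOo l → ℂ)),
    Function.Injective Φ ∧
    LinearMap.range Φ =
      Submodule.span ℂ (Set.range fun (m : M l) (x : SOo l) => f ((m : SOo l)⁻¹ * x)) ∧
    ∀ (m : M l) (v : Fin k → V),
      Φ (fun i => ρ m (v i)) = fun x => Φ v ((m : SOo l)⁻¹ * x)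

/-- The derived representation: `π(Z) v = d/dt|_{t=0} π(exp tZ) v` for `Z ∈ 𝔪`. -/
def dRep {l : ℕ} (π : IrrRep l) (Z : mLie l) (v : Fin π.dim → ℂ) : Fin π.dim → ℂ :=
  deriv (fun t : ℝ => π.rep (expM (t • Z)) v) 0

/-- `V_π^{Z_M(S)}`, where `Z_M(S)` is the centralizer in `M` of `S = exp ℝ⁺X₁`. -/
def fixedSpace {l : ℕ} (π : IrrRep l) (X₁ : so1 l) : Set (Fin π.dim → ℂ) :=
  {v | ∀ m : M l, (∀ s : ℝ, (m : SOo l) * expG (s • X₁) = expG (s • X₁) * m) → π.rep m v = v}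

/-! ### The hypergeometric function -/

open Classical in
/-- Gauss' hypergeometric function on `ℂ ∖ [1,∞)`: the holomorphic function on this domain that is
given by the hypergeometric series on the unit disc. -/
def gauss2F1 (a b c : ℂ) : ℂ → ℂ :=
  if h : ∃ F : ℂ → ℂ, DifferentiableOn ℂ F {z | ¬ (z.im = 0 ∧ 1 ≤ z.re)} ∧
      ∀ z : ℂ, ‖z‖ < 1 → F z = ordinaryHypergeometric a b c z
  then h.choose else 0

/-! ### Automorphic eigenfunctions, closed geodesics, weights -/

/-- `φ` is an eigenfunction of the Laplacian `Ω` on `X_Γ = Γ\G/K` with eigenvalue `μ`. -/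
structure IsAutomorphicEigenfunction {l : ℕ} (Γ : Subgroup (SOo l)) (φ : SOo l → ℂ) (μ : ℂ) :
    Prop where
  smooth : IsSmoothOnX φ
  left_inv : ∀ δ ∈ Γ, ∀ g, φ (δ * g) = φ g
  eigen : ∀ g, casimir φ g = μ * φ g

/-- The choices that belong to a nontrivial element `γ` of a uniform lattice `Γ`: the primitive
element `γ₀` with `γ = γ₀ⁿ` that generates the centralizer of `γ` in `Γ`; an `α ∈ G` with
`α γ α⁻¹ = a_L m ∈ A⁺M`; and the length `L₀ > 0` of `γ₀`, which is conjugate to `a_{L₀} m₀ ∈ A⁺M`. -/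
structure GeodesicData {l : ℕ} (Γ : Subgroup (SOo l)) (γ : SOo l) where
  γ₀ : SOo l
  γ₀_mem : γ₀ ∈ Γ
  n : ℕ
  n_pos : 0 < n
  pow_eq : γ = γ₀ ^ n
  centralizer_eq : ∀ δ ∈ Γ, δ * γ = γ * δ → δ ∈ Subgroup.zpowers γ₀
  α : SOo l
  L : ℝ
  L_pos : 0 < L
  m : M l
  conj_eq : α * γ * α⁻¹ = a L * (m : SOo l)
  β : SOo l
  L₀ : ℝ
  L₀_pos : 0 < L₀
  m₀ : M l
  conj_eq₀ : β * γ₀ * β⁻¹ = a L₀ * (m₀ : SOo l)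

/-- `M_{m_γ}`: the centralizer of `m_γ` in `M`. The centralizer of `δ = α γ α⁻¹ = a_γ m_γ` in `G`
is `G_δ = A M_{m_γ}`. -/
abbrev GeodesicData.cent {l : ℕ} {Γ : Subgroup (SOo l)} {γ : SOo l} (D : GeodesicData Γ γ) :
    Subgroup (M l) := Subgroup.centralizer {D.m}

/-- The weight `I_γ(φ)(x) = ∫_{⟨α γ₀ α⁻¹⟩ \ G_δ} φ(α⁻¹ y x) dy`, where `G_δ = A M_{m_γ}` carries the
product of `dt` and the normalized Haar measure `dz` of `M_{m_γ}`. The set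
`{a_t z : 0 ≤ t ≤ L₀, z ∈ M_{m_γ}}` is a fundamental domain for `⟨α γ₀ α⁻¹⟩`. -/
def weight {l : ℕ} {Γ : Subgroup (SOo l)} {γ : SOo l} (D : GeodesicData Γ γ)
    (dz : Measure D.cent) (φ : SOo l → ℂ) : SOo l → ℂ :=
  fun x => ∫ z : D.cent, (∫ t in (0 : ℝ)..D.L₀, φ (D.α⁻¹ * a t * ((z : M l) : SOo l) * x)) ∂dz

/-- The integral `∫_0^{L₀} φ(α⁻¹ a_t x) dt` over a fundamental domain of `A/⟨a_{γ₀}⟩`. -/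
def weightA {l : ℕ} {Γ : Subgroup (SOo l)} {γ : SOo l} (D : GeodesicData Γ γ)
    (φ : SOo l → ℂ) : SOo l → ℂ :=
  fun x => ∫ t in (0 : ℝ)..D.L₀, φ (D.α⁻¹ * a t * x)

/-- The integrand `φ(α⁻¹ a x)` is a function of `a ∈ A/⟨a_{γ₀}⟩`, for every `x`. -/
def IntegrandPeriodic {l : ℕ} {Γ : Subgroup (SOo l)} {γ : SOo l} (D : GeodesicData Γ γ)
    (φ : SOo l → ℂ) : Prop :=
  ∀ (t : ℝ) (x : SOo l), φ (D.α⁻¹ * a (t + D.L₀) * x) = φ (D.α⁻¹ * a t * x)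

/-- The integral `∫_{c_{γ₀}} f = ∫_0^{ℓ₀} f(α⁻¹ exp tH_1) dt` over the prime closed geodesic
belonging to `γ`, where `a_{γ₀} = exp ℓ₀H_1`, i.e. `ℓ₀ = √(2(l-1)) L₀`. -/
def geodesicIntegral {l : ℕ} {Γ : Subgroup (SOo l)} {γ : SOo l} (D : GeodesicData Γ γ)
    (f : SOo l → ℂ) : ℂ :=
  ∫ t in (0 : ℝ)..(Real.sqrt (2 * ((l : ℝ) - 1)) * D.L₀), f (D.α⁻¹ * expG (t • H1 l))

/-! ### The two parts of the conclusion -/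

/-- `I = ∑_{π ∈ M̂} d_π (χ_π * I)`, absolutely convergent in `C^∞(X)` (i.e. for the seminorms
`sup_C |Q_1 ⋯ Q_k f|`, `Q_i ∈ 𝔤`, `C ⊆ G` compact), and every `d_π (χ_π * I)` is equal to
`Tr(I^π)`, lies in `C^∞(X)`, is `M`-finite of type `π̌` and satisfies `Ω f = μ f`. -/
def DecomposesInto {l : ℕ} (dm : Measure (M l)) (I : SOo l → ℂ) (μ : ℂ) : Prop :=
  (∀ x, HasSum (fun π : MHat l => compHat dm I π x) (I x)) ∧
  (∀ (Q : List (so1 l)) (C : Set (SOo l)), IsCompact C →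
    ∃ u : MHat l → ℝ, Summable u ∧
      ∀ π, ∀ x ∈ C, ‖Q.foldr lieD (compHat dm I π) x‖ ≤ u π) ∧
  ∀ π : IrrRep l,
    (∀ x, comp dm π I x = (piProj dm π I x).trace) ∧
    IsSmoothOnX (comp dm π I) ∧
    IsOfType (comp dm π I) π.rep.dual ∧
    ∀ x, casimir (comp dm π I) x = μ * comp dm π I x

/-- `{Z_j}_{2 ≤ j ≤ l-1}`: elements of the orthogonal complement in `𝔪` of the centralizer
`𝔷_𝔪(X₁)` such that the `Y_j = [Z_j, X₁]` are orthonormal. Automatically `Y_j ∈ 𝔫` and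
`Y_j ⊥ X₁`, so that `X₁, Y_2, …, Y_{l-1}` is an orthonormal basis of `𝔫`. -/
def IsFrame {l : ℕ} (X₁ : so1 l) (Z : Fin (l - 2) → mLie l) : Prop :=
  (∀ j, ∀ W : mLie l, ((W : so1 l) : Mat l) * (X₁ : Mat l) = (X₁ : Mat l) * ((W : so1 l) : Mat l) →
    killing ((Z j : so1 l) : Mat l) ((W : so1 l) : Mat l) = 0) ∧
  ∀ i j, Btheta (((Z i : so1 l) : Mat l) * (X₁ : Mat l) - (X₁ : Mat l) * ((Z i : so1 l) : Mat l))
    (((Z j : so1 l) : Mat l) * (X₁ : Mat l) - (X₁ : Mat l) * ((Z j : so1 l) : Mat l)) = if i = j then 1 else 0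

/-- The equation, with `D = ∑_j π(Z_j)²|_{V_π^{Z_M(S)}}`, `α(H_1)² = 1/(2(l-1))`, `α(H_ρ) = 1/4`:
`((α(H_1)² s² + 2) d²/ds² + ((α(H_1)² + 2α(H_ρ)) s + 2(l-2)/s) d/ds + 2D/s² - μ) F = 0`, `s > 0`. -/
def SatisfiesRadialODE (l : ℕ) (D : ℝ) (μ : ℂ) (F : ℝ → ℂ) : Prop :=
  ∀ s : ℝ, 0 < s →
    (((1 / (2 * ((l : ℝ) - 1))) * s ^ 2 + 2 : ℝ) : ℂ) * deriv (deriv F) s +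
      (((1 / (2 * ((l : ℝ) - 1)) + 2 * (1 / 4)) * s + 2 * ((l : ℝ) - 2) / s : ℝ) : ℂ) * deriv F s +
      ((2 * D / s ^ 2 : ℝ) : ℂ) * F s - μ * F s = 0

/-- The explicit form of `d_π (χ_π * I)` on all slices `S = exp ℝ⁺X₁`, `|X₁| = 1`; here
`ρ₀ = (l-1)/2`, `a = (ρ₀ + ir)/2`, `b = (ρ₀ - ir)/2`, `d = D/4`,
`p = (1-ρ₀)/2 + √((1-ρ₀)²/4 - d)`. -/
def HasSliceFormulas {l : ℕ} (dm : Measure (M l)) {Γ : Subgroup (SOo l)} {γ : SOo l}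
    (D : GeodesicData Γ γ) (φ I : SOo l → ℂ) (μ r : ℂ) : Prop :=
  ∀ (π : IrrRep l) (X₁ : so1 l), X₁ ∈ nLie l → Btheta (X₁ : Mat l) (X₁ : Mat l) = 1 →
    let ρ₀ : ℝ := ((l : ℝ) - 1) / 2
    let a : ℂ := ((ρ₀ : ℂ) + Complex.I * r) / 2
    let b : ℂ := ((ρ₀ : ℂ) - Complex.I * r) / 2
    let F : ℝ → ℂ := fun s => comp dm π I (expG (s • X₁))
    (fixedSpace π X₁ = {0} → ∀ s : ℝ, 0 < s → F s = 0) ∧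
    (fixedSpace π X₁ ≠ {0} → ∀ Z : Fin (l - 2) → mLie l, IsFrame X₁ Z →
      ∃ E : ℝ, E ≤ 0 ∧
        (∀ v ∈ fixedSpace π X₁, ∑ j, dRep π (Z j) (dRep π (Z j) v) = (E : ℂ) • v) ∧
        SatisfiesRadialODE l E μ F ∧
        (3 ≤ l →
          let d : ℝ := E / 4
          let w : ℝ := Real.sqrt ((1 - ρ₀) ^ 2 / 4 - d)
          let p : ℝ := (1 - ρ₀) / 2 + w
          ∃ k : ℕ, (k : ℝ) = 2 * p ∧
            ∀ s : ℝ, 0 < s →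
              F (2 * Real.sqrt ((l : ℝ) - 1) * s) =
                (((4 * ((l : ℝ) - 1)) ^ p / (k.factorial : ℝ) : ℝ) : ℂ) *
                  ((lieD X₁)^[k] (comp dm π I)) 1 * (s : ℂ) ^ k *
                  gauss2F1 (a + p) (b + p) ((1 + 2 * w : ℝ) : ℂ) (-(s : ℂ) ^ 2))) ∧
    (l = 2 → ∀ s : ℝ, 0 < s →
      F (2 * s) =
        ((Real.sqrt 2)⁻¹ : ℝ) * geodesicIntegral D φ *
            gauss2F1 a b (1 / 2) (-(s : ℂ) ^ 2) +
          (Real.sqrt 2 : ℝ) * geodesicIntegral D (lieD X₁ φ) * s *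
            gauss2F1 (a + 1 / 2) (b + 1 / 2) (3 / 2) (-(s : ℂ) ^ 2))

end RealHyp

end

/-! Write `l = n + 2`, so that `M` acts on `ℝ^{n+1}` by rotations. The weight is an integral of left
translates of `φ` over a compact set. Such integrals commute with left-invariant differential
operators, so the weight is a smooth function on `X` with the same Casimir eigenvalue as `φ`.

Decomposition. Let `f` be a smooth eigenfunction on `X`. The matrix function `f^π` satisfies
`f^π(hx) = π(h) f^π(x)` for `h ∈ M`, so the columns of `f^π(x)` are fixed by the stabilizer in `M`
of the point `xK`. That group contains the stabilizer of a vector of `ℝ^{n+1}` (`conj_mem_K`), hence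
only class-one `π` contribute. For these, averaging polynomials against `π(m)v` gives an equivariant
map `W` from polynomials to `V_π`, which is nonzero by Stone–Weierstrass. Let `N` be the least
degree in which `W ≠ 0`. By irreducibility `W` is onto from degree `N`. It kills `r²Δp` for `p` of
degree `N`, because `r²` is constant on an orbit and `Δp` has smaller degree (`exists_hasLevel`).
This level `N` replaces the classification of spherical representations. It bounds `dim V_π` and the
number of classes of level `N` by `(N+1)^{n+1}`, and it makes `∑_{i<j} π(Z_ij)²` the scalar
`-N(N+n-1)`. Integrating by parts `3(n+1)` times with `ellip` therefore beats the polynomial growth,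
which gives absolute convergence with all derivatives (`exists_summable_bound`). The sum is `f`
since both have the same isotypic integrals along each `M`-orbit, and these determine a continuous
function on `M` (`eq_zero_of_character`, a form of Peter–Weyl proved with tensor powers of
`ℂ^{n+1}`).

Radial equation. The element `αγ₀α⁻¹` lies in `a_{L₀} M_{m_γ}` (`GeodesicData.exists_cent`), so the
`M_{m_γ}`-average of the integrand is periodic in `t`, and the weight is invariant under left
translation by `A`. On right-`K`-invariant functions, `2(l-1)Ω = H₀² - (l-1)H₀ + ∑ Y_i²` over a
basis of `𝔫` (`casimir_radial`). On the slice `exp sX₁`, left `A`-invariance turns `H₀` into `-s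
d/ds`. Conjugating a rotation `Z_j` past `exp sX₁` expresses `s²Y_j²`, with `Y_j = [Z_j, X₁]`,
through the left derivative `Z_j²` and a first-order term (`leftD_sq_slice`). The left derivatives
act on the component through `∑ π(Z_j)²`, which is `-N(N+n-1)` on vectors fixed by `Z_M(S)`
(`IsFrame.sum_drmat_sq`). This is the differential equation with `E = -N(N+n-1)`. Its discriminant
is then a perfect square, `p = N/2`, and `2p = N` is an integer.

Solution. After rescaling, `s^N ₂F₁(-s²)` solves the equation. For `n ≥ 1` the Wronskian with a
solution regular at `0`, multiplied by `s^n(1+s²)`, is constant and tends to `0`. The component is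
thus a multiple of this solution, and its `N`-th derivative at `0` gives the constant. For `n = 0`
the group `M` is trivial and the equation is regular at `0`, so the two initial values, which are
geodesic integrals, determine the solution. The continuation of `₂F₁` to `ℂ ∖ [1,∞)` exists by
Euler's integral and contiguous relations (`exists_isGauss`).

For the integral over `A` alone the same arguments apply, with periodicity of the integrand as a
hypothesis. -/

noncomputable section

set_option linter.unusedSectionVars false

namespace RealHyp

open scoped Topology ContDiff

/-! ### Parametric integrals of smooth functions -/

section ParametricIntegral

variable {E P W T : Type} [NormedAddCommGroup E] [NormedSpace ℝ E] [NormedAddCommGroup P]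
  [NormedSpace ℝ P] [NormedAddCommGroup W] [NormedSpace ℝ W] [TopologicalSpace T]

/-- `F x t` is locally a smooth function of `x` and of a continuous vector valued function of
the parameter `t`. -/
def JointlySmooth (ι : T → P) (F : E → T → W) : Prop :=
  ∀ x t, ∃ Φ : E × P → W, ContDiffAt ℝ ∞ Φ (x, ι t) ∧
    ∀ᶠ q : E × T in 𝓝 (x, t), F q.1 q.2 = Φ (q.1, ι q.2)

variable {ι : T → P} {F : E → T → W}

lemma JointlySmooth.continuous (hι : Continuous ι) (hF : JointlySmooth ι F) :
    Continuous F.uncurry := by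
  rw [continuous_iff_continuousAt]
  rintro ⟨x, t⟩
  obtain ⟨Φ, hΦ, he⟩ := hF x t
  have h1 : ContinuousAt (fun q : E × T => Φ (q.1, ι q.2)) (x, t) := by
    have h2 : ContinuousAt (fun q : E × T => (q.1, ι q.2)) (x, t) := by fun_prop
    exact ContinuousAt.comp (g := Φ) (f := fun q : E × T => (q.1, ι q.2)) hΦ.continuousAt h2
  exact h1.congr (he.mono fun q hq => hq.symm)

lemma JointlySmooth.contDiff (hF : JointlySmooth ι F) (t : T) : ContDiff ℝ ∞ (F · t) := by
  rw [contDiff_iff_contDiffAt]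
  intro x
  obtain ⟨Φ, hΦ, he⟩ := hF x t
  have h1 : ContDiffAt ℝ ∞ (fun y : E => Φ (y, ι t)) x :=
    ContDiffAt.comp (g := Φ) (f := fun y : E => (y, ι t)) x hΦ
      (contDiffAt_id.prodMk contDiffAt_const)
  refine h1.congr_of_eventuallyEq ?_
  have h2 : Filter.Tendsto (fun y : E => (y, t)) (𝓝 x) (𝓝 (x, t)) :=
    (continuous_id.prodMk continuous_const).tendsto x
  exact h2.eventually he

/-- The class is stable under differentiation in `x`, because the local representative `Φ` can be
differentiated in its first variable. This lets smoothness of the integral be proved by induction on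
the order, with the target `W` changing at each step. -/
lemma JointlySmooth.fderiv (hι : Continuous ι) (hF : JointlySmooth ι F) :
    JointlySmooth ι (fun x t => fderiv ℝ (F · t) x) := by
  intro x t
  obtain ⟨Φ, hΦ, he⟩ := hF x t
  refine ⟨fun p => (_root_.fderiv ℝ Φ p).comp (ContinuousLinearMap.inl ℝ E P), ?_, ?_⟩
  · exact (hΦ.fderiv_right (m := ∞) (by simp)).clm_comp contDiffAt_const
  · have h2 : Filter.Tendsto (fun q : E × T => (q.1, ι q.2)) (𝓝 (x, t)) (𝓝 (x, ι t)) :=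
      (show Continuous (fun q : E × T => (q.1, ι q.2)) by fun_prop).tendsto (x, t)
    have h3 := h2.eventually ((hΦ.of_le (m := 1) (by exact_mod_cast le_top)).eventually (by simp))
    filter_upwards [he.eventually_nhds, h3] with q hq hd
    have h4 : Filter.Tendsto (fun y : E => (y, q.2)) (𝓝 q.1) (𝓝 q) :=
      (continuous_id.prodMk continuous_const).tendsto q.1
    have h5 : (F · q.2) =ᶠ[𝓝 q.1] fun y => Φ (y, ι q.2) := h4.eventually hq
    rw [h5.fderiv_eq]
    have h6 := (hd.differentiableAt (by simp)).hasFDerivAt.comp q.1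
      (hasFDerivAt_prodMk_left (𝕜 := ℝ) q.1 (ι q.2))
    exact h6.fderiv

variable [MeasurableSpace T] [OpensMeasurableSpace T] [SecondCountableTopology T]
  [FiniteDimensional ℝ E] {μ : Measure T} [IsFiniteMeasure μ]

lemma hasFDerivAt_integral_of_continuous [T2Space T] {S : Set T} (hS : IsCompact S)
    {F : E → T → W} {F' : E → T → E →L[ℝ] W}
    (hF : Continuous F.uncurry) (hF' : Continuous F'.uncurry)
    (hd : ∀ x t, HasFDerivAt (F · t) (F' x t) x) (x : E) :
    HasFDerivAt (fun x => ∫ t in S, F x t ∂μ) (∫ t in S, F' x t ∂μ) x := by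
  have : ProperSpace E := FiniteDimensional.proper ℝ E
  obtain ⟨U, hU, hUx⟩ := exists_compact_mem_nhds x
  obtain ⟨C, hC⟩ := (hU.prod hS).bddAbove_image hF'.norm.continuousOn
  refine hasFDerivAt_integral_of_dominated_of_fderiv_le (bound := fun _ => C) hUx
    (Filter.Eventually.of_forall fun y => ?_) ?_ ?_ ?_ ?_ ?_
  · exact (show Continuous (F y) from hF.uncurry_left y).aestronglyMeasurable
  · have hc : Continuous (F x) := hF.uncurry_left x
    exact hc.continuousOn.integrableOn_compact hS
  · exact (show Continuous (F' x) from hF'.uncurry_left x).aestronglyMeasurable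
  · rw [ae_restrict_iff' hS.measurableSet]
    exact Filter.Eventually.of_forall fun t ht y hy => hC ⟨(y, t), ⟨hy, ht⟩, rfl⟩
  · exact integrable_const _
  · exact Filter.Eventually.of_forall fun t y _ => hd y t

lemma JointlySmooth.hasFDerivAt_integral [T2Space T] (hι : Continuous ι) (hF : JointlySmooth ι F)
    {S : Set T} (hS : IsCompact S) (x : E) :
    HasFDerivAt (fun x => ∫ t in S, F x t ∂μ) (∫ t in S, _root_.fderiv ℝ (F · t) x ∂μ) x :=
  hasFDerivAt_integral_of_continuous hS (hF.continuous hι) ((hF.fderiv hι).continuous hι)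
    (fun y t => ((hF.contDiff t).differentiable (by simp) y).hasFDerivAt) x

lemma JointlySmooth.contDiff_integral [T2Space T] (hι : Continuous ι) (hF : JointlySmooth ι F)
    {S : Set T} (hS : IsCompact S) : ContDiff ℝ ∞ (fun x => ∫ t in S, F x t ∂μ) := by
  rw [contDiff_infty]
  intro n
  induction n generalizing W with
  | zero =>
    have : ProperSpace E := FiniteDimensional.proper ℝ E
    exact contDiff_zero.2 (continuous_parametric_integral_of_continuous (hF.continuous hι) hS)
  | succ n ih =>
    push_cast
    rw [contDiff_succ_iff_hasFDerivAt]
    exact ⟨_, ih (hF.fderiv hι), fun x => hF.hasFDerivAt_integral hι hS x⟩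

end ParametricIntegral

end RealHyp

namespace RealHyp

open scoped Topology ContDiff Matrix.Norms.Operator

variable {l : ℕ}

/-! ### The matrix realization of `G` -/

lemma mat_mul (g h : SOo l) : mat (g * h) = mat g * mat h := rfl

lemma mat_one : mat (1 : SOo l) = 1 := rfl

lemma mat_injective : Function.Injective (mat : SOo l → Mat l) :=
  fun _ _ h => Subtype.ext (Units.ext h)

lemma mat_expG (X : so1 l) : mat (expG X) = NormedSpace.exp (X : Mat l) := rfl

lemma mem_SO1 (g : SOo l) : (g : GL (Fin (l + 1)) ℝ) ∈ SO1 l := by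
  obtain ⟨x, -, hx⟩ := g.2
  rw [← hx]
  exact x.2

lemma mat_preserves (g : SOo l) : (mat g).transpose * J l * mat g = J l := (mem_SO1 g).1

lemma mat_det (g : SOo l) : (mat g).det = 1 := (mem_SO1 g).2

lemma mat_mul_mat_inv (g : SOo l) : mat g * mat g⁻¹ = 1 := by
  rw [← mat_mul, mul_inv_cancel, mat_one]

lemma mat_inv_mul_mat (g : SOo l) : mat g⁻¹ * mat g = 1 := by
  rw [← mat_mul, inv_mul_cancel, mat_one]

lemma mat_inv (g : SOo l) : mat g⁻¹ = J l * (mat g).transpose * J l := by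
  have h : J l * (mat g).transpose * J l * mat g = 1 := by
    rw [Matrix.mul_assoc, Matrix.mul_assoc, ← Matrix.mul_assoc _ (J l), mat_preserves, J_mul_J]
  calc mat g⁻¹ = J l * (mat g).transpose * J l * mat g * mat g⁻¹ := by rw [h, Matrix.one_mul]
    _ = _ := by rw [Matrix.mul_assoc, mat_mul_mat_inv, Matrix.mul_one]

lemma isEmbedding_mat : Topology.IsEmbedding (mat : SOo l → Mat l) := by
  refine ⟨?_, mat_injective⟩
  have hj : Continuous fun A : Mat l => (A, MulOpposite.op (J l * A.transpose * J l)) := by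
    fun_prop
  have hc : Continuous (mat : SOo l → Mat l) := Units.continuous_val.comp continuous_subtype_val
  refine Topology.IsInducing.of_comp hc hj ?_
  have h1 : Topology.IsInducing (fun g : SOo l => Units.embedProduct (Mat l) g) :=
    Units.isInducing_embedProduct.comp Topology.IsInducing.subtypeVal
  convert! h1 using 1
  funext g
  exact Prod.ext rfl (congrArg MulOpposite.op (mat_inv g).symm)

@[fun_prop]
lemma continuous_mat : Continuous (mat : SOo l → Mat l) := isEmbedding_mat.continuous

instance : SecondCountableTopology (Mat l) :=
  inferInstanceAs (SecondCountableTopology (Fin (l + 1) → Fin (l + 1) → ℝ))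

instance : SecondCountableTopology (SOo l) := isEmbedding_mat.secondCountableTopology

instance : T2Space (SOo l) := isEmbedding_mat.t2Space

instance : IsTopologicalGroup (SOo l) := inferInstance

lemma continuous_expG : Continuous (expG : so1 l → SOo l) :=
  Continuous.subtype_mk ((continuous_expGL l).comp continuous_subtype_val) _

lemma expG_zero : expG (0 : so1 l) = 1 := by
  apply mat_injective
  rw [mat_expG, mat_one, Submodule.coe_zero, NormedSpace.exp_zero]

/-- The projection of the space of matrices onto `𝔤`. -/
def projSo : Mat l →L[ℝ] so1 l :=
  LinearMap.toContinuousLinearMap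
    { toFun := fun X => ⟨(2⁻¹ : ℝ) • (X - J l * X.transpose * J l), by
        rw [mem_so1, Matrix.transpose_smul, Matrix.transpose_sub, Matrix.transpose_mul,
          Matrix.transpose_mul, Matrix.transpose_transpose, J_transpose, Matrix.smul_mul,
          ← smul_neg, Matrix.mul_smul, neg_sub, Matrix.sub_mul, Matrix.mul_sub]
        congr 2
        · rw [Matrix.mul_assoc (J l), ← Matrix.mul_assoc (J l) (J l), J_mul_J, Matrix.one_mul]
        · rw [Matrix.mul_assoc, Matrix.mul_assoc, J_mul_J, Matrix.mul_one]⟩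
      map_add' := fun X Y => by
        apply Subtype.ext
        simp only [Matrix.transpose_add, Matrix.mul_add, Matrix.add_mul, Submodule.coe_add,
          ← smul_add]
        congr 1
        abel
      map_smul' := fun c X => by
        apply Subtype.ext
        simp only [Matrix.transpose_smul, Matrix.mul_smul, Matrix.smul_mul, Submodule.coe_smul,
          RingHom.id_apply, ← smul_sub]
        rw [smul_comm] }

lemma projSo_coe (X : Mat l) :
    (projSo X : Mat l) = (2⁻¹ : ℝ) • (X - J l * X.transpose * J l) := rfl

lemma contDiff_exp : ContDiff ℝ ∞ (NormedSpace.exp : Mat l → Mat l) := by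
  rw [contDiff_iff_contDiffAt]
  exact fun x => (NormedSpace.exp_analytic (𝕂 := ℝ) x).contDiffAt

/-- A smooth logarithm of matrices near `1`, which takes values in `𝔤` on `G`. -/
lemma exists_smooth_log (l : ℕ) : ∃ L : Mat l → so1 l, ContDiffAt ℝ ∞ L 1 ∧ L 1 = 0 ∧
    ∀ᶠ g : SOo l in 𝓝 1, expG (L (mat g)) = g := by
  have h0 : HasFDerivAt (NormedSpace.exp : Mat l → Mat l)
      ((ContinuousLinearEquiv.refl ℝ (Mat l) : Mat l ≃L[ℝ] Mat l) : Mat l →L[ℝ] Mat l) 0 :=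
    hasFDerivAt_exp_zero
  have hs : ContDiffAt ℝ ∞ (NormedSpace.exp : Mat l → Mat l) 0 := contDiff_exp.contDiffAt
  have hn : (∞ : WithTop ℕ∞) ≠ 0 := by simp
  set e := hs.toOpenPartialHomeomorph NormedSpace.exp h0 hn with he
  have hcoe : (e : Mat l → Mat l) = NormedSpace.exp :=
    hs.toOpenPartialHomeomorph_coe h0 hn
  have hsrc : (0 : Mat l) ∈ e.source := hs.mem_toOpenPartialHomeomorph_source h0 hn
  have he0 : e 0 = 1 := by rw [hcoe, NormedSpace.exp_zero]
  have htgt : (1 : Mat l) ∈ e.target := by rw [← he0]; exact e.map_source hsrc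
  have hsymm1 : e.symm 1 = 0 := by rw [← he0]; exact e.left_inv hsrc
  have hsm : ContDiffAt ℝ ∞ e.symm 1 := by
    have := hs.to_localInverse h0 hn
    rwa [NormedSpace.exp_zero] at this
  refine ⟨fun A => projSo (e.symm A), ?_, ?_, ?_⟩
  · exact (projSo (l := l)).contDiff.contDiffAt.comp 1 hsm
  · change projSo (e.symm 1) = 0
    rw [hsymm1, map_zero]
  · have hcm : Filter.Tendsto (mat : SOo l → Mat l) (𝓝 1) (𝓝 1) := continuous_mat.tendsto 1
    have hcs : Filter.Tendsto e.symm (𝓝 1) (𝓝 0) := by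
      have := hsm.continuousAt.tendsto
      rwa [hsymm1] at this
    have h1 : ∀ᶠ X : Mat l in 𝓝 0, X.transpose ∈ e.source ∧ -(J l * X * J l) ∈ e.source := by
      have c1 : Continuous fun X : Mat l => X.transpose := by fun_prop
      have c2 : Continuous fun X : Mat l => -(J l * X * J l) := by fun_prop
      have m1 := c1.tendsto 0
      have m2 := c2.tendsto 0
      simp only [Matrix.transpose_zero, Matrix.mul_zero, Matrix.zero_mul, neg_zero] at m1 m2
      exact (m1.eventually (e.open_source.mem_nhds hsrc)).and
        (m2.eventually (e.open_source.mem_nhds hsrc))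
    filter_upwards [hcm.eventually (e.open_target.mem_nhds htgt),
      hcm.eventually (hcs.eventually h1)] with g hg hX
    set X := e.symm (mat g) with hXdef
    have hexp : NormedSpace.exp X = mat g := by rw [← hcoe]; exact e.right_inv hg
    have hJ : IsUnit (J l) := IsUnit.of_mul_eq_one _ (J_mul_J l)
    have hJi : (J l)⁻¹ = J l := Matrix.inv_eq_right_inv (J_mul_J l)
    -- Both sides are logarithms of `(mat g)ᵀ` close to `0`, where `exp` is injective. Their
    -- equality says that `X` lies in `𝔤`, so that projecting to `𝔤` changes nothing.
    have h2 : X.transpose = -(J l * X * J l) := by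
      apply e.injOn hX.1 hX.2
      rw [hcoe, Matrix.exp_transpose, hexp]
      have h3 : -(J l * X * J l) = J l * (-X) * (J l)⁻¹ := by
        rw [hJi, Matrix.mul_neg, Matrix.neg_mul]
      have h4 : NormedSpace.exp (-X) = mat g⁻¹ := by
        have h5 : mat g * NormedSpace.exp (-X) = 1 := by
          rw [← hexp, ← Matrix.exp_add_of_commute _ _ (Commute.neg_right (Commute.refl X))]
          simp
        calc NormedSpace.exp (-X) = mat g⁻¹ * mat g * NormedSpace.exp (-X) := by
              rw [mat_inv_mul_mat, Matrix.one_mul]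
          _ = mat g⁻¹ := by rw [Matrix.mul_assoc, h5, Matrix.mul_one]
      rw [h3, Matrix.exp_conj _ _ hJ, hJi, h4, mat_inv]
      simp only [Matrix.mul_assoc, J_mul_J, Matrix.mul_one]
      rw [← Matrix.mul_assoc, J_mul_J, Matrix.one_mul]
    have h6 : (projSo X : Mat l) = X := by
      rw [projSo_coe, h2, Matrix.mul_neg, Matrix.neg_mul, sub_neg_eq_add]
      have : J l * (J l * X * J l) * J l = X := by
        rw [Matrix.mul_assoc, Matrix.mul_assoc, J_mul_J, Matrix.mul_one, ← Matrix.mul_assoc,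
          J_mul_J, Matrix.one_mul]
      rw [this, ← two_smul ℝ X, smul_smul]
      norm_num
    apply mat_injective
    rw [mat_expG, h6, hexp]

/-! ### Smooth functions on `G` -/

/-- A function on `G` is smooth if and only if it is locally the restriction of a smooth function
of matrices. -/
lemma isSmooth_iff {f : SOo l → ℂ} : IsSmooth f ↔ ∀ g, ∃ F : Mat l → ℂ,
    ContDiffAt ℝ ∞ F (mat g) ∧ ∀ᶠ h in 𝓝 g, F (mat h) = f h := by
  constructor
  · intro hf g
    obtain ⟨L, hL, hL1, hLe⟩ := exists_smooth_log l
    let b := Module.finBasis ℝ (so1 l)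
    let u : Mat l → (Fin (Module.finrank ℝ (so1 l)) → ℝ) := fun A =>
      b.equivFunL (L (mat g⁻¹ * A))
    have hmul : ContDiffAt ℝ ∞ (fun A : Mat l => mat g⁻¹ * A) (mat g) :=
      contDiffAt_const.mul contDiffAt_id
    have hu : ContDiffAt ℝ ∞ u (mat g) := by
      refine b.equivFunL.contDiff.contDiffAt.comp (mat g) ?_
      refine ContDiffAt.comp (mat g) ?_ hmul
      rwa [mat_inv_mul_mat]
    have hu0 : u (mat g) = 0 := by
      simp only [u, mat_inv_mul_mat, hL1, map_zero]
    refine ⟨fun A => f (g * expG (∑ i, u A i • b i)), ?_, ?_⟩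
    · have h1 := hf g _ b
      rw [← hu0] at h1
      exact ContDiffAt.comp (g := fun t => f (g * expG (∑ i, t i • b i))) (mat g) h1 hu
    · have h2 : Filter.Tendsto (fun h : SOo l => g⁻¹ * h) (𝓝 g) (𝓝 1) := by
        have := (continuous_const_mul g⁻¹).tendsto g
        rwa [inv_mul_cancel] at this
      filter_upwards [h2.eventually hLe] with h hh
      have h3 : ∑ i, u (mat h) i • b i = L (mat g⁻¹ * mat h) :=
        b.sum_equivFun _
      rw [h3, ← mat_mul, hh, mul_inv_cancel_left]
  · intro hf g k X
    obtain ⟨F, hF, he⟩ := hf g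
    let ψ : (Fin k → ℝ) → Mat l := fun t => mat g * NormedSpace.exp ((∑ i, t i • X i : so1 l) : Mat l)
    have hlin : ContDiff ℝ ∞ fun t : Fin k → ℝ => ((∑ i, t i • X i : so1 l) : Mat l) := by
      have : (fun t : Fin k → ℝ => ((∑ i, t i • X i : so1 l) : Mat l)) =
          fun t => ∑ i, t i • (X i : Mat l) := by
        funext t; simp
      rw [this]
      fun_prop
    have hψ : ContDiff ℝ ∞ ψ := contDiff_const.mul (contDiff_exp.comp hlin)
    have hψ0 : ψ 0 = mat g := by simp [ψ]
    have h1 : ContDiffAt ℝ ∞ (fun t => F (ψ t)) 0 := by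
      refine ContDiffAt.comp 0 ?_ hψ.contDiffAt
      rwa [hψ0]
    refine h1.congr_of_eventuallyEq ?_
    have hc : Continuous fun t : Fin k → ℝ => g * expG (∑ i, t i • X i) := by
      refine continuous_const.mul (continuous_expG.comp ?_)
      fun_prop
    have h2 := hc.tendsto 0
    simp only [Pi.zero_apply, zero_smul, Finset.sum_const_zero, expG_zero, mul_one] at h2
    filter_upwards [h2.eventually he] with t ht
    exact ht.symm

end RealHyp

/-! ### Calculus of left- and right-invariant vector fields -/

namespace RealHyp

open scoped Topology ContDiff Matrix.Norms.Operator

variable {l : ℕ}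

lemma IsSmooth.comp_contDiffAt {E : Type*} [NormedAddCommGroup E] [NormedSpace ℝ E]
    {f : SOo l → ℂ} (hf : IsSmooth f) {ψ : E → SOo l} {x : E}
    (hψ : ContDiffAt ℝ ∞ (fun y => mat (ψ y)) x) : ContDiffAt ℝ ∞ (fun y => f (ψ y)) x := by
  obtain ⟨F, hF, he⟩ := isSmooth_iff.1 hf (ψ x)
  have hc : ContinuousAt ψ x := isEmbedding_mat.continuousAt_iff.2 hψ.continuousAt
  refine (ContDiffAt.comp (g := F) x hF hψ).congr_of_eventuallyEq ?_
  filter_upwards [hc.eventually he] with y hy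
  exact hy.symm

lemma IsSmooth.continuous {f : SOo l → ℂ} (hf : IsSmooth f) : Continuous f := by
  rw [continuous_iff_continuousAt]
  intro g
  obtain ⟨F, hF, he⟩ := isSmooth_iff.1 hf g
  exact (ContinuousAt.comp (g := F) hF.continuousAt continuous_mat.continuousAt).congr he

lemma IsSmooth.const_mul {f : SOo l → ℂ} (hf : IsSmooth f) (c : ℂ) :
    IsSmooth (fun g => c * f g) :=
  fun g k X => contDiffAt_const.mul (hf g k X)

lemma IsSmooth.add {f f' : SOo l → ℂ} (hf : IsSmooth f) (hf' : IsSmooth f') :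
    IsSmooth (fun g => f g + f' g) :=
  fun g k X => (hf g k X).add (hf' g k X)

lemma IsSmooth.sum {ι : Type*} {s : Finset ι} {f : ι → SOo l → ℂ}
    (hf : ∀ i ∈ s, IsSmooth (f i)) : IsSmooth (fun g => ∑ i ∈ s, f i g) :=
  fun g k X => ContDiffAt.sum fun i hi => hf i hi g k X

lemma hasDerivAt_comp_curve {f : SOo l → ℂ} {F : Mat l → ℂ} {c : ℝ → SOo l} {t : ℝ} {V : Mat l}
    (hF : DifferentiableAt ℝ F (mat (c t))) (he : ∀ᶠ h in 𝓝 (c t), F (mat h) = f h)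
    (hc : HasDerivAt (fun s => mat (c s)) V t) :
    HasDerivAt (fun s => f (c s)) (fderiv ℝ F (mat (c t)) V) t := by
  have hcc : ContinuousAt c t := isEmbedding_mat.continuousAt_iff.2 hc.continuousAt
  refine (hF.hasFDerivAt.comp_hasDerivAt t hc).congr_of_eventuallyEq ?_
  filter_upwards [hcc.eventually he] with y hy
  exact hy.symm

lemma hasDerivAt_mat_mul_expG (g : SOo l) (X : so1 l) (t : ℝ) :
    HasDerivAt (fun s : ℝ => mat (g * expG (s • X))) (mat (g * expG (t • X)) * (X : Mat l)) t := by
  have h := (hasDerivAt_exp_smul_const (𝕂 := ℝ) (X : Mat l) t).const_mul (mat g)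
  rw [← Matrix.mul_assoc] at h
  exact h

lemma hasDerivAt_mat_expG_mul (g : SOo l) (X : so1 l) (t : ℝ) :
    HasDerivAt (fun s : ℝ => mat (expG (s • X) * g)) ((X : Mat l) * mat (expG (t • X) * g)) t := by
  have h := (hasDerivAt_exp_smul_const' (𝕂 := ℝ) (X : Mat l) t).mul_const (mat g)
  rw [Matrix.mul_assoc] at h
  exact h

lemma contDiff_mat_expG (X : so1 l) : ContDiff ℝ ∞ fun s : ℝ => mat (expG (s • X)) :=
  contDiff_exp.comp (contDiff_id.smul contDiff_const)

/-- The right-invariant vector field of `Z ∈ 𝔤`: `d/dt|_{t=0} f(exp(tZ) g)`. -/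
def leftD (Z : so1 l) (f : SOo l → ℂ) : SOo l → ℂ :=
  fun g => deriv (fun t : ℝ => f (expG (t • Z) * g)) 0

/-- For a local extension `F` to matrices, invariant fields on `G` are restrictions of the linear
fields `A ↦ A X`. Smoothness of derivatives, linearity in `X` and commutators thereby reduce to
Fréchet calculus on a vector space. -/
lemma lieD_eq_fderiv {f : SOo l → ℂ} {F : Mat l → ℂ} {g : SOo l} (X : so1 l)
    (hF : DifferentiableAt ℝ F (mat g)) (he : ∀ᶠ h in 𝓝 g, F (mat h) = f h) :
    lieD X f g = fderiv ℝ F (mat g) (mat g * (X : Mat l)) := by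
  have h0 : g * expG ((0 : ℝ) • X) = g := by rw [zero_smul, expG_zero, mul_one]
  have h := hasDerivAt_comp_curve (f := f) (F := F) (c := fun s : ℝ => g * expG (s • X)) (t := 0)
    (by rwa [h0]) (by rwa [h0]) (hasDerivAt_mat_mul_expG g X 0)
  rw [h0] at h
  exact h.deriv

lemma leftD_eq_fderiv {f : SOo l → ℂ} {F : Mat l → ℂ} {g : SOo l} (X : so1 l)
    (hF : DifferentiableAt ℝ F (mat g)) (he : ∀ᶠ h in 𝓝 g, F (mat h) = f h) :
    leftD X f g = fderiv ℝ F (mat g) ((X : Mat l) * mat g) := by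
  have h0 : expG ((0 : ℝ) • X) * g = g := by rw [zero_smul, expG_zero, one_mul]
  have h := hasDerivAt_comp_curve (f := f) (F := F) (c := fun s : ℝ => expG (s • X) * g) (t := 0)
    (by rwa [h0]) (by rwa [h0]) (hasDerivAt_mat_expG_mul g X 0)
  rw [h0] at h
  exact h.deriv

lemma eventually_differentiableAt {F : Mat l → ℂ} {g : SOo l} (hF : ContDiffAt ℝ ∞ F (mat g)) :
    ∀ᶠ h in 𝓝 g, DifferentiableAt ℝ F (mat h) := by
  have h1 := (hF.of_le (m := 1) (by exact_mod_cast le_top)).eventually (by simp)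
  filter_upwards [continuous_mat.continuousAt.eventually h1] with h hh
  exact hh.differentiableAt (by simp)

lemma IsSmooth.lieD {f : SOo l → ℂ} (hf : IsSmooth f) (X : so1 l) : IsSmooth (lieD X f) := by
  rw [isSmooth_iff] at hf ⊢
  intro g
  obtain ⟨F, hF, he⟩ := hf g
  refine ⟨fun A => fderiv ℝ F A (A * (X : Mat l)), ?_, ?_⟩
  · exact (hF.fderiv_right (m := ∞) (by simp)).clm_apply (contDiffAt_id.mul contDiffAt_const)
  · filter_upwards [eventually_differentiableAt hF, he.eventually_nhds] with h h1 h2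
    exact (lieD_eq_fderiv X h1 h2).symm

lemma IsSmooth.leftD {f : SOo l → ℂ} (hf : IsSmooth f) (X : so1 l) : IsSmooth (leftD X f) := by
  rw [isSmooth_iff] at hf ⊢
  intro g
  obtain ⟨F, hF, he⟩ := hf g
  refine ⟨fun A => fderiv ℝ F A ((X : Mat l) * A), ?_, ?_⟩
  · exact (hF.fderiv_right (m := ∞) (by simp)).clm_apply (contDiffAt_const.mul contDiffAt_id)
  · filter_upwards [eventually_differentiableAt hF, he.eventually_nhds] with h h1 h2
    exact (leftD_eq_fderiv X h1 h2).symm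

lemma IsSmooth.hasDerivAt_right {f : SOo l → ℂ} (hf : IsSmooth f) (X : so1 l) (g : SOo l) (t : ℝ) :
    HasDerivAt (fun s : ℝ => f (g * expG (s • X))) (RealHyp.lieD X f (g * expG (t • X))) t := by
  obtain ⟨F, hF, he⟩ := isSmooth_iff.1 hf (g * expG (t • X))
  have hd : DifferentiableAt ℝ F (mat (g * expG (t • X))) := hF.differentiableAt (by simp)
  rw [lieD_eq_fderiv X hd he]
  exact hasDerivAt_comp_curve hd he (hasDerivAt_mat_mul_expG g X t)

lemma IsSmooth.hasDerivAt_left {f : SOo l → ℂ} (hf : IsSmooth f) (X : so1 l) (g : SOo l) (t : ℝ) :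
    HasDerivAt (fun s : ℝ => f (expG (s • X) * g)) (RealHyp.leftD X f (expG (t • X) * g)) t := by
  obtain ⟨F, hF, he⟩ := isSmooth_iff.1 hf (expG (t • X) * g)
  have hd : DifferentiableAt ℝ F (mat (expG (t • X) * g)) := hF.differentiableAt (by simp)
  rw [leftD_eq_fderiv X hd he]
  exact hasDerivAt_comp_curve hd he (hasDerivAt_mat_expG_mul g X t)

lemma IsSmooth.deriv_right {f : SOo l → ℂ} (hf : IsSmooth f) (X : so1 l) (g : SOo l) :
    deriv (fun s : ℝ => f (g * expG (s • X))) = fun t => RealHyp.lieD X f (g * expG (t • X)) :=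
  funext fun t => (hf.hasDerivAt_right X g t).deriv

lemma IsSmooth.deriv_left {f : SOo l → ℂ} (hf : IsSmooth f) (X : so1 l) (g : SOo l) :
    deriv (fun s : ℝ => f (expG (s • X) * g)) = fun t => RealHyp.leftD X f (expG (t • X) * g) :=
  funext fun t => (hf.hasDerivAt_left X g t).deriv

lemma IsSmooth.deriv_deriv_right {f : SOo l → ℂ} (hf : IsSmooth f) (X : so1 l) (g : SOo l) (t : ℝ) :
    deriv (deriv (fun s : ℝ => f (g * expG (s • X)))) t =
      RealHyp.lieD X (RealHyp.lieD X f) (g * expG (t • X)) := by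
  rw [hf.deriv_right, (hf.lieD X).deriv_right]

lemma IsSmooth.deriv_deriv_left {f : SOo l → ℂ} (hf : IsSmooth f) (X : so1 l) (g : SOo l) (t : ℝ) :
    deriv (deriv (fun s : ℝ => f (expG (s • X) * g))) t =
      RealHyp.leftD X (RealHyp.leftD X f) (expG (t • X) * g) := by
  rw [hf.deriv_left, (hf.leftD X).deriv_left]

lemma lieD_add {f : SOo l → ℂ} (hf : IsSmooth f) (X Y : so1 l) :
    lieD (X + Y) f = fun g => lieD X f g + lieD Y f g := by
  funext g
  obtain ⟨F, hF, he⟩ := isSmooth_iff.1 hf g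
  have hd : DifferentiableAt ℝ F (mat g) := hF.differentiableAt (by simp)
  rw [lieD_eq_fderiv _ hd he, lieD_eq_fderiv _ hd he, lieD_eq_fderiv _ hd he, Submodule.coe_add,
    Matrix.mul_add, map_add]

lemma lieD_smul {f : SOo l → ℂ} (hf : IsSmooth f) (c : ℝ) (X : so1 l) :
    lieD (c • X) f = fun g => (c : ℂ) * lieD X f g := by
  funext g
  obtain ⟨F, hF, he⟩ := isSmooth_iff.1 hf g
  have hd : DifferentiableAt ℝ F (mat g) := hF.differentiableAt (by simp)
  rw [lieD_eq_fderiv _ hd he, lieD_eq_fderiv _ hd he, Submodule.coe_smul, Matrix.mul_smul,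
    map_smul, Complex.real_smul]

lemma lieD_fun_add {f f' : SOo l → ℂ} (hf : IsSmooth f) (hf' : IsSmooth f') (X : so1 l) :
    lieD X (fun g => f g + f' g) = fun g => lieD X f g + lieD X f' g := by
  funext g
  have h := ((hf.hasDerivAt_right X g 0).add (hf'.hasDerivAt_right X g 0)).deriv
  rw [zero_smul, expG_zero, mul_one] at h
  exact h

lemma lieD_fun_const_mul {f : SOo l → ℂ} (hf : IsSmooth f) (c : ℂ) (X : so1 l) :
    lieD X (fun g => c * f g) = fun g => c * lieD X f g := by
  funext g
  have h := ((hf.hasDerivAt_right X g 0).const_mul c).deriv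
  rw [zero_smul, expG_zero, mul_one] at h
  exact h

lemma lieD_zero_fun (X : so1 l) : lieD X (fun _ : SOo l => (0 : ℂ)) = fun _ => 0 := by
  funext g
  simp [lieD]

/-- The terms with second derivatives cancel by symmetry. What remains is the first derivative along
`A X Y - A Y X`. -/
lemma fderiv_mul_right_comm {𝔸 : Type*} [NormedRing 𝔸] [NormedAlgebra ℝ 𝔸] {F : 𝔸 → ℂ} {A : 𝔸}
    (hF : ContDiffAt ℝ ∞ F A) (X Y : 𝔸) :
    fderiv ℝ (fun B => fderiv ℝ F B (B * Y)) A (A * X) -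
      fderiv ℝ (fun B => fderiv ℝ F B (B * X)) A (A * Y) = fderiv ℝ F A (A * (X * Y - Y * X)) := by
  have hd2 : DifferentiableAt ℝ (fderiv ℝ F) A :=
    (hF.fderiv_right (m := ∞) (by simp)).differentiableAt (by simp)
  have key : ∀ U V : 𝔸, fderiv ℝ (fun B => fderiv ℝ F B (B * V)) A (A * U) =
      fderiv ℝ (fderiv ℝ F) A (A * U) (A * V) + fderiv ℝ F A (A * U * V) := by
    intro U V
    have hV : HasFDerivAt (fun B : 𝔸 => B * V) ((ContinuousLinearMap.mul ℝ 𝔸).flip V) A :=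
      ((ContinuousLinearMap.mul ℝ 𝔸).flip V).hasFDerivAt
    rw [(hd2.hasFDerivAt.clm_apply hV).fderiv]
    simp [add_comm]
  have hsymm : IsSymmSndFDerivAt ℝ F A := by
    refine (hF.of_le (m := 2) (mod_cast le_top : ((2 : ℕ∞) : WithTop ℕ∞) ≤ ∞)).isSymmSndFDerivAt ?_
    simp
  rw [key, key, hsymm.eq, mul_sub, map_sub, ← mul_assoc, ← mul_assoc]
  ring

/-- The commutator of left-invariant vector fields. -/
lemma lieD_comm {f : SOo l → ℂ} (hf : IsSmooth f) {X Y Z : so1 l}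
    (hZ : (Z : Mat l) = (X : Mat l) * Y - (Y : Mat l) * X) (g : SOo l) :
    lieD X (lieD Y f) g - lieD Y (lieD X f) g = lieD Z f g := by
  obtain ⟨F, hF, he⟩ := isSmooth_iff.1 hf g
  have key : ∀ U V : so1 l, lieD U (lieD V f) g =
      fderiv ℝ (fun B => fderiv ℝ F B (B * (V : Mat l))) (mat g) (mat g * (U : Mat l)) := by
    intro U V
    refine lieD_eq_fderiv (F := fun A => fderiv ℝ F A (A * (V : Mat l))) U ?_ ?_
    · exact ((hF.fderiv_right (m := ∞) (by simp)).clm_apply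
        (contDiffAt_id.mul contDiffAt_const)).differentiableAt (by simp)
    · filter_upwards [eventually_differentiableAt hF, he.eventually_nhds] with h h1 h2
      exact (lieD_eq_fderiv V h1 h2).symm
  rw [key, key, lieD_eq_fderiv Z (hF.differentiableAt (by simp)) he, hZ]
  exact fderiv_mul_right_comm hF (X : Mat l) (Y : Mat l)

/-! ### Averages of left translates -/

section Average

variable {T : Type} [TopologicalSpace T] {ι : T → SOo l} {c : T → ℂ}

/-- Both outer factors may move, so one statement serves derivatives from the left and from the
right. The parameter enters only through `mat (ι t)` and `c t`, hence mere continuity in `t` is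
enough. -/
lemma jointlySmooth_translate {E : Type} [NormedAddCommGroup E] [NormedSpace ℝ E]
    {f : SOo l → ℂ} (hf : IsSmooth f) (hι : Continuous ι) {ψ ψ' : E → SOo l}
    (hψ : ContDiff ℝ ∞ fun x => mat (ψ x)) (hψ' : ContDiff ℝ ∞ fun x => mat (ψ' x)) :
    JointlySmooth (fun t => (mat (ι t), c t)) (fun x t => f (ψ x * ι t * ψ' x) * c t) := by
  intro x t
  obtain ⟨F, hF, he⟩ := isSmooth_iff.1 hf (ψ x * ι t * ψ' x)
  refine ⟨fun p => F (mat (ψ p.1) * p.2.1 * mat (ψ' p.1)) * p.2.2, ?_, ?_⟩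
  · refine ContDiffAt.mul (ContDiffAt.comp (g := F) (x, (mat (ι t), c t)) hF ?_) (by fun_prop)
    exact ((hψ.contDiffAt.comp _ contDiffAt_fst).mul (by fun_prop)).mul
      (hψ'.contDiffAt.comp _ contDiffAt_fst)
  · have hc : Continuous ψ := isEmbedding_mat.continuous_iff.2 hψ.continuous
    have hc' : Continuous ψ' := isEmbedding_mat.continuous_iff.2 hψ'.continuous
    have h1 : Continuous fun q : E × T => ψ q.1 * ι q.2 * ψ' q.1 := by fun_prop
    filter_upwards [(h1.tendsto (x, t)).eventually he] with q hq
    rw [← hq, mat_mul, mat_mul]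

variable [MeasurableSpace T] [OpensMeasurableSpace T] [SecondCountableTopology T] [T2Space T]
  {μ : Measure T} [IsFiniteMeasure μ] {S : Set T}

lemma isSmooth_average {f : SOo l → ℂ} (hf : IsSmooth f) (hι : Continuous ι) (hc : Continuous c)
    (hS : IsCompact S) : IsSmooth (fun x => ∫ t in S, f (ι t * x) * c t ∂μ) := by
  intro g k X
  have hψ : ContDiff ℝ ∞ fun τ : Fin k → ℝ => mat (g * expG (∑ i, τ i • X i)) := by
    have hlin : ContDiff ℝ ∞ fun t : Fin k → ℝ => ((∑ i, t i • X i : so1 l) : Mat l) := by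
      have : (fun t : Fin k → ℝ => ((∑ i, t i • X i : so1 l) : Mat l)) =
          fun t => ∑ i, t i • (X i : Mat l) := by
        funext t; simp
      rw [this]
      fun_prop
    exact contDiff_const.mul (contDiff_exp.comp hlin)
  have h := (jointlySmooth_translate (c := c) hf hι (ψ := fun _ => 1) contDiff_const
    hψ).contDiff_integral (μ := μ) (by fun_prop) hS
  simp only [one_mul] at h
  exact h.contDiffAt

lemma hasDerivAt_integral_translate {f : SOo l → ℂ} (hf : IsSmooth f) (hι : Continuous ι)
    (hc : Continuous c) (hS : IsCompact S) {ψ ψ' : ℝ → SOo l}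
    (hψ : ContDiff ℝ ∞ fun x => mat (ψ x)) (hψ' : ContDiff ℝ ∞ fun x => mat (ψ' x)) (s : ℝ) :
    HasDerivAt (fun s => ∫ t in S, f (ψ s * ι t * ψ' s) * c t ∂μ)
      (∫ t in S, deriv (fun s => f (ψ s * ι t * ψ' s)) s * c t ∂μ) s := by
  have hJ := jointlySmooth_translate (c := c) hf hι hψ hψ'
  have hcont : Continuous fun t => (mat (ι t), c t) := by fun_prop
  have h := (hJ.hasFDerivAt_integral (μ := μ) hcont hS s).hasDerivAt
  have hint : IntegrableOn (fun t => fderiv ℝ (fun x => f (ψ x * ι t * ψ' x) * c t) s) S μ := by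
    have := (hJ.fderiv hcont).continuous hcont
    exact (this.uncurry_left s).continuousOn.integrableOn_compact hS
  rw [ContinuousLinearMap.integral_apply hint] at h
  refine h.congr_deriv (integral_congr_ae (Filter.Eventually.of_forall fun t => ?_))
  have hd : DifferentiableAt ℝ (fun s => f (ψ s * ι t * ψ' s)) s := by
    refine (hf.comp_contDiffAt (ψ := fun s => ψ s * ι t * ψ' s) ?_).differentiableAt (by simp)
    exact (hψ.contDiffAt.mul contDiffAt_const).mul hψ'.contDiffAt
  exact (hd.hasDerivAt.mul_const (c t)).deriv

lemma lieD_average {f : SOo l → ℂ} (hf : IsSmooth f) (hι : Continuous ι) (hc : Continuous c)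
    (hS : IsCompact S) (X : so1 l) : lieD X (fun x => ∫ t in S, f (ι t * x) * c t ∂μ) =
      fun x => ∫ t in S, lieD X f (ι t * x) * c t ∂μ := by
  funext x
  have hψ : ContDiff ℝ ∞ fun s : ℝ => mat (x * expG (s • X)) :=
    contDiff_const.mul (contDiff_mat_expG X)
  have h := (hasDerivAt_integral_translate (μ := μ) hf hι hc hS (ψ := fun _ => 1) contDiff_const
    hψ 0).deriv
  simp only [one_mul] at h
  simpa only [lieD, mul_assoc] using h

end Average

end RealHyp

namespace RealHyp

open scoped Topology ContDiff Matrix.Norms.Operator Matrix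

variable {n : ℕ}

/-! ### Coordinates in `G` for `l = n + 2` -/

/-- The indices `1, …, l - 1`. -/
def mid (i : Fin (n + 1)) : Fin (n + 2 + 1) := i.succ.castSucc

lemma mid_injective : Function.Injective (mid : Fin (n + 1) → Fin (n + 2 + 1)) :=
  (Fin.castSucc_injective _).comp (Fin.succ_injective _)

@[simp] lemma mid_inj {i j : Fin (n + 1)} : mid i = mid j ↔ i = j := mid_injective.eq_iff

@[simp] lemma mid_ne_zero (i : Fin (n + 1)) : mid i ≠ 0 := by
  intro h
  have := congrArg Fin.val h
  simp only [mid, Fin.val_castSucc, Fin.val_succ, Fin.val_zero] at this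
  omega

@[simp] lemma mid_ne_last (i : Fin (n + 1)) : mid i ≠ Fin.last (n + 2) := by
  intro h
  have := congrArg Fin.val h
  simp only [mid, Fin.val_castSucc, Fin.val_succ, Fin.val_last] at this
  omega

@[simp] lemma zero_ne_mid (i : Fin (n + 1)) : 0 ≠ mid i := (mid_ne_zero i).symm

@[simp] lemma last_ne_mid (i : Fin (n + 1)) : Fin.last (n + 2) ≠ mid i := (mid_ne_last i).symm

lemma sum_index {R : Type*} [AddCommMonoid R] (f : Fin (n + 2 + 1) → R) :
    ∑ k, f k = f 0 + ∑ i, f (mid i) + f (Fin.last (n + 2)) := by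
  rw [Fin.sum_univ_castSucc, Fin.sum_univ_succ]
  rfl

lemma index_cases {p : Fin (n + 2 + 1) → Prop} (h0 : p 0) (hl : p (Fin.last (n + 2)))
    (hm : ∀ i, p (mid i)) (k : Fin (n + 2 + 1)) : p k := by
  refine Fin.lastCases hl (fun k => ?_) k
  refine Fin.cases h0 (fun i => hm i) k

lemma ext_index {A B : Mat (n + 2)}
    (h00 : A 0 0 = B 0 0) (h0l : A 0 (Fin.last _) = B 0 (Fin.last _)) (h0m : ∀ j, A 0 (mid j) = B 0 (mid j))
    (hl0 : A (Fin.last _) 0 = B (Fin.last _) 0)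
    (hll : A (Fin.last _) (Fin.last _) = B (Fin.last _) (Fin.last _))
    (hlm : ∀ j, A (Fin.last _) (mid j) = B (Fin.last _) (mid j))
    (hm0 : ∀ i, A (mid i) 0 = B (mid i) 0) (hml : ∀ i, A (mid i) (Fin.last _) = B (mid i) (Fin.last _))
    (hmm : ∀ i j, A (mid i) (mid j) = B (mid i) (mid j)) : A = B := by
  refine Matrix.ext fun i => ?_
  refine index_cases (p := fun i => ∀ j, A i j = B i j) ?_ ?_ (fun i => ?_) i
  · exact index_cases h00 h0l h0m
  · exact index_cases hl0 hll hlm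
  · exact index_cases (hm0 i) (hml i) (hmm i)

section Entries

lemma J_apply {l : ℕ} (i j : Fin (l + 1)) : J l i j = if i = j then (if i = 0 then -1 else 1) else 0 := by
  simp [J, Matrix.diagonal_apply]

lemma J_mul_apply {l : ℕ} (A : Mat l) (i j : Fin (l + 1)) :
    (J l * A) i j = (if i = 0 then -1 else 1) * A i j := by
  simp [J, Matrix.diagonal_mul]

lemma mul_J_apply {l : ℕ} (A : Mat l) (i j : Fin (l + 1)) :
    (A * J l) i j = A i j * (if j = 0 then -1 else 1) := by
  simp [J, Matrix.mul_diagonal]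

lemma gen_apply {l : ℕ} (i j p q : Fin (l + 1)) : (gen i j : Mat l) p q =
    ((if i = p ∧ j = q then 1 else 0) - (if j = p ∧ i = q then 1 else 0)) *
      (if q = 0 then -1 else 1) := by
  refine (mul_J_apply _ p q).trans ?_
  simp [Matrix.single_apply]

lemma so1_apply {l : ℕ} (X : so1 l) (i j : Fin (l + 1)) :
    (if j = 0 then -1 else 1) * (X : Mat l) j i = -((if i = 0 then -1 else 1) * (X : Mat l) i j) := by
  have h := congrFun (congrFun (mem_so1.1 X.2) i) j
  rw [mul_J_apply, J_mul_apply, Matrix.transpose_apply, Matrix.neg_apply] at h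
  rw [mul_comm, h]
  ring

end Entries

lemma H0_mul_apply (A : Mat (n + 2)) (j : Fin (n + 2 + 1)) :
    (((H0 (n + 2) : Mat (n + 2)) * A) 0 j = A (Fin.last _) j) ∧
    (((H0 (n + 2) : Mat (n + 2)) * A) (Fin.last _) j = A 0 j) ∧
    (∀ i, ((H0 (n + 2) : Mat (n + 2)) * A) (mid i) j = 0) := by
  refine ⟨?_, ?_, fun i => ?_⟩ <;>
  simp [Matrix.mul_apply, sum_index, H0, gen_apply]

lemma mul_H0_apply (A : Mat (n + 2)) (i : Fin (n + 2 + 1)) :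
    ((A * (H0 (n + 2) : Mat (n + 2))) i 0 = A i (Fin.last _)) ∧
    ((A * (H0 (n + 2) : Mat (n + 2))) i (Fin.last _) = A i 0) ∧
    (∀ j, (A * (H0 (n + 2) : Mat (n + 2))) i (mid j) = 0) := by
  refine ⟨?_, ?_, fun i => ?_⟩ <;>
  simp [Matrix.mul_apply, H0, gen_apply]

/-- The isomorphism of `ℝ^{l-1}` with `𝔫`. -/
def Nm : (Fin (n + 1) → ℝ) →ₗ[ℝ] so1 (n + 2) :=
  Fintype.linearCombination ℝ fun i => gen 0 (mid i) + gen (Fin.last (n + 2)) (mid i)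

lemma Nm_coe (y : Fin (n + 1) → ℝ) : (Nm y : Mat (n + 2)) =
    ∑ i, y i • ((gen 0 (mid i) : Mat (n + 2)) + gen (Fin.last (n + 2)) (mid i)) := by
  simp [Nm, Fintype.linearCombination_apply]

lemma Nm_single (i : Fin (n + 1)) :
    Nm (Pi.single i 1) = gen 0 (mid i) + gen (Fin.last (n + 2)) (mid i) := by
  simp [Nm]

section NmEntries
variable (y : Fin (n + 1) → ℝ) (i j : Fin (n + 1))

@[simp] lemma Nm_00 : (Nm y : Mat (n + 2)) 0 0 = 0 := by
  simp [Nm_coe, Matrix.sum_apply, gen_apply]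
@[simp] lemma Nm_0l : (Nm y : Mat (n + 2)) 0 (Fin.last _) = 0 := by
  simp [Nm_coe, Matrix.sum_apply, gen_apply]
@[simp] lemma Nm_l0 : (Nm y : Mat (n + 2)) (Fin.last _) 0 = 0 := by
  simp [Nm_coe, Matrix.sum_apply, gen_apply]
@[simp] lemma Nm_ll : (Nm y : Mat (n + 2)) (Fin.last _) (Fin.last _) = 0 := by
  simp [Nm_coe, Matrix.sum_apply, gen_apply]
@[simp] lemma Nm_mm : (Nm y : Mat (n + 2)) (mid i) (mid j) = 0 := by
  simp [Nm_coe, Matrix.sum_apply, gen_apply]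
@[simp] lemma Nm_0m : (Nm y : Mat (n + 2)) 0 (mid j) = y j := by
  simp [Nm_coe, Matrix.sum_apply, gen_apply]
@[simp] lemma Nm_m0 : (Nm y : Mat (n + 2)) (mid i) 0 = y i := by
  simp [Nm_coe, Matrix.sum_apply, gen_apply]
@[simp] lemma Nm_lm : (Nm y : Mat (n + 2)) (Fin.last _) (mid j) = y j := by
  simp [Nm_coe, Matrix.sum_apply, gen_apply]
@[simp] lemma Nm_ml : (Nm y : Mat (n + 2)) (mid i) (Fin.last _) = -y i := by
  simp [Nm_coe, Matrix.sum_apply, gen_apply]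

end NmEntries

lemma H0_Nm (y : Fin (n + 1) → ℝ) : (H0 (n + 2) : Mat (n + 2)) * Nm y - (Nm y : Mat (n + 2)) * H0 (n + 2) = Nm y := by
  apply ext_index <;> intros <;>
    simp [H0_mul_apply, mul_H0_apply]

lemma exists_Nm_of_mem_nLie {X : so1 (n + 2)} (hX : X ∈ nLie (n + 2)) : ∃ y, X = Nm y := by
  have h : (H0 (n + 2) : Mat (n + 2)) * X - (X : Mat (n + 2)) * H0 (n + 2) = X := hX
  have e : ∀ i j, ((H0 (n + 2) : Mat (n + 2)) * X - (X : Mat (n + 2)) * H0 (n + 2)) i j = (X : Mat (n + 2)) i j :=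
    fun i j => congrFun (congrFun h i) j
  have s := so1_apply X
  refine ⟨fun j => (X : Mat (n + 2)) 0 (mid j), Subtype.ext ?_⟩
  have e00 := e 0 0
  have e0l := e 0 (Fin.last _)
  have el0 := e (Fin.last _) 0
  have ell := e (Fin.last _) (Fin.last _)
  have e0m := fun j => e 0 (mid j)
  have elm := fun j => e (Fin.last _) (mid j)
  have em0 := fun j => e (mid j) 0
  have eml := fun j => e (mid j) (Fin.last _)
  have emm := fun i j => e (mid i) (mid j)
  have s00 := s 0 0
  have sll := s (Fin.last _) (Fin.last _)
  have sl0 := s (Fin.last _) 0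
  have sm0 := fun j => s (mid j) 0
  simp only [Matrix.sub_apply, H0_mul_apply, mul_H0_apply] at e00 e0l el0 ell e0m elm em0 eml emm
  simp at s00 sll sl0 sm0
  have a1 : ∀ j, (X : Mat (n + 2)) (Fin.last _) (mid j) = (X : Mat (n + 2)) 0 (mid j) := fun j => by
    linarith [e0m j]
  have a2 : ∀ j, (X : Mat (n + 2)) (mid j) (Fin.last _) = -(X : Mat (n + 2)) 0 (mid j) := fun j => by
    linarith [eml j, sm0 j]
  have a3 : ∀ i j, (X : Mat (n + 2)) (mid i) (mid j) = 0 := fun i j => by linarith [emm i j]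
  refine ext_index ?_ ?_ ?_ ?_ ?_ ?_ ?_ ?_ ?_ <;> intros <;> simp [a1, a2, a3, sm0] <;> linarith

lemma Nm_mul_Nm_mul_Nm (x y z : Fin (n + 1) → ℝ) :
    (Nm x : Mat (n + 2)) * Nm y * Nm z = 0 := by
  apply ext_index <;> intros <;>
    simp [Matrix.mul_apply, sum_index, Finset.sum_mul, Finset.sum_neg_distrib]

lemma Nm_mul_comm (x y : Fin (n + 1) → ℝ) :
    (Nm x : Mat (n + 2)) * Nm y = (Nm y : Mat (n + 2)) * Nm x := by
  apply ext_index <;> intros <;>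
    simp [Matrix.mul_apply, sum_index, mul_comm]

/-- Source of the scale `2√(l-1)` in the final formulas: `Nm x` is a unit vector exactly when
`2√(l-1) x` is a Euclidean unit vector. -/
lemma Btheta_Nm (x y : Fin (n + 1) → ℝ) :
    Btheta (Nm x : Mat (n + 2)) (Nm y) = 4 * (n + 1) * (x ⬝ᵥ y) := by
  have hθ : ∀ i j, (J (n + 2) * (Nm y : Mat (n + 2)) * J (n + 2)) i j =
      (if i = 0 then -1 else 1) * (Nm y : Mat (n + 2)) i j * (if j = 0 then -1 else 1) := fun i j => by
    rw [mul_J_apply, J_mul_apply]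
  simp only [Btheta, killing, Matrix.trace, Matrix.diag_apply]
  rw [Finset.sum_congr rfl fun i _ => Matrix.mul_apply]
  simp only [hθ]
  simp [sum_index, dotProduct, Finset.sum_add_distrib]
  ring


/-! ### `𝔪` and `M` -/

section mLie
variable (Z : mLie (n + 2))

lemma mLie_zero_row (k : Fin (n + 2 + 1)) : ((Z : so1 (n + 2)) : Mat (n + 2)) 0 k = 0 ∧
    ((Z : so1 (n + 2)) : Mat (n + 2)) (Fin.last _) k = 0 ∧
    ((Z : so1 (n + 2)) : Mat (n + 2)) k 0 = 0 ∧ ((Z : so1 (n + 2)) : Mat (n + 2)) k (Fin.last _) = 0 := by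
  obtain ⟨h1, h2⟩ := Z.2
  have a := fun i j => congrFun (congrFun h1 i) j
  have b := fun i j => congrFun (congrFun h2 i) j
  have s := so1_apply (Z : so1 (n + 2))
  simp only [J_mul_apply, mul_J_apply] at a
  have z0 : ∀ k, ((Z : so1 (n + 2)) : Mat (n + 2)) 0 k = 0 := fun k => by
    rcases eq_or_ne k 0 with rfl | hk
    · have := s 0 0
      simp at this
      linarith
    · have := a 0 k
      simp [hk] at this
      linarith
  have z0' : ∀ k, ((Z : so1 (n + 2)) : Mat (n + 2)) k 0 = 0 := fun k => by
    rcases eq_or_ne k 0 with rfl | hk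
    · exact z0 0
    · have := a k 0
      simp [hk] at this
      linarith
  refine ⟨z0 k, ?_, z0' k, ?_⟩
  · rw [← (H0_mul_apply ((Z : so1 (n + 2)) : Mat (n + 2)) k).1, b 0 k]
    revert k
    refine index_cases ?_ ?_ (fun i => ?_)
    · rw [(mul_H0_apply _ 0).1, z0]
    · rw [(mul_H0_apply _ 0).2.1, z0]
    · rw [(mul_H0_apply _ 0).2.2]
  · rw [← (mul_H0_apply ((Z : so1 (n + 2)) : Mat (n + 2)) k).1, ← b k 0]
    revert k
    refine index_cases ?_ ?_ (fun i => ?_)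
    · rw [(H0_mul_apply _ 0).1, z0']
    · rw [(H0_mul_apply _ 0).2.1, z0]
    · rw [(H0_mul_apply _ 0).2.2]

@[simp] lemma mLie_0 (k : Fin (n + 2 + 1)) : ((Z : so1 (n + 2)) : Mat (n + 2)) 0 k = 0 :=
  (mLie_zero_row Z k).1
@[simp] lemma mLie_l (k : Fin (n + 2 + 1)) : ((Z : so1 (n + 2)) : Mat (n + 2)) (Fin.last _) k = 0 :=
  (mLie_zero_row Z k).2.1
@[simp] lemma mLie_0' (k : Fin (n + 2 + 1)) : ((Z : so1 (n + 2)) : Mat (n + 2)) k 0 = 0 :=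
  (mLie_zero_row Z k).2.2.1
@[simp] lemma mLie_l' (k : Fin (n + 2 + 1)) : ((Z : so1 (n + 2)) : Mat (n + 2)) k (Fin.last _) = 0 :=
  (mLie_zero_row Z k).2.2.2

end mLie

/-- The middle block of a matrix. -/
def blk (A : Mat (n + 2)) : Matrix (Fin (n + 1)) (Fin (n + 1)) ℝ := A.submatrix mid mid

@[simp] lemma blk_apply (A : Mat (n + 2)) (i j : Fin (n + 1)) : blk A i j = A (mid i) (mid j) := rfl

lemma mLie_ext {Z W : mLie (n + 2)}
    (h : blk ((Z : so1 (n + 2)) : Mat (n + 2)) = blk ((W : so1 (n + 2)) : Mat (n + 2))) : Z = W := by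
  apply Subtype.ext
  apply Subtype.ext
  refine ext_index ?_ ?_ ?_ ?_ ?_ ?_ ?_ ?_ fun i j => congrFun (congrFun h i) j <;> intros <;>
    simp only [mLie_0, mLie_l, mLie_0', mLie_l']

lemma blk_transpose_mLie (Z : mLie (n + 2)) :
    (blk ((Z : so1 (n + 2)) : Mat (n + 2))).transpose = -blk ((Z : so1 (n + 2)) : Mat (n + 2)) := by
  ext i j
  have := so1_apply (Z : so1 (n + 2)) (mid i) (mid j)
  simpa using this

/-- The rotation generators `E_ij - E_ji ∈ 𝔪`. -/
def rot (i j : Fin (n + 1)) : mLie (n + 2) :=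
  ⟨gen (mid i) (mid j), by
    constructor
    · refine Matrix.ext fun p q => ?_
      rw [J_mul_apply, mul_J_apply, gen_apply]
      by_cases hp : p = 0 <;> by_cases hq : q = 0 <;> simp [hp, hq]
    · apply ext_index <;> intros <;>
        simp [H0_mul_apply, mul_H0_apply, gen_apply]⟩

lemma blk_rot (i j : Fin (n + 1)) : blk ((rot i j : so1 (n + 2)) : Mat (n + 2)) =
    Matrix.single i j 1 - Matrix.single j i 1 := by
  ext p q
  change (gen (mid i) (mid j) : Mat (n + 2)) (mid p) (mid q) = _
  rw [gen_apply]
  simp [Matrix.single_apply]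

/-- `[Z, Nm y] = Nm (Z y)`. -/
lemma mLie_Nm (Z : mLie (n + 2)) (y : Fin (n + 1) → ℝ) :
    ((Z : so1 (n + 2)) : Mat (n + 2)) * Nm y - (Nm y : Mat (n + 2)) * ((Z : so1 (n + 2)) : Mat (n + 2)) =
      Nm (blk ((Z : so1 (n + 2)) : Mat (n + 2)) *ᵥ y) := by
  have s : ∀ i j, ((Z : so1 (n + 2)) : Mat (n + 2)) (mid j) (mid i) = -((Z : so1 (n + 2)) : Mat (n + 2)) (mid i) (mid j) := fun i j => by
    have := so1_apply (Z : so1 (n + 2)) (mid i) (mid j)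
    simpa using this
  apply ext_index <;> intros <;>
    simp [Matrix.mul_apply, sum_index, Matrix.mulVec, dotProduct]
  all_goals rename_i j
  all_goals rw [← Finset.sum_neg_distrib]
  all_goals refine Finset.sum_congr rfl fun i _ => ?_
  all_goals rw [s i j]
  all_goals ring

section M
variable (m : M (n + 2))

lemma mat_M_commute_J : J (n + 2) * mat (m : SOo (n + 2)) = mat (m : SOo (n + 2)) * J (n + 2) := m.2.1

lemma mat_a {l : ℕ} (t : ℝ) : mat (a t : SOo l) = NormedSpace.exp (t • (H0 l : Mat l)) := rfl

/-- Differentiate `a_t m = m a_t` at `t = 0`. -/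
lemma mat_M_commute_H0 : (H0 (n + 2) : Mat (n + 2)) * mat (m : SOo (n + 2)) = mat (m : SOo (n + 2)) * H0 (n + 2) := by
  have h : ∀ t : ℝ, mat (a t) * mat (m : SOo (n + 2)) = mat (m : SOo (n + 2)) * mat (a t) := fun t => by
    rw [← mat_mul, ← mat_mul]
    exact congrArg mat (Subgroup.mem_centralizer_iff.1 m.2.2 _ ⟨t, rfl⟩)
  have h1 := (hasDerivAt_exp_smul_const (𝕂 := ℝ) (H0 (n + 2) : Mat (n + 2)) 0)
  have h2 := h1.mul_const (mat (m : SOo (n + 2)))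
  have h3 := h1.const_mul (mat (m : SOo (n + 2)))
  have h5 := (h2.congr_of_eventuallyEq (Filter.Eventually.of_forall fun t => (h t).symm)).unique h3
  simpa using h5

end M

/-- The entry `g_00` of an element of `SO_o(1,l)` is positive. -/
lemma mat_zero_zero_pos {l : ℕ} (g : SOo l) : 0 < mat g 0 0 := by
  have hne : ∀ x : SO1 l, ((x : GL (Fin (l + 1)) ℝ) : Mat l) 0 0 ≠ 0 := by
    intro x h0
    have h := congrFun (congrFun x.2.1 0) 0
    rw [Matrix.mul_apply] at h
    simp only [mul_J_apply, Matrix.transpose_apply, J_apply] at h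
    rw [Fin.sum_univ_succ] at h
    simp only [h0, if_true, Fin.succ_ne_zero, if_false, mul_one, mul_zero, zero_add] at h
    have : 0 ≤ ∑ i : Fin l, ((x : GL (Fin (l + 1)) ℝ) : Mat l) i.succ 0 *
        ((x : GL (Fin (l + 1)) ℝ) : Mat l) i.succ 0 :=
      Finset.sum_nonneg fun i _ => mul_self_nonneg _
    linarith
  obtain ⟨x, hx, hxg⟩ := g.2
  have hc : Continuous fun x : SO1 l => ((x : GL (Fin (l + 1)) ℝ) : Mat l) 0 0 := by
    have : Continuous fun x : SO1 l => ((x : GL (Fin (l + 1)) ℝ) : Mat l) :=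
      Units.continuous_val.comp continuous_subtype_val
    exact (continuous_apply_apply (0 : Fin (l + 1)) (0 : Fin (l + 1))).comp this
  have hp := (isPreconnected_connectedComponent (x := (1 : SO1 l))).image _ hc.continuousOn
  -- The entry vanishes nowhere on `SO(1,l)` and is `1` at the identity. A nonpositive value on the
  -- identity component would force a zero in between.
  by_contra hneg
  have h1 : mat g 0 0 ∈ (fun x : SO1 l => ((x : GL (Fin (l + 1)) ℝ) : Mat l) 0 0) ''
      connectedComponent 1 := ⟨x, hx, by rw [mat, ← hxg]; rfl⟩
  have h2 : (1 : ℝ) ∈ (fun x : SO1 l => ((x : GL (Fin (l + 1)) ℝ) : Mat l) 0 0) ''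
      connectedComponent 1 := ⟨1, mem_connectedComponent, by simp⟩
  obtain ⟨y, -, hy⟩ := hp.Icc_subset h1 h2 ⟨not_lt.1 hneg, zero_le_one⟩
  exact hne y hy

/-- Commuting with `J` and preserving the form give `m_00² = 1`, and positivity on the identity
component selects `1`. Commuting with `H_0` then carries the first row and column over to the last
ones. -/
lemma mat_M_rows (m : M (n + 2)) (k : Fin (n + 2 + 1)) :
    mat (m : SOo (n + 2)) 0 k = (1 : Mat (n + 2)) 0 k ∧ mat (m : SOo (n + 2)) k 0 = (1 : Mat (n + 2)) k 0 ∧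
    mat (m : SOo (n + 2)) (Fin.last _) k = (1 : Mat (n + 2)) (Fin.last _) k ∧
    mat (m : SOo (n + 2)) k (Fin.last _) = (1 : Mat (n + 2)) k (Fin.last _) := by
  have a := fun i j => congrFun (congrFun (mat_M_commute_J m) i) j
  have b := fun i j => congrFun (congrFun (mat_M_commute_H0 m) i) j
  simp only [J_mul_apply, mul_J_apply] at a
  have z0 : ∀ k ≠ 0, mat (m : SOo (n + 2)) 0 k = 0 := fun k hk => by
    have := a 0 k
    simp [hk] at this
    linarith
  have z0' : ∀ k ≠ 0, mat (m : SOo (n + 2)) k 0 = 0 := fun k hk => by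
    have := a k 0
    simp [hk] at this
    linarith
  have z00 : mat (m : SOo (n + 2)) 0 0 = 1 := by
    have h := congrFun (congrFun (mat_preserves (m : SOo (n + 2))) 0) 0
    rw [Matrix.mul_apply, Fin.sum_univ_succ] at h
    simp only [mul_J_apply, Matrix.transpose_apply, J_apply] at h
    simp [z0', Fin.succ_ne_zero] at h
    have hp := mat_zero_zero_pos (m : SOo (n + 2))
    nlinarith
  have r0 : ∀ k, mat (m : SOo (n + 2)) 0 k = (1 : Mat (n + 2)) 0 k := fun k => by
    rcases eq_or_ne k 0 with rfl | hk
    · simp [z00]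
    · rw [z0 k hk, Matrix.one_apply_ne hk.symm]
  have c0 : ∀ k, mat (m : SOo (n + 2)) k 0 = (1 : Mat (n + 2)) k 0 := fun k => by
    rcases eq_or_ne k 0 with rfl | hk
    · simp [z00]
    · rw [z0' k hk, Matrix.one_apply_ne hk]
  refine ⟨r0 k, c0 k, ?_, ?_⟩
  · rw [← (H0_mul_apply (mat (m : SOo (n + 2))) k).1, b 0 k]
    revert k
    refine index_cases ?_ ?_ (fun i => ?_)
    · rw [(mul_H0_apply _ 0).1, r0]; simp
    · rw [(mul_H0_apply _ 0).2.1, r0]; simp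
    · rw [(mul_H0_apply _ 0).2.2]; simp
  · rw [← (mul_H0_apply (mat (m : SOo (n + 2))) k).1, ← b k 0]
    revert k
    refine index_cases ?_ ?_ (fun i => ?_)
    · rw [(H0_mul_apply _ 0).1, c0]; simp
    · rw [(H0_mul_apply _ 0).2.1, c0]; simp
    · rw [(H0_mul_apply _ 0).2.2]; simp


lemma mat_M_mid_zero (m : M (n + 2)) (i : Fin (n + 1)) :
    mat (m : SOo (n + 2)) (mid i) 0 = 0 ∧ mat (m : SOo (n + 2)) 0 (mid i) = 0 ∧
    mat (m : SOo (n + 2)) (mid i) (Fin.last _) = 0 ∧ mat (m : SOo (n + 2)) (Fin.last _) (mid i) = 0 := by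
  obtain ⟨h1, h2, h3, h4⟩ := mat_M_rows m (mid i)
  rw [h1, h2, h3, h4]
  simp

lemma mat_M_corner (m : M (n + 2)) :
    mat (m : SOo (n + 2)) 0 0 = 1 ∧ mat (m : SOo (n + 2)) 0 (Fin.last _) = 0 ∧
    mat (m : SOo (n + 2)) (Fin.last _) 0 = 0 ∧ mat (m : SOo (n + 2)) (Fin.last _) (Fin.last _) = 1 := by
  obtain ⟨h1, h2, h3, h4⟩ := mat_M_rows m 0
  obtain ⟨h5, h6, h7, h8⟩ := mat_M_rows m (Fin.last _)
  rw [h1, h3, h4, h8]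
  simp

/-- The action of `M` on `ℝ^{l-1}`. -/
def mblk (m : M (n + 2)) : Matrix (Fin (n + 1)) (Fin (n + 1)) ℝ := blk (mat (m : SOo (n + 2)))

@[fun_prop]
lemma continuous_mblk : Continuous (mblk : M (n + 2) → _) :=
  (continuous_mat.comp continuous_subtype_val).matrix_submatrix mid mid

lemma mat_M_eq_iff {m m' : M (n + 2)} : m = m' ↔ mblk m = mblk m' := by
  constructor
  · rintro rfl; rfl
  · intro h
    apply Subtype.ext
    apply mat_injective
    obtain ⟨a1, a2, a3, a4⟩ := mat_M_corner m
    obtain ⟨b1, b2, b3, b4⟩ := mat_M_corner m'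
    have a := mat_M_mid_zero m
    have b := mat_M_mid_zero m'
    apply ext_index
    · rw [a1, b1]
    · rw [a2, b2]
    · intro j; rw [(a j).2.1, (b j).2.1]
    · rw [a3, b3]
    · rw [a4, b4]
    · intro j; rw [(a j).2.2.2, (b j).2.2.2]
    · intro j; rw [(a j).1, (b j).1]
    · intro j; rw [(a j).2.2.1, (b j).2.2.1]
    · exact fun i j => congrFun (congrFun h i) j

@[simp] lemma mblk_mul (m m' : M (n + 2)) : mblk (m * m') = mblk m * mblk m' := by
  ext i j
  simp only [mblk, blk_apply, Subgroup.coe_mul, mat_mul, Matrix.mul_apply, sum_index]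
  rw [(mat_M_mid_zero m i).1, (mat_M_mid_zero m i).2.2.1]
  simp

@[simp] lemma mblk_one : mblk (1 : M (n + 2)) = 1 := by
  ext i j
  simp [mblk, mat_one, Matrix.one_apply]

lemma mblk_transpose_mul (m : M (n + 2)) : (mblk m).transpose * mblk m = 1 := by
  ext i j
  have h := congrFun (congrFun (mat_preserves (m : SOo (n + 2))) (mid i)) (mid j)
  rw [Matrix.mul_apply, sum_index] at h
  simp only [mul_J_apply, Matrix.transpose_apply, J_apply] at h
  rw [(mat_M_mid_zero m j).2.1, (mat_M_mid_zero m j).2.2.2] at h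
  simpa [Matrix.mul_apply, mblk, Matrix.one_apply] using h

lemma mblk_inv (m : M (n + 2)) : mblk m⁻¹ = (mblk m).transpose := by
  have h : mblk m * mblk m⁻¹ = 1 := by rw [← mblk_mul, mul_inv_cancel, mblk_one]
  calc mblk m⁻¹ = (mblk m).transpose * mblk m * mblk m⁻¹ := by rw [mblk_transpose_mul, Matrix.one_mul]
    _ = _ := by rw [Matrix.mul_assoc, h, Matrix.mul_one]

lemma mblk_mulVec_dotProduct (m : M (n + 2)) (x y : Fin (n + 1) → ℝ) :
    (mblk m *ᵥ x) ⬝ᵥ (mblk m *ᵥ y) = x ⬝ᵥ y := by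
  rw [Matrix.dotProduct_mulVec, Matrix.vecMul_mulVec, mblk_transpose_mul, Matrix.vecMul_one]

lemma M_mul_Nm (m : M (n + 2)) (y : Fin (n + 1) → ℝ) :
    mat (m : SOo (n + 2)) * (Nm y : Mat (n + 2)) = (Nm (mblk m *ᵥ y) : Mat (n + 2)) * mat (m : SOo (n + 2)) := by
  obtain ⟨a1, a2, a3, a4⟩ := mat_M_corner m
  have a := mat_M_mid_zero m
  have ho := fun i => congrFun (congrArg (fun A => A *ᵥ y) (mblk_transpose_mul m)) i
  simp only [← Matrix.mulVec_mulVec, Matrix.one_mulVec] at ho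
  have ho' : ∀ j, ∑ i, (mblk m *ᵥ y) i * mat (m : SOo (n + 2)) (mid i) (mid j) = y j := fun j => by
    rw [← ho j, Matrix.mulVec, dotProduct]
    exact Finset.sum_congr rfl fun i _ => mul_comm _ _
  apply ext_index <;> intros <;>
    simp [Matrix.mul_apply, sum_index, a1, a2, a3, a4, a, ho']
  · rfl
  · rfl

lemma expG_Nm_conj (m : M (n + 2)) (y : Fin (n + 1) → ℝ) :
    (m : SOo (n + 2)) * expG (Nm y) = expG (Nm (mblk m *ᵥ y)) * m := by
  apply mat_injective
  exact SemiconjBy.exp_right (x := mat (m : SOo (n + 2))) (M_mul_Nm m y)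

/-- `[H_0, Nm y] = Nm y` can be read as `Nm y (H_0 + 1) = H_0 Nm y`. Exponentiating this
semiconjugacy gives `Ad(a_t) Nm y = e^t Nm y`. -/
lemma a_mul_expG_Nm (t : ℝ) (y : Fin (n + 1) → ℝ) :
    a t * expG (Nm y) = expG (Nm (Real.exp t • y)) * a t := by
  have h1 : SemiconjBy (Nm y : Mat (n + 2)) (t • ((H0 (n + 2) : Mat (n + 2)) + 1)) (t • (H0 (n + 2) : Mat (n + 2))) := by
    have h := H0_Nm y
    unfold SemiconjBy
    rw [Matrix.mul_smul, Matrix.smul_mul, Matrix.mul_add, Matrix.mul_one]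
    congr 1
    rw [sub_eq_iff_eq_add] at h
    rw [h]
    exact add_comm _ _
  have h2 : NormedSpace.exp (t • ((H0 (n + 2) : Mat (n + 2)) + 1)) =
      Real.exp t • NormedSpace.exp (t • (H0 (n + 2) : Mat (n + 2))) := by
    rw [smul_add, Matrix.exp_add_of_commute _ _ ((Commute.one_right _).smul_right t)]
    have : NormedSpace.exp (t • (1 : Mat (n + 2))) = Real.exp t • (1 : Mat (n + 2)) := by
      have := NormedSpace.algebraMap_exp_comm (𝔸 := Mat (n + 2)) t
      rw [Algebra.algebraMap_eq_smul_one, Algebra.algebraMap_eq_smul_one] at this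
      rw [Real.exp_eq_exp_ℝ]
      exact this.symm
    rw [this, Matrix.mul_smul, Matrix.mul_one]
  have h3 : (Nm y : Mat (n + 2)) * NormedSpace.exp (t • ((H0 (n + 2) : Mat (n + 2)) + 1)) =
      NormedSpace.exp (t • (H0 (n + 2) : Mat (n + 2))) * Nm y := h1.exp_right
  rw [h2] at h3
  apply mat_injective
  have h4 : SemiconjBy (mat (a t)) (Nm y : Mat (n + 2)) (Nm (Real.exp t • y) : Mat (n + 2)) := by
    unfold SemiconjBy
    rw [mat_a, map_smul, Submodule.coe_smul, Matrix.smul_mul, ← h3, Matrix.mul_smul]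
  exact h4.exp_right

lemma exp_Nm (y : Fin (n + 1) → ℝ) : NormedSpace.exp (Nm y : Mat (n + 2)) =
    1 + (Nm y : Mat (n + 2)) + (2⁻¹ : ℝ) • ((Nm y : Mat (n + 2)) * Nm y) := by
  have h3 : (Nm y : Mat (n + 2)) ^ 3 = 0 := by
    rw [pow_succ, pow_two]; exact Nm_mul_Nm_mul_Nm y y y
  rw [NormedSpace.exp_eq_tsum ℝ]
  change ∑' k : ℕ, ((k.factorial : ℝ)⁻¹ • (Nm y : Mat (n + 2)) ^ k) = _
  rw [tsum_eq_sum (s := Finset.range 3)]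
  · simp [Finset.sum_range_succ, Nat.factorial, pow_two]
  · intro k hk
    have : 3 ≤ k := by simpa using hk
    rw [← Nat.sub_add_cancel this, pow_add, h3, mul_zero, smul_zero]

/-- `exp(-Nm y) Z exp(Nm y) = Z + [Z, Nm y]` without further terms, since `[Z, Nm y]` lies in the
abelian algebra `𝔫`. Through this identity left derivatives along `𝔪` become right derivatives on a
slice. -/
lemma expG_mLie_mul_expG_Nm (Z : mLie (n + 2)) (y : Fin (n + 1) → ℝ) (t : ℝ) :
    expG (t • (Z : so1 (n + 2))) * expG (Nm y) =
      expG (Nm y) * expG (t • ((Z : so1 (n + 2)) + Nm (blk ((Z : so1 (n + 2)) : Mat (n + 2)) *ᵥ y))) := by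
  set Y := blk ((Z : so1 (n + 2)) : Mat (n + 2)) *ᵥ y with hY
  have hc := mLie_Nm Z y
  rw [← hY, sub_eq_iff_eq_add] at hc
  set z := ((Z : so1 (n + 2)) : Mat (n + 2)) with hz
  set X := (Nm y : Mat (n + 2)) with hX
  have h1 : SemiconjBy (NormedSpace.exp X) (z + (Nm Y : Mat (n + 2))) z := by
    unfold SemiconjBy
    rw [hX, exp_Nm, ← hX]
    have e1 : X * (Nm Y : Mat (n + 2)) = (Nm Y : Mat (n + 2)) * X := Nm_mul_comm _ _
    have e2 : X * X * (Nm Y : Mat (n + 2)) = 0 := Nm_mul_Nm_mul_Nm _ _ _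
    have e3 : z * (X * X) = X * X * z + (2 : ℝ) • (X * (Nm Y : Mat (n + 2))) := by
      rw [← Matrix.mul_assoc, hc, Matrix.add_mul, Matrix.mul_assoc X z X, hc, Matrix.mul_add, ← e1,
        two_smul, Matrix.mul_assoc]
      abel
    simp only [Matrix.add_mul, Matrix.mul_add, Matrix.one_mul, Matrix.mul_one, Matrix.smul_mul,
      Matrix.mul_smul, e2, e3, smul_zero, add_zero, smul_add, smul_smul]
    rw [hc]
    norm_num
    abel
  apply mat_injective
  have h2 : SemiconjBy (NormedSpace.exp X) (t • (z + (Nm Y : Mat (n + 2)))) (t • z) := by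
    unfold SemiconjBy at h1 ⊢
    rw [Matrix.mul_smul, h1, Matrix.smul_mul]
  exact (h2.exp_right).symm

/-- An element of `G` that fixes the base point `e_0` of hyperbolic space lies in `K`. -/
lemma mem_K_of_col {l : ℕ} {g : SOo l} (h : ∀ k, mat g k 0 = (1 : Mat l) k 0) : g ∈ K l := by
  have h0 : ∀ k, mat g 0 k = (1 : Mat l) 0 k := by
    intro k
    have e := congrFun (congrFun (mat_preserves g) 0) k
    rw [Matrix.mul_apply, Finset.sum_eq_single 0] at e
    · rw [mul_J_apply, Matrix.transpose_apply, h 0, J_apply] at e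
      rcases eq_or_ne k 0 with rfl | hk
      · exact h 0
      · rw [Matrix.one_apply_ne hk.symm]
        simpa [hk.symm] using e
    · intro j _ hj
      rw [mul_J_apply, Matrix.transpose_apply, h j, Matrix.one_apply_ne hj]
      ring
    · simp
  change J l * mat g = mat g * J l
  refine Matrix.ext fun i j => ?_
  rw [J_mul_apply, mul_J_apply]
  by_cases hi : i = 0
  · subst hi
    rw [h0]
    by_cases hj : j = 0
    · simp [hj]
    · rw [Matrix.one_apply_ne (Ne.symm hj)]; simp
  · by_cases hj : j = 0
    · subst hj; rw [h, Matrix.one_apply_ne hi]; simp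
    · simp [hi, hj]

/-- Elements of `M` that fix the `ℝ^{l-1}`-component of the point `xK` fix `xK`. -/
lemma conj_mem_K {x : SOo (n + 2)} {h : M (n + 2)}
    (hx : mblk h *ᵥ (fun i => mat x (mid i) 0) = fun i => mat x (mid i) 0) :
    x⁻¹ * h * x ∈ K (n + 2) := by
  apply mem_K_of_col
  obtain ⟨a1, a2, a3, a4⟩ := mat_M_corner h
  have a := mat_M_mid_zero h
  have h1 : ∀ k, (mat (h : SOo (n + 2)) * mat x) k 0 = mat x k 0 := by
    refine index_cases ?_ ?_ (fun i => ?_)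
    · simp [Matrix.mul_apply, sum_index, a1, a2, a]
    · simp [Matrix.mul_apply, sum_index, a3, a4, a]
    · rw [← congrFun hx i]
      simp [Matrix.mul_apply, sum_index, a, Matrix.mulVec, dotProduct, mblk]
  intro k
  rw [mat_mul, mat_mul, Matrix.mul_assoc, Matrix.mul_apply, ← mat_inv_mul_mat x, Matrix.mul_apply]
  exact Finset.sum_congr rfl fun j _ => by rw [h1]

/-- `SO(1,l)` is closed in the space of matrices and its identity component is closed in it, so
`mat` is a closed embedding. Elements of `M` commute with `J` and preserve the form, hence are
orthogonal matrices with bounded entries. -/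
lemma isCompact_M : IsCompact (M (n + 2) : Set (SOo (n + 2))) := by
  rw [isEmbedding_mat.isCompact_iff]
  have hSO1 : Topology.IsClosedEmbedding
      (fun x : SO1 (n + 2) => ((x : GL (Fin (n + 2 + 1)) ℝ) : Mat (n + 2))) := by
    refine ⟨⟨?_, fun x y h => Subtype.ext (Units.ext h)⟩, ?_⟩
    · have hj : Continuous fun A : Mat (n + 2) => (A, MulOpposite.op (J (n + 2) * A.transpose * J (n + 2))) := by
        fun_prop
      refine Topology.IsInducing.of_comp (Units.continuous_val.comp continuous_subtype_val) hj ?_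
      have h1 : Topology.IsInducing (fun g : SO1 (n + 2) => Units.embedProduct (Mat (n + 2)) g) :=
        Units.isInducing_embedProduct.comp Topology.IsInducing.subtypeVal
      convert! h1 using 1
      funext g
      refine Prod.ext rfl (congrArg MulOpposite.op ?_)
      have h : J (n + 2) * ((g : GL (Fin (n + 2 + 1)) ℝ) : Mat (n + 2)).transpose * J (n + 2) *
          ((g : GL (Fin (n + 2 + 1)) ℝ) : Mat (n + 2)) = 1 := by
        rw [Matrix.mul_assoc, Matrix.mul_assoc, ← Matrix.mul_assoc _ (J (n + 2)), g.2.1, J_mul_J]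
      exact (Units.inv_eq_of_mul_eq_one_left h).symm
    · have : Set.range (fun x : SO1 (n + 2) => ((x : GL (Fin (n + 2 + 1)) ℝ) : Mat (n + 2))) =
          {A | A.transpose * J (n + 2) * A = J (n + 2) ∧ A.det = 1} := by
        ext A
        constructor
        · rintro ⟨x, rfl⟩; exact x.2
        · rintro ⟨h1, h2⟩
          refine ⟨⟨Matrix.GeneralLinearGroup.mkOfDetNeZero A (by rw [h2]; exact one_ne_zero), h1, h2⟩, rfl⟩
      rw [this]
      exact (isClosed_eq (by fun_prop) continuous_const).inter
        (isClosed_eq (Continuous.matrix_det continuous_id) continuous_const)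
  have hclosed : IsClosed (Set.range (mat : SOo (n + 2) → Mat (n + 2))) := by
    have h1 := hSO1.isClosedMap _ (isClosed_connectedComponent (x := (1 : SO1 (n + 2))))
    convert! h1 using 1
    ext A
    constructor
    · rintro ⟨g, rfl⟩
      obtain ⟨x, hx, hxg⟩ := g.2
      exact ⟨x, hx, by rw [mat, ← hxg]; rfl⟩
    · rintro ⟨x, hx, rfl⟩
      exact ⟨⟨_, x, hx, rfl⟩, rfl⟩
  have himg : mat '' (M (n + 2) : Set (SOo (n + 2))) ⊆
      Set.pi Set.univ (fun _ : Fin (n + 2 + 1) => Set.pi Set.univ fun _ : Fin (n + 2 + 1) => Set.Icc (-1 : ℝ) 1) := by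
    rintro _ ⟨m, hm, rfl⟩ i - j -
    have h1 : (mat m).transpose * mat m = 1 := by
      have := mat_preserves m
      rw [Matrix.mul_assoc, show J (n + 2) * mat m = mat m * J (n + 2) from hm.1, ← Matrix.mul_assoc] at this
      calc (mat m).transpose * mat m = (mat m).transpose * mat m * J (n + 2) * J (n + 2) := by
            rw [Matrix.mul_assoc _ (J (n + 2)), J_mul_J, Matrix.mul_one]
        _ = 1 := by rw [this, J_mul_J]
    have h2 := congrFun (congrFun h1 j) j
    rw [Matrix.mul_apply, Matrix.one_apply_eq] at h2
    have h3 : mat m i j * mat m i j ≤ 1 := by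
      rw [← h2]
      exact Finset.single_le_sum (f := fun k => (mat m).transpose j k * mat m k j)
        (fun k _ => mul_self_nonneg (mat m k j)) (Finset.mem_univ i)
    exact abs_le.1 (abs_le_one_iff_mul_self_le_one.2 h3)
  refine IsCompact.of_isClosed_subset (isCompact_univ_pi fun _ => isCompact_univ_pi fun _ => isCompact_Icc) ?_ himg
  have hM : IsClosed (M (n + 2) : Set (SOo (n + 2))) := by
    rw [M, Subgroup.coe_inf]
    refine IsClosed.inter ?_ ?_
    · exact isClosed_eq (f := fun g : SOo (n + 2) => J (n + 2) * mat g) (by fun_prop) (by fun_prop)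
    · have : ((Subgroup.centralizer (Set.range (a : ℝ → SOo (n + 2)))) : Set (SOo (n + 2))) =
          ⋂ t : ℝ, {g | a t * g = g * a t} := by
        ext g
        simp [Subgroup.mem_centralizer_iff]
      rw [this]
      exact isClosed_iInter fun t => isClosed_eq (by fun_prop) (by fun_prop)
  exact (Topology.IsClosedEmbedding.mk isEmbedding_mat hclosed).isClosedMap _ hM

instance : CompactSpace (M (n + 2)) := isCompact_iff_compactSpace.1 isCompact_M

end RealHyp

namespace RealHyp

open scoped Topology ContDiff Matrix.Norms.Operator Matrix

variable {n : ℕ}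

/-! ### Haar integration on `M` -/

section Haar

variable (dm : Measure (M (n + 2))) [dm.IsHaarMeasure] [IsProbabilityMeasure dm]

lemma integral_M_mul_left (f : M (n + 2) → ℂ) (h : M (n + 2)) : ∫ m, f (h * m) ∂dm = ∫ m, f m ∂dm :=
  integral_mul_left_eq_self f h

/-- A right translate of `dm` is again a Haar probability measure, and there is only one. -/
lemma isMulRightInvariant_M : dm.IsMulRightInvariant := by
  refine ⟨fun g => ?_⟩
  have : IsProbabilityMeasure (dm.map (· * g)) :=
    Measure.isProbabilityMeasure_map (continuous_mul_const g).measurable.aemeasurable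
  exact Measure.isHaarMeasure_eq_of_isProbabilityMeasure _ _

lemma integral_M_mul_right (f : M (n + 2) → ℂ) (h : M (n + 2)) :
    ∫ m, f (m * h) ∂dm = ∫ m, f m ∂dm := by
  have := isMulRightInvariant_M dm
  exact integral_mul_right_eq_self f h

lemma integrable_M {E : Type*} [NormedAddCommGroup E] {f : M (n + 2) → E} (hf : Continuous f) :
    Integrable f dm :=
  hf.integrable_of_hasCompactSupport (HasCompactSupport.of_compactSpace f)

/-- The entrywise integral of a matrix valued function. -/
def matInt {ι κ : Type*} (f : M (n + 2) → Matrix ι κ ℂ) : Matrix ι κ ℂ :=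
  Matrix.of fun i j => ∫ m, f m i j ∂dm

lemma matInt_apply {ι κ : Type*} (f : M (n + 2) → Matrix ι κ ℂ) (i : ι) (j : κ) :
    matInt dm f i j = ∫ m, f m i j ∂dm := rfl

lemma mul_matInt {ι κ θ : Type*} [Fintype κ] (C : Matrix ι κ ℂ)
    {f : M (n + 2) → Matrix κ θ ℂ} (hf : ∀ i j, Continuous fun m => f m i j) :
    C * matInt dm f = matInt dm fun m => C * f m := by
  ext i j
  simp only [Matrix.mul_apply, matInt_apply]
  rw [integral_finsetSum _ fun k _ => ((integrable_M dm (hf k j)).const_mul _)]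
  exact Finset.sum_congr rfl fun k _ => (integral_const_mul _ _).symm

lemma matInt_mul {ι κ θ : Type*} [Fintype κ] (C : Matrix κ θ ℂ)
    {f : M (n + 2) → Matrix ι κ ℂ} (hf : ∀ i j, Continuous fun m => f m i j) :
    matInt dm f * C = matInt dm fun m => f m * C := by
  ext i j
  simp only [Matrix.mul_apply, matInt_apply]
  rw [integral_finsetSum _ fun k _ => ((integrable_M dm (hf i k)).mul_const _)]
  exact Finset.sum_congr rfl fun k _ => (integral_mul_const _ _).symm

lemma trace_matInt {ι : Type*} [Fintype ι] {f : M (n + 2) → Matrix ι ι ℂ}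
    (hf : ∀ i j, Continuous fun m => f m i j) : (matInt dm f).trace = ∫ m, (f m).trace ∂dm := by
  simp only [Matrix.trace, Matrix.diag_apply, matInt_apply]
  rw [integral_finsetSum _ fun k _ => integrable_M dm (hf k k)]

end Haar

/-! ### Schur's lemma and orthogonality -/

namespace IrrRep

variable (π σ : IrrRep (n + 2))

/-- The matrix of `π(m)`. -/
def rmat {l : ℕ} (π : IrrRep l) (m : M l) : Matrix (Fin π.dim) (Fin π.dim) ℂ :=
  LinearMap.toMatrix' (π.rep m)

lemma rmat_mulVec (m : M (n + 2)) (v : Fin π.dim → ℂ) : π.rmat m *ᵥ v = π.rep m v := by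
  rw [rmat, ← Matrix.toLin'_apply, Matrix.toLin'_toMatrix']

@[simp] lemma rmat_one : π.rmat 1 = 1 := by simp [rmat]

@[simp] lemma rmat_mul (m m' : M (n + 2)) : π.rmat (m * m') = π.rmat m * π.rmat m' := by
  rw [rmat, map_mul, Module.End.mul_eq_comp, LinearMap.toMatrix'_comp]; rfl

lemma rmat_inv_mul (m : M (n + 2)) : π.rmat m⁻¹ * π.rmat m = 1 := by
  rw [← rmat_mul, inv_mul_cancel, rmat_one]

lemma character_eq (m : M (n + 2)) : π.rep.character m = (π.rmat m).trace :=
  by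
  rw [Representation.character, LinearMap.trace_eq_matrix_trace ℂ (Pi.basisFun ℂ (Fin π.dim)),
    LinearMap.toMatrix_eq_toMatrix']; rfl

lemma rmat_apply (m : M (n + 2)) (i j : Fin π.dim) : π.rmat m i j = π.rep m (Pi.single j 1) i := by
  rw [rmat, LinearMap.toMatrix'_apply]

@[fun_prop]
lemma continuous_rmat : Continuous π.rmat := by
  refine continuous_matrix fun i j => ?_
  simp only [rmat_apply]
  exact (continuous_apply i).comp (π.cont _)

lemma continuous_rmat_apply (i j : Fin π.dim) : Continuous fun m => π.rmat m i j :=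
  π.continuous_rmat.matrix_elem i j

@[fun_prop]
lemma continuous_character : Continuous π.rep.character := by
  have : π.rep.character = fun m => (π.rmat m).trace := funext π.character_eq
  rw [this]
  fun_prop

lemma invariant_eq_bot_or_top {U : Submodule ℂ (Fin π.dim → ℂ)}
    (hU : ∀ m, ∀ v ∈ U, π.rep m v ∈ U) : U = ⊥ ∨ U = ⊤ := by
  have := π.irr
  rcases eq_bot_or_eq_top (⟨U, hU⟩ : Subrepresentation π.rep) with h | h
  · exact Or.inl (congrArg Subrepresentation.toSubmodule h)
  · exact Or.inr (congrArg Subrepresentation.toSubmodule h)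

lemma dim_pos : 0 < π.dim := by
  have := π.irr
  rw [Nat.pos_iff_ne_zero]
  intro h
  have hs : Subsingleton (Fin π.dim → ℂ) := by rw [h]; infer_instance
  apply bot_ne_top (α := Subrepresentation π.rep)
  apply Subrepresentation.toSubmodule_injective
  exact Subsingleton.elim _ _

/-- Schur's lemma. -/
lemma eq_smul_one_of_commute {B : Matrix (Fin π.dim) (Fin π.dim) ℂ}
    (hB : ∀ m, B * π.rmat m = π.rmat m * B) : ∃ c : ℂ, B = c • (1 : Matrix _ _ ℂ) := by
  have : Nonempty (Fin π.dim) := ⟨⟨0, π.dim_pos⟩⟩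
  obtain ⟨c, hc⟩ := Module.End.exists_eigenvalue (Matrix.toLin' B)
  refine ⟨c, ?_⟩
  have h := π.invariant_eq_bot_or_top (U := Module.End.eigenspace (Matrix.toLin' B) c) ?_
  · have htop : Module.End.eigenspace (Matrix.toLin' B) c = ⊤ := h.resolve_left hc
    apply Matrix.toLin'.injective
    refine LinearMap.ext fun v => ?_
    have hv : v ∈ Module.End.eigenspace (Matrix.toLin' B) c := by rw [htop]; trivial
    rw [Module.End.mem_eigenspace_iff] at hv
    rw [hv]
    simp
  · intro m v hv
    rw [Module.End.mem_eigenspace_iff, Matrix.toLin'_apply] at hv ⊢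
    rw [← rmat_mulVec, Matrix.mulVec_mulVec, hB, ← Matrix.mulVec_mulVec, hv, Matrix.mulVec_smul]

lemma eq_zero_of_intertwining (h : ¬ Nonempty (π.rep.Equiv σ.rep))
    {B : Matrix (Fin σ.dim) (Fin π.dim) ℂ} (hB : ∀ m, B * π.rmat m = σ.rmat m * B) : B = 0 := by
  have := π.irr
  have := σ.irr
  let T : Representation.IntertwiningMap π.rep σ.rep :=
    LinearMap.intertwiningMap_of_isIntertwiningMap π.rep σ.rep (Matrix.toLin' B) (fun m v => by
      rw [Matrix.toLin'_apply, Matrix.toLin'_apply, ← rmat_mulVec, ← rmat_mulVec,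
        Matrix.mulVec_mulVec, hB, ← Matrix.mulVec_mulVec])
  rcases Representation.IsIrreducible.bijective_or_eq_zero T with hT | hT
  · exact absurd ⟨T.ofBijective hT⟩ h
  · apply Matrix.toLin'.injective
    rw [map_zero]
    exact congrArg (fun S : Representation.IntertwiningMap π.rep σ.rep => S.toLinearMap) hT

section Orthogonality

variable (dm : Measure (M (n + 2))) [dm.IsHaarMeasure] [IsProbabilityMeasure dm]

lemma continuous_conj_apply (A : Matrix (Fin σ.dim) (Fin π.dim) ℂ) (i : Fin σ.dim) (j : Fin π.dim) :
    Continuous fun m => (σ.rmat m * A * π.rmat m⁻¹) i j := by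
  refine Continuous.matrix_elem ?_ i j
  exact (Continuous.matrix_mul (Continuous.matrix_mul σ.continuous_rmat continuous_const)
    (π.continuous_rmat.comp continuous_inv))

/-- Source of the orthogonality relations: the average of `σ(m) A π(m)⁻¹` intertwines `π` and `σ`,
so Schur's lemma applies. With `A` an elementary matrix, its entries are the integrals of products
of matrix coefficients. -/
lemma matInt_intertwining (A : Matrix (Fin σ.dim) (Fin π.dim) ℂ) (h : M (n + 2)) :
    matInt dm (fun m => σ.rmat m * A * π.rmat m⁻¹) * π.rmat h =
      σ.rmat h * matInt dm (fun m => σ.rmat m * A * π.rmat m⁻¹) := by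
  rw [mul_matInt dm _ (continuous_conj_apply π σ A), matInt_mul dm _ (continuous_conj_apply π σ A)]
  ext i j
  rw [matInt_apply, matInt_apply]
  rw [← integral_M_mul_left dm (fun m => (σ.rmat m * A * π.rmat m⁻¹ * π.rmat h) i j) h]
  congr 1
  funext m
  rw [mul_inv_rev, rmat_mul, rmat_mul, Matrix.mul_assoc _ _ (π.rmat h), Matrix.mul_assoc (π.rmat m⁻¹),
    rmat_inv_mul, Matrix.mul_one]
  simp only [Matrix.mul_assoc]

lemma integral_rmat_of_not_equiv (h : ¬ Nonempty (π.rep.Equiv σ.rep)) (i j : Fin σ.dim)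
    (k q : Fin π.dim) : ∫ m, σ.rmat m i j * π.rmat m⁻¹ k q ∂dm = 0 := by
  have h1 := eq_zero_of_intertwining π σ h (matInt_intertwining π σ dm (Matrix.single j k 1))
  have h2 := congrFun (congrFun h1 i) q
  rw [matInt_apply] at h2
  rw [Matrix.zero_apply] at h2
  rw [← h2]
  congr 1
  funext m
  simp [Matrix.mul_apply, Matrix.single_apply, ite_and]

/-- The scalar supplied by Schur's lemma is found by taking traces: the trace of the averaged
elementary matrix is that of the matrix itself. -/
lemma integral_rmat_self (i j k q : Fin π.dim) :
    ∫ m, π.rmat m i j * π.rmat m⁻¹ k q ∂dm = if j = k ∧ i = q then (π.dim : ℂ)⁻¹ else 0 := by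
  obtain ⟨c, hc⟩ := π.eq_smul_one_of_commute (matInt_intertwining π π dm (Matrix.single j k 1))
  have htr := congrArg Matrix.trace hc
  rw [trace_matInt dm (continuous_conj_apply π π _)] at htr
  have h1 : ∀ m, (π.rmat m * Matrix.single j k 1 * π.rmat m⁻¹).trace = if j = k then 1 else 0 := by
    intro m
    rw [Matrix.trace_mul_comm, ← Matrix.mul_assoc, rmat_inv_mul, Matrix.one_mul]
    by_cases hjk : j = k
    · subst hjk; simp
    · rw [if_neg hjk, Matrix.trace_single_eq_of_ne _ _ _ hjk]
  simp only [h1, integral_const, probReal_univ, one_smul, Matrix.trace_smul, Matrix.trace_one,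
    Fintype.card_fin, smul_eq_mul] at htr
  have hd : (π.dim : ℂ) ≠ 0 := Nat.cast_ne_zero.2 π.dim_pos.ne'
  have h2 := congrFun (congrFun hc i) q
  rw [matInt_apply, Matrix.smul_apply, Matrix.one_apply] at h2
  have h3 : ∫ m, π.rmat m i j * π.rmat m⁻¹ k q ∂dm = c • (if i = q then 1 else 0) := by
    rw [← h2]
    congr 1
    funext m
    simp [Matrix.mul_apply, Matrix.single_apply, ite_and]
  rw [h3]
  have hcv : c = (if j = k then (π.dim : ℂ)⁻¹ else 0) := by
    rw [← mul_left_inj' hd, ← htr]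
    split_ifs <;> simp [hd]
  rw [hcv]
  by_cases hjk : j = k <;> by_cases hiq : i = q <;> simp [hjk, hiq]

end Orthogonality

end IrrRep

end RealHyp

/-! ### Bound for characters and completeness of the matrix coefficients -/

namespace RealHyp

open scoped Topology ContDiff Matrix.Norms.Operator Matrix ComplexConjugate

variable {n : ℕ}

/-- An eigenvalue `c` of `π(m)` has modulus at most `1`: the vectors `π(m^k)v = c^k v` stay in the
compact orbit of an eigenvector `v`. The character is the sum of at most `dim π` such roots. -/
lemma IrrRep.norm_character_le (π : IrrRep (n + 2)) (m : M (n + 2)) :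
    ‖π.rep.character m‖ ≤ π.dim := by
  rw [π.character_eq, Matrix.trace_eq_sum_roots_charpoly]
  have hroot : ∀ c ∈ (π.rmat m).charpoly.roots, ‖c‖ ≤ 1 := by
    intro c hc
    have hc1 : Module.End.HasEigenvalue (Matrix.toLin' (π.rmat m)) c := by
      rw [Module.End.hasEigenvalue_iff_isRoot_charpoly, Matrix.charpoly_toLin']
      exact Polynomial.isRoot_of_mem_roots hc
    obtain ⟨v, hv⟩ := hc1.exists_hasEigenvector
    have hv1 : π.rmat m *ᵥ v = c • v := hv.apply_eq_smul
    have hpow : ∀ k : ℕ, π.rmat (m ^ k) *ᵥ v = c ^ k • v := by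
      intro k
      induction k with
      | zero => simp
      | succ k ih =>
        rw [pow_succ, IrrRep.rmat_mul, ← Matrix.mulVec_mulVec, hv1, Matrix.mulVec_smul, ih, smul_smul,
          pow_succ, mul_comm]
    obtain ⟨C, hC⟩ := (isCompact_range (f := fun m => π.rmat m *ᵥ v) (by fun_prop)).isBounded.exists_norm_le
    by_contra hlt
    have h1 := tendsto_pow_atTop_atTop_of_one_lt (not_le.1 hlt)
    have hvpos : 0 < ‖v‖ := norm_pos_iff.2 hv.2
    obtain ⟨k, hk⟩ := (h1.eventually (Filter.eventually_gt_atTop (C / ‖v‖))).exists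
    have h2 := hC _ ⟨m ^ k, rfl⟩
    simp only [hpow, norm_smul, norm_pow] at h2
    rw [div_lt_iff₀ hvpos] at hk
    linarith
  have hcard : Multiset.card (π.rmat m).charpoly.roots ≤ π.dim := by
    refine (Polynomial.card_roots' _).trans ?_
    rw [Matrix.charpoly_natDegree_eq_dim, Fintype.card_fin]
  have h3 : ∀ s : Multiset ℂ, (∀ c ∈ s, ‖c‖ ≤ 1) → ‖s.sum‖ ≤ Multiset.card s := by
    intro s
    induction s using Multiset.induction_on with
    | empty => simp
    | cons a s ih =>
      intro h
      rw [Multiset.sum_cons, Multiset.card_cons]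
      push_cast
      have := norm_add_le a s.sum
      have h4 := h a (Multiset.mem_cons_self a s)
      have h5 := ih fun c hc => h c (Multiset.mem_cons_of_mem hc)
      linarith
  exact (h3 _ hroot).trans (by exact_mod_cast hcard)

/-! ### Polynomial approximation -/

/-- Stone–Weierstrass on the compact image of `c`. Polynomials in the real coordinates are closed
under conjugation and separate points there, and `h` descends to that image because it is constant
on the fibres of `c`. -/
lemma exists_mvPolynomial_near {X κ : Type} [TopologicalSpace X] [CompactSpace X] [Finite κ]
    {c : X → κ → ℝ} (hc : Continuous c) {h : X → ℂ} (hh : Continuous h)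
    (hch : ∀ x y, c x = c y → h x = h y) {ε : ℝ} (hε : 0 < ε) :
    ∃ p : MvPolynomial κ ℂ, ∀ x, ‖h x - MvPolynomial.eval (fun k => (c x k : ℂ)) p‖ < ε := by
  let Y := Set.range c
  have hYc : CompactSpace Y := isCompact_iff_compactSpace.1 (isCompact_range hc)
  let c' : X → Y := fun x => ⟨c x, x, rfl⟩
  have hc' : Continuous c' := hc.subtype_mk _
  have hs : Function.Surjective c' := by rintro ⟨_, x, rfl⟩; exact ⟨x, rfl⟩
  have hq : Topology.IsQuotientMap c' := hc'.isClosedMap.isQuotientMap hc' hs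
  let coord : κ → C(Y, ℂ) := fun k => ⟨fun y => ((y : κ → ℝ) k : ℂ),
    Complex.continuous_ofReal.comp ((continuous_apply k).comp continuous_subtype_val)⟩
  let A := MvPolynomial.aeval (R := ℂ) coord
  have hA : ∀ (p : MvPolynomial κ ℂ) (y : Y), A p y = MvPolynomial.eval (fun k => ((y : κ → ℝ) k : ℂ)) p := by
    intro p y
    induction p using MvPolynomial.induction_on with
    | C a => simp [A]
    | add p q hp hq => simp [hp, hq]
    | mul_X p k hp => simp [hp, A, coord]
  let S : StarSubalgebra ℂ C(Y, ℂ) :=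
    { A.range with
      star_mem' := by
        rintro _ ⟨p, rfl⟩
        refine ⟨MvPolynomial.map (starRingEnd ℂ) p, ?_⟩
        ext y
        change A _ y = star (A p y)
        rw [hA, hA, MvPolynomial.eval_map]
        induction p using MvPolynomial.induction_on with
        | C a => simp
        | add p q hp hq => simp [hp, hq]
        | mul_X p k hp => simp [hp] }
  have hS : S.SeparatesPoints := by
    intro x y hxy
    obtain ⟨k, hk⟩ : ∃ k, (x : κ → ℝ) k ≠ (y : κ → ℝ) k := by
      by_contra hcon
      push Not at hcon
      exact hxy (Subtype.ext (funext hcon))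
    refine ⟨coord k, ⟨coord k, ⟨MvPolynomial.X k, by simp [A]⟩, rfl⟩, ?_⟩
    simpa [coord] using hk
  have htop := ContinuousMap.starSubalgebra_topologicalClosure_eq_top_of_separatesPoints S hS
  let cC : C(X, Y) := ⟨c', hc'⟩
  have hqC : Topology.IsQuotientMap cC := hq
  have hfac : Function.FactorsThrough (⟨h, hh⟩ : C(X, ℂ)) cC :=
    fun x y hxy => hch x y (congrArg Subtype.val hxy)
  let H : C(Y, ℂ) := hqC.lift ⟨h, hh⟩ hfac
  have hH : ∀ x, H (c' x) = h x := fun x =>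
    congrArg (fun f : C(X, ℂ) => f x) (hqC.lift_comp ⟨h, hh⟩ hfac)
  have hmem : H ∈ closure (S : Set C(Y, ℂ)) := by
    have : H ∈ S.topologicalClosure := by rw [htop]; trivial
    exact this
  obtain ⟨_, ⟨p, rfl⟩, hp⟩ := Metric.mem_closure_iff.1 hmem ε hε
  refine ⟨p, fun x => ?_⟩
  rw [dist_eq_norm] at hp
  have h1 := (H - A p).norm_coe_le_norm (c' x)
  rw [ContinuousMap.sub_apply, hH, hA] at h1
  exact h1.trans_lt hp

section Completeness

variable (dm : Measure (M (n + 2))) [dm.IsHaarMeasure] [IsProbabilityMeasure dm]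

/-- If `p` approximates the conjugate of `f` uniformly, then `∫ |f|² = ∫ f (f̄ - p)` is arbitrarily
small. A continuous function that vanishes almost everywhere for Haar measure is zero. -/
lemma eq_zero_of_integral_polynomial {κ : Type} [Finite κ] {c : M (n + 2) → κ → ℝ}
    (hc : Continuous c) {f : M (n + 2) → ℂ} (hf : Continuous f) (hcf : ∀ x y, c x = c y → f x = f y)
    (h0 : ∀ p : MvPolynomial κ ℂ, ∫ m, f m * MvPolynomial.eval (fun k => (c m k : ℂ)) p ∂dm = 0) :
    f = 0 := by
  obtain ⟨C, hC⟩ := (isCompact_range hf).isBounded.exists_norm_le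
  have hC0 : 0 ≤ C := (norm_nonneg _).trans (hC _ ⟨1, rfl⟩)
  have hint : ∫ m, ‖f m‖ ^ 2 ∂dm ≤ 0 := by
    refine le_of_forall_pos_le_add fun ε hε => ?_
    obtain ⟨p, hp⟩ := exists_mvPolynomial_near hc (h := fun m => conj (f m)) (by fun_prop)
      (fun x y hxy => by rw [hcf x y hxy]) (show 0 < ε / (C + 1) by positivity)
    have hpc : Continuous fun m => MvPolynomial.eval (fun k => (c m k : ℂ)) p := by
      have : Continuous fun z : κ → ℂ => MvPolynomial.eval z p := MvPolynomial.continuous_eval p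
      exact this.comp (by fun_prop)
    have h1 : ((∫ m, ‖f m‖ ^ 2 ∂dm : ℝ) : ℂ) =
        ∫ m, f m * (conj (f m) - MvPolynomial.eval (fun k => (c m k : ℂ)) p) ∂dm := by
      simp only [mul_sub]
      rw [integral_sub (integrable_M dm (by fun_prop)) (integrable_M dm (by fun_prop)), h0, sub_zero,
        ← integral_complex_ofReal]
      congr 1
      funext m
      rw [Complex.mul_conj, Complex.normSq_eq_norm_sq]
    have h2 : ‖((∫ m, ‖f m‖ ^ 2 ∂dm : ℝ) : ℂ)‖ ≤ C * (ε / (C + 1)) := by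
      rw [h1]
      refine (norm_integral_le_of_norm_le_const (C := C * (ε / (C + 1)))
        (Filter.Eventually.of_forall fun m => ?_)).trans (by simp)
      rw [norm_mul]
      exact mul_le_mul (hC _ ⟨m, rfl⟩) (hp m).le (norm_nonneg _) hC0
    rw [Complex.norm_real] at h2
    have h3 : C * (ε / (C + 1)) ≤ ε := by
      rw [← mul_div_assoc, div_le_iff₀ (by positivity)]
      nlinarith
    have := le_abs_self (∫ m, ‖f m‖ ^ 2 ∂dm)
    rw [Real.norm_eq_abs] at h2
    linarith
  have hcont : Continuous fun m => ‖f m‖ ^ 2 := by fun_prop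
  have h4 : ∫ m, ‖f m‖ ^ 2 ∂dm = 0 := le_antisymm hint (integral_nonneg fun m => by positivity)
  rw [integral_eq_zero_iff_of_nonneg (fun m => by positivity) (integrable_M dm hcont)] at h4
  have h5 := (Continuous.ae_eq_iff_eq dm hcont continuous_const).1 h4
  funext m
  have : ‖f m‖ ^ 2 = 0 := congrFun h5 m
  simpa using this

/-! ### Completeness of the characters -/

/-- The matrix of the `N`-th tensor power of the representation of `M` on `ℂ^{l-1}`. -/
def tpow (N : ℕ) (m : M (n + 2)) : Matrix (Fin N → Fin (n + 1)) (Fin N → Fin (n + 1)) ℂ :=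
  Matrix.of fun i j => ∏ a, (mblk m (i a) (j a) : ℂ)

@[fun_prop]
lemma continuous_tpow (N : ℕ) : Continuous (tpow (n := n) N) := by
  refine continuous_matrix fun i j => ?_
  simp only [tpow, Matrix.of_apply]
  refine continuous_finsetProd _ fun a _ => ?_
  exact Complex.continuous_ofReal.comp (continuous_mblk.matrix_elem _ _)

lemma tpow_mul (N : ℕ) (m m' : M (n + 2)) : tpow N (m * m') = tpow N m * tpow N m' := by
  ext i j
  simp only [tpow, Matrix.of_apply, Matrix.mul_apply, mblk_mul]
  push_cast
  rw [Finset.prod_univ_sum]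
  simp only [Fintype.piFinset_univ, Finset.prod_mul_distrib]

lemma tpow_one (N : ℕ) : tpow N (1 : M (n + 2)) = 1 := by
  ext i j
  simp only [tpow, Matrix.of_apply, mblk_one, Matrix.one_apply]
  by_cases h : i = j
  · subst h; simp
  · rw [if_neg h]
    obtain ⟨a, ha⟩ := Function.ne_iff.1 h
    exact Finset.prod_eq_zero (Finset.mem_univ a) (by simp [ha])

lemma tpow_inv (N : ℕ) (m : M (n + 2)) : tpow N m⁻¹ = (tpow N m).transpose := by
  ext i j
  simp [tpow, mblk_inv]

/-- Every nonzero invariant subspace contains an irreducible one. -/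
lemma exists_irrRep {I : Type} [Fintype I] [DecidableEq I] {T : M (n + 2) → Matrix I I ℂ}
    (hT : Continuous T) (hT1 : T 1 = 1) (hTm : ∀ m m', T (m * m') = T m * T m')
    {U : Submodule ℂ (I → ℂ)} (hU : U ≠ ⊥) (hUT : ∀ m, ∀ v ∈ U, T m *ᵥ v ∈ U) :
    ∃ (σ : IrrRep (n + 2)) (j : (Fin σ.dim → ℂ) →ₗ[ℂ] (I → ℂ)), Function.Injective j ∧
      (∀ v, j v ∈ U) ∧ ∀ m v, j (σ.rep m v) = T m *ᵥ j v := by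
  let P : ℕ → Prop := fun d => ∃ W : Submodule ℂ (I → ℂ), W ≠ ⊥ ∧ W ≤ U ∧
    (∀ m, ∀ v ∈ W, T m *ᵥ v ∈ W) ∧ Module.finrank ℂ W = d
  have hP : ∃ d, P d := ⟨_, U, hU, le_rfl, hUT, rfl⟩
  classical
  -- A nonzero invariant subspace of least dimension is irreducible. A basis then transports the
  -- action to `ℂ^d`, where `IrrRep` requires it to live.
  obtain ⟨W, hW0, hWU, hWT, hWd⟩ := Nat.find_spec hP
  have hmin : ∀ W' : Submodule ℂ (I → ℂ), W' ≠ ⊥ → W' ≤ W → (∀ m, ∀ v ∈ W', T m *ᵥ v ∈ W') → W' = W := by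
    intro W' h1 h2 h3
    refine Submodule.eq_of_le_of_finrank_le h2 ?_
    rw [hWd]
    exact Nat.find_min' hP ⟨W', h1, h2.trans hWU, h3, rfl⟩
  let d := Module.finrank ℂ W
  let e : W ≃ₗ[ℂ] (Fin d → ℂ) := (Module.finBasis ℂ W).equivFun
  let j : (Fin d → ℂ) →ₗ[ℂ] (I → ℂ) := W.subtype ∘ₗ (e.symm : (Fin d → ℂ) →ₗ[ℂ] W)
  have hj : Function.Injective j := Subtype.val_injective.comp e.symm.injective
  have hjW : ∀ v, j v ∈ W := fun v => (e.symm v).2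
  let R : M (n + 2) → Module.End ℂ (Fin d → ℂ) := fun m =>
    (e : W →ₗ[ℂ] (Fin d → ℂ)) ∘ₗ ((Matrix.toLin' (T m)).restrict (p := W) (q := W)
      (fun v hv => by rw [Matrix.toLin'_apply]; exact hWT m v hv)) ∘ₗ (e.symm : (Fin d → ℂ) →ₗ[ℂ] W)
  have hR : ∀ m v, j (R m v) = T m *ᵥ j v := by
    intro m v
    simp [j, R]
  let ρ : Representation ℂ (M (n + 2)) (Fin d → ℂ) :=
    { toFun := R
      map_one' := by
        refine LinearMap.ext fun v => hj ?_
        rw [hR, hT1, Matrix.one_mulVec]; rfl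
      map_mul' := fun m m' => by
        refine LinearMap.ext fun v => hj ?_
        rw [hR, hTm, ← Matrix.mulVec_mulVec, Module.End.mul_apply, hR, hR] }
  have hcont : ∀ v, Continuous fun m => ρ m v := by
    intro v
    obtain ⟨g, hg⟩ := j.exists_leftInverse_of_injective (LinearMap.ker_eq_bot.2 hj)
    have h1 : (fun m => ρ m v) = fun m => g (T m *ᵥ j v) := by
      funext m
      rw [← hR]
      exact (LinearMap.congr_fun hg (R m v)).symm
    rw [h1]
    exact g.continuous_of_finiteDimensional.comp (by fun_prop)
  have hdpos : 0 < d := by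
    rw [Nat.pos_iff_ne_zero]
    intro h
    exact hW0 (Submodule.finrank_eq_zero.1 h)
  have hirr : ρ.IsIrreducible := by
    have hnt : Nontrivial (Subrepresentation ρ) := by
      refine ⟨⊥, ⊤, fun h => ?_⟩
      have h1 : (⊥ : Submodule ℂ (Fin d → ℂ)) = ⊤ := congrArg Subrepresentation.toSubmodule h
      have h2 : (Pi.single ⟨0, hdpos⟩ 1 : Fin d → ℂ) ∈ (⊥ : Submodule ℂ (Fin d → ℂ)) := by
        rw [h1]; trivial
      have h3 := congrFun ((Submodule.mem_bot ℂ).1 h2) ⟨0, hdpos⟩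
      simp at h3
    refine { eq_bot_or_eq_top := fun V => ?_ }
    by_cases hV : V.toSubmodule = ⊥
    · exact Or.inl (Subrepresentation.toSubmodule_injective hV)
    · right
      apply Subrepresentation.toSubmodule_injective
      have h1 := hmin (V.toSubmodule.map j) ?_ ?_ ?_
      · change V.toSubmodule = (⊤ : Submodule ℂ (Fin d → ℂ))
        rw [eq_top_iff]
        intro v _
        have h2 : j v ∈ V.toSubmodule.map j := by rw [h1]; exact hjW v
        obtain ⟨u, hu, huv⟩ := h2
        rwa [← hj huv]
      · intro h0
        refine hV ((Submodule.eq_bot_iff _).2 fun v hv => hj ?_)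
        rw [map_zero]
        exact (Submodule.mem_bot ℂ).1 (h0 ▸ Submodule.mem_map_of_mem hv)
      · rintro _ ⟨u, -, rfl⟩
        exact hjW u
      · rintro m _ ⟨u, hu, rfl⟩
        rw [← hR]
        exact ⟨_, V.apply_mem_toSubmodule m hu, rfl⟩
  exact ⟨⟨d, ρ, hcont, hirr⟩, j, hj, fun v => hWU (hjW v), hR⟩

lemma matInt_character (σ : IrrRep (n + 2)) :
    matInt dm (fun h => σ.rep.character h⁻¹ • σ.rmat h) = (σ.dim : ℂ)⁻¹ • (1 : Matrix _ _ ℂ) := by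
  ext i j
  rw [matInt_apply]
  have h1 : ∀ h, (σ.rep.character h⁻¹ • σ.rmat h) i j = ∑ k, σ.rmat h i j * σ.rmat h⁻¹ k k := by
    intro h
    rw [Matrix.smul_apply, σ.character_eq, smul_eq_mul, mul_comm, Matrix.trace, Finset.mul_sum]
    rfl
  simp only [h1]
  have h2 : ∀ k, Integrable (fun m => σ.rmat m i j * σ.rmat m⁻¹ k k) dm := fun k =>
    integrable_M dm ((σ.continuous_rmat_apply i j).mul
      ((σ.continuous_rmat_apply k k).comp continuous_inv))
  rw [integral_finsetSum _ fun k _ => h2 k]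
  simp only [σ.integral_rmat_self dm, ite_and, Finset.sum_ite_eq, Finset.mem_univ, if_true,
    Matrix.smul_apply, Matrix.one_apply, smul_eq_mul, mul_ite, mul_one, mul_zero]

lemma IrrRep.character_conj (π : IrrRep (n + 2)) (m h : M (n + 2)) :
    π.rep.character (m * h * m⁻¹) = π.rep.character h := by
  rw [π.character_eq, π.character_eq, rmat_mul, rmat_mul, Matrix.trace_mul_comm, ← Matrix.mul_assoc,
    rmat_inv_mul, Matrix.one_mul]

lemma integral_M_conj (f : M (n + 2) → ℂ) (m : M (n + 2)) :
    ∫ h, f (m * h * m⁻¹) ∂dm = ∫ h, f h ∂dm := by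
  rw [integral_M_mul_left dm (fun h => f (h * m⁻¹)) m, integral_M_mul_right]

/-- A continuous function on `M` all of whose isotypic components vanish is orthogonal to the
coefficients of every finite dimensional representation. -/
lemma matInt_eq_zero_of_character {f : M (n + 2) → ℂ} (hf : Continuous f)
    (h0 : ∀ (π : IrrRep (n + 2)) (k : M (n + 2)), ∫ h, f (h * k) * π.rep.character h⁻¹ ∂dm = 0)
    {I : Type} [Fintype I] [DecidableEq I] {T : M (n + 2) → Matrix I I ℂ}
    (hT : Continuous T) (hT1 : T 1 = 1) (hTm : ∀ m m', T (m * m') = T m * T m') :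
    matInt dm (fun m => f m • T m⁻¹) = 0 := by
  set F := matInt dm (fun m => f m • T m⁻¹) with hF
  have hFc : ∀ i j, Continuous fun m => (f m • T m⁻¹) i j := fun i j =>
    Continuous.matrix_elem (hf.smul (hT.comp continuous_inv)) i j
  let E : IrrRep (n + 2) → Matrix I I ℂ := fun π => matInt dm fun h => π.rep.character h⁻¹ • T h
  have hEc : ∀ (π : IrrRep (n + 2)) i j, Continuous fun h => (π.rep.character h⁻¹ • T h) i j :=
    fun π i j => Continuous.matrix_elem
      ((π.continuous_character.comp continuous_inv).smul hT) i j
  -- Up to the factor `dim π`, `E π` is the projection onto the `π`-isotypic part. In the double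
  -- integral for `E π * F`, the substitution `m ↦ m h` followed by conjugation of `h` by `m`
  -- isolates exactly the integrals assumed to vanish.
  have hEF : ∀ π, E π * F = 0 := by
    intro π
    rw [hF, mul_matInt dm _ hFc]
    ext i j
    rw [matInt_apply, Matrix.zero_apply]
    have h1 : ∀ m, (E π * (f m • T m⁻¹)) i j =
        ∫ h, f m * π.rep.character h⁻¹ * T (h * m⁻¹) i j ∂dm := by
      intro m
      rw [matInt_mul dm _ (hEc π), matInt_apply]
      congr 1
      funext h
      rw [Matrix.mul_smul, Matrix.smul_mul, ← hTm, Matrix.smul_apply, Matrix.smul_apply, smul_eq_mul,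
        smul_eq_mul, mul_assoc]
    simp only [h1]
    have hc : Continuous (Function.uncurry fun m h : M (n + 2) =>
        f m * π.rep.character h⁻¹ * T (h * m⁻¹) i j) := by
      have h2 : Continuous fun q : M (n + 2) × M (n + 2) => T (q.2 * q.1⁻¹) i j :=
        (hT.matrix_elem i j).comp (continuous_snd.mul continuous_fst.inv)
      exact ((hf.comp continuous_fst).mul
        (π.continuous_character.comp continuous_snd.inv)).mul h2
    rw [integral_integral_swap_of_hasCompactSupport hc (HasCompactSupport.of_compactSpace _)]
    have h3 : ∀ h, ∫ m, f m * π.rep.character h⁻¹ * T (h * m⁻¹) i j ∂dm =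
        ∫ m, f (m * h) * π.rep.character h⁻¹ * T m⁻¹ i j ∂dm := by
      intro h
      rw [← integral_M_mul_right dm _ h]
      congr 1
      funext m
      rw [mul_inv_rev, mul_inv_cancel_left]
    simp only [h3]
    have hc' : Continuous (Function.uncurry fun h m : M (n + 2) =>
        f (m * h) * π.rep.character h⁻¹ * T m⁻¹ i j) := by
      have h2 : Continuous fun q : M (n + 2) × M (n + 2) => T (q.2⁻¹) i j :=
        (hT.matrix_elem i j).comp (continuous_snd.inv)
      exact ((hf.comp (continuous_snd.mul continuous_fst)).mul
        (π.continuous_character.comp continuous_fst.inv)).mul h2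
    rw [integral_integral_swap_of_hasCompactSupport hc' (HasCompactSupport.of_compactSpace _)]
    have h4 : ∀ m, ∫ h, f (m * h) * π.rep.character h⁻¹ * T m⁻¹ i j ∂dm = 0 := by
      intro m
      rw [integral_mul_const, ← integral_M_conj dm _ m⁻¹]
      have h5 : ∀ h, f (m * (m⁻¹ * h * m⁻¹⁻¹)) * π.rep.character (m⁻¹ * h * m⁻¹⁻¹)⁻¹ =
          f (h * m) * π.rep.character h⁻¹ := by
        intro h
        have e : (m⁻¹ * h * m⁻¹⁻¹)⁻¹ = m⁻¹ * h⁻¹ * m⁻¹⁻¹ := by group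
        rw [e, π.character_conj]
        congr 2
        group
      simp only [h5, h0, zero_mul]
    simp only [h4, integral_zero]
  have hET : ∀ π m, E π * T m = T m * E π := by
    intro π m
    rw [mul_matInt dm _ (hEc π), matInt_mul dm _ (hEc π)]
    ext i j
    rw [matInt_apply, matInt_apply, ← integral_M_conj dm _ m]
    congr 1
    funext h
    have e : (m * h * m⁻¹)⁻¹ = m * h⁻¹ * m⁻¹ := by group
    rw [e, π.character_conj, Matrix.smul_mul, ← hTm, Matrix.mul_smul, ← hTm, inv_mul_cancel_right]
  let U : Submodule ℂ (I → ℂ) :=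
    { carrier := {u | ∀ π, E π *ᵥ u = 0}
      zero_mem' := fun π => Matrix.mulVec_zero _
      add_mem' := fun {u v} hu hv π => by rw [Matrix.mulVec_add, hu, hv, add_zero]
      smul_mem' := fun c u hu π => by rw [Matrix.mulVec_smul, hu, smul_zero] }
  -- A nonzero space killed by all `E π` would contain an irreducible `σ`, on which `E σ` acts as `1
  -- / dim σ ≠ 0`.
  have hU : U = ⊥ := by
    by_contra hne
    obtain ⟨σ, j, hj, hjU, hjT⟩ := exists_irrRep hT hT1 hTm hne (fun m v hv π => by
      rw [Matrix.mulVec_mulVec, hET, ← Matrix.mulVec_mulVec, hv, Matrix.mulVec_zero])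
    let A := LinearMap.toMatrix' j
    have hA : ∀ v, A *ᵥ v = j v := fun v => by
      rw [← Matrix.toLin'_apply, Matrix.toLin'_toMatrix']
    have hTA : ∀ m, T m * A = A * σ.rmat m := by
      intro m
      apply Matrix.toLin'.injective
      refine LinearMap.ext fun v => ?_
      rw [Matrix.toLin'_apply, Matrix.toLin'_apply, ← Matrix.mulVec_mulVec, ← Matrix.mulVec_mulVec, hA,
        hA, IrrRep.rmat_mulVec, hjT]
    have hEA : E σ * A = 0 := by
      apply Matrix.toLin'.injective
      refine LinearMap.ext fun v => ?_
      rw [Matrix.toLin'_apply, ← Matrix.mulVec_mulVec, hA, hjU v σ, map_zero]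
      rfl
    have h2 : E σ * A = (σ.dim : ℂ)⁻¹ • A := by
      rw [matInt_mul dm _ (hEc σ)]
      have h3 : (fun m => σ.rep.character m⁻¹ • T m * A) =
          fun m => A * (σ.rep.character m⁻¹ • σ.rmat m) := by
        funext m
        rw [Matrix.smul_mul, hTA, Matrix.mul_smul]
      rw [h3, ← mul_matInt dm, matInt_character, Matrix.mul_smul, Matrix.mul_one]
      exact fun i j => Continuous.matrix_elem
        ((σ.continuous_character.comp continuous_inv).smul σ.continuous_rmat) i j
    rw [hEA] at h2
    have hd : (σ.dim : ℂ)⁻¹ ≠ 0 := inv_ne_zero (Nat.cast_ne_zero.2 σ.dim_pos.ne')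
    have h4 : A = 0 := (smul_eq_zero.1 h2.symm).resolve_left hd
    have h5 : (Pi.single ⟨0, σ.dim_pos⟩ 1 : Fin σ.dim → ℂ) = 0 := by
      apply hj
      rw [← hA, h4, Matrix.zero_mulVec, map_zero]
    simpa using congrFun h5 ⟨0, σ.dim_pos⟩
  apply Matrix.toLin'.injective
  refine LinearMap.ext fun v => ?_
  rw [Matrix.toLin'_apply, map_zero, LinearMap.zero_apply, ← Submodule.mem_bot ℂ, ← hU]
  intro π
  rw [Matrix.mulVec_mulVec, hEF, Matrix.zero_mulVec]

/-- A continuous function on `M` all of whose isotypic components vanish is zero. -/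
lemma eq_zero_of_character {f : M (n + 2) → ℂ} (hf : Continuous f)
    (h0 : ∀ (π : IrrRep (n + 2)) (k : M (n + 2)), ∫ h, f (h * k) * π.rep.character h⁻¹ ∂dm = 0) :
    f = 0 := by
  let c : M (n + 2) → Fin (n + 1) × Fin (n + 1) → ℝ := fun m k => mblk m k.1 k.2
  have hc : Continuous c := continuous_pi fun k => continuous_mblk.matrix_elem k.1 k.2
  refine eq_zero_of_integral_polynomial dm hc hf (fun x y hxy => ?_) fun p => ?_
  · rw [mat_M_eq_iff.2 (Matrix.ext fun i j => congrFun hxy (i, j))]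
  -- The extra product of matrix entries strengthens the induction. A factor `X k` of the polynomial
  -- is moved into the product, which grows by one entry. For constant polynomials the integral is
  -- an entry of the `N`-th tensor power.
  suffices h : ∀ (N : ℕ) (i j : Fin N → Fin (n + 1)), ∫ m, f m * (∏ a, (mblk m (i a) (j a) : ℂ)) *
      MvPolynomial.eval (fun k => (c m k : ℂ)) p ∂dm = 0 by
    simpa using h 0 Fin.elim0 Fin.elim0
  have hpc : ∀ p : MvPolynomial (Fin (n + 1) × Fin (n + 1)) ℂ,
      Continuous fun m => MvPolynomial.eval (fun k => (c m k : ℂ)) p := fun p => by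
    have : Continuous fun z : Fin (n + 1) × Fin (n + 1) → ℂ => MvPolynomial.eval z p :=
      MvPolynomial.continuous_eval p
    exact this.comp (by fun_prop)
  have hprod : ∀ (N : ℕ) (i j : Fin N → Fin (n + 1)),
      Continuous fun m : M (n + 2) => ∏ a, (mblk m (i a) (j a) : ℂ) := fun N i j =>
    continuous_finsetProd _ fun a _ => Complex.continuous_ofReal.comp (continuous_mblk.matrix_elem _ _)
  induction p using MvPolynomial.induction_on with
  | C z =>
    intro N i j
    simp only [MvPolynomial.eval_C]
    rw [integral_mul_const]
    have h1 := matInt_eq_zero_of_character dm hf h0 (continuous_tpow N) (tpow_one N) (tpow_mul N)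
    have h2 := congrFun (congrFun h1 j) i
    rw [matInt_apply] at h2
    have h3 : ∀ m, (f m • tpow N m⁻¹) j i = f m * ∏ a, (mblk m (i a) (j a) : ℂ) := fun m => by
      rw [tpow_inv]; rfl
    simp only [h3] at h2
    rw [h2, Matrix.zero_apply, zero_mul]
  | add p q hp hq =>
    intro N i j
    simp only [map_add, mul_add]
    have hi : ∀ p, Integrable (fun m => f m * (∏ a, (mblk m (i a) (j a) : ℂ)) *
        MvPolynomial.eval (fun k => (c m k : ℂ)) p) dm := fun p =>
      integrable_M dm ((hf.mul (hprod N i j)).mul (hpc p))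
    rw [integral_add (hi p) (hi q), hp, hq, add_zero]
  | mul_X p k hp =>
    intro N i j
    rw [← hp (N + 1) (Fin.cons k.1 i) (Fin.cons k.2 j)]
    congr 1
    funext m
    rw [Fin.prod_univ_succ, map_mul, MvPolynomial.eval_X]
    simp only [Fin.cons_zero, Fin.cons_succ, c]
    ring

end Completeness

end RealHyp

namespace RealHyp

open scoped Topology ContDiff Matrix.Norms.Operator Matrix ComplexConjugate

variable {n : ℕ}

/-! ### Polynomials on `ℝ^{l-1}` -/

/-- Complex polynomials on `ℝ^{l-1}`. -/
abbrev Pol (n : ℕ) : Type := MvPolynomial (Fin (n + 1)) ℂ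

open MvPolynomial (X C pderiv)

/-- Evaluation at a real point. -/
def pev (y : Fin (n + 1) → ℝ) : Pol n →ₐ[ℂ] ℂ := MvPolynomial.aeval fun k => (y k : ℂ)

@[simp] lemma pev_X (y : Fin (n + 1) → ℝ) (k : Fin (n + 1)) : pev y (X k) = y k := by simp [pev]

lemma pev_eq_eval (y : Fin (n + 1) → ℝ) (p : Pol n) :
    pev y p = MvPolynomial.eval (fun k => (y k : ℂ)) p := by
  rw [pev, MvPolynomial.aeval_eq_eval]

lemma continuous_pev (p : Pol n) : Continuous fun y : Fin (n + 1) → ℝ => pev y p := by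
  simp only [pev_eq_eval]
  have : Continuous fun z : Fin (n + 1) → ℂ => MvPolynomial.eval z p := MvPolynomial.continuous_eval p
  exact this.comp (by fun_prop)

/-- Linear substitution `p ↦ p ∘ A`. -/
def psub (A : Matrix (Fin (n + 1)) (Fin (n + 1)) ℝ) : Pol n →ₐ[ℂ] Pol n :=
  MvPolynomial.aeval fun i => ∑ j, C (A i j : ℂ) * X j

lemma pev_psub (A : Matrix (Fin (n + 1)) (Fin (n + 1)) ℝ) (y : Fin (n + 1) → ℝ) (p : Pol n) :
    pev y (psub A p) = pev (A *ᵥ y) p := by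
  suffices h : (pev y).comp (psub A) = pev (A *ᵥ y) from congrArg (fun f : Pol n →ₐ[ℂ] ℂ => f p) h
  refine MvPolynomial.algHom_ext fun i => ?_
  simp [psub, pev, Matrix.mulVec, dotProduct]

lemma psub_isHomogeneous (A : Matrix (Fin (n + 1)) (Fin (n + 1)) ℝ) {p : Pol n} {N : ℕ}
    (hp : p.IsHomogeneous N) : (psub A p).IsHomogeneous N := by
  have h := hp.aeval (S := ℂ) (n := 1) (fun i => ∑ j, C (A i j : ℂ) * X j) fun i =>
    MvPolynomial.IsHomogeneous.sum _ _ _ fun j _ => by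
      simpa using (MvPolynomial.isHomogeneous_C _ _).mul (MvPolynomial.isHomogeneous_X ℂ j)
  simpa [psub] using h

lemma hasDerivAt_pev {c : ℝ → Fin (n + 1) → ℝ} {c' : Fin (n + 1) → ℝ} {t : ℝ} (hc : HasDerivAt c c' t)
    (p : Pol n) : HasDerivAt (fun s => pev (c s) p) (∑ i, (c' i : ℂ) * pev (c t) (pderiv i p)) t := by
  induction p using MvPolynomial.induction_on with
  | C z => simpa [pev] using hasDerivAt_const t z
  | add p q hp hq =>
    simp only [map_add, mul_add, Finset.sum_add_distrib]
    exact hp.add hq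
  | mul_X p k hp =>
    have hk : HasDerivAt (fun s => ((c s k : ℝ) : ℂ)) (c' k : ℂ) t :=
      (hasDerivAt_pi.1 hc k).ofReal_comp
    have h := hp.mul hk
    simp only [map_mul, pev_X, Derivation.leibniz, MvPolynomial.pderiv_X, map_add, smul_eq_mul,
      mul_add, Finset.sum_add_distrib]
    convert! h using 1
    rw [Finset.sum_mul, add_comm]
    congr 1
    · exact Finset.sum_congr rfl fun i _ => by ring
    · rw [Finset.sum_eq_single k]
      · simp; ring
      · intro i _ hi; simp [hi.symm]
      · simp

/-- The vector field of the infinitesimal rotation `A`. -/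
def vf (A : Matrix (Fin (n + 1)) (Fin (n + 1)) ℝ) (p : Pol n) : Pol n :=
  ∑ i, (∑ j, C (A i j : ℂ) * X j) * pderiv i p

lemma pev_vf (A : Matrix (Fin (n + 1)) (Fin (n + 1)) ℝ) (y : Fin (n + 1) → ℝ) (p : Pol n) :
    pev y (vf A p) = ∑ i, ((A *ᵥ y) i : ℂ) * pev y (pderiv i p) := by
  simp [vf, Matrix.mulVec, dotProduct, pev]

/-- The Laplace operator on polynomials. -/
def plap (p : Pol n) : Pol n := ∑ i, pderiv i (pderiv i p)

lemma pderiv_comm (i j : Fin (n + 1)) (p : Pol n) : pderiv i (pderiv j p) = pderiv j (pderiv i p) := by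
  have h : ⁅(pderiv i : Derivation ℂ (Pol n) (Pol n)), (pderiv j : Derivation ℂ (Pol n) (Pol n))⁆ = 0 := by
    refine MvPolynomial.derivation_ext (R := ℂ) fun k => ?_
    simp only [Derivation.commutator_apply, MvPolynomial.pderiv_X, Derivation.zero_apply]
    by_cases h1 : j = k <;> by_cases h2 : i = k <;> simp [eq_comm, h1, h2]
  have h' := congrArg (fun D : Derivation ℂ (Pol n) (Pol n) => D p) h
  simp only [Derivation.commutator_apply, Derivation.zero_apply] at h'
  exact sub_eq_zero.1 h'

lemma vf_rot (i j : Fin (n + 1)) (p : Pol n) :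
    vf (blk ((rot (n := n) i j : so1 (n + 2)) : Mat (n + 2))) p = X j * pderiv i p - X i * pderiv j p := by
  rw [blk_rot, vf]
  have h : ∀ a, (∑ b, C (((Matrix.single i j (1 : ℝ) - Matrix.single j i 1 :
      Matrix (Fin (n + 1)) (Fin (n + 1)) ℝ) a b : ℝ) : ℂ) * X b : Pol n) =
      (if i = a then X j else 0) - (if j = a then X i else 0) := by
    intro a
    simp only [Matrix.sub_apply, Matrix.single_apply, Complex.ofReal_sub, map_sub, sub_mul,
      Finset.sum_sub_distrib]
    congr 1
    · by_cases h : i = a <;> simp [h, apply_ite]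
    · by_cases h : j = a <;> simp [h, apply_ite]
  simp only [h, sub_mul, Finset.sum_sub_distrib, ite_mul, zero_mul, Finset.sum_ite_eq, Finset.mem_univ,
    if_true]

/-- The classical formula `∑_{i<j} (x_j ∂_i - x_i ∂_j)² = r²Δ - N(N+d-2)` in degree `N` and
dimension `d = n + 1`, a consequence of Euler's identity for `p` and its first derivatives. The
factor `2` comes from summing over ordered pairs. -/
lemma sum_vf_rot_sq {p : Pol n} {N : ℕ} (hp : p.IsHomogeneous N) :
    ∑ i, ∑ j, vf (blk ((rot (n := n) i j : so1 (n + 2)) : Mat (n + 2)))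
      (vf (blk ((rot (n := n) i j : so1 (n + 2)) : Mat (n + 2))) p) =
    2 * ((∑ k, X k * X k) * plap p) - C (2 * ((N : ℂ) * (N + n - 1))) * p := by
  have e1 : ∑ i, X i * pderiv i p = C (N : ℂ) * p := by
    rw [hp.sum_X_mul_pderiv]; simp
  have e2 : ∀ j, ∑ i, X i * pderiv i (pderiv j p) = C ((N : ℂ) - 1) * pderiv j p := by
    intro j
    have h := congrArg (pderiv j) e1
    simp only [map_sum, Derivation.leibniz, MvPolynomial.pderiv_X, smul_eq_mul, MvPolynomial.pderiv_C,
      Finset.sum_add_distrib, mul_zero, add_zero] at h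
    rw [Finset.sum_eq_single (a := j) (f := fun x => pderiv x p * (Pi.single j 1 : Fin (n + 1) → Pol n) x)
      (by intro i _ hi; simp [hi]) (by simp)] at h
    rw [Pi.single_eq_same, mul_one] at h
    rw [map_sub, sub_mul, ← h, MvPolynomial.C_1, one_mul, add_sub_cancel_right]
    exact Finset.sum_congr rfl fun i _ => by rw [pderiv_comm]
  have e3 : ∀ i j, vf (blk ((rot (n := n) i j : so1 (n + 2)) : Mat (n + 2)))
      (vf (blk ((rot (n := n) i j : so1 (n + 2)) : Mat (n + 2))) p) =
      X j * X j * pderiv i (pderiv i p) + X i * X i * pderiv j (pderiv j p) +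
        (if i = j then 2 * (X j * pderiv j p) else 0) - X j * pderiv j p - X i * pderiv i p -
        2 * (X j * (X i * pderiv i (pderiv j p))) := by
    intro i j
    rw [vf_rot, vf_rot]
    simp only [map_sub, Derivation.leibniz, MvPolynomial.pderiv_X, smul_eq_mul]
    rw [pderiv_comm j i]
    by_cases h : i = j
    · subst h; simp; ring
    · rw [if_neg h, Pi.single_eq_same, Pi.single_eq_same, Pi.single_eq_of_ne h,
        Pi.single_eq_of_ne (Ne.symm h)]
      ring
  simp only [e3, Finset.sum_sub_distrib, Finset.sum_add_distrib, Finset.sum_ite_eq, Finset.mem_univ,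
    if_true, ← Finset.mul_sum, e1, Finset.sum_const, Finset.card_univ, Fintype.card_fin]
  have e4 : ∑ i, ∑ j, X j * (X i * pderiv i (pderiv j p)) = C ((N : ℂ) - 1) * (C (N : ℂ) * p) := by
    rw [Finset.sum_comm]
    simp only [← Finset.mul_sum, e2]
    rw [← e1, Finset.mul_sum]
    exact Finset.sum_congr rfl fun i _ => by ring
  have e7 : ∑ i, X i * (n + 1) • pderiv i p = (n + 1) • (C (N : ℂ) * p) := by
    rw [← e1, Finset.smul_sum]
    exact Finset.sum_congr rfl fun i _ => by rw [mul_smul_comm]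
  have e5 : ∑ x, ∑ i, X i * X i * pderiv x (pderiv x p) = (∑ k, X k * X k) * plap p := by
    rw [plap, Finset.mul_sum]
    exact Finset.sum_congr rfl fun i _ => by rw [Finset.sum_mul]
  have e6 : ∑ x, X x * X x * ∑ i, pderiv i (pderiv i p) = (∑ k, X k * X k) * plap p := by
    rw [plap, Finset.sum_mul]
  rw [e4, e5, e6, e7]
  simp only [map_mul, map_sub, map_add, map_one, map_natCast, nsmul_eq_mul, map_ofNat]
  push_cast
  ring


/-! ### Class-one representations -/

lemma expM_coe (Z : mLie (n + 2)) : ((expM Z : M (n + 2)) : SOo (n + 2)) = expG (Z : so1 (n + 2)) := rfl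

lemma expM_neg (Z : mLie (n + 2)) : expM (-Z) = (expM Z)⁻¹ := by
  apply eq_inv_of_mul_eq_one_left
  apply Subtype.ext
  apply mat_injective
  change NormedSpace.exp (-((Z : so1 (n + 2)) : Mat (n + 2))) * NormedSpace.exp ((Z : so1 (n + 2)) : Mat (n + 2)) = 1
  rw [← Matrix.exp_add_of_commute _ _
    (Commute.neg_left (Commute.refl ((Z : so1 (n + 2)) : Mat (n + 2))))]
  simp

instance : SecondCountableTopology (M (n + 2)) :=
  inferInstanceAs (SecondCountableTopology (M (n + 2) : Set (SOo (n + 2))))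

lemma expM_zero : expM (0 : mLie (n + 2)) = 1 := Subtype.ext expG_zero

lemma continuous_expM : Continuous (expM : mLie (n + 2) → M (n + 2)) :=
  (continuous_expG.comp continuous_subtype_val).subtype_mk _

lemma hasDerivAt_mblk_expM (Z : mLie (n + 2)) (u : Fin (n + 1) → ℝ) (t : ℝ) :
    HasDerivAt (fun s : ℝ => mblk (expM (s • Z)) *ᵥ u)
      (blk ((Z : so1 (n + 2)) : Mat (n + 2)) *ᵥ (mblk (expM (t • Z)) *ᵥ u)) t := by
  have h := hasDerivAt_mat_expG_mul (1 : SOo (n + 2)) (Z : so1 (n + 2)) t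
  simp only [mul_one] at h
  rw [hasDerivAt_pi]
  intro i
  have h1 : ∀ j, HasDerivAt (fun s : ℝ => mat (expG (s • (Z : so1 (n + 2)))) (mid i) (mid j))
      ((((Z : so1 (n + 2)) : Mat (n + 2)) * mat (expG (t • (Z : so1 (n + 2))))) (mid i) (mid j)) t := fun j =>
    hasDerivAt_pi.1 (hasDerivAt_pi.1 h (mid i)) (mid j)
  have h2 := HasDerivAt.sum (u := Finset.univ) fun j _ => (h1 j).mul_const (u j)
  convert! h2 using 1
  · funext s
    simp [Matrix.mulVec, dotProduct, mblk, expM_coe]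
  · rw [Matrix.mulVec_mulVec]
    simp only [Matrix.mulVec, dotProduct]
    refine Finset.sum_congr rfl fun j _ => ?_
    congr 1
    obtain ⟨h3, h4, h5, h6⟩ := mLie_zero_row Z (mid i)
    rw [Matrix.mul_apply, Matrix.mul_apply, sum_index, h5, h6]
    simp [mblk, expM_coe]

section ClassOne

variable (dm : Measure (M (n + 2))) [dm.IsHaarMeasure] [IsProbabilityMeasure dm]

/-- `π` has a nonzero vector that is invariant under the stabilizer of a point of `ℝ^{l-1}`. -/
def IsClassOne (π : IrrRep (n + 2)) : Prop :=
  ∃ (y : Fin (n + 1) → ℝ) (v : Fin π.dim → ℂ), v ≠ 0 ∧ ∀ h : M (n + 2), mblk h *ᵥ y = y → π.rep h v = v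

/-- The map `p ↦ ∫_M p(m y) π(m) v dm`. -/
def polMap (π : IrrRep (n + 2)) (y : Fin (n + 1) → ℝ) (v : Fin π.dim → ℂ) :
    Pol n →ₗ[ℂ] (Fin π.dim → ℂ) where
  toFun p := fun i => ∫ m, pev (mblk m *ᵥ y) p * π.rep m v i ∂dm
  map_add' p q := by
    funext i
    have hi : ∀ p, Integrable (fun m => pev (mblk m *ᵥ y) p * π.rep m v i) dm := fun p =>
      integrable_M dm (((continuous_pev p).comp (by fun_prop)).mul ((continuous_apply i).comp (π.cont v)))
    simp only [map_add, add_mul, Pi.add_apply]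
    exact integral_add (hi p) (hi q)
  map_smul' c p := by
    funext i
    simp only [map_smul, smul_eq_mul, mul_assoc, Pi.smul_apply, RingHom.id_apply]
    exact integral_const_mul _ _

variable {π : IrrRep (n + 2)} {y : Fin (n + 1) → ℝ} {v : Fin π.dim → ℂ}

lemma continuous_polMap_integrand (p : Pol n) (i : Fin π.dim) :
    Continuous fun m : M (n + 2) => pev (mblk m *ᵥ y) p * π.rep m v i :=
  ((continuous_pev p).comp (by fun_prop)).mul ((continuous_apply i).comp (π.cont v))

lemma polMap_apply (p : Pol n) (i : Fin π.dim) :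
    polMap dm π y v p i = ∫ m, pev (mblk m *ᵥ y) p * π.rep m v i ∂dm := rfl

lemma rep_polMap_apply (h : M (n + 2)) (p : Pol n) (i : Fin π.dim) :
    π.rep h (polMap dm π y v p) i = ∫ m, pev (mblk h⁻¹ *ᵥ (mblk m *ᵥ y)) p * π.rep m v i ∂dm := by
  rw [← integral_M_mul_left dm _ h]
  have h1 : ∀ m, pev (mblk h⁻¹ *ᵥ (mblk (h * m) *ᵥ y)) p * π.rep (h * m) v i =
      ∑ j, π.rmat h i j * (pev (mblk m *ᵥ y) p * π.rep m v j) := by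
    intro m
    rw [Matrix.mulVec_mulVec, ← mblk_mul, inv_mul_cancel_left, map_mul, Module.End.mul_apply,
      ← IrrRep.rmat_mulVec, Matrix.mulVec, dotProduct, Finset.mul_sum]
    exact Finset.sum_congr rfl fun j _ => by ring
  simp only [h1]
  rw [integral_finsetSum _ fun j _ => (integrable_M dm (continuous_polMap_integrand p j)).const_mul _,
    ← IrrRep.rmat_mulVec, Matrix.mulVec, dotProduct]
  exact Finset.sum_congr rfl fun j _ => (integral_const_mul _ _).symm

lemma rep_polMap (h : M (n + 2)) (p : Pol n) :
    π.rep h (polMap dm π y v p) = polMap dm π y v (psub (mblk h⁻¹) p) := by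
  funext i
  rw [rep_polMap_apply, polMap_apply]
  simp only [pev_psub]

/-- The representation is only assumed continuous. Its differentiability comes from that of
polynomials, since the translation by `exp sZ` can be moved from `π` to `p`. -/
lemma hasDerivAt_rep_polMap (Z : mLie (n + 2)) (p : Pol n) (t : ℝ) :
    HasDerivAt (fun s : ℝ => π.rep (expM (s • Z)) (polMap dm π y v p))
      (π.rep (expM (t • Z)) (polMap dm π y v (-vf (blk ((Z : so1 (n + 2)) : Mat (n + 2))) p))) t := by
  rw [hasDerivAt_pi]
  intro i
  simp only [rep_polMap_apply, ← expM_neg]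
  let c : ℝ → M (n + 2) → Fin (n + 1) → ℝ := fun s m => mblk (expM (-(s • Z))) *ᵥ (mblk m *ᵥ y)
  have hcc : Continuous (Function.uncurry c) := by
    have h1 : Continuous fun q : ℝ × M (n + 2) => mblk (expM (-(q.1 • Z))) := by
      simp only [expM_neg]
      have h0 : Continuous fun q : ℝ × M (n + 2) => expM (q.1 • Z) :=
        continuous_expM.comp (by fun_prop)
      exact continuous_mblk.comp h0.inv
    exact h1.matrix_mulVec ((continuous_mblk.comp continuous_snd).matrix_mulVec continuous_const)
  have hvc : Continuous fun m => π.rep m v i := (continuous_apply i).comp (π.cont v)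
  let F : ℝ → M (n + 2) → ℂ := fun s m => pev (c s m) p * π.rep m v i
  let F' : ℝ → M (n + 2) → ℂ := fun s m =>
    pev (c s m) (-vf (blk ((Z : so1 (n + 2)) : Mat (n + 2))) p) * π.rep m v i
  have hF : Continuous (Function.uncurry F) :=
    ((continuous_pev p).comp hcc).mul (hvc.comp continuous_snd)
  have hF' : Continuous (Function.uncurry F') :=
    ((continuous_pev _).comp hcc).mul (hvc.comp continuous_snd)
  have hd : ∀ s m, HasDerivAt (fun s => F s m) (F' s m) s := by
    intro s m
    have h0 := (hasDerivAt_mblk_expM Z (mblk m *ᵥ y) (-s)).scomp s (hasDerivAt_neg s)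
    have h1 : HasDerivAt (fun s => c s m) (-(blk ((Z : so1 (n + 2)) : Mat (n + 2)) *ᵥ c s m)) s := by
      convert! h0 using 1
      · funext s
        change mblk (expM (-(s • Z))) *ᵥ _ = mblk (expM ((-s) • Z)) *ᵥ _
        rw [show (-s) • Z = -(s • Z) from neg_smul s Z]
      · rw [show (-s) • Z = -(s • Z) from neg_smul s Z, neg_one_smul]
    have h2 := (hasDerivAt_pev (c := fun s => c s m) h1 p).mul_const (π.rep m v i)
    convert! h2 using 1
    simp only [F', map_neg, pev_vf, Pi.neg_apply, Complex.ofReal_neg, neg_mul,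
      Finset.sum_neg_distrib]
  have h3 := hasFDerivAt_integral_of_continuous (μ := dm) isCompact_univ hF
    (F' := fun s m => ContinuousLinearMap.toSpanSingleton ℝ (F' s m))
    ((ContinuousLinearMap.toSpanSingletonCLE (𝕜 := ℝ) (E := ℂ)).continuous.comp hF')
    (fun s m => (hd s m).hasFDerivAt) t
  have h4 := h3.hasDerivAt
  simp only [Measure.restrict_univ] at h4
  convert! h4 using 1
  rw [ContinuousLinearMap.integral_apply]
  · simp [F', c]
  · exact integrable_M dm ((ContinuousLinearMap.toSpanSingletonCLE (𝕜 := ℝ) (E := ℂ)).continuous.comp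
      (hF'.uncurry_left t))

end ClassOne

end RealHyp

namespace RealHyp

open scoped Topology ContDiff Matrix.Norms.Operator Matrix ComplexConjugate

open MvPolynomial (X C pderiv homogeneousSubmodule)

variable {n : ℕ}

/-! ### The level of a class-one representation -/

/-- `π` is an equivariant quotient of the polynomials of degree `N` on `ℝ^{l-1}`, by a quotient map
that vanishes on `r² Δ p`. -/
def HasLevel (π : IrrRep (n + 2)) (N : ℕ) : Prop :=
  ∃ W : Pol n →ₗ[ℂ] (Fin π.dim → ℂ),
    (∀ h p, π.rep h (W p) = W (psub (mblk h⁻¹) p)) ∧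
    (∀ u, ∃ p : Pol n, p.IsHomogeneous N ∧ W p = u) ∧
    (∀ (Z : mLie (n + 2)) p (t : ℝ), HasDerivAt (fun s : ℝ => π.rep (expM (s • Z)) (W p))
      (π.rep (expM (t • Z)) (W (-vf (blk ((Z : so1 (n + 2)) : Mat (n + 2))) p))) t) ∧
    ∀ p : Pol n, p.IsHomogeneous N → W ((∑ k, X k * X k) * plap p) = 0

lemma plap_isHomogeneous {p : Pol n} {N : ℕ} (hp : p.IsHomogeneous N) :
    (plap p).IsHomogeneous (N - 1 - 1) :=
  MvPolynomial.IsHomogeneous.sum _ _ _ fun _ _ => hp.pderiv.pderiv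

lemma pderiv_eq_zero_of_isHomogeneous_zero {p : Pol n} (hp : p.IsHomogeneous 0) (i : Fin (n + 1)) :
    pderiv i p = 0 := by
  rw [MvPolynomial.totalDegree_eq_zero_iff_eq_C.1
    ((MvPolynomial.totalDegree_zero_iff_isHomogeneous _).2 hp), MvPolynomial.pderiv_C]

/-- The function `m ↦ π(m)v` factors through the orbit map `m ↦ m y`, so it cannot be orthogonal to
all polynomials on the orbit and `W ≠ 0`. The level is the least degree with `W ≠ 0`: the image of
that degree is invariant, hence everything, and `W(r²Δp) = |y|² W(Δp) = 0` by minimality. -/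
lemma exists_hasLevel (dm : Measure (M (n + 2))) [dm.IsHaarMeasure] [IsProbabilityMeasure dm]
    {π : IrrRep (n + 2)} (hπ : IsClassOne π) : ∃ N, HasLevel π N := by
  obtain ⟨y, v, hv, hfix⟩ := hπ
  let W := polMap dm π y v
  have hW : ∃ p, W p ≠ 0 := by
    by_contra hcon
    push Not at hcon
    apply hv
    funext i
    have h1 : (fun m => π.rep m v i) = 0 := by
      refine eq_zero_of_integral_polynomial dm (c := fun m => mblk m *ᵥ y) (by fun_prop)
        ((continuous_apply i).comp (π.cont v)) (fun x x' hx => ?_) fun p => ?_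
      · have h2 : π.rep (x⁻¹ * x') v = v := by
          apply hfix
          rw [mblk_mul, ← Matrix.mulVec_mulVec, ← hx, Matrix.mulVec_mulVec, ← mblk_mul, inv_mul_cancel,
            mblk_one, Matrix.one_mulVec]
        have h3 := congrArg (π.rep x) h2
        rw [← Module.End.mul_apply, ← map_mul, mul_inv_cancel_left] at h3
        rw [h3]
      · have h2 := congrFun (hcon p) i
        rw [polMap_apply] at h2
        simp only [pev_eq_eval] at h2
        rw [← Pi.zero_apply (M := fun _ : Fin π.dim => ℂ) i, ← h2]
        congr 1
        funext m
        rw [mul_comm]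
    have h2 := congrFun h1 1
    simpa using h2
  have hN : ∃ N, ∃ p : Pol n, p.IsHomogeneous N ∧ W p ≠ 0 := by
    obtain ⟨p, hp⟩ := hW
    by_contra hcon
    push Not at hcon
    apply hp
    rw [← MvPolynomial.sum_homogeneousComponent p, map_sum]
    exact Finset.sum_eq_zero fun i _ => hcon i _ (MvPolynomial.homogeneousComponent_isHomogeneous i p)
  classical
  obtain ⟨p₀, hp₀, hWp₀⟩ := Nat.find_spec hN
  have hmin : ∀ k < Nat.find hN, ∀ p : Pol n, p.IsHomogeneous k → W p = 0 := by
    intro k hk p hp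
    have := Nat.find_min hN hk
    push Not at this
    exact this p hp
  set N := Nat.find hN
  refine ⟨N, W, rep_polMap dm, fun u => ?_, hasDerivAt_rep_polMap dm, fun p hp => ?_⟩
  · have h1 := π.invariant_eq_bot_or_top (U := (homogeneousSubmodule (Fin (n + 1)) ℂ N).map W) (by
      rintro m _ ⟨p, hp, rfl⟩
      rw [rep_polMap]
      exact ⟨_, psub_isHomogeneous _ hp, rfl⟩)
    rcases h1 with h1 | h1
    · exact absurd ((Submodule.mem_bot ℂ).1 (h1 ▸ Submodule.mem_map_of_mem (f := W) hp₀)) hWp₀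
    · have h2 : u ∈ (homogeneousSubmodule (Fin (n + 1)) ℂ N).map W := by rw [h1]; trivial
      obtain ⟨p, hp, hpu⟩ := h2
      exact ⟨p, hp, hpu⟩
  · have h1 : W ((∑ k, X k * X k) * plap p) = ((y ⬝ᵥ y : ℝ) : ℂ) • W (plap p) := by
      funext i
      rw [Pi.smul_apply, polMap_apply, polMap_apply, smul_eq_mul, ← integral_const_mul]
      congr 1
      funext m
      rw [map_mul, ← mblk_mulVec_dotProduct m]
      simp [dotProduct, mul_assoc]
    rw [h1]
    -- For `N = 0` the truncated `N - 1 - 1` is not smaller than `N`, so minimality is no help.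
    -- Below degree two `Δp` itself is zero.
    rcases Nat.lt_or_ge N 2 with h2 | h2
    · have h3 : plap p = 0 := by
        refine Finset.sum_eq_zero fun i _ => pderiv_eq_zero_of_isHomogeneous_zero ?_ i
        have h4 := hp.pderiv (i := i)
        rwa [show N - 1 = 0 by omega] at h4
      rw [h3, map_zero, smul_zero]
    · rw [hmin (N - 1 - 1) (by omega) _ (plap_isHomogeneous hp), smul_zero]

/-! #### The derived representation -/

section Derived

variable {π : IrrRep (n + 2)} {N : ℕ}

lemma HasLevel.hasDerivAt (h : HasLevel π N) (Z : mLie (n + 2)) (v : Fin π.dim → ℂ) (t : ℝ) :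
    HasDerivAt (fun s : ℝ => π.rep (expM (s • Z)) v) (π.rep (expM (t • Z)) (dRep π Z v)) t := by
  obtain ⟨W, -, hs, hd, -⟩ := h
  obtain ⟨p, -, rfl⟩ := hs v
  have h0 := (hd Z p 0).deriv
  rw [show (0 : ℝ) • Z = 0 from zero_smul ℝ Z, expM_zero, map_one, Module.End.one_apply] at h0
  rw [dRep, h0]
  exact hd Z p t

/-- The matrix of `π(Z)`. -/
def drmat (π : IrrRep (n + 2)) (Z : mLie (n + 2)) : Matrix (Fin π.dim) (Fin π.dim) ℂ :=
  Matrix.of fun i j => dRep π Z (Pi.single j 1) i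

lemma HasLevel.hasDerivAt_rmat (h : HasLevel π N) (Z : mLie (n + 2)) (i j : Fin π.dim) (t : ℝ) :
    HasDerivAt (fun s : ℝ => π.rmat (expM (s • Z)) i j) ((π.rmat (expM (t • Z)) * drmat π Z) i j) t := by
  simp only [π.rmat_apply]
  have h1 := hasDerivAt_pi.1 (h.hasDerivAt Z (Pi.single j 1) t) i
  rw [← IrrRep.rmat_mulVec] at h1
  exact h1

lemma HasLevel.drmat_mulVec (h : HasLevel π N) (Z : mLie (n + 2)) (v : Fin π.dim → ℂ) :
    drmat π Z *ᵥ v = dRep π Z v := by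
  have h1 := h.hasDerivAt Z v 0
  rw [show (0 : ℝ) • Z = 0 from zero_smul ℝ Z, expM_zero, map_one, Module.End.one_apply] at h1
  funext i
  have h2 := hasDerivAt_pi.1 h1 i
  have h3 := HasDerivAt.sum (u := Finset.univ) fun j _ => (h.hasDerivAt_rmat Z i j 0).mul_const (v j)
  rw [show (0 : ℝ) • Z = 0 from zero_smul ℝ Z, expM_zero, IrrRep.rmat_one, Matrix.one_mul] at h3
  refine HasDerivAt.unique (f := fun s : ℝ => π.rep (expM (s • Z)) v i) ?_ h2
  convert! h3 using 1
  funext s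
  rw [← IrrRep.rmat_mulVec]
  simp [Matrix.mulVec, dotProduct]

lemma vf_linear (c : ℝ) (A B : Matrix (Fin (n + 1)) (Fin (n + 1)) ℝ) (p : Pol n) :
    vf (c • A + B) p = (c : ℂ) • vf A p + vf B p := by
  simp only [vf, Finset.smul_sum, ← Finset.sum_add_distrib]
  refine Finset.sum_congr rfl fun i _ => ?_
  rw [← smul_mul_assoc, ← add_mul, Finset.smul_sum, ← Finset.sum_add_distrib]
  congr 1
  refine Finset.sum_congr rfl fun j _ => ?_
  simp only [Matrix.add_apply, Matrix.smul_apply, smul_eq_mul, Complex.ofReal_add, Complex.ofReal_mul,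
    map_add, map_mul, MvPolynomial.smul_eq_C_mul]
  ring

/-- Linearity in `Z` is not visible from the definition by one-parameter groups. It is read off from
the vector fields `vf`, which depend linearly on the matrix of `Z`. -/
lemma HasLevel.dRep_linear (h : HasLevel π N) (c : ℝ) (Z Z' : mLie (n + 2)) (v : Fin π.dim → ℂ) :
    dRep π (c • Z + Z') v = (c : ℂ) • dRep π Z v + dRep π Z' v := by
  obtain ⟨W, -, hs, hd, -⟩ := h
  obtain ⟨p, -, rfl⟩ := hs v
  have h0 : ∀ Z, dRep π Z (W p) = W (-vf (blk ((Z : so1 (n + 2)) : Mat (n + 2))) p) := fun Z => by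
    have h1 := (hd Z p 0).deriv
    rwa [show (0 : ℝ) • Z = 0 from zero_smul ℝ Z, expM_zero, map_one, Module.End.one_apply] at h1
  rw [h0, h0, h0, ← map_smul, ← map_add, smul_neg, ← neg_add, ← vf_linear]
  rfl

lemma HasLevel.exists_linear (h : HasLevel π N) :
    ∃ δ : mLie (n + 2) →ₗ[ℝ] Matrix (Fin π.dim) (Fin π.dim) ℂ, ∀ Z, δ Z = drmat π Z := by
  have h0 : ∀ v, dRep π 0 v = 0 := fun v => by
    have := h.dRep_linear 1 0 0 v
    simpa using this
  refine ⟨{ toFun := drmat π, map_add' := fun Z Z' => ?_, map_smul' := fun c Z => ?_ }, fun _ => rfl⟩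
  · ext i j
    have := congrFun (h.dRep_linear 1 Z Z' (Pi.single j 1)) i
    simpa [drmat] using this
  · ext i j
    have := congrFun (h.dRep_linear c Z 0 (Pi.single j 1)) i
    simpa [drmat, h0] using this

/-- Under `W` the operator `π(Z)` becomes `-vf`, and `W` kills the `r²Δ` term of `sum_vf_rot_sq`.
This gives the Casimir scalar of `𝔪` on `V_π` explicitly, again counted over ordered pairs. -/
lemma HasLevel.sum_drmat_rot_sq (h : HasLevel π N) :
    ∑ i, ∑ j, drmat π (rot i j) * drmat π (rot i j) =
      -(2 * ((N : ℂ) * (N + n - 1))) • (1 : Matrix (Fin π.dim) (Fin π.dim) ℂ) := by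
  apply Matrix.toLin'.injective
  refine LinearMap.ext fun v => ?_
  simp only [map_sum, LinearMap.sum_apply, Matrix.toLin'_apply, ← Matrix.mulVec_mulVec, h.drmat_mulVec]
  obtain ⟨W, -, hs, hd, hl⟩ := h
  obtain ⟨p, hp, rfl⟩ := hs v
  have h0 : ∀ Z q, dRep π Z (W q) = W (-vf (blk ((Z : so1 (n + 2)) : Mat (n + 2))) q) := fun Z q => by
    have h1 := (hd Z q 0).deriv
    rwa [show (0 : ℝ) • Z = 0 from zero_smul ℝ Z, expM_zero, map_one, Module.End.one_apply] at h1
  have hneg : ∀ A (q : Pol n), -vf A (-vf A q) = vf A (vf A q) := by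
    intro A q
    simp [vf]
  simp only [h0, hneg, ← map_sum]
  rw [sum_vf_rot_sq hp, map_sub, two_mul, map_add, hl p hp, add_zero, zero_sub,
    ← MvPolynomial.smul_eq_C_mul, map_smul, Matrix.smul_mulVec, Matrix.one_mulVec, neg_smul]

end Derived

/-! #### Dimensions and multiplicities -/

/-- Crude count: a monomial of degree `N` has `n + 1` exponents, each at most `N`. Only polynomial
growth in `N` matters later. -/
lemma finrank_homogeneousSubmodule_le (n N : ℕ) :
    Module.finrank ℂ (homogeneousSubmodule (Fin (n + 1)) ℂ N) ≤ (N + 1) ^ (n + 1) := by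
  let T : homogeneousSubmodule (Fin (n + 1)) ℂ N →ₗ[ℂ] ((Fin (n + 1) → Fin (N + 1)) → ℂ) :=
    LinearMap.pi fun e => (MvPolynomial.lcoeff ℂ (Finsupp.equivFunOnFinite.symm fun i => (e i : ℕ))) ∘ₗ
      (homogeneousSubmodule (Fin (n + 1)) ℂ N).subtype
  have hT : Function.Injective T := by
    rw [← LinearMap.ker_eq_bot, LinearMap.ker_eq_bot']
    rintro ⟨p, hp⟩ h0
    apply Subtype.ext
    refine MvPolynomial.ext _ _ fun d => ?_
    by_cases hd : d.degree = N
    · have h1 : ∀ i, d i < N + 1 := fun i => by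
        rw [← hd]
        exact Nat.lt_succ_of_le (Finsupp.le_degree i d)
      have h2 := congrFun h0 fun i => ⟨d i, h1 i⟩
      have h3 : (Finsupp.equivFunOnFinite.symm fun i => d i : Fin (n + 1) →₀ ℕ) = d := by
        ext i; rfl
      simpa [T, h3] using h2
    · have hp' : p.IsHomogeneous N := hp
      simpa using hp'.coeff_eq_zero hd
  have := LinearMap.finrank_le_finrank_of_injective hT
  simpa using this

instance (n N : ℕ) : Module.Finite ℂ (homogeneousSubmodule (Fin (n + 1)) ℂ N) :=
  Module.Finite.iff_fg.2 (MvPolynomial.homogeneousSubmodule_fg _ _ _)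

lemma HasLevel.dim_le {π : IrrRep (n + 2)} {N : ℕ} (h : HasLevel π N) : π.dim ≤ (N + 1) ^ (n + 1) := by
  obtain ⟨W, -, hs, -⟩ := h
  refine le_trans ?_ (finrank_homogeneousSubmodule_le n N)
  have h1 : Function.Surjective (W ∘ₗ (homogeneousSubmodule (Fin (n + 1)) ℂ N).subtype) := fun u => by
    obtain ⟨p, hp, hpu⟩ := hs u
    exact ⟨⟨p, hp⟩, hpu⟩
  simpa using LinearMap.finrank_le_finrank_of_surjective h1

/-- Each class gives a functional on polynomials of degree `N`, one coordinate of its map `W`.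
Evaluated on all translates of a polynomial these become matrix coefficients, and orthogonality
makes functionals of inequivalent classes linearly independent. -/
lemma card_le_of_hasLevel (dm : Measure (M (n + 2))) [dm.IsHaarMeasure] [IsProbabilityMeasure dm]
    {ι : Type} [Fintype ι] {N : ℕ} (π : ι → IrrRep (n + 2))
    (hne : ∀ i j, i ≠ j → ¬ Nonempty ((π i).rep.Equiv (π j).rep)) (h : ∀ i, HasLevel (π i) N) :
    Fintype.card ι ≤ (N + 1) ^ (n + 1) := by
  classical
  choose W hW hs _ _ using h
  let b : ∀ k, Fin (π k).dim := fun k => ⟨0, (π k).dim_pos⟩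
  let f : ι → Module.Dual ℂ (homogeneousSubmodule (Fin (n + 1)) ℂ N) := fun k =>
    LinearMap.proj (b k) ∘ₗ W k ∘ₗ (homogeneousSubmodule (Fin (n + 1)) ℂ N).subtype
  have hf : LinearIndependent ℂ f := by
    rw [Fintype.linearIndependent_iff]
    intro c hc k
    obtain ⟨p, hp, hpk⟩ := hs k (Pi.single (b k) 1)
    have h1 : ∀ m : M (n + 2), ∑ i, c i * (π i).rep m (W i p) (b i) = 0 := by
      intro m
      have h2 := LinearMap.congr_fun hc ⟨psub (mblk m⁻¹) p, psub_isHomogeneous _ hp⟩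
      simpa [f, hW] using h2
    have h3 : ∀ i, ∫ m, (π i).rep m (W i p) (b i) * (π k).rmat m⁻¹ (b k) (b k) ∂dm =
        if i = k then ((π k).dim : ℂ)⁻¹ else 0 := by
      intro i
      have h4 : ∀ m, (π i).rep m (W i p) (b i) * (π k).rmat m⁻¹ (b k) (b k) =
          ∑ j, W i p j * ((π i).rmat m (b i) j * (π k).rmat m⁻¹ (b k) (b k)) := by
        intro m
        rw [← IrrRep.rmat_mulVec, Matrix.mulVec, dotProduct, Finset.sum_mul]
        exact Finset.sum_congr rfl fun j _ => by ring
      simp only [h4]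
      have h5 : ∀ j, Integrable (fun m => W i p j * ((π i).rmat m (b i) j *
          (π k).rmat m⁻¹ (b k) (b k))) dm := fun j =>
        integrable_M dm (continuous_const.mul (((π i).continuous_rmat_apply _ _).mul
          (((π k).continuous_rmat_apply _ _).comp continuous_inv)))
      rw [integral_finsetSum _ fun j _ => h5 j]
      simp only [integral_const_mul]
      by_cases hik : i = k
      · subst hik
        simp only [(π i).integral_rmat_self dm, hpk, if_true]
        rw [Finset.sum_eq_single (b i)] <;> simp +contextual
      · rw [if_neg hik]
        refine Finset.sum_eq_zero fun j _ => ?_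
        rw [(π k).integral_rmat_of_not_equiv (π i) dm (hne k i (Ne.symm hik)), mul_zero]
    have h6 : ∫ m, (∑ i, c i * (π i).rep m (W i p) (b i)) * (π k).rmat m⁻¹ (b k) (b k) ∂dm = 0 := by
      simp [h1]
    simp only [Finset.sum_mul, mul_assoc] at h6
    have h7 : ∀ i, Integrable (fun m => c i * ((π i).rep m (W i p) (b i) *
        (π k).rmat m⁻¹ (b k) (b k))) dm := fun i =>
      integrable_M dm (continuous_const.mul (((continuous_apply _).comp ((π i).cont _)).mul
        (((π k).continuous_rmat_apply _ _).comp continuous_inv)))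
    rw [integral_finsetSum _ fun i _ => h7 i] at h6
    simp only [integral_const_mul, h3, mul_ite, mul_zero, Finset.sum_ite_eq', Finset.mem_univ,
      if_true] at h6
    exact (mul_eq_zero.1 h6).resolve_right (inv_ne_zero (Nat.cast_ne_zero.2 (π k).dim_pos.ne'))
  have h1 := hf.fintype_card_le_finrank
  rw [Subspace.dual_finrank_eq] at h1
  exact h1.trans (finrank_homogeneousSubmodule_le n N)

end RealHyp

namespace RealHyp

open scoped Topology ContDiff Matrix.Norms.Operator Matrix ComplexConjugate

variable {n : ℕ}

section Averages

variable (dm : Measure (M (n + 2))) [dm.IsHaarMeasure] [IsProbabilityMeasure dm]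

/-! ### Averages over `M` -/

/-- The average `∫_M f(m x) c(m) dm`. -/
def avg (c : M (n + 2) → ℂ) (f : SOo (n + 2) → ℂ) : SOo (n + 2) → ℂ :=
  fun x => ∫ m : M (n + 2), f ((m : SOo (n + 2)) * x) * c m ∂dm

variable {c : M (n + 2) → ℂ} {f f' : SOo (n + 2) → ℂ}

lemma isSmooth_avg (hc : Continuous c) (hf : IsSmooth f) : IsSmooth (avg dm c f) := by
  have h := isSmooth_average (μ := dm) hf continuous_subtype_val hc isCompact_univ
  simp only [Measure.restrict_univ] at h
  exact h

lemma lieD_avg (hc : Continuous c) (hf : IsSmooth f) (X : so1 (n + 2)) :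
    lieD X (avg dm c f) = avg dm c (lieD X f) := by
  have h := lieD_average (μ := dm) hf continuous_subtype_val hc isCompact_univ X
  simp only [Measure.restrict_univ] at h
  exact h

lemma integrable_avg (hc : Continuous c) (hf : IsSmooth f) (x : SOo (n + 2)) :
    Integrable (fun m : M (n + 2) => f ((m : SOo (n + 2)) * x) * c m) dm :=
  integrable_M dm ((hf.continuous.comp (continuous_subtype_val.mul continuous_const)).mul hc)

lemma avg_add (hc : Continuous c) (hf : IsSmooth f) (hf' : IsSmooth f') :
    avg dm c (fun g => f g + f' g) = fun g => avg dm c f g + avg dm c f' g := by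
  funext x
  simp only [avg, add_mul]
  exact integral_add (integrable_avg dm hc hf x) (integrable_avg dm hc hf' x)

lemma avg_const_mul (z : ℂ) : avg dm c (fun g => z * f g) = fun g => z * avg dm c f g := by
  funext x
  simp only [avg, mul_assoc]
  exact integral_const_mul _ _

lemma avg_sum {ι : Type} (s : Finset ι) (hc : Continuous c) {F : ι → SOo (n + 2) → ℂ}
    (hF : ∀ i, IsSmooth (F i)) :
    avg dm c (fun g => ∑ i ∈ s, F i g) = fun g => ∑ i ∈ s, avg dm c (F i) g := by
  funext x
  simp only [avg, Finset.sum_mul]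
  exact integral_finsetSum _ fun i _ => integrable_avg dm hc (hF i) x

lemma foldr_lieD_avg (hc : Continuous c) (hf : IsSmooth f) (Q : List (so1 (n + 2))) :
    Q.foldr lieD (avg dm c f) = avg dm c (Q.foldr lieD f) ∧ IsSmooth (Q.foldr lieD f) := by
  induction Q with
  | nil => exact ⟨rfl, hf⟩
  | cons X Q ih =>
    rw [List.foldr_cons, List.foldr_cons, ih.1, lieD_avg dm hc ih.2]
    exact ⟨rfl, ih.2.lieD X⟩

end Averages

/-! ### The Casimir operator and averages -/

lemma casimir_eq_sum {l : ℕ} (f : SOo l → ℂ) (g : SOo l) : casimir f g =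
    (((2 * ((l : ℝ) - 1))⁻¹ : ℝ) : ℂ) *
      (∑ j : Fin l, lieD (gen 0 j.succ) (lieD (gen 0 j.succ) f) g +
        ∑ q : Fin l × Fin l, (if q.1 < q.2 then (-1 : ℂ) else 0) *
          lieD (gen q.1.succ q.2.succ) (lieD (gen q.1.succ q.2.succ) f) g) := by
  rw [casimir, Fintype.sum_prod_type]
  congr 1
  rw [sub_eq_add_neg]
  congr 1
  rw [← Finset.sum_neg_distrib]
  refine Finset.sum_congr rfl fun i _ => ?_
  rw [← Finset.sum_neg_distrib]
  refine Finset.sum_congr rfl fun j _ => ?_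
  split_ifs <;> simp

lemma exists_casimir_eq (l : ℕ) : ∃ (κ : Type) (_ : Fintype κ) (Y : κ → so1 l) (z : κ → ℂ),
    ∀ (f : SOo l → ℂ) (g : SOo l), casimir f g = ∑ q, z q * lieD (Y q) (lieD (Y q) f) g := by
  refine ⟨Fin l ⊕ Fin l × Fin l, inferInstance,
    Sum.elim (fun j => gen 0 j.succ) fun q => gen q.1.succ q.2.succ,
    Sum.elim (fun _ => (((2 * ((l : ℝ) - 1))⁻¹ : ℝ) : ℂ))
      fun q => (((2 * ((l : ℝ) - 1))⁻¹ : ℝ) : ℂ) * if q.1 < q.2 then (-1 : ℂ) else 0,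
    fun f g => ?_⟩
  rw [casimir_eq_sum, Fintype.sum_sum_type, mul_add, Finset.mul_sum, Finset.mul_sum]
  simp only [Sum.elim_inl, Sum.elim_inr, mul_assoc]

lemma casimir_average {l : ℕ} {T : Type} [TopologicalSpace T] [MeasurableSpace T]
    [OpensMeasurableSpace T] [SecondCountableTopology T] [T2Space T] {μ : Measure T} [IsFiniteMeasure μ]
    {ι : T → SOo l} {c : T → ℂ} {S : Set T} {f : SOo l → ℂ} (hf : IsSmooth f) (hι : Continuous ι)
    (hc : Continuous c) (hS : IsCompact S) (x : SOo l) :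
    casimir (fun x => ∫ t in S, f (ι t * x) * c t ∂μ) x = ∫ t in S, casimir f (ι t * x) * c t ∂μ := by
  obtain ⟨κ, _, Y, z, h⟩ := exists_casimir_eq l
  simp only [h]
  have h1 : ∀ q, Integrable (fun t => z q * lieD (Y q) (lieD (Y q) f) (ι t * x) * c t) (μ.restrict S) :=
    fun q => by
      have h2 : Continuous fun t => z q * lieD (Y q) (lieD (Y q) f) (ι t * x) * c t :=
        (continuous_const.mul (((hf.lieD (Y q)).lieD (Y q)).continuous.comp
          (hι.mul continuous_const))).mul hc
      exact h2.continuousOn.integrableOn_compact hS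
  simp only [Finset.sum_mul]
  rw [integral_finsetSum _ fun q _ => h1 q]
  refine Finset.sum_congr rfl fun q _ => ?_
  rw [lieD_average hf hι hc hS, lieD_average (hf.lieD _) hι hc hS, ← integral_const_mul]
  simp only [mul_assoc]

section Components

variable (dm : Measure (M (n + 2))) [dm.IsHaarMeasure] [IsProbabilityMeasure dm]

variable {c : M (n + 2) → ℂ} {f f' : SOo (n + 2) → ℂ}

lemma casimir_avg (hc : Continuous c) (hf : IsSmooth f) :
    casimir (avg dm c f) = avg dm c (casimir f) := by
  funext x
  have h := casimir_average (μ := dm) hf continuous_subtype_val hc isCompact_univ x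
  simp only [Measure.restrict_univ] at h
  exact h

/-! ### The components of a function -/

variable (π : IrrRep (n + 2))

lemma comp_eq_avg (f : SOo (n + 2) → ℂ) :
    comp dm π f = avg dm (fun m => π.rep.character m⁻¹ * π.dim) f := by
  funext x
  rw [comp, charConv, avg, ← integral_const_mul]
  congr 1
  funext m
  ring

lemma continuous_comp_weight : Continuous fun m => π.rep.character m⁻¹ * (π.dim : ℂ) :=
  (π.continuous_character.comp continuous_inv).mul continuous_const

lemma continuous_rmat_inv (i j : Fin π.dim) : Continuous fun m => π.rmat m⁻¹ i j :=
  (π.continuous_rmat_apply i j).comp continuous_inv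

lemma piProj_apply (f : SOo (n + 2) → ℂ) (x : SOo (n + 2)) (i j : Fin π.dim) :
    piProj dm π f x i j = (π.dim : ℂ) * avg dm (fun m => π.rmat m⁻¹ i j) f x := rfl

lemma comp_eq_trace (hf : IsSmooth f) (x : SOo (n + 2)) :
    comp dm π f x = (piProj dm π f x).trace := by
  simp only [Matrix.trace, Matrix.diag_apply, piProj_apply, ← Finset.mul_sum, avg]
  rw [comp, charConv, ← integral_finsetSum _ fun i _ =>
    integrable_avg dm (continuous_rmat_inv π i i) hf x]
  congr 2
  funext m
  rw [π.character_eq, Matrix.trace, Finset.mul_sum]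
  rfl

lemma piProj_mul_left (hf : IsSmooth f) (h : M (n + 2)) (x : SOo (n + 2)) :
    piProj dm π f ((h : SOo (n + 2)) * x) = π.rmat h * piProj dm π f x := by
  ext i j
  rw [Matrix.mul_apply]
  simp only [piProj_apply, avg]
  have h1 : ∀ m : M (n + 2), f ((m : SOo (n + 2)) * ((h : SOo (n + 2)) * x)) * π.rmat m⁻¹ i j =
      f (((m * h : M (n + 2)) : SOo (n + 2)) * x) * π.rmat (h * (m * h)⁻¹) i j := by
    intro m
    rw [mul_inv_rev, mul_inv_cancel_left, Subgroup.coe_mul, mul_assoc]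
  simp only [h1]
  rw [integral_M_mul_right dm (fun m : M (n + 2) => f ((m : SOo (n + 2)) * x) * π.rmat (h * m⁻¹) i j) h]
  have h2 : ∀ m : M (n + 2), f ((m : SOo (n + 2)) * x) * π.rmat (h * m⁻¹) i j =
      ∑ k, π.rmat h i k * (f ((m : SOo (n + 2)) * x) * π.rmat m⁻¹ k j) := by
    intro m
    rw [IrrRep.rmat_mul, Matrix.mul_apply, Finset.mul_sum]
    exact Finset.sum_congr rfl fun k _ => by ring
  simp only [h2]
  rw [integral_finsetSum _ fun k _ => (integrable_avg dm (continuous_rmat_inv π k j) hf x).const_mul _,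
    Finset.mul_sum]
  refine Finset.sum_congr rfl fun k _ => ?_
  rw [integral_const_mul]
  ring

lemma comp_mul_left (hf : IsSmooth f) (h : M (n + 2)) (x : SOo (n + 2)) :
    comp dm π f ((h : SOo (n + 2)) * x) = (π.rmat h * piProj dm π f x).trace := by
  rw [comp_eq_trace dm π hf, piProj_mul_left dm π hf]

lemma piProj_mul_right {k : SOo (n + 2)} (hk : ∀ g, f (g * k) = f g) (x : SOo (n + 2)) :
    piProj dm π f (x * k) = piProj dm π f x := by
  ext i j
  simp only [piProj_apply, avg, ← mul_assoc, hk]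

lemma isSmoothOnX_comp (hf : IsSmoothOnX f) : IsSmoothOnX (comp dm π f) := by
  refine ⟨by rw [comp_eq_avg]; exact isSmooth_avg dm (continuous_comp_weight π) hf.1, fun g k hk => ?_⟩
  rw [comp_eq_trace dm π hf.1, comp_eq_trace dm π hf.1, piProj_mul_right dm π fun g => hf.2 g k hk]

lemma casimir_comp {μ : ℂ} (hf : IsSmooth f) (he : ∀ x, casimir f x = μ * f x) (x : SOo (n + 2)) :
    casimir (comp dm π f) x = μ * comp dm π f x := by
  rw [comp_eq_avg, casimir_avg dm (continuous_comp_weight π) hf,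
    show casimir f = fun x => μ * f x from funext he, avg_const_mul]

/-- The component of `π` vanishes unless `π` is of class one. -/
lemma isClassOne_of_piProj_ne_zero (hf : IsSmoothOnX f) {x : SOo (n + 2)}
    (hx : piProj dm π f x ≠ 0) : IsClassOne π := by
  obtain ⟨j, hj⟩ : ∃ j, (fun i => piProj dm π f x i j) ≠ 0 := by
    by_contra hcon
    push Not at hcon
    exact hx (Matrix.ext fun i j => congrFun (hcon j) i)
  refine ⟨fun i => mat x (mid i) 0, _, hj, fun h hh => ?_⟩
  have h1 := conj_mem_K hh
  have h2 : piProj dm π f ((h : SOo (n + 2)) * x) = piProj dm π f x := by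
    rw [show (h : SOo (n + 2)) * x = x * (x⁻¹ * h * x) by group]
    exact piProj_mul_right dm π (fun g => hf.2 g _ h1) x
  rw [piProj_mul_left dm π hf.1] at h2
  rw [← IrrRep.rmat_mulVec]
  funext i
  exact congrFun (congrFun h2 i) j

lemma comp_eq_zero_of_not_isClassOne (hf : IsSmoothOnX f) (hπ : ¬ IsClassOne π) :
    comp dm π f = fun _ => 0 := by
  funext x
  rw [comp_eq_trace dm π hf.1]
  have : piProj dm π f x = 0 := by
    by_contra hx
    exact hπ (isClassOne_of_piProj_ne_zero dm π hf hx)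
  rw [this, Matrix.trace_zero]

variable {π} {N : ℕ}

/-- Replacing `exp(sZ) m` by `m` in the average turns `π(m⁻¹)` into `π(m⁻¹) π(exp sZ)`. The
derivative is taken before averaging, so `π(Z)` stands on the right of `f^π`. -/
lemma HasLevel.piProj_leftD (h : HasLevel π N) (hf : IsSmooth f) (Z : mLie (n + 2)) (x : SOo (n + 2)) :
    piProj dm π (leftD Z f) x = piProj dm π f x * drmat π Z := by
  ext i j
  have hι : Continuous (Subtype.val : M (n + 2) → SOo (n + 2)) := continuous_subtype_val
  have hc := continuous_rmat_inv π i j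
  have h1 := hasDerivAt_integral_translate (μ := dm) hf hι hc isCompact_univ
    (contDiff_mat_expG (Z : so1 (n + 2))) (ψ' := fun _ => x) contDiff_const 0
  simp only [Measure.restrict_univ] at h1
  have h2 : ∀ s : ℝ, ∫ m : M (n + 2), f (expG (s • (Z : so1 (n + 2))) * (m : SOo (n + 2)) * x) * π.rmat m⁻¹ i j ∂dm =
      ∑ k, avg dm (fun m => π.rmat m⁻¹ i k) f x * π.rmat (expM (s • Z)) k j := by
    intro s
    have h3 : ∀ m : M (n + 2), f (expG (s • (Z : so1 (n + 2))) * (m : SOo (n + 2)) * x) * π.rmat m⁻¹ i j =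
        f (((expM (s • Z) * m : M (n + 2)) : SOo (n + 2)) * x) * π.rmat ((expM (s • Z) * m)⁻¹ * expM (s • Z)) i j := by
      intro m
      rw [mul_inv_rev, inv_mul_cancel_right]
      rfl
    simp only [h3]
    rw [integral_M_mul_left dm (fun m : M (n + 2) =>
      f ((m : SOo (n + 2)) * x) * π.rmat (m⁻¹ * expM (s • Z)) i j)]
    have h4 : ∀ m : M (n + 2), f ((m : SOo (n + 2)) * x) * π.rmat (m⁻¹ * expM (s • Z)) i j =
        ∑ k, f ((m : SOo (n + 2)) * x) * π.rmat m⁻¹ i k * π.rmat (expM (s • Z)) k j := by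
      intro m
      rw [IrrRep.rmat_mul, Matrix.mul_apply, Finset.mul_sum]
      exact Finset.sum_congr rfl fun k _ => by ring
    simp only [h4]
    rw [integral_finsetSum _ fun k _ => (integrable_avg dm (continuous_rmat_inv π i k) hf x).mul_const _]
    exact Finset.sum_congr rfl fun k _ => integral_mul_const _ _
  simp only [h2] at h1
  have h5 : HasDerivAt (fun s : ℝ => ∑ k, avg dm (fun m => π.rmat m⁻¹ i k) f x * π.rmat (expM (s • Z)) k j)
      (∑ k, avg dm (fun m => π.rmat m⁻¹ i k) f x * drmat π Z k j) 0 := by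
    have h6 := HasDerivAt.sum (u := Finset.univ) fun k _ =>
      (h.hasDerivAt_rmat Z k j 0).const_mul (avg dm (fun m => π.rmat m⁻¹ i k) f x)
    rw [show (0 : ℝ) • Z = 0 from zero_smul ℝ Z, expM_zero, IrrRep.rmat_one, Matrix.one_mul] at h6
    convert! h6 using 1
    funext s
    simp
  have h7 := h1.unique h5
  rw [Matrix.mul_apply]
  simp only [piProj_apply, mul_assoc, ← Finset.mul_sum]
  rw [← h7, avg]
  congr 2
  funext m
  simp only [leftD, mul_assoc]

/-- The operator `1 - ½ ∑_{i,j} Z_ij²`, `Z_ij` the infinitesimal rotations, from the left. -/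
def ellip (f : SOo (n + 2) → ℂ) : SOo (n + 2) → ℂ := fun x =>
  f x + (-2⁻¹ : ℂ) * ∑ q : Fin (n + 1) × Fin (n + 1),
    leftD (rot q.1 q.2 : mLie (n + 2)) (leftD (rot q.1 q.2 : mLie (n + 2)) f) x

lemma IsSmooth.ellip (hf : IsSmooth f) : IsSmooth (ellip f) :=
  hf.add (IsSmooth.const_mul (IsSmooth.sum fun _ _ => (hf.leftD _).leftD _) _)

/-- The factor `½` in `ellip` compensates for the ordered pairs of indices. The summand `1` keeps
the eigenvalue away from zero when `N = 0`. -/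
lemma HasLevel.piProj_ellip (h : HasLevel π N) (hf : IsSmooth f) (x : SOo (n + 2)) :
    piProj dm π (ellip f) x = (1 + (N : ℂ) * (N + n - 1)) • piProj dm π f x := by
  have hs : ∀ q : Fin (n + 1) × Fin (n + 1), IsSmooth (leftD (rot q.1 q.2 : mLie (n + 2))
      (leftD (rot q.1 q.2 : mLie (n + 2)) f)) := fun q => (hf.leftD _).leftD _
  have h1 : piProj dm π (ellip f) x = piProj dm π f x + (-2⁻¹ : ℂ) • ∑ q : Fin (n + 1) × Fin (n + 1),
      piProj dm π (leftD (rot q.1 q.2 : mLie (n + 2)) (leftD (rot q.1 q.2 : mLie (n + 2)) f)) x := by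
    ext i j
    rw [Matrix.add_apply, Matrix.smul_apply, Matrix.sum_apply]
    simp only [piProj_apply, ← Finset.mul_sum, smul_eq_mul]
    unfold RealHyp.ellip
    rw [avg_add dm (continuous_rmat_inv π i j) hf ((IsSmooth.sum fun q _ => hs q).const_mul _),
      avg_const_mul, avg_sum dm _ (continuous_rmat_inv π i j) hs]
    ring
  rw [h1]
  simp only [h.piProj_leftD dm (hf.leftD _), h.piProj_leftD dm hf, mul_assoc, ← Finset.mul_sum]
  rw [Fintype.sum_prod_type, h.sum_drmat_rot_sq, Matrix.mul_smul, Matrix.mul_one, smul_smul, add_smul,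
    one_smul]
  congr 2
  ring

lemma HasLevel.comp_ellip_iterate (h : HasLevel π N) (hf : IsSmooth f) (k : ℕ) :
    IsSmooth (ellip^[k] f) ∧
    comp dm π (ellip^[k] f) = fun x => (1 + (N : ℂ) * (N + n - 1)) ^ k * comp dm π f x := by
  induction k with
  | zero => exact ⟨hf, by simp⟩
  | succ k ih =>
    rw [Function.iterate_succ_apply']
    refine ⟨ih.1.ellip, ?_⟩
    funext x
    rw [comp_eq_trace dm π ih.1.ellip, h.piProj_ellip dm ih.1, Matrix.trace_smul,
      ← comp_eq_trace dm π ih.1, ih.2, smul_eq_mul, pow_succ]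
    ring

end Components

end RealHyp

namespace RealHyp

open scoped Topology ContDiff Matrix.Norms.Operator Matrix ComplexConjugate

variable {n : ℕ}

section Decomposition

variable (dm : Measure (M (n + 2))) [dm.IsHaarMeasure] [IsProbabilityMeasure dm]

/-! ### The isotypic type of a component -/

/-- Burnside's theorem by orthogonality: integrating a functional that vanishes on all `π(m⁻¹)`
against the matrix coefficients of `π` shows that it vanishes on every elementary matrix. -/
lemma IrrRep.span_rmat (π : IrrRep (n + 2)) : Submodule.span ℂ (Set.range fun m => π.rmat m⁻¹) = ⊤ := by
  by_contra hne
  obtain ⟨dm, hdm⟩ : ∃ dm : Measure (M (n + 2)), dm.IsHaarMeasure ∧ IsProbabilityMeasure dm :=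
    ⟨Measure.haarMeasure ⊤, inferInstance, ⟨Measure.haarMeasure_self⟩⟩
  have := hdm.1
  have := hdm.2
  obtain ⟨ℓ, hℓ, hker⟩ := Submodule.exists_le_ker_of_lt_top _ (lt_top_iff_ne_top.2 hne)
  apply hℓ
  have h1 : ∀ B : Matrix (Fin π.dim) (Fin π.dim) ℂ, ℓ B = ∑ i, ∑ j, B i j * ℓ (Matrix.single i j 1) := by
    intro B
    conv_lhs => rw [Matrix.matrix_eq_sum_single B]
    simp only [map_sum]
    refine Finset.sum_congr rfl fun i _ => Finset.sum_congr rfl fun j _ => ?_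
    rw [← smul_eq_mul (B i j), ← map_smul, Matrix.smul_single, smul_eq_mul, mul_one]
  have h2 : ∀ m, ℓ (π.rmat m⁻¹) = 0 := fun m => hker (Submodule.subset_span ⟨m, rfl⟩)
  have h3 : ∀ i j, ℓ (Matrix.single i j 1) = 0 := by
    intro k q
    have h4 : ∫ m, π.rmat m q k * ℓ (π.rmat m⁻¹) ∂dm = 0 := by simp [h2]
    have h6 : ∀ m, ℓ (π.rmat m⁻¹) = ∑ i, ∑ j, π.rmat m⁻¹ i j * ℓ (Matrix.single i j 1) := fun m => h1 _
    simp only [h6, Finset.mul_sum] at h4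
    have h5 : ∀ i j, Integrable (fun m => π.rmat m q k * (π.rmat m⁻¹ i j * ℓ (Matrix.single i j 1))) dm :=
      fun i j => integrable_M dm ((π.continuous_rmat_apply q k).mul
        ((continuous_rmat_inv π i j).mul continuous_const))
    rw [integral_finsetSum _ fun i _ => integrable_finsetSum _ fun j _ => h5 i j] at h4
    simp only [integral_finsetSum _ fun j _ => h5 _ j] at h4
    simp only [← mul_assoc, integral_mul_const, π.integral_rmat_self dm] at h4
    rw [Finset.sum_eq_single k (by intro i _ hi; simp [Ne.symm hi]) (by simp),
      Finset.sum_eq_single q (by intro i _ hi; simp [Ne.symm hi]) (by simp)] at h4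
    simpa [π.dim_pos.ne'] using h4
  refine LinearMap.ext fun B => ?_
  rw [h1]
  simp [h3]

/-- With `A = f^π`, the translates of the component are `Tr(π(m⁻¹) A(x))`, so by Burnside they span
all functions `Tr(B A(x))`. If `N₀` is the space of vectors killed by every `A(x)`, this span is
`V_π* ⊗ (V_π / N₀)`, one copy of the dual for each basis vector of the quotient. -/
lemma isOfType_comp (π : IrrRep (n + 2)) {f : SOo (n + 2) → ℂ} (hf : IsSmooth f) :
    IsOfType (comp dm π f) π.rep.dual := by
  set A := piProj dm π f with hA
  let N₀ : Submodule ℂ (Fin π.dim → ℂ) :=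
    { carrier := {c | ∀ x, A x *ᵥ c = 0}
      zero_mem' := fun x => Matrix.mulVec_zero _
      add_mem' := fun {c c'} h h' x => by rw [Matrix.mulVec_add, h, h', add_zero]
      smul_mem' := fun z c h x => by rw [Matrix.mulVec_smul, h, smul_zero] }
  let b := Module.finBasis ℂ ((Fin π.dim → ℂ) ⧸ N₀)
  choose c hc using fun a => Submodule.mkQ_surjective N₀ (b a)
  let Φ : (Fin (Module.finrank ℂ ((Fin π.dim → ℂ) ⧸ N₀)) → Module.Dual ℂ (Fin π.dim → ℂ)) →ₗ[ℂ] (SOo (n + 2) → ℂ) :=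
    { toFun := fun ξ x => ∑ a, ξ a (A x *ᵥ c a)
      map_add' := fun ξ η => by
        funext x
        simp [Finset.sum_add_distrib]
      map_smul' := fun z ξ => by
        funext x
        simp [Finset.mul_sum] }
  have hΦ : ∀ ξ x, Φ ξ x = ∑ a, ξ a (A x *ᵥ c a) := fun _ _ => rfl
  let T : Matrix (Fin π.dim) (Fin π.dim) ℂ →ₗ[ℂ] (SOo (n + 2) → ℂ) :=
    { toFun := fun B x => (B * A x).trace
      map_add' := fun B B' => by
        funext x
        simp [Matrix.add_mul]
      map_smul' := fun z B => by
        funext x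
        simp }
  have hAm : ∀ (m : M (n + 2)) x, A ((m : SOo (n + 2))⁻¹ * x) = π.rmat m⁻¹ * A x := fun m x =>
    piProj_mul_left dm π hf m⁻¹ x
  have hT : LinearMap.range T =
      Submodule.span ℂ (Set.range fun (m : M (n + 2)) (x : SOo (n + 2)) => comp dm π f ((m : SOo (n + 2))⁻¹ * x)) := by
    rw [LinearMap.range_eq_map, ← π.span_rmat, Submodule.map_span, ← Set.range_comp]
    congr 2
    funext m x
    exact (comp_mul_left dm π hf m⁻¹ x).symm
  have hdec : ∀ v : Fin π.dim → ℂ, v - ∑ a, b.repr (N₀.mkQ v) a • c a ∈ N₀ := by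
    intro v
    refine (Submodule.Quotient.mk_eq_zero N₀).1 ?_
    change N₀.mkQ _ = 0
    rw [map_sub, map_sum]
    simp only [map_smul, hc]
    rw [b.sum_repr, sub_self]
  refine ⟨_, Φ, ?_, ?_, ?_⟩
  · rw [← LinearMap.ker_eq_bot, LinearMap.ker_eq_bot']
    intro ξ hξ
    have h1 : ∀ (x) (B : Matrix (Fin π.dim) (Fin π.dim) ℂ), ∑ a, ξ a (B *ᵥ (A x *ᵥ c a)) = 0 := by
      intro x B
      have hB : B ∈ Submodule.span ℂ (Set.range fun m => π.rmat m⁻¹) := by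
        rw [π.span_rmat]; trivial
      induction hB using Submodule.span_induction with
      | mem B hB =>
        obtain ⟨m, rfl⟩ := hB
        have := congrFun hξ ((m : SOo (n + 2))⁻¹ * x)
        rw [hΦ] at this
        simpa only [hAm, ← Matrix.mulVec_mulVec, Pi.zero_apply] using this
      | zero => simp
      | add B B' _ _ h h' => simp only [Matrix.add_mulVec, map_add, Finset.sum_add_distrib, h, h', add_zero]
      | smul z B _ h => simp only [Matrix.smul_mulVec, map_smul, ← Finset.smul_sum, h, smul_zero]
    -- Taking for `B` the rank-one matrices `u e_kᵀ` extracts the `k`-th coordinate of `A x` applied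
    -- to `∑ ξ_a(u) c_a`. This vector therefore lies in `N₀`, and independence of the `c_a` modulo
    -- `N₀` gives `ξ = 0`.
    have h2 : ∀ u : Fin π.dim → ℂ, ∑ a, ξ a u • c a ∈ N₀ := by
      intro u x
      funext k
      have h3 := h1 x (Matrix.vecMulVec u (Pi.single k 1))
      have h4 : ∀ a, Matrix.vecMulVec u (Pi.single k 1) *ᵥ (A x *ᵥ c a) = ((A x *ᵥ c a) k) • u := by
        intro a
        funext i
        simp [Matrix.mulVec, dotProduct, Matrix.vecMulVec_apply, Pi.single_apply, mul_comm]
      simp only [h4, map_smul, smul_eq_mul] at h3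
      rw [Matrix.mulVec_sum, Finset.sum_apply, Pi.zero_apply, ← h3]
      refine Finset.sum_congr rfl fun a _ => ?_
      rw [Matrix.mulVec_smul, Pi.smul_apply, smul_eq_mul, mul_comm]
    funext a
    refine LinearMap.ext fun u => ?_
    have h3 : N₀.mkQ (∑ a, ξ a u • c a) = 0 := (Submodule.Quotient.mk_eq_zero N₀).2 (h2 u)
    rw [map_sum] at h3
    simp only [map_smul, hc] at h3
    exact Fintype.linearIndependent_iff.1 b.linearIndependent _ h3 a
  · rw [← hT]
    apply le_antisymm
    · rintro _ ⟨ξ, rfl⟩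
      refine ⟨∑ a, Matrix.vecMulVec (c a) (fun k => ξ a (Pi.single k 1)), ?_⟩
      funext x
      change ((∑ a, Matrix.vecMulVec (c a) (fun k => ξ a (Pi.single k 1))) * A x).trace = _
      rw [Finset.sum_mul, Matrix.trace_sum, hΦ]
      refine Finset.sum_congr rfl fun a _ => ?_
      rw [Matrix.trace_mul_comm, Matrix.mul_vecMulVec, Matrix.trace_vecMulVec]
      conv_rhs => rw [pi_eq_sum_univ' (A x *ᵥ c a)]
      simp [dotProduct]
    · rintro _ ⟨B, rfl⟩
      refine ⟨fun a => ∑ i, b.repr (N₀.mkQ (B *ᵥ Pi.single i 1)) a • LinearMap.proj i, ?_⟩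
      funext x
      rw [hΦ]
      change _ = (B * A x).trace
      rw [Matrix.trace_mul_comm, Matrix.trace]
      simp only [LinearMap.sum_apply, LinearMap.smul_apply]
      rw [Finset.sum_comm]
      refine Finset.sum_congr rfl fun i _ => ?_
      have h1 := congrFun (hdec (B *ᵥ Pi.single i 1) x) i
      rw [Matrix.mulVec_sub, Matrix.mulVec_sum, Pi.sub_apply, Pi.zero_apply, sub_eq_zero,
        Matrix.mulVec_mulVec, Finset.sum_apply] at h1
      simp only [Matrix.mulVec_smul, Pi.smul_apply] at h1
      refine Eq.trans h1.symm ?_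
      simp
  · intro m ξ
    funext x
    rw [hΦ, hΦ]
    refine Finset.sum_congr rfl fun a _ => ?_
    rw [Representation.dual_apply, hAm, ← Matrix.mulVec_mulVec, IrrRep.rmat_mulVec]
    rfl

/-! ### Absolute convergence -/

/-- `1 + N(N-1) - (N+1)²/4 = 3(N-1)²/4 ≥ 0`. -/
lemma level_bound (n N : ℕ) : (N + 1 : ℝ) ^ 2 / 4 ≤ ‖(1 + (N : ℂ) * (N + n - 1))‖ := by
  have h1 : (1 + (N : ℂ) * (N + n - 1)) = ((1 + (N : ℝ) * (N + n - 1) : ℝ) : ℂ) := by push_cast; ring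
  rw [h1, Complex.norm_real, Real.norm_eq_abs]
  refine le_trans ?_ (le_abs_self _)
  have h2 : (0 : ℝ) ≤ N * n := by positivity
  nlinarith [sq_nonneg ((N : ℝ) - 1)]

lemma norm_avg_le {c : M (n + 2) → ℂ} {f : SOo (n + 2) → ℂ} {x : SOo (n + 2)} {R S : ℝ}
    (hf : ∀ m : M (n + 2), ‖f ((m : SOo (n + 2)) * x)‖ ≤ R) (hc : ∀ m, ‖c m‖ ≤ S) :
    ‖avg dm c f x‖ ≤ R * S := by
  refine (norm_integral_le_of_norm_le_const (C := R * S)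
    (Filter.Eventually.of_forall fun m => ?_)).trans (by simp)
  rw [norm_mul]
  exact mul_le_mul (hf m) (hc m) (norm_nonneg _) ((norm_nonneg _).trans (hf m))

/-- Integration by parts: the component of `f` is `z⁻ᵏ` times the component of `ellip^[k] f`, where
`z` is the eigenvalue of `ellip`. The remaining weight is at most `dim² ≤ (N+1)^{2(n+1)}`. -/
lemma HasLevel.norm_foldr_comp_le {π : IrrRep (n + 2)} {N : ℕ} (h : HasLevel π N)
    {f : SOo (n + 2) → ℂ} (hf : IsSmooth f) (Q : List (so1 (n + 2))) (k : ℕ) {x : SOo (n + 2)} {R : ℝ}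
    (hR : ∀ m : M (n + 2), ‖Q.foldr lieD (ellip^[k] f) ((m : SOo (n + 2)) * x)‖ ≤ R) :
    ‖Q.foldr lieD (comp dm π f) x‖ ≤ R * ((4 / (N + 1 : ℝ) ^ 2) ^ k * ((N + 1 : ℝ) ^ (n + 1)) ^ 2) := by
  obtain ⟨h1, h2⟩ := h.comp_ellip_iterate dm hf k
  set z : ℂ := (1 + (N : ℂ) * (N + n - 1)) with hz
  have hzn := level_bound n N
  rw [← hz] at hzn
  have hpos : (0 : ℝ) < (N + 1 : ℝ) ^ 2 / 4 := by positivity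
  have hz0 : z ≠ 0 := norm_pos_iff.1 (hpos.trans_le hzn)
  have h3 : comp dm π f = avg dm (fun m => (z ^ k)⁻¹ * (π.rep.character m⁻¹ * π.dim)) (ellip^[k] f) := by
    funext y
    have h4 := congrFun h2 y
    rw [comp_eq_avg, avg] at h4
    simp only [avg, mul_left_comm _ (z ^ k)⁻¹]
    rw [integral_const_mul, h4, inv_mul_cancel_left₀ (pow_ne_zero k hz0)]
  have hc : Continuous fun m => (z ^ k)⁻¹ * (π.rep.character m⁻¹ * π.dim) :=
    continuous_const.mul (continuous_comp_weight π)
  rw [h3, (foldr_lieD_avg dm hc h1 Q).1]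
  refine norm_avg_le dm hR fun m => ?_
  rw [norm_mul, norm_inv, norm_pow, norm_mul, Complex.norm_natCast]
  have hd : (π.dim : ℝ) ≤ (N + 1 : ℝ) ^ (n + 1) := by exact_mod_cast h.dim_le
  have h5 : (‖z‖ ^ k)⁻¹ ≤ (4 / (N + 1 : ℝ) ^ 2) ^ k := by
    rw [← inv_pow]
    refine pow_le_pow_left₀ (by positivity) ?_ k
    rw [← inv_div]
    exact inv_anti₀ hpos hzn
  have h6 : ‖π.rep.character m⁻¹‖ * π.dim ≤ ((N + 1 : ℝ) ^ (n + 1)) ^ 2 := by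
    rw [pow_two]
    exact mul_le_mul ((π.norm_character_le _).trans hd) hd (by positivity) (by positivity)
  exact mul_le_mul h5 h6 (by positivity) (by positivity)

/-- The choice of `k`: there are at most `(N+1)^{n+1}` classes of level `N`, each with weight at
most `(N+1)^{2(n+1)}`. Dividing by `(N+1)^{2k}` with `k = 3(n+1)` leaves `(N+1)^{-3(n+1)}`. -/
lemma summable_level (n k : ℕ) (hk : k = 3 * (n + 1)) (R : ℝ) : Summable fun N : ℕ =>
    (N + 1 : ℝ) ^ (n + 1) * (R * ((4 / (N + 1 : ℝ) ^ 2) ^ k * ((N + 1 : ℝ) ^ (n + 1)) ^ 2)) := by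
  have h1 : Summable fun N : ℕ => R * 4 ^ k * (1 / ((N + 1 : ℕ) : ℝ) ^ (3 * (n + 1))) :=
    ((summable_nat_add_iff (f := fun N : ℕ => 1 / (N : ℝ) ^ (3 * (n + 1))) 1).2
      (Real.summable_one_div_nat_pow.2 (by omega))).mul_left _
  refine h1.congr fun N => ?_
  have h2 : (N + 1 : ℝ) ≠ 0 := by positivity
  rw [hk]
  push_cast
  rw [div_pow]
  generalize (N + 1 : ℝ) = t at h2 ⊢
  field_simp
  ring

lemma compHat_out (f : SOo (n + 2) → ℂ) (π : MHat (n + 2)) :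
    compHat dm f π = comp dm (Quotient.out π) f := by
  conv_lhs => rw [← Quotient.out_eq π]
  rfl

lemma foldr_lieD_zero {l : ℕ} (Q : List (so1 l)) :
    Q.foldr lieD (fun _ : SOo l => (0 : ℂ)) = fun _ => 0 := by
  induction Q with
  | nil => rfl
  | cons X Q ih => rw [List.foldr_cons, ih, lieD_zero_fun]

/-- Classes without a level have zero component. The others are grouped by a chosen level, and the
bound for a class depends only on that level because derivatives of `ellip^[k] f` are bounded on the
compact set `M · S`. -/
lemma exists_summable_bound {f : SOo (n + 2) → ℂ} (hf : IsSmoothOnX f) (Q : List (so1 (n + 2)))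
    {S : Set (SOo (n + 2))} (hS : IsCompact S) : ∃ u : MHat (n + 2) → ℝ, Summable u ∧
      ∀ π, ∀ x ∈ S, ‖Q.foldr lieD (compHat dm f π) x‖ ≤ u π := by
  classical
  set k := 3 * (n + 1) with hk
  have hsm : IsSmooth (ellip^[k] f) := by
    have : ∀ j, IsSmooth (ellip^[j] f) := fun j => by
      induction j with
      | zero => exact hf.1
      | succ j ih => rw [Function.iterate_succ_apply']; exact ih.ellip
    exact this k
  have hgs : IsSmooth (Q.foldr lieD (ellip^[k] f)) := by
    have : ∀ Q : List (so1 (n + 2)), IsSmooth (Q.foldr lieD (ellip^[k] f)) := fun Q => by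
      induction Q with
      | nil => exact hsm
      | cons X Q ih => exact ih.lieD X
    exact this Q
  obtain ⟨R, hR⟩ := ((isCompact_M.mul hS).image hgs.continuous).isBounded.exists_norm_le
  have hR' : ∀ x ∈ S, ∀ m : M (n + 2), ‖Q.foldr lieD (ellip^[k] f) ((m : SOo (n + 2)) * x)‖ ≤ max R 0 :=
    fun x hx m => (hR _ ⟨_, Set.mul_mem_mul m.2 hx, rfl⟩).trans (le_max_left _ _)
  let b : ℕ → ℝ := fun N =>
    max R 0 * ((4 / (N + 1 : ℝ) ^ 2) ^ k * ((N + 1 : ℝ) ^ (n + 1)) ^ 2)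
  have hb : ∀ N, 0 ≤ b N := fun N => by positivity
  let good : MHat (n + 2) → Prop := fun π => ∃ N, HasLevel (Quotient.out π) N
  let lev : MHat (n + 2) → ℕ := fun π => if h : good π then h.choose else 0
  have hlev : ∀ π, good π → HasLevel (Quotient.out π) (lev π) := fun π h => by
    simp only [lev, dif_pos h]
    exact h.choose_spec
  have hsum := summable_level n k hk (max R 0)
  refine ⟨fun π => if good π then b (lev π) else 0, ?_, fun π x hx => ?_⟩
  · refine summable_of_sum_le (c := ∑' N : ℕ, (N + 1 : ℝ) ^ (n + 1) * b N) (fun π => ?_) fun s => ?_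
    · dsimp only
      split_ifs
      · exact hb _
      · exact le_rfl
    rw [← Finset.sum_filter]
    have hmaps : ∀ π ∈ s.filter good, lev π ∈ (s.filter good).image lev := fun π hπ =>
      Finset.mem_image_of_mem _ hπ
    rw [← Finset.sum_fiberwise_of_maps_to hmaps]
    refine le_trans (Finset.sum_le_sum fun N _ => ?_)
      (hsum.sum_le_tsum ((s.filter good).image lev) fun N _ => mul_nonneg (by positivity) (hb N))
    have h1 : ∑ π ∈ (s.filter good).filter fun π => lev π = N, b (lev π) =
        ((s.filter good).filter fun π => lev π = N).card * b N := by
      rw [← nsmul_eq_mul, ← Finset.sum_const]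
      exact Finset.sum_congr rfl fun π hπ => by rw [(Finset.mem_filter.1 hπ).2]
    rw [h1]
    refine mul_le_mul_of_nonneg_right ?_ (hb N)
    have h2 := card_le_of_hasLevel dm (N := N)
      (fun π : ((s.filter good).filter fun π => lev π = N) => Quotient.out (π : MHat (n + 2)))
      (fun π σ hne heq => hne (Subtype.ext (by
        rw [← Quotient.out_eq (π : MHat (n + 2)), ← Quotient.out_eq (σ : MHat (n + 2))]
        exact Quotient.sound heq)))
      (fun π => by
        have h3 := Finset.mem_filter.1 π.2
        have h4 := hlev _ (Finset.mem_filter.1 h3.1).2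
        rwa [h3.2] at h4)
    rw [Fintype.card_coe] at h2
    exact_mod_cast h2
  · rw [compHat_out]
    dsimp only
    by_cases hg : good π
    · rw [if_pos hg]
      exact (hlev π hg).norm_foldr_comp_le dm hf.1 Q k (hR' x hx)
    · rw [if_neg hg]
      have h1 : comp dm (Quotient.out π) f = fun _ => 0 :=
        comp_eq_zero_of_not_isClassOne dm _ hf fun h => hg (exists_hasLevel dm h)
      rw [h1, foldr_lieD_zero, norm_zero]

/-! ### The sum of the components -/

lemma integral_comp_character (π σ : IrrRep (n + 2)) {f : SOo (n + 2) → ℂ} (hf : IsSmooth f)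
    (x : SOo (n + 2)) : (¬ Nonempty (σ.rep.Equiv π.rep) →
      ∫ h : M (n + 2), comp dm π f ((h : SOo (n + 2)) * x) * σ.rep.character h⁻¹ ∂dm = 0) ∧
    ∫ h : M (n + 2), comp dm π f ((h : SOo (n + 2)) * x) * π.rep.character h⁻¹ ∂dm =
      charConv dm π f x := by
  have h1 : ∀ (τ : IrrRep (n + 2)) (h : M (n + 2)),
      comp dm π f ((h : SOo (n + 2)) * x) * τ.rep.character h⁻¹ =
      ∑ i, ∑ j, ∑ k, piProj dm π f x j i * (π.rmat h i j * τ.rmat h⁻¹ k k) := by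
    intro τ h
    rw [comp_mul_left dm π hf, τ.character_eq, Matrix.trace, Matrix.trace, Finset.sum_mul]
    refine Finset.sum_congr rfl fun i _ => ?_
    rw [Matrix.diag_apply, Matrix.mul_apply, Finset.sum_mul]
    refine Finset.sum_congr rfl fun j _ => ?_
    rw [Finset.mul_sum]
    refine Finset.sum_congr rfl fun k _ => ?_
    rw [Matrix.diag_apply]
    ring
  have h2 : ∀ (τ : IrrRep (n + 2)) i j k, Integrable (fun h =>
      piProj dm π f x j i * (π.rmat h i j * τ.rmat h⁻¹ k k)) dm := fun τ i j k =>
    integrable_M dm (continuous_const.mul ((π.continuous_rmat_apply i j).mul (continuous_rmat_inv τ k k)))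
  have h3 : ∀ τ : IrrRep (n + 2),
      ∫ h : M (n + 2), comp dm π f ((h : SOo (n + 2)) * x) * τ.rep.character h⁻¹ ∂dm =
      ∑ i, ∑ j, ∑ k, piProj dm π f x j i * ∫ h, π.rmat h i j * τ.rmat h⁻¹ k k ∂dm := by
    intro τ
    simp only [h1]
    rw [integral_finsetSum _ fun i _ => integrable_finsetSum _ fun j _ =>
      integrable_finsetSum _ fun k _ => h2 τ i j k]
    refine Finset.sum_congr rfl fun i _ => ?_
    rw [integral_finsetSum _ fun j _ => integrable_finsetSum _ fun k _ => h2 τ i j k]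
    refine Finset.sum_congr rfl fun j _ => ?_
    rw [integral_finsetSum _ fun k _ => h2 τ i j k]
    exact Finset.sum_congr rfl fun k _ => integral_const_mul _ _
  constructor
  · intro hne
    rw [h3]
    simp [σ.integral_rmat_of_not_equiv π dm hne]
  · rw [h3]
    simp only [π.integral_rmat_self dm, ite_and, mul_ite, mul_zero, Finset.sum_ite_eq, Finset.mem_univ,
      if_true]
    have h4 : ((π.dim : ℂ)) ≠ 0 := Nat.cast_ne_zero.2 π.dim_pos.ne'
    rw [← Finset.sum_mul]
    have h5 := comp_eq_trace dm π hf x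
    rw [Matrix.trace] at h5
    simp only [Matrix.diag_apply] at h5
    rw [← h5, comp, mul_comm, inv_mul_cancel_left₀ h4]

/-- The bound without derivatives makes the series converge uniformly along the orbit `M x`. The sum
and `f` have the same integrals against all translated characters, so they agree on the orbit, in
particular at `x`. -/
lemma hasSum_compHat {f : SOo (n + 2) → ℂ} (hf : IsSmoothOnX f) (x : SOo (n + 2)) :
    HasSum (fun π : MHat (n + 2) => compHat dm f π x) (f x) := by
  have hcomp : ∀ π : MHat (n + 2), IsSmooth (compHat dm f π) := fun π => by
    rw [compHat_out]
    exact (isSmoothOnX_comp dm _ hf).1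
  have htr : Continuous fun m : M (n + 2) => (m : SOo (n + 2)) * x :=
    continuous_subtype_val.mul continuous_const
  let F : MHat (n + 2) → C(M (n + 2), ℂ) := fun π =>
    ⟨fun m => compHat dm f π ((m : SOo (n + 2)) * x), (hcomp π).continuous.comp htr⟩
  obtain ⟨u, hu, hub⟩ := exists_summable_bound dm hf [] (isCompact_range htr)
  have hF : Summable F := by
    refine Summable.of_norm_bounded hu fun π => ?_
    refine (ContinuousMap.norm_le _ ((norm_nonneg _).trans (hub π _ ⟨1, rfl⟩))).2 fun m => ?_
    exact hub π _ ⟨m, rfl⟩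
  obtain ⟨S, hS⟩ := hF
  let f₀ : C(M (n + 2), ℂ) := ⟨fun m => f ((m : SOo (n + 2)) * x), hf.1.continuous.comp htr⟩
  have hkey : (fun m => f₀ m - S m) = 0 := by
    refine eq_zero_of_character dm (f₀.continuous.sub S.continuous) fun σ k => ?_
    let Λ : C(M (n + 2), ℂ) →L[ℂ] ℂ := LinearMap.mkContinuous
      { toFun := fun g => ∫ h, g (h * k) * σ.rep.character h⁻¹ ∂dm
        map_add' := fun g g' => by
          have hi : ∀ g : C(M (n + 2), ℂ), Integrable (fun h => g (h * k) * σ.rep.character h⁻¹) dm :=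
            fun g => integrable_M dm ((g.continuous.comp (continuous_mul_const k)).mul
              (σ.continuous_character.comp continuous_inv))
          simp only [ContinuousMap.add_apply, add_mul]
          exact integral_add (hi g) (hi g')
        map_smul' := fun z g => by
          simp only [ContinuousMap.smul_apply, smul_eq_mul, mul_assoc, RingHom.id_apply]
          exact integral_const_mul _ _ } σ.dim (fun g => by
        refine (norm_integral_le_of_norm_le_const (C := σ.dim * ‖g‖)
          (Filter.Eventually.of_forall fun m => ?_)).trans (by simp)
        rw [norm_mul, mul_comm]
        exact mul_le_mul (σ.norm_character_le _) (g.norm_coe_le_norm _) (norm_nonneg _) (by positivity))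
    have hΛ : ∀ g, Λ g = ∫ h, g (h * k) * σ.rep.character h⁻¹ ∂dm := fun _ => rfl
    have h1 : HasSum (fun π => Λ (F π)) (Λ S) := hS.mapL Λ
    have h2 : HasSum (fun π => Λ (F π)) (Λ (F ⟦σ⟧)) := by
      refine hasSum_single _ fun π hπ => ?_
      rw [hΛ]
      have h3 := (integral_comp_character dm (Quotient.out π) σ hf.1 ((k : SOo (n + 2)) * x)).1
        (fun he => hπ (by
          rw [← Quotient.out_eq π]
          exact (Quotient.sound he).symm))
      rw [← h3]
      congr 1
      funext h
      simp only [F, ContinuousMap.coe_mk, compHat_out, Subgroup.coe_mul, mul_assoc]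
    have h3 : Λ (F ⟦σ⟧) = Λ f₀ := by
      rw [hΛ, hΛ]
      have h4 := (integral_comp_character dm σ σ hf.1 ((k : SOo (n + 2)) * x)).2
      rw [charConv] at h4
      convert! h4 using 1
      · congr 1
        funext h
        change comp dm σ f _ * _ = _
        rw [Subgroup.coe_mul, mul_assoc]
      · congr 1
        funext h
        simp only [f₀, ContinuousMap.coe_mk, Subgroup.coe_mul, mul_assoc]
    have h4 : Λ (f₀ - S) = 0 := by rw [map_sub, h1.unique h2, h3, sub_self]
    exact h4
  have h1 := hS.mapL (ContinuousMap.evalCLM ℂ (1 : M (n + 2)))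
  have h2 := congrFun hkey 1
  have h3 : f x = S 1 := by
    have := sub_eq_zero.1 h2
    simpa [f₀] using this
  rw [h3]
  convert! h1 using 1
  funext π
  simp [F]

theorem decomposesInto {f : SOo (n + 2) → ℂ} {μ : ℂ} (hf : IsSmoothOnX f)
    (he : ∀ x, casimir f x = μ * f x) : DecomposesInto dm f μ :=
  ⟨hasSum_compHat dm hf, fun Q _ hS => exists_summable_bound dm hf Q hS, fun π =>
    ⟨comp_eq_trace dm π hf.1, isSmoothOnX_comp dm π hf, isOfType_comp dm π hf.1,
      casimir_comp dm π hf.1 he⟩⟩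

end Decomposition

end RealHyp

namespace RealHyp

open scoped Topology ContDiff Matrix.Norms.Operator Matrix ComplexConjugate

variable {n : ℕ}

/-! ### The group `A` -/

lemma exp_mul_of_mul_eq_smul {l : ℕ} {A E : Mat l} {c : ℝ} (h : A * E = c • E) :
    NormedSpace.exp A * E = Real.exp c • E := by
  have h1 : SemiconjBy E (c • (1 : Mat l)) A := by
    rw [SemiconjBy, Matrix.mul_smul, Matrix.mul_one, h]
  have h2 : E * NormedSpace.exp (c • (1 : Mat l)) = NormedSpace.exp A * E := h1.exp_right
  have h3 : NormedSpace.exp (c • (1 : Mat l)) = Real.exp c • (1 : Mat l) := by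
    have := NormedSpace.algebraMap_exp_comm (𝔸 := Mat l) c
    rw [Algebra.algebraMap_eq_smul_one, Algebra.algebraMap_eq_smul_one] at this
    rw [Real.exp_eq_exp_ℝ]
    exact this.symm
  rw [← h2, h3, Matrix.mul_smul, Matrix.mul_one]

/-- `a_t` scales `e_0 ± e_l` by `e^{±t}` and fixes the other basis vectors. -/
lemma mat_a_apply (t : ℝ) (k : Fin (n + 2 + 1)) :
    mat (a t) k 0 = Real.cosh t * (1 : Mat (n + 2)) k 0 + Real.sinh t * (1 : Mat (n + 2)) k (Fin.last _) ∧
    mat (a t) k (Fin.last _) = Real.sinh t * (1 : Mat (n + 2)) k 0 + Real.cosh t * (1 : Mat (n + 2)) k (Fin.last _) ∧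
    ∀ i, mat (a t) k (mid i) = (1 : Mat (n + 2)) k (mid i) := by
  have key : ∀ (v : Fin (n + 2 + 1) → ℝ) (c : ℝ), (H0 (n + 2) : Mat (n + 2)) *ᵥ v = c • v →
      mat (a t) *ᵥ v = Real.exp (t * c) • v := by
    intro v c h
    have h1 : (t • (H0 (n + 2) : Mat (n + 2))) * Matrix.vecMulVec v (Pi.single (0 : Fin (n + 2 + 1)) 1) =
        (t * c) • Matrix.vecMulVec v (Pi.single (0 : Fin (n + 2 + 1)) 1) := by
      rw [Matrix.smul_mul, Matrix.mul_vecMulVec, h, Matrix.smul_vecMulVec, smul_smul]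
    have h2 := exp_mul_of_mul_eq_smul (l := n + 2) (A := t • (H0 (n + 2) : Mat (n + 2)))
      (E := Matrix.vecMulVec v (Pi.single (0 : Fin (n + 2 + 1)) 1)) h1
    funext k
    have h3 := congrFun (congrFun h2 k) 0
    rw [Matrix.mul_vecMulVec] at h3
    simpa [Matrix.vecMulVec_apply, mat_a] using h3
  have hH : ∀ v : Fin (n + 2 + 1) → ℝ, ((H0 (n + 2) : Mat (n + 2)) *ᵥ v) 0 = v (Fin.last _) ∧
      ((H0 (n + 2) : Mat (n + 2)) *ᵥ v) (Fin.last _) = v 0 ∧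
      ∀ i, ((H0 (n + 2) : Mat (n + 2)) *ᵥ v) (mid i) = 0 := fun v => by
    refine ⟨?_, ?_, fun i => ?_⟩ <;>
    simp [Matrix.mulVec, dotProduct, sum_index, H0, gen_apply]
  have h1 := congrFun (key (Pi.single 0 1 + Pi.single (Fin.last _) 1) 1 (by
    funext k
    revert k
    refine index_cases ?_ ?_ fun i => ?_
    · rw [(hH _).1]; simp
    · rw [(hH _).2.1]; simp
    · rw [(hH _).2.2 i]; simp)) k
  have h2 := congrFun (key (Pi.single 0 1 - Pi.single (Fin.last _) 1) (-1) (by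
    funext k
    revert k
    refine index_cases ?_ ?_ fun i => ?_
    · rw [(hH _).1]; simp
    · rw [(hH _).2.1]; simp
    · rw [(hH _).2.2 i]; simp)) k
  have h3 : ∀ i : Fin (n + 1), _ := fun i => congrFun (key (Pi.single (mid i) 1) 0 (by
    funext k
    revert k
    refine index_cases ?_ ?_ fun j => ?_
    · rw [(hH _).1]; simp
    · rw [(hH _).2.1]; simp
    · rw [(hH _).2.2 j]; simp)) k
  simp only [Matrix.mulVec_add, Matrix.mulVec_sub, Matrix.mulVec_single_one, Pi.add_apply, Pi.sub_apply,
    Matrix.col_apply, Pi.smul_apply, smul_eq_mul, mul_one, mul_neg, mul_zero, Real.exp_zero, one_mul,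
    Pi.single_apply] at h1 h2 h3
  simp only [Matrix.one_apply, Real.cosh_eq, Real.sinh_eq]
  refine ⟨?_, ?_, h3⟩ <;> linarith

lemma a_add {l : ℕ} (s t : ℝ) : (a (s + t) : SOo l) = a s * a t := by
  apply mat_injective
  rw [mat_mul, mat_a, mat_a, mat_a, add_smul, Matrix.exp_add_of_commute]
  exact ((Commute.refl (H0 l : Mat l)).smul_left s).smul_right t

lemma a_zero {l : ℕ} : (a 0 : SOo l) = 1 := by rw [a, zero_smul, expG_zero]

lemma M_commute_a (m : M (n + 2)) (t : ℝ) : Commute (a t) (m : SOo (n + 2)) :=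
  Subgroup.mem_centralizer_iff.1 m.2.2 _ ⟨t, rfl⟩

lemma mem_M_of_cols {g : SOo (n + 2)} (h0 : ∀ k, mat g k 0 = (1 : Mat (n + 2)) k 0)
    (hl : ∀ k, mat g k (Fin.last _) = (1 : Mat (n + 2)) k (Fin.last _)) : g ∈ M (n + 2) := by
  have hr : ∀ j, (∀ k, mat g k j = (1 : Mat (n + 2)) k j) → ∀ k, mat g j k = (1 : Mat (n + 2)) j k := by
    intro j hj k
    have e := congrFun (congrFun (mat_preserves g) j) k
    rw [Matrix.mul_apply] at e
    simp only [mul_J_apply, Matrix.transpose_apply, hj, Matrix.one_apply, ite_mul, one_mul, zero_mul,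
      J_apply, Finset.sum_ite_eq', Finset.mem_univ, if_true] at e
    rw [Matrix.one_apply]
    by_cases hjk : j = k
    · subst hjk
      rw [if_pos rfl] at e ⊢
      split_ifs at e <;> linarith
    · rw [if_neg hjk] at e ⊢
      split_ifs at e <;> linarith
  have h0' := hr 0 h0
  have hl' := hr _ hl
  refine ⟨mem_K_of_col h0, Subgroup.mem_centralizer_iff.2 ?_⟩
  rintro _ ⟨t, rfl⟩
  apply mat_injective
  have hc : Commute (mat g) (H0 (n + 2) : Mat (n + 2)) := by
    change mat g * (H0 (n + 2) : Mat (n + 2)) = (H0 (n + 2) : Mat (n + 2)) * mat g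
    apply ext_index <;> intros <;>
      simp [H0_mul_apply, mul_H0_apply, h0, hl, h0', hl']
  exact (commute_exp (X := mat g) (Y := t • (H0 (n + 2) : Mat (n + 2))) (hc.smul_right t)).symm

lemma mat_M_mulVec (m : M (n + 2)) (v : Fin (n + 2 + 1) → ℝ) :
    (mat (m : SOo (n + 2)) *ᵥ v) 0 = v 0 ∧ (mat (m : SOo (n + 2)) *ᵥ v) (Fin.last _) = v (Fin.last _) ∧
    ∀ i, (mat (m : SOo (n + 2)) *ᵥ v) (mid i) = (mblk m *ᵥ fun j => v (mid j)) i := by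
  obtain ⟨h1, h2, h3, h4⟩ := mat_M_corner m
  have h5 := mat_M_mid_zero m
  refine ⟨?_, ?_, fun i => ?_⟩ <;>
    simp [Matrix.mulVec, dotProduct, sum_index, h1, h2, h3, h4, h5, mblk]

/-- `a_t m` multiplies the coordinates `v_0 ± v_l` by `e^{±t}` and acts orthogonally on the others.
An eigenvector with `c² ≠ 1` thus has no middle components, by comparing Euclidean norms. -/
lemma eigenvector_a_mul_M {t c : ℝ} {m : M (n + 2)} {v : Fin (n + 2 + 1) → ℝ}
    (h : mat (a t * (m : SOo (n + 2))) *ᵥ v = c • v) :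
    (Real.exp t - c) * (v 0 + v (Fin.last _)) = 0 ∧ (Real.exp (-t) - c) * (v 0 - v (Fin.last _)) = 0 ∧
    (c ^ 2 ≠ 1 → ∀ i, v (mid i) = 0) := by
  rw [mat_mul, ← Matrix.mulVec_mulVec] at h
  obtain ⟨m0, ml, mm⟩ := mat_M_mulVec m v
  set w := mat (m : SOo (n + 2)) *ᵥ v
  have ha : ∀ k, (mat (a t) *ᵥ w) k = mat (a t) k 0 * v 0 + ∑ i, mat (a t) k (mid i) * w (mid i) +
      mat (a t) k (Fin.last _) * v (Fin.last _) := fun k => by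
    rw [Matrix.mulVec, dotProduct, sum_index, m0, ml]
  have h0 := ha 0
  have hl := ha (Fin.last _)
  have hm : ∀ i, _ := fun i => ha (mid i)
  simp only [h, (mat_a_apply t _).1, (mat_a_apply t _).2.1, (mat_a_apply t _).2.2, Pi.smul_apply,
    smul_eq_mul, Matrix.one_apply] at h0 hl hm
  simp at h0 hl hm
  refine ⟨?_, ?_, fun hc i => ?_⟩
  · rw [← Real.cosh_add_sinh]
    linear_combination (-1 : ℝ) * h0 - hl
  · rw [← Real.cosh_sub_sinh]
    linear_combination (-1 : ℝ) * h0 + hl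
  · have h1 : (mblk m *ᵥ fun j => v (mid j)) = c • fun j => v (mid j) := by
      funext i
      rw [← mm, ← hm]
      rfl
    have h2 := mblk_mulVec_dotProduct m (fun j => v (mid j)) (fun j => v (mid j))
    rw [h1, smul_dotProduct, dotProduct_smul, smul_eq_mul, smul_eq_mul] at h2
    have h3 : (c ^ 2 - 1) * ((fun j => v (mid j)) ⬝ᵥ fun j => v (mid j)) = 0 := by linear_combination h2
    have h4 := (mul_eq_zero.1 h3).resolve_left (sub_ne_zero.2 hc)
    exact congrFun (dotProduct_self_eq_zero.1 h4) i

/-- The elements that commute with `a_L m`, `L > 0`, lie in `A M`. -/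
lemma exists_eq_a_mul_M {L : ℝ} (hL : 0 < L) {m : M (n + 2)} {g : SOo (n + 2)}
    (hg : g * (a L * (m : SOo (n + 2))) = a L * (m : SOo (n + 2)) * g) :
    ∃ (T : ℝ) (m' : M (n + 2)), g = a T * (m' : SOo (n + 2)) := by
  have hE : ∀ (v : Fin (n + 2 + 1) → ℝ) (c : ℝ), mat (a L * (m : SOo (n + 2))) *ᵥ v = c • v →
      mat (a L * (m : SOo (n + 2))) *ᵥ (mat g *ᵥ v) = c • (mat g *ᵥ v) := fun v c h => by
    rw [Matrix.mulVec_mulVec, ← mat_mul, ← hg, mat_mul, ← Matrix.mulVec_mulVec, h, Matrix.mulVec_smul]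
  -- The eigenvalues are `e^{±L}` for `ε = ±1`. Since `g` commutes with `a_L m`, it preserves these
  -- two lightlike eigenlines, hence the plane of `e_0` and `e_l`.
  have hpm : ∀ ε : ℝ, ε ^ 2 = 1 → mat (a L * (m : SOo (n + 2))) *ᵥ
      (Pi.single 0 1 + ε • Pi.single (Fin.last _) 1) =
      (Real.cosh L + ε * Real.sinh L) • (Pi.single 0 1 + ε • Pi.single (Fin.last _) 1) := by
    intro ε hε
    rw [mat_mul, ← Matrix.mulVec_mulVec]
    have h1 : mat (m : SOo (n + 2)) *ᵥ (Pi.single 0 1 + ε • Pi.single (Fin.last _) 1) =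
        Pi.single 0 1 + ε • Pi.single (Fin.last _) 1 := by
      funext k
      have := mat_M_rows m k
      simp only [Matrix.mulVec_add, Matrix.mulVec_smul, Matrix.mulVec_single_one, Pi.add_apply,
        Matrix.col_apply, Pi.smul_apply, smul_eq_mul, this.2.1, this.2.2.2, Matrix.one_apply,
        Pi.single_apply]
    rw [h1]
    funext k
    obtain ⟨h2, h3, -⟩ := mat_a_apply L k
    simp only [Matrix.mulVec_add, Matrix.mulVec_smul, Matrix.mulVec_single_one, Pi.add_apply,
      Matrix.col_apply, Pi.smul_apply, smul_eq_mul, h2, h3, Matrix.one_apply, Pi.single_apply]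
    linear_combination (-(if k = Fin.last (n + 2) then (1 : ℝ) else 0) * Real.sinh L) * hε
  have hexp : Real.exp L ≠ 0 ∧ 1 < Real.exp L ∧ Real.exp (-L) < 1 ∧ 0 < Real.exp (-L) :=
    ⟨(Real.exp_pos L).ne', Real.one_lt_exp_iff.2 hL, by
      rw [Real.exp_lt_one_iff]; linarith, Real.exp_pos _⟩
  have hp := eigenvector_a_mul_M (hE _ _ (hpm 1 (by norm_num)))
  have hm := eigenvector_a_mul_M (hE _ _ (hpm (-1) (by norm_num)))
  rw [one_mul, Real.cosh_add_sinh] at hp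
  rw [neg_one_mul, ← sub_eq_add_neg, Real.cosh_sub_sinh] at hm
  have hcol : ∀ (ε : ℝ) k, (mat g *ᵥ (Pi.single 0 1 + ε • Pi.single (Fin.last _) 1)) k =
      mat g k 0 + ε * mat g k (Fin.last _) := fun ε k => by
    simp only [Matrix.mulVec_add, Matrix.mulVec_smul, Matrix.mulVec_single_one, Pi.add_apply,
      Matrix.col_apply, Pi.smul_apply, smul_eq_mul]
  simp only [hcol] at hp hm
  have hp1 := (mul_eq_zero.1 hp.2.1).resolve_left (by linarith [hexp.2.1, hexp.2.2.1] : _ ≠ (0:ℝ))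
  have hm1 := (mul_eq_zero.1 hm.1).resolve_left (by linarith [hexp.2.1, hexp.2.2.1] : _ ≠ (0:ℝ))
  have hp2 := hp.2.2 (by nlinarith [hexp.2.1])
  have hm2 := hm.2.2 (by nlinarith [hexp.2.2.1, hexp.2.2.2])
  have hJ := congrFun (congrFun (mat_preserves g) 0) 0
  rw [Matrix.mul_apply, sum_index] at hJ
  simp only [mul_J_apply, Matrix.transpose_apply, J_apply] at hJ
  have hmid0 : ∀ i, mat g (mid i) 0 = 0 := fun i => by linarith [hp2 i, hm2 i]
  have hmidl : ∀ i, mat g (mid i) (Fin.last _) = 0 := fun i => by linarith [hp2 i, hm2 i]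
  simp [hmid0] at hJ
  have hpos := mat_zero_zero_pos g
  set x := mat g 0 0 with hx
  set y := mat g (Fin.last _) 0 with hy
  have hlast : mat g (Fin.last _) (Fin.last _) = x ∧ mat g 0 (Fin.last _) = y := by
    constructor <;> linarith
  -- `T` is read off from `g e_0 = cosh T e_0 + sinh T e_l`. The positive entry `g_00` is then the
  -- hyperbolic cosine.
  refine ⟨Real.arsinh y, ⟨a (-Real.arsinh y) * g, ?_⟩, ?_⟩
  · have hs : Real.sinh (-Real.arsinh y) = -y := by rw [Real.sinh_neg, Real.sinh_arsinh]
    have hc : Real.cosh (-Real.arsinh y) = x := by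
      rw [Real.cosh_neg, Real.cosh_arsinh, Real.sqrt_eq_iff_mul_self_eq (by positivity) hpos.le]
      linarith
    have ha := fun k : Fin (n + 2 + 1) => mat_a_apply (-Real.arsinh y) k
    simp only [hs, hc] at ha
    refine mem_M_of_cols (fun k => ?_) fun k => ?_
    · rw [mat_mul, Matrix.mul_apply, sum_index]
      simp only [hmid0, ← hx, ← hy, (ha k).1, (ha k).2.1, mul_zero,
        Finset.sum_const_zero, add_zero]
      linear_combination (-(1 : Mat (n + 2)) k 0) * hJ
    · rw [mat_mul, Matrix.mul_apply, sum_index]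
      simp only [hmidl, hlast.1, hlast.2, (ha k).1, (ha k).2.1, mul_zero,
        Finset.sum_const_zero, add_zero]
      linear_combination (-(1 : Mat (n + 2)) k (Fin.last _)) * hJ
  · change g = a _ * (a _ * g)
    rw [← mul_assoc, ← a_add, add_neg_cancel, a_zero, one_mul]

/-! ### The primitive element -/

lemma eq_zero_of_a_mem_M {s : ℝ} (h : (a s : SOo (n + 2)) ∈ M (n + 2)) : s = 0 := by
  have h1 := (mat_M_corner ⟨a s, h⟩).2.1
  have h2 := (mat_a_apply (n := n) s 0).2.1
  simp only at h1
  rw [h1] at h2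
  simpa [Matrix.one_apply] using h2.symm

lemma a_mul_M_pow (t : ℝ) (m : M (n + 2)) (k : ℕ) :
    (a t * (m : SOo (n + 2))) ^ k = a (k * t) * ((m ^ k : M (n + 2)) : SOo (n + 2)) := by
  rw [(M_commute_a m t).mul_pow, Subgroup.coe_pow]
  congr 1
  induction k with
  | zero => simp [a_zero]
  | succ k ih => rw [pow_succ, ih, ← a_add]; congr 1; push_cast; ring

section Geodesic

variable {Γ : Subgroup (SOo (n + 2))} {γ : SOo (n + 2)} (D : GeodesicData Γ γ)

/-- `α γ₀ α⁻¹` lies in `a_{L₀} M_{m_γ}`. -/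
lemma GeodesicData.exists_cent : ∃ m' : D.cent,
    D.α * D.γ₀ * D.α⁻¹ = a D.L₀ * ((m' : M (n + 2)) : SOo (n + 2)) := by
  set g := D.α * D.γ₀ * D.α⁻¹ with hg
  have hpow : g ^ D.n = a D.L * (D.m : SOo (n + 2)) := by
    rw [hg, conj_pow, ← D.pow_eq, D.conj_eq]
  obtain ⟨T, m', hT⟩ := exists_eq_a_mul_M D.L_pos (m := D.m) (g := g) (by
    rw [← hpow]; exact (Commute.refl g).pow_right D.n)
  rw [hT, a_mul_M_pow] at hpow
  -- Compare `a_{nT} m'^n` with `a_L m_γ`: their quotient lies in `A ∩ M`, which is trivial.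
  have h1 : (a (D.n * T - D.L) : SOo (n + 2)) = ((D.m * (m' ^ D.n)⁻¹ : M (n + 2)) : SOo (n + 2)) := by
    rw [Subgroup.coe_mul, Subgroup.coe_inv, eq_mul_inv_iff_mul_eq, sub_eq_neg_add, a_add, mul_assoc,
      hpow, ← mul_assoc, ← a_add, neg_add_cancel, a_zero, one_mul]
  have h2 : D.n * T - D.L = 0 := eq_zero_of_a_mem_M (n := n) (by rw [h1]; exact SetLike.coe_mem _)
  have hm : m' ^ D.n = D.m := by
    rw [h2, a_zero] at h1
    have h3 : (1 : M (n + 2)) = D.m * (m' ^ D.n)⁻¹ := Subtype.ext h1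
    rw [eq_comm, ← mul_inv_eq_one]
    exact h3.symm
  have hTpos : 0 < T := by
    by_contra hneg
    have : (D.n : ℝ) * T ≤ 0 := mul_nonpos_of_nonneg_of_nonpos (by positivity) (not_lt.1 hneg)
    linarith [D.L_pos]
  -- `L₀` is given through an unrelated conjugation by `β`, but translation length is a conjugation
  -- invariant: `e^T > 1` is an eigenvalue of a conjugate of `a_{L₀} m₀`, whose only eigenvalue
  -- above `1` is `e^{L₀}`.
  have hTL : T = D.L₀ := by
    set h := D.β * D.α⁻¹ with hh
    have hconj : h * g = a D.L₀ * (D.m₀ : SOo (n + 2)) * h := by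
      rw [← D.conj_eq₀, hg, hh]; group
    let e : Fin (n + 2 + 1) → ℝ := Pi.single 0 1 + Pi.single (Fin.last _) 1
    have hge : mat g *ᵥ e = Real.exp T • e := by
      have h3 : mat (m' : SOo (n + 2)) *ᵥ e = e := by
        funext k
        have := mat_M_rows m' k
        simp only [e, Matrix.mulVec_add, Matrix.mulVec_single_one, Pi.add_apply, Matrix.col_apply,
          this.2.1, this.2.2.2, Matrix.one_apply, Pi.single_apply]
      rw [hT, mat_mul, ← Matrix.mulVec_mulVec, h3]
      funext k
      obtain ⟨h4, h5, -⟩ := mat_a_apply T k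
      simp only [e, Matrix.mulVec_add, Matrix.mulVec_single_one, Pi.add_apply, Matrix.col_apply, h4, h5,
        Matrix.one_apply, Pi.single_apply, Pi.smul_apply, smul_eq_mul, ← Real.cosh_add_sinh]
      ring
    have h3 : mat (a D.L₀ * (D.m₀ : SOo (n + 2))) *ᵥ (mat h *ᵥ e) = Real.exp T • (mat h *ᵥ e) := by
      rw [Matrix.mulVec_mulVec, ← mat_mul, ← hconj, mat_mul, ← Matrix.mulVec_mulVec, hge,
        Matrix.mulVec_smul]
    obtain ⟨h4, h5, h6⟩ := eigenvector_a_mul_M h3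
    have hT1 : 1 < Real.exp T := Real.one_lt_exp_iff.2 hTpos
    have hL1 : Real.exp (-D.L₀) < 1 := by
      rw [Real.exp_lt_one_iff]; linarith [D.L₀_pos]
    have h5' := (mul_eq_zero.1 h5).resolve_left (by linarith : _ ≠ (0 : ℝ))
    have h6' := h6 (by nlinarith)
    rcases mul_eq_zero.1 h4 with h7 | h7
    · exact (Real.exp_injective (sub_eq_zero.1 h7)).symm
    · exfalso
      have h8 : mat h *ᵥ e = 0 := by
        funext k
        revert k
        refine index_cases ?_ ?_ fun i => h6' i
        · change (mat h *ᵥ e) 0 = 0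
          linarith
        · change (mat h *ᵥ e) (Fin.last _) = 0
          linarith
      have h9 : e = 0 := by
        have := congrArg (mat h⁻¹ *ᵥ ·) h8
        simpa [Matrix.mulVec_mulVec, mat_inv_mul_mat] using this
      have := congrFun h9 0
      simp [e] at this
  subst hTL
  refine ⟨⟨m', Subgroup.mem_centralizer_singleton_iff.2 ?_⟩, hT⟩
  rw [← hm]
  exact (Commute.refl m').pow_right D.n

end Geodesic

end RealHyp

namespace RealHyp

open scoped Topology ContDiff Matrix.Norms.Operator Matrix ComplexConjugate

variable {n : ℕ}

/-! ### The weights -/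

lemma continuous_a {l : ℕ} : Continuous (a : ℝ → SOo l) :=
  continuous_expG.comp (continuous_id.smul continuous_const)

section Weights

variable {Γ : Subgroup (SOo (n + 2))} {γ : SOo (n + 2)} (D : GeodesicData Γ γ) {φ : SOo (n + 2) → ℂ}
  {μ : ℂ}

/-- Lebesgue measure is restricted to `[0, L₀]` beforehand because the lemmas on averages ask for a
finite measure. The integration set is the same interval, so nothing changes. -/
lemma weightA_eq_average (φ : SOo (n + 2) → ℂ) : weightA D φ = fun x =>
    ∫ t in Set.Icc 0 D.L₀, φ (D.α⁻¹ * a t * x) * (fun _ => (1 : ℂ)) t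
      ∂(volume.restrict (Set.Icc 0 D.L₀)) := by
  funext x
  rw [weightA, intervalIntegral.integral_of_le D.L₀_pos.le, ← integral_Icc_eq_integral_Ioc,
    Measure.restrict_restrict measurableSet_Icc, Set.inter_self]
  simp only [mul_one]

lemma continuous_weightA_curve : Continuous fun t => D.α⁻¹ * (a t : SOo (n + 2)) :=
  continuous_const.mul continuous_a

lemma isSmoothOnX_weightA (hφ : IsSmoothOnX φ) : IsSmoothOnX (weightA D φ) := by
  refine ⟨?_, fun g k hk => ?_⟩
  · rw [weightA_eq_average]
    exact isSmooth_average hφ.1 (continuous_weightA_curve D) continuous_const isCompact_Icc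
  · simp only [weightA, ← mul_assoc, hφ.2 _ k hk]

lemma lieD_weightA (hφ : IsSmooth φ) (X : so1 (n + 2)) :
    lieD X (weightA D φ) = weightA D (lieD X φ) := by
  rw [weightA_eq_average, weightA_eq_average]
  exact lieD_average hφ (continuous_weightA_curve D) continuous_const isCompact_Icc X

lemma casimir_weightA (hφ : IsAutomorphicEigenfunction Γ φ μ) (x : SOo (n + 2)) :
    casimir (weightA D φ) x = μ * weightA D φ x := by
  rw [weightA_eq_average, casimir_average hφ.smooth.1 (continuous_weightA_curve D) continuous_const
    isCompact_Icc]
  simp only [hφ.eigen, mul_assoc]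
  exact integral_const_mul _ _

instance : CompactSpace D.cent :=
  isCompact_iff_compactSpace.1 (Set.isClosed_centralizer {D.m}).isCompact

instance : SecondCountableTopology D.cent :=
  inferInstanceAs (SecondCountableTopology (D.cent : Set (M (n + 2))))

variable (dz : Measure D.cent) [IsProbabilityMeasure dz]

lemma weight_eq_average (φ : SOo (n + 2) → ℂ) : weight D dz φ = fun x =>
    ∫ z in Set.univ, weightA D φ (((z : M (n + 2)) : SOo (n + 2)) * x) * (fun _ => (1 : ℂ)) z ∂dz := by
  funext x
  simp only [weight, weightA, Measure.restrict_univ, mul_one, mul_assoc]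

lemma continuous_cent_val : Continuous fun z : D.cent => ((z : M (n + 2)) : SOo (n + 2)) :=
  continuous_subtype_val.comp continuous_subtype_val

lemma isSmoothOnX_weight (hφ : IsSmoothOnX φ) : IsSmoothOnX (weight D dz φ) := by
  refine ⟨?_, fun g k hk => ?_⟩
  · rw [weight_eq_average]
    exact isSmooth_average (isSmoothOnX_weightA D hφ).1 (continuous_cent_val D) continuous_const
      isCompact_univ
  · simp only [weight, ← mul_assoc, hφ.2 _ k hk]

lemma casimir_weight (hφ : IsAutomorphicEigenfunction Γ φ μ) (x : SOo (n + 2)) :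
    casimir (weight D dz φ) x = μ * weight D dz φ x := by
  rw [weight_eq_average, casimir_average (isSmoothOnX_weightA D hφ.smooth).1 (continuous_cent_val D)
    continuous_const isCompact_univ]
  simp only [casimir_weightA D hφ, mul_assoc]
  exact integral_const_mul _ _

/-- `I` is invariant under left translation by `A`. -/
def IsLeftAInvariant {l : ℕ} (I : SOo l → ℂ) : Prop := ∀ (t : ℝ) (x : SOo l), I (a t * x) = I x

lemma isLeftAInvariant_weightA (hp : IntegrandPeriodic D φ) : IsLeftAInvariant (weightA D φ) := by
  intro s x
  have hper : Function.Periodic (fun t => φ (D.α⁻¹ * a t * x)) D.L₀ := fun t => hp t x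
  have h := hper.intervalIntegral_add_eq s 0
  rw [zero_add] at h
  rw [weightA, weightA, ← h]
  have h2 := intervalIntegral.integral_comp_add_right (a := 0) (b := D.L₀)
    (fun t => φ (D.α⁻¹ * a t * x)) s
  rw [zero_add, add_comm D.L₀ s] at h2
  rw [← h2]
  congr 1
  funext t
  rw [a_add]
  simp only [mul_assoc]

/-- The average of the integrand over `M_{m_γ}` is periodic. -/
lemma cent_average_periodic [dz.IsHaarMeasure] (hφ : IsAutomorphicEigenfunction Γ φ μ) (x : SOo (n + 2)) :
    Function.Periodic (fun t => ∫ z : D.cent, φ (D.α⁻¹ * a t * ((z : M (n + 2)) : SOo (n + 2)) * x) ∂dz)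
      D.L₀ := by
  intro t
  obtain ⟨m', hm'⟩ := D.exists_cent
  -- Since `γ₀ = α⁻¹ a_{L₀} m' α`, left invariance of `φ` under `γ₀` trades the shift by `L₀` for
  -- the rotation `m'`, which the invariance of `dz` then absorbs.
  have h1 : ∀ z : D.cent, φ (D.α⁻¹ * a (t + D.L₀) * (((m' * z : D.cent) : M (n + 2)) : SOo (n + 2)) * x) =
      φ (D.α⁻¹ * a t * ((z : M (n + 2)) : SOo (n + 2)) * x) := by
    intro z
    rw [← hφ.left_inv D.γ₀ D.γ₀_mem (D.α⁻¹ * a t * ((z : M (n + 2)) : SOo (n + 2)) * x)]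
    congr 1
    have h2 : D.γ₀ = D.α⁻¹ * (a D.L₀ * ((m' : M (n + 2)) : SOo (n + 2))) * D.α := by
      rw [← hm']; group
    have h3 := M_commute_a (m' : M (n + 2)) t
    rw [h2, add_comm t, a_add, Subgroup.coe_mul, Subgroup.coe_mul]
    calc D.α⁻¹ * (a D.L₀ * a t) * (((m' : M (n + 2)) : SOo (n + 2)) * ((z : M (n + 2)) : SOo (n + 2))) * x
        = D.α⁻¹ * a D.L₀ * (a t * ((m' : M (n + 2)) : SOo (n + 2))) *
          ((z : M (n + 2)) : SOo (n + 2)) * x := by simp only [mul_assoc]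
      _ = _ := by rw [h3.eq]; group
  change ∫ z : D.cent, φ (D.α⁻¹ * a (t + D.L₀) * ((z : M (n + 2)) : SOo (n + 2)) * x) ∂dz = _
  rw [← integral_mul_left_eq_self _ m']
  exact integral_congr_ae (Filter.Eventually.of_forall h1)

/-- After Fubini the inner average over `M_{m_γ}` is periodic in `t` with period `L₀`. As `a_s`
commutes with `M`, translating by it only shifts the interval of integration. -/
lemma isLeftAInvariant_weight [dz.IsHaarMeasure] (hφ : IsAutomorphicEigenfunction Γ φ μ) :
    IsLeftAInvariant (weight D dz φ) := by
  have hswap : ∀ x, weight D dz φ x = ∫ t in (0 : ℝ)..D.L₀,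
      ∫ z : D.cent, φ (D.α⁻¹ * a t * ((z : M (n + 2)) : SOo (n + 2)) * x) ∂dz := by
    intro x
    have hc : Continuous (Function.uncurry fun (z : D.cent) (t : ℝ) =>
        φ (D.α⁻¹ * a t * ((z : M (n + 2)) : SOo (n + 2)) * x)) := by
      have h1 : Continuous fun q : D.cent × ℝ => D.α⁻¹ * (a q.2 : SOo (n + 2)) :=
        (continuous_weightA_curve D).comp continuous_snd
      have h2 : Continuous fun q : D.cent × ℝ => ((q.1 : M (n + 2)) : SOo (n + 2)) :=
        (continuous_cent_val D).comp continuous_fst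
      have h3 : Continuous fun q : D.cent × ℝ =>
          D.α⁻¹ * a q.2 * ((q.1 : M (n + 2)) : SOo (n + 2)) * x := (h1.mul h2).mul continuous_const
      exact hφ.smooth.1.continuous.comp h3
    simp only [weight, intervalIntegral.integral_of_le D.L₀_pos.le, ← integral_Icc_eq_integral_Ioc]
    rw [integral_integral_swap]
    have hK : IsCompact ((Set.univ : Set D.cent) ×ˢ Set.Icc 0 D.L₀) := isCompact_univ.prod isCompact_Icc
    have h1 := (hc.continuousOn (s := Set.univ ×ˢ Set.Icc 0 D.L₀)).integrableOn_compact
      (μ := dz.prod volume) hK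
    rwa [IntegrableOn, ← Measure.prod_restrict, Measure.restrict_univ] at h1
  intro s x
  have shift : ∀ f : ℝ → ℂ, ∫ t in (0 : ℝ)..D.L₀, f (t + s) = ∫ t in s..s + D.L₀, f t := fun f => by
    rw [intervalIntegral.integral_comp_add_right, zero_add, add_comm]
  have h := (cent_average_periodic D dz hφ x).intervalIntegral_add_eq s 0
  rw [zero_add] at h
  rw [hswap, hswap, ← h]
  rw [← shift]
  congr 1
  funext t
  congr 1
  funext z
  rw [a_add]
  have h3 := M_commute_a (z : M (n + 2)) s
  congr 1
  calc D.α⁻¹ * a t * ((z : M (n + 2)) : SOo (n + 2)) * (a s * x)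
      = D.α⁻¹ * a t * (((z : M (n + 2)) : SOo (n + 2)) * a s) * x := by simp only [mul_assoc]
    _ = _ := by rw [← h3.eq]; simp only [mul_assoc]

lemma isLeftAInvariant_comp (dm : Measure (M (n + 2))) (π : IrrRep (n + 2)) {I : SOo (n + 2) → ℂ}
    (hI : IsLeftAInvariant I) : IsLeftAInvariant (comp dm π I) := by
  intro t x
  simp only [comp, charConv]
  congr 2
  funext m
  rw [← mul_assoc, ← (M_commute_a m t).eq, mul_assoc, hI]

end Weights

/-! ### Closed geodesics on surfaces -/

/-- The middle block has size one, and the determinant forces it to be `1`. -/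
lemma eq_one_of_M_two (m : M (0 + 2)) : m = 1 := by
  apply mat_M_eq_iff.2
  rw [mblk_one]
  have h := mat_det (m : SOo (0 + 2))
  rw [Matrix.det_fin_three] at h
  obtain ⟨h1, h2, h3, h4⟩ := mat_M_corner m
  obtain ⟨h5, h6, h7, h8⟩ := mat_M_mid_zero m 0
  change mat (m : SOo (0 + 2)) 1 0 = 0 at h5
  change mat (m : SOo (0 + 2)) 0 1 = 0 at h6
  change mat (m : SOo (0 + 2)) 0 2 = 0 at h2
  change mat (m : SOo (0 + 2)) 2 2 = 1 at h4
  change mat (m : SOo (0 + 2)) 1 2 = 0 at h7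
  rw [h1, h2, h4, h6, h7] at h
  ext i j
  obtain rfl : i = 0 := Subsingleton.elim (α := Fin 1) i 0
  obtain rfl : j = 0 := Subsingleton.elim (α := Fin 1) j 0
  rw [Matrix.one_apply_eq]
  change mat (m : SOo (0 + 2)) 1 1 = 1
  linarith

/-- Every matrix commutes with a representation of the trivial group, so Schur's lemma leaves only
dimension one. -/
lemma comp_two (dm : Measure (M (0 + 2))) [IsProbabilityMeasure dm] (π : IrrRep (0 + 2))
    (I : SOo (0 + 2) → ℂ) : comp dm π I = I := by
  have hd : π.dim = 1 := by
    have h0 := π.dim_pos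
    by_contra hne
    obtain ⟨c, hc⟩ := π.eq_smul_one_of_commute (B := Matrix.single ⟨0, h0⟩ ⟨0, h0⟩ 1) fun m => by
      rw [eq_one_of_M_two m, π.rmat_one, Matrix.mul_one, Matrix.one_mul]
    have h1 := congrFun (congrFun hc ⟨0, h0⟩) ⟨0, h0⟩
    have h2 := congrFun (congrFun hc ⟨1, by omega⟩) ⟨1, by omega⟩
    simp at h1 h2
    exact one_ne_zero (h1.trans h2.symm)
  funext x
  have hm : ∀ m : M (0 + 2), I ((m : SOo (0 + 2)) * x) * π.rep.character m⁻¹ = I x := fun m => by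
    rw [eq_one_of_M_two m, inv_one, Representation.char_one]
    simp [hd]
  simp only [comp, charConv, hm, hd]
  simp

end RealHyp

namespace RealHyp

open scoped Topology ContDiff Matrix.Norms.Operator Matrix ComplexConjugate

variable {n : ℕ}

/-! ### Sums of squares in orthonormal bases -/

/-- A sum of squares over a basis is unchanged by an orthogonal substitution. It is applied to `∑
Y_i²` over a basis of `𝔫` and, in both indices, to the rotations in `𝔪`. -/
lemma sum_orthogonal_change {ι V W : Type*} [Fintype ι] [DecidableEq ι] [AddCommGroup V] [Module ℝ V]
    [AddCommGroup W] [Module ℝ W] {U : Matrix ι ι ℝ} (hU : U.transpose * U = 1)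
    (B : V →ₗ[ℝ] V →ₗ[ℝ] W) (e : ι → V) :
    ∑ k, B (∑ i, U k i • e i) (∑ i, U k i • e i) = ∑ i, B (e i) (e i) := by
  simp only [map_sum, map_smul, LinearMap.sum_apply, LinearMap.smul_apply, smul_smul, Finset.smul_sum]
  rw [Finset.sum_comm]
  refine Finset.sum_congr rfl fun i _ => ?_
  rw [Finset.sum_comm]
  have h : ∀ j, ∑ k, (U k i * U k j) • B (e j) (e i) = if j = i then B (e j) (e i) else 0 := fun j => by
    rw [← Finset.sum_smul]
    have := congrFun (congrFun hU i) j
    rw [Matrix.mul_apply] at this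
    simp only [Matrix.transpose_apply] at this
    rw [this, Matrix.one_apply, ite_smul, one_smul, zero_smul]
    simp only [eq_comm]
  simp only [h, Finset.sum_ite_eq', Finset.mem_univ, if_true]

/-- The bilinear map `(X, Y) ↦ (X Y f)(g)`. -/
def lieBilin {l : ℕ} {f : SOo l → ℂ} (hf : IsSmooth f) (g : SOo l) : so1 l →ₗ[ℝ] so1 l →ₗ[ℝ] ℂ :=
  LinearMap.mk₂ ℝ (fun X Y => lieD X (lieD Y f) g)
    (fun X X' Y => by rw [lieD_add (hf.lieD Y)])
    (fun c X Y => by rw [lieD_smul (hf.lieD Y), Complex.real_smul])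
    (fun X Y Y' => by rw [lieD_add hf, lieD_fun_add (hf.lieD Y) (hf.lieD Y')])
    (fun c X Y => by rw [lieD_smul hf, lieD_fun_const_mul (hf.lieD Y), Complex.real_smul])

lemma lieBilin_apply {l : ℕ} {f : SOo l → ℂ} (hf : IsSmooth f) (g : SOo l) (X Y : so1 l) :
    lieBilin hf g X Y = lieD X (lieD Y f) g := rfl

/-! ### The Casimir operator on right `K`-invariant functions -/

lemma lieD_eq_zero_of_mem_K {l : ℕ} {f : SOo l → ℂ} (hf : ∀ g : SOo l, ∀ k ∈ K l, f (g * k) = f g)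
    {X : so1 l} (hX : J l * (X : Mat l) = X * J l) : lieD X f = fun _ => 0 := by
  funext g
  have h : ∀ t : ℝ, expG (t • X) ∈ K l := fun t => by
    have h1 : Commute (J l) (t • (X : Mat l)) := Commute.smul_right hX t
    exact commute_exp h1
  simp only [lieD, hf g _ (h _), deriv_const]

lemma gen_commute_J {l : ℕ} {i j : Fin (l + 1)} (hi : i ≠ 0) (hj : j ≠ 0) :
    J l * (gen i j : Mat l) = gen i j * J l := by
  ext p q
  rw [J_mul_apply, mul_J_apply, gen_apply]
  by_cases hp : p = 0 <;> by_cases hq : q = 0 <;> simp [hp, hq, hi, hj]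

lemma rot_last_mid_bracket (j : Fin (n + 1)) : (H0 (n + 2) : Mat (n + 2)) =
    (gen (Fin.last (n + 2)) (mid j) : Mat (n + 2)) * Nm (Pi.single j 1) -
      (Nm (Pi.single j 1) : Mat (n + 2)) * gen (Fin.last (n + 2)) (mid j) := by
  apply ext_index <;> intros <;>
    simp [Matrix.mul_apply, sum_index, gen_apply, H0, Pi.single_apply, eq_comm]
  split_ifs <;> simp

/-- The boost in direction `j` is `Y_j - R_j` with `Y_j ∈ 𝔫` and `R_j ∈ 𝔨`. Since `R_j f = 0`, its
square acts as `Y_j² - R_j Y_j`, and `R_j Y_j f = [R_j, Y_j] f = H_0 f`. The `n + 1` copies of `H_0`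
make up the first-order term. -/
lemma casimir_radial {f : SOo (n + 2) → ℂ} (hf : IsSmoothOnX f) (g : SOo (n + 2)) :
    2 * ((n : ℂ) + 1) * casimir f g = lieD (H0 (n + 2)) (lieD (H0 (n + 2)) f) g -
      (n + 1) * lieD (H0 (n + 2)) f g +
      ∑ i : Fin (n + 1), lieD (Nm (Pi.single i 1)) (lieD (Nm (Pi.single i 1)) f) g := by
  have hn : (n : ℂ) + 1 ≠ 0 := by exact_mod_cast Nat.succ_ne_zero n
  have hrot : ∀ i j : Fin (n + 2), lieD (gen i.succ j.succ) f = fun _ => 0 := fun i j =>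
    lieD_eq_zero_of_mem_K hf.2 (gen_commute_J (Fin.succ_ne_zero _) (Fin.succ_ne_zero _))
  have hboost : ∀ j : Fin (n + 1), lieD (gen 0 (mid j)) (lieD (gen 0 (mid j)) f) g =
      lieD (Nm (Pi.single j 1)) (lieD (Nm (Pi.single j 1)) f) g - lieD (H0 (n + 2)) f g := by
    intro j
    set R : so1 (n + 2) := gen (Fin.last (n + 2)) (mid j) with hR
    set Y : so1 (n + 2) := Nm (Pi.single j 1) with hY
    have hg : gen 0 (mid j) = Y - R := by rw [hY, Nm_single, ← hR, add_sub_cancel_right]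
    have hRf : lieD R f = fun _ => 0 :=
      lieD_eq_zero_of_mem_K hf.2 (gen_commute_J (Fin.last_pos.ne') (mid_ne_zero j))
    have h0 : ∀ X : so1 (n + 2), lieBilin hf.1 g X R = 0 := fun X => by
      rw [lieBilin_apply, hRf, lieD_zero_fun]
    have hc := lieD_comm hf.1 (rot_last_mid_bracket j) g
    rw [← hR, ← hY, hRf, lieD_zero_fun, sub_zero] at hc
    rw [← lieBilin_apply hf.1, hg]
    simp only [map_sub, LinearMap.sub_apply, h0, sub_zero]
    rw [lieBilin_apply, lieBilin_apply, hc]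
  have hsum : ∑ j : Fin (n + 2), lieD (gen 0 j.succ) (lieD (gen 0 j.succ) f) g =
      ∑ j : Fin (n + 1), lieD (gen 0 (mid j)) (lieD (gen 0 (mid j)) f) g +
        lieD (H0 (n + 2)) (lieD (H0 (n + 2)) f) g := by
    rw [Fin.sum_univ_castSucc]
    rfl
  rw [casimir, hsum]
  simp only [hrot, lieD_zero_fun, hboost, Finset.sum_sub_distrib, Finset.sum_const, Finset.card_univ,
    Fintype.card_fin, ite_self]
  push_cast
  simp only [nsmul_eq_mul]
  push_cast
  rw [show (2 : ℂ) * ((n : ℂ) + 2 - 1) = 2 * (n + 1) by ring, mul_inv_cancel_left₀ (by simpa using hn)]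
  ring

/-! ### Frames -/

/-- The element of `𝔪` with matrix `x yᵀ - y xᵀ`. -/
def wedge (x y : Fin (n + 1) → ℝ) : mLie (n + 2) := ∑ i, x i • ∑ j, y j • rot i j

lemma blk_wedge (x y : Fin (n + 1) → ℝ) : blk ((wedge x y : so1 (n + 2)) : Mat (n + 2)) =
    Matrix.vecMulVec x y - Matrix.vecMulVec y x := by
  have h : ∀ i j p q : Fin (n + 1), ((rot i j : so1 (n + 2)) : Mat (n + 2)) (mid p) (mid q) =
      (if i = p ∧ j = q then 1 else 0) - (if j = p ∧ i = q then 1 else 0) := fun i j p q => by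
    have := congrFun (congrFun (blk_rot i j) p) q
    simpa [Matrix.single_apply] using this
  ext p q
  simp only [wedge, blk_apply, Submodule.coe_sum, Submodule.coe_smul, Matrix.sum_apply, Matrix.smul_apply,
    h, smul_eq_mul, mul_sub, Finset.sum_sub_distrib, Finset.mul_sum, Matrix.sub_apply,
    Matrix.vecMulVec_apply]
  congr 1
  · rw [Finset.sum_eq_single p, Finset.sum_eq_single q] <;> simp +contextual
  · rw [Finset.sum_eq_single q, Finset.sum_eq_single p] <;> simp +contextual [mul_comm]

lemma wedge_mulVec (x y v : Fin (n + 1) → ℝ) :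
    blk ((wedge x y : so1 (n + 2)) : Mat (n + 2)) *ᵥ v = (y ⬝ᵥ v) • x - (x ⬝ᵥ v) • y := by
  rw [blk_wedge, Matrix.sub_mulVec]
  funext i
  simp [Matrix.vecMulVec_mulVec]

lemma commute_Nm_iff (Z : mLie (n + 2)) (x : Fin (n + 1) → ℝ) :
    ((Z : so1 (n + 2)) : Mat (n + 2)) * Nm x = (Nm x : Mat (n + 2)) * ((Z : so1 (n + 2)) : Mat (n + 2)) ↔
      blk ((Z : so1 (n + 2)) : Mat (n + 2)) *ᵥ x = 0 := by
  rw [← sub_eq_zero, mLie_Nm]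
  refine ⟨fun h => ?_, fun h => by rw [h, map_zero]; rfl⟩
  funext i
  have := congrFun (congrFun h 0) (mid i)
  rwa [Nm_0m] at this

lemma killing_mLie (Z W : mLie (n + 2)) :
    killing ((Z : so1 (n + 2)) : Mat (n + 2)) ((W : so1 (n + 2)) : Mat (n + 2)) =
      (n + 1) * (blk ((Z : so1 (n + 2)) : Mat (n + 2)) * blk ((W : so1 (n + 2)) : Mat (n + 2))).trace := by
  rw [killing, Matrix.trace, Matrix.trace, sum_index]
  simp only [Matrix.diag_apply, Matrix.mul_apply, sum_index, mLie_0, mLie_l, mLie_0', mLie_l', blk_apply]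
  push_cast
  simp only [mul_zero, Finset.sum_const_zero, add_zero, zero_add]
  ring

lemma killing_self_eq_zero {Z : mLie (n + 2)}
    (h : killing ((Z : so1 (n + 2)) : Mat (n + 2)) ((Z : so1 (n + 2)) : Mat (n + 2)) = 0) : Z = 0 := by
  rw [killing_mLie] at h
  have h1 := (mul_eq_zero.1 h).resolve_left (by positivity)
  set A := blk ((Z : so1 (n + 2)) : Mat (n + 2)) with hA
  have h2 : (A.transpose * A).trace = 0 := by
    rw [hA, blk_transpose_mLie, ← hA, Matrix.neg_mul, Matrix.trace_neg, h1, neg_zero]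
  apply mLie_ext
  rw [← hA]
  have h3 := Matrix.trace_conjTranspose_mul_self_eq_zero_iff (A := A)
  rw [Matrix.conjTranspose_eq_transpose_of_trivial] at h3
  rw [h3.1 h2]
  rfl

section Frame

variable {x : Fin (n + 1) → ℝ} {Z : Fin n → mLie (n + 2)}

/-- The vectors `y_j` with `[Z_j, Nm x] = Nm y_j`. -/
def frameVec (Z : mLie (n + 2)) (x : Fin (n + 1) → ℝ) : Fin (n + 1) → ℝ :=
  blk ((Z : so1 (n + 2)) : Mat (n + 2)) *ᵥ x

lemma frameVec_dotProduct (Z : mLie (n + 2)) (x y : Fin (n + 1) → ℝ) :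
    frameVec Z x ⬝ᵥ y = -(x ⬝ᵥ frameVec Z y) := by
  rw [frameVec, frameVec, Matrix.dotProduct_mulVec, ← Matrix.mulVec_transpose, blk_transpose_mLie,
    Matrix.neg_mulVec, neg_dotProduct, neg_neg]

lemma dotProduct_self_of_Btheta (hx : Btheta (Nm x : Mat (n + 2)) (Nm x) = 1) : 4 * ((n : ℝ) + 1) * (x ⬝ᵥ x) = 1 := by
  rw [← Btheta_Nm, hx]

lemma IsFrame.dotProduct (hZ : IsFrame (l := n + 2) (Nm x) Z) (i j : Fin n) :
    4 * ((n : ℝ) + 1) * (frameVec (Z i) x ⬝ᵥ frameVec (Z j) x) = if i = j then 1 else 0 := by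
  rw [← Btheta_Nm, ← hZ.2 i j, mLie_Nm, mLie_Nm]
  rfl

/-- The elements of a frame are `4 (l - 1) (y_j xᵀ - x y_jᵀ)`. -/
lemma IsFrame.eq_wedge (hx : Btheta (Nm x : Mat (n + 2)) (Nm x) = 1)
    (hZ : IsFrame (l := n + 2) (Nm x) Z) (j : Fin n) : Z j = (4 * ((n : ℝ) + 1)) • wedge (frameVec (Z j) x) x := by
  have hx1 := dotProduct_self_of_Btheta hx
  set y := frameVec (Z j) x with hy
  have hyx : y ⬝ᵥ x = 0 := by
    have h := frameVec_dotProduct (Z j) x x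
    rw [← hy, dotProduct_comm x y] at h
    linarith
  -- `R` kills `x`, so it lies in the centralizer of `Nm x`. Both terms of the difference are
  -- orthogonal to that centralizer, hence `R` is orthogonal to itself, and the form is definite on
  -- `𝔪`.
  set R := Z j - (4 * ((n : ℝ) + 1)) • wedge y x with hR
  have hRx : frameVec R x = 0 := by
    have h1 : frameVec R x = y - (4 * ((n : ℝ) + 1)) • frameVec (wedge y x) x := by
      rw [hy]
      simp only [frameVec]
      rw [← Matrix.smul_mulVec, ← Matrix.sub_mulVec]
      rfl
    rw [h1, frameVec, wedge_mulVec, hyx, zero_smul, sub_zero, smul_smul, hx1, one_smul, sub_self]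
  have hcomm := (commute_Nm_iff R x).2 hRx
  have h1 := hZ.1 j R hcomm
  have h2 : killing ((wedge y x : so1 (n + 2)) : Mat (n + 2)) ((R : so1 (n + 2)) : Mat (n + 2)) = 0 := by
    rw [killing_mLie, blk_wedge, Matrix.sub_mul, Matrix.trace_sub, Matrix.vecMulVec_mul,
      Matrix.vecMulVec_mul, Matrix.trace_vecMulVec, Matrix.trace_vecMulVec]
    rw [dotProduct_comm y, dotProduct_comm x, ← Matrix.dotProduct_mulVec, ← Matrix.dotProduct_mulVec]
    have h3 := frameVec_dotProduct R x y
    rw [hRx, zero_dotProduct] at h3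
    change ((n : ℝ) + 1) * (x ⬝ᵥ frameVec R y - y ⬝ᵥ frameVec R x) = 0
    rw [hRx, dotProduct_zero]
    linear_combination ((n : ℝ) + 1) * h3
  have h3 : killing ((R : so1 (n + 2)) : Mat (n + 2)) ((R : so1 (n + 2)) : Mat (n + 2)) = 0 := by
    have h4 : killing ((R : so1 (n + 2)) : Mat (n + 2)) ((R : so1 (n + 2)) : Mat (n + 2)) =
        killing ((Z j : so1 (n + 2)) : Mat (n + 2)) ((R : so1 (n + 2)) : Mat (n + 2)) -
        (4 * ((n : ℝ) + 1)) * killing ((wedge y x : so1 (n + 2)) : Mat (n + 2)) ((R : so1 (n + 2)) : Mat (n + 2)) := by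
      have h5 : ((R : so1 (n + 2)) : Mat (n + 2)) = ((Z j : so1 (n + 2)) : Mat (n + 2)) -
        (4 * ((n : ℝ) + 1)) • ((wedge y x : so1 (n + 2)) : Mat (n + 2)) := rfl
      simp only [killing]
      conv_lhs => rw [h5, Matrix.sub_mul, Matrix.smul_mul, Matrix.trace_sub, Matrix.trace_smul, ← h5]
      rw [smul_eq_mul]
      ring
    rw [h4, h1, h2, mul_zero, sub_zero]
  exact sub_eq_zero.1 (killing_self_eq_zero h3)

/-- The orthogonal matrix with rows `2√(l-1) x`, `2√(l-1) y_j`. -/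
def frameMatrix (x : Fin (n + 1) → ℝ) (Z : Fin n → mLie (n + 2)) : Matrix (Fin (n + 1)) (Fin (n + 1)) ℝ :=
  Matrix.of (Fin.cons (Real.sqrt (4 * (n + 1)) • x) fun j => Real.sqrt (4 * (n + 1)) • frameVec (Z j) x)

lemma frameMatrix_zero : frameMatrix x Z 0 = Real.sqrt (4 * (n + 1)) • x := rfl

lemma frameMatrix_succ (j : Fin n) :
    frameMatrix x Z j.succ = Real.sqrt (4 * (n + 1)) • frameVec (Z j) x := rfl

lemma IsFrame.frameMatrix_orthogonal (hx : Btheta (Nm x : Mat (n + 2)) (Nm x) = 1)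
    (hZ : IsFrame (l := n + 2) (Nm x) Z) : (frameMatrix x Z).transpose * frameMatrix x Z = 1 := by
  have hs : Real.sqrt (4 * ((n : ℝ) + 1)) * Real.sqrt (4 * (n + 1)) = 4 * (n + 1) :=
    Real.mul_self_sqrt (by positivity)
  have hx1 := dotProduct_self_of_Btheta hx
  have hxy : ∀ j, x ⬝ᵥ frameVec (Z j) x = 0 := fun j => by
    have h := frameVec_dotProduct (Z j) x x
    rw [dotProduct_comm] at h
    linarith
  apply mul_eq_one_comm.1
  ext i j
  change frameMatrix x Z i ⬝ᵥ frameMatrix x Z j = _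
  refine Fin.cases ?_ (fun i => ?_) i <;> refine Fin.cases ?_ (fun j => ?_) j <;>
    simp only [frameMatrix_zero, frameMatrix_succ, smul_dotProduct,
      dotProduct_smul, smul_eq_mul, ← mul_assoc, hs]
  · rw [hx1, Matrix.one_apply_eq]
  · rw [hxy, mul_zero, Matrix.one_apply_ne (Fin.succ_ne_zero _).symm]
  · rw [dotProduct_comm, hxy, mul_zero, Matrix.one_apply_ne (Fin.succ_ne_zero _)]
  · rw [hZ.dotProduct, Matrix.one_apply]
    simp

end Frame

end RealHyp

namespace RealHyp

open scoped Topology ContDiff Matrix.Norms.Operator Matrix ComplexConjugate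

variable {n : ℕ}

/-! ### Vectors fixed by `Z_M(S)` -/

section Fixed

variable {x : Fin (n + 1) → ℝ} {Z : Fin n → mLie (n + 2)} {π : IrrRep (n + 2)} {N : ℕ}

lemma mblk_mulVec_of_commute {m : M (n + 2)}
    (h : (m : SOo (n + 2)) * expG (Nm x) = expG (Nm x) * m) : mblk m *ᵥ x = x := by
  rw [expG_Nm_conj] at h
  have h1 := congrFun (congrFun (congrArg mat (mul_right_cancel h)) 0)
  have h2 : ∀ y : Fin (n + 1) → ℝ, ∀ j, mat (expG (Nm y)) 0 (mid j) = y j := fun y j => by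
    change (NormedSpace.exp (Nm y : Mat (n + 2))) 0 (mid j) = y j
    rw [exp_Nm]
    simp [Matrix.mul_apply, sum_index]
  funext j
  rw [← h2 (mblk m *ᵥ x) j, ← h2 x j, h1]

lemma commute_of_mblk_mulVec {m : M (n + 2)} (h : mblk m *ᵥ x = x) (s : ℝ) :
    (m : SOo (n + 2)) * expG (s • Nm x) = expG (s • Nm x) * m := by
  rw [← map_smul, expG_Nm_conj, Matrix.mulVec_smul, h]

lemma mem_fixedSpace_iff {v : Fin π.dim → ℂ} :
    v ∈ fixedSpace π (Nm x) ↔ ∀ m : M (n + 2), mblk m *ᵥ x = x → π.rep m v = v := by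
  refine ⟨fun h m hm => h m (commute_of_mblk_mulVec hm), fun h m hm => h m (mblk_mulVec_of_commute ?_)⟩
  have := hm 1
  rwa [one_smul] at this

lemma zero_mem_fixedSpace : (0 : Fin π.dim → ℂ) ∈ fixedSpace π (Nm x) := fun _ _ => map_zero _

lemma isClassOne_of_fixedSpace (h : fixedSpace π (Nm x) ≠ {0}) : IsClassOne π := by
  obtain ⟨v, hv, hv0⟩ : ∃ v ∈ fixedSpace π (Nm x), v ≠ 0 := by
    by_contra hcon
    push Not at hcon
    exact h (Set.eq_singleton_iff_unique_mem.2 ⟨zero_mem_fixedSpace, hcon⟩)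
  exact ⟨x, v, hv0, mem_fixedSpace_iff.1 hv⟩

lemma drmat_mulVec_eq_zero (h : HasLevel π N) {W : mLie (n + 2)}
    (hW : blk ((W : so1 (n + 2)) : Mat (n + 2)) *ᵥ x = 0) {v : Fin π.dim → ℂ}
    (hv : v ∈ fixedSpace π (Nm x)) : drmat π W *ᵥ v = 0 := by
  rw [h.drmat_mulVec, dRep]
  have hc := (commute_Nm_iff W x).2 hW
  have h1 : ∀ t : ℝ, π.rep (expM (t • W)) v = v := fun t => hv _ fun s => by
    apply mat_injective
    have h2 : Commute (t • ((W : so1 (n + 2)) : Mat (n + 2))) (s • (Nm x : Mat (n + 2))) :=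
      (Commute.smul_left hc t).smul_right s
    exact (commute_exp (commute_exp h2).symm).symm
  simp only [h1, deriv_const]

lemma wedge_swap (y z : Fin (n + 1) → ℝ) : wedge y z = -wedge z y := by
  apply mLie_ext
  change _ = -blk ((wedge z y : so1 (n + 2)) : Mat (n + 2))
  rw [blk_wedge, blk_wedge, neg_sub]

lemma smul_wedge (c : ℝ) (y z : Fin (n + 1) → ℝ) : wedge (c • y) (c • z) = (c * c) • wedge y z := by
  apply mLie_ext
  change _ = (c * c) • blk ((wedge y z : so1 (n + 2)) : Mat (n + 2))
  rw [blk_wedge, blk_wedge]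
  ext i j
  simp [Matrix.vecMulVec_apply]
  ring

/-- `∑_j π(Z_j)²` is the scalar `-N (N + l - 3)` on the vectors fixed by `Z_M(S)`. -/
lemma IsFrame.sum_drmat_sq (hx : Btheta (Nm x : Mat (n + 2)) (Nm x) = 1)
    (hZ : IsFrame (l := n + 2) (Nm x) Z) (h : HasLevel π N) {v : Fin π.dim → ℂ}
    (hv : v ∈ fixedSpace π (Nm x)) :
    ∑ j, drmat π (Z j) *ᵥ (drmat π (Z j) *ᵥ v) = (-((N : ℂ) * (N + n - 1))) • v := by
  obtain ⟨δ, hδ⟩ := h.exists_linear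
  have hU := hZ.frameMatrix_orthogonal hx
  set U := frameMatrix x Z with hUdef
  have hs : Real.sqrt (4 * ((n : ℝ) + 1)) * Real.sqrt (4 * (n + 1)) = 4 * (n + 1) :=
    Real.mul_self_sqrt (by positivity)
  have hx1 := dotProduct_self_of_Btheta hx
  let B : mLie (n + 2) →ₗ[ℝ] mLie (n + 2) →ₗ[ℝ] Matrix (Fin π.dim) (Fin π.dim) ℂ :=
    (LinearMap.mul ℝ (Matrix (Fin π.dim) (Fin π.dim) ℂ)).compl₁₂ δ δ
  have hB : ∀ V W, B V W = drmat π V * drmat π W := fun V W => by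
    change δ V * δ W = _
    rw [hδ, hδ]
  -- The full sum over rotations is rewritten in an orthonormal basis that starts with the direction
  -- of `x`. Pairs containing index `0` give `±Z_j`, each square occurring twice. The other
  -- rotations fix `x` and therefore annihilate `v`.
  have h1 : ∑ k, ∑ k', B (wedge (U k) (U k')) (wedge (U k) (U k')) = ∑ i, ∑ j, B (rot i j) (rot i j) := by
    rw [Finset.sum_comm]
    have h2 : ∀ k', ∑ k, B (wedge (U k) (U k')) (wedge (U k) (U k')) =
        ∑ i, B (∑ j, U k' j • rot i j) (∑ j, U k' j • rot i j) := fun k' =>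
      sum_orthogonal_change hU B fun i => ∑ j, U k' j • rot i j
    simp only [h2]
    rw [Finset.sum_comm]
    exact Finset.sum_congr rfl fun i _ => sum_orthogonal_change hU B fun j => rot i j
  simp only [hB, h.sum_drmat_rot_sq] at h1
  have hU0 : U 0 = Real.sqrt (4 * (n + 1)) • x := rfl
  have hUs : ∀ j : Fin n, U j.succ = Real.sqrt (4 * (n + 1)) • frameVec (Z j) x := fun j => rfl
  have hyx : ∀ j, frameVec (Z j) x ⬝ᵥ x = 0 := fun j => by
    have h := frameVec_dotProduct (Z j) x x
    rw [dotProduct_comm x] at h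
    linarith
  have hZw : ∀ j : Fin n, wedge (U j.succ) (U 0) = Z j := fun j => by
    rw [hU0, hUs, smul_wedge, hs, ← hZ.eq_wedge hx j]
  have hneg : ∀ W : mLie (n + 2), drmat π (-W) = -drmat π W := fun W => by
    rw [← hδ, ← hδ]
    exact δ.map_neg W
  have hZw' : ∀ j : Fin n, wedge (U 0) (U j.succ) = -Z j := fun j => by
    rw [wedge_swap, hZw]
  have h00 : drmat π (wedge (U 0) (U 0)) = 0 := by
    have h3 := hneg (wedge (U 0) (U 0))
    rw [← wedge_swap] at h3
    exact Matrix.ext fun i j => self_eq_neg.1 (congrFun (congrFun h3 i) j)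
  have hss : ∀ i j : Fin n, drmat π (wedge (U i.succ) (U j.succ)) *ᵥ v = 0 := fun i j => by
    refine drmat_mulVec_eq_zero h ?_ hv
    rw [wedge_mulVec, hUs, hUs, smul_dotProduct, smul_dotProduct, hyx, hyx]
    simp
  have h4 := congrArg (fun A => A *ᵥ v) h1
  simp only [Fin.sum_univ_succ, h00, hZw, hZw', hneg, Matrix.add_mulVec, Matrix.sum_mulVec,
    ← Matrix.mulVec_mulVec, hss, Matrix.mulVec_zero, Matrix.neg_mulVec, Matrix.mulVec_neg, neg_neg,
    Matrix.smul_mulVec, Matrix.one_mulVec, Finset.sum_const_zero, Matrix.zero_mulVec, zero_add,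
    add_zero] at h4
  have h5 : (2 : ℂ) • ∑ j, drmat π (Z j) *ᵥ (drmat π (Z j) *ᵥ v) =
      (2 : ℂ) • (-((N : ℂ) * (N + n - 1))) • v := by
    rw [two_smul, h4, smul_smul]
    congr 1
    ring
  exact smul_right_injective _ (two_ne_zero' ℂ) h5

end Fixed

/-! ### The radial equation on a slice -/

section Slice

variable {u : SOo (n + 2) → ℂ} {x : Fin (n + 1) → ℝ} {Z : Fin n → mLie (n + 2)}

lemma hasDerivAt_slice {l : ℕ} {u : SOo l → ℂ} (hu : IsSmooth u) (X : so1 l) (s : ℝ) :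
    HasDerivAt (fun s : ℝ => u (expG (s • X))) (lieD X u (expG (s • X))) s := by
  have h := hu.hasDerivAt_right X 1 s
  simpa only [one_mul] using h

/-- `exp(sX₁) a_t = a_t exp(e^{-t}sX₁)`, and left `A`-invariance discards `a_t`. Moving along `H_0`
is thus a rescaling of `s`, which makes `H_0` act as `-s d/ds`. -/
lemma slice_mul_a (hA : IsLeftAInvariant u) (s t : ℝ) :
    u (expG (s • Nm x) * expG (t • H0 (n + 2))) = u (expG ((Real.exp (-t) * s) • Nm x)) := by
  rw [← hA (-t), ← mul_assoc, ← map_smul, a_mul_expG_Nm, smul_smul, map_smul, mul_assoc]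
  change u (_ * (a (-t) * a t)) = _
  rw [← a_add, neg_add_cancel, a_zero, mul_one]

lemma lieD_H0_slice (hu : IsSmooth u) (hA : IsLeftAInvariant u) (s : ℝ) :
    lieD (H0 (n + 2)) u (expG (s • Nm x)) = -s * lieD (Nm x) u (expG (s • Nm x)) ∧
    lieD (H0 (n + 2)) (lieD (H0 (n + 2)) u) (expG (s • Nm x)) =
      s * lieD (Nm x) u (expG (s • Nm x)) +
        s ^ 2 * lieD (Nm x) (lieD (Nm x) u) (expG (s • Nm x)) := by
  have he : ∀ t : ℝ, HasDerivAt (fun t => Real.exp (-t) * s) (-(Real.exp (-t) * s)) t := fun t => by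
    exact (((hasDerivAt_neg t).exp).mul_const s).congr_deriv (by ring)
  have h1 : ∀ t : ℝ, HasDerivAt (fun t : ℝ => u (expG (s • Nm x) * expG (t • H0 (n + 2))))
      (((-(Real.exp (-t) * s) : ℝ) : ℂ) * lieD (Nm x) u (expG ((Real.exp (-t) * s) • Nm x))) t := by
    intro t
    simp only [slice_mul_a hA]
    have := (hasDerivAt_slice hu (Nm x) (Real.exp (-t) * s)).scomp t (he t)
    rwa [Complex.real_smul] at this
  have h2 := hu.deriv_right (H0 (n + 2)) (expG (s • Nm x))
  have h3 := hu.deriv_deriv_right (H0 (n + 2)) (expG (s • Nm x)) 0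
  have h4 : deriv (fun t : ℝ => u (expG (s • Nm x) * expG (t • H0 (n + 2)))) = fun t : ℝ =>
      ((-(Real.exp (-t) * s) : ℝ) : ℂ) * lieD (Nm x) u (expG ((Real.exp (-t) * s) • Nm x)) :=
    funext fun t => (h1 t).deriv
  have h5 : HasDerivAt (fun t : ℝ => ((-(Real.exp (-t) * s) : ℝ) : ℂ) *
      lieD (Nm x) u (expG ((Real.exp (-t) * s) • Nm x)))
      (s * lieD (Nm x) u (expG (s • Nm x)) +
        s ^ 2 * lieD (Nm x) (lieD (Nm x) u) (expG (s • Nm x))) 0 := by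
    have h6 := (hasDerivAt_slice (hu.lieD (Nm x)) (Nm x) (Real.exp (-0) * s)).scomp (0 : ℝ) (he 0)
    have h7 : HasDerivAt (fun t : ℝ => ((-(Real.exp (-t) * s) : ℝ) : ℂ) *
      lieD (Nm x) u (expG ((Real.exp (-t) * s) • Nm x))) _ 0 := ((he 0).neg.ofReal_comp).mul h6
    refine h7.congr_deriv ?_
    simp
    ring
  constructor
  · have := congrFun (h2.symm.trans h4) 0
    simpa [expG_zero] using this
  · rw [h4, h5.deriv, zero_smul, expG_zero, mul_one] at h3
    exact h3.symm

/-- Moving `exp(tZ)` past `exp(sX₁)` turns the left derivative along `Z` into the right derivative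
along `Z + sY`, `Y = [Z, X₁]`. As `Z ∈ 𝔨` annihilates `u`, the square is `s²Y²u + s ZYu`, and `ZYu =
[Z, Y]u = κ X₁u`. -/
lemma leftD_sq_slice (hu : IsSmoothOnX u) (Z : mLie (n + 2)) {κ : ℝ}
    (hκ : frameVec Z (frameVec Z x) = κ • x) (s : ℝ) :
    leftD (Z : so1 (n + 2)) (leftD (Z : so1 (n + 2)) u) (expG (s • Nm x)) =
      s ^ 2 * lieD (Nm (frameVec Z x)) (lieD (Nm (frameVec Z x)) u) (expG (s • Nm x)) +
        s * κ * lieD (Nm x) u (expG (s • Nm x)) := by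
  set g := expG (s • Nm x) with hg
  set W : so1 (n + 2) := (Z : so1 (n + 2)) + s • Nm (frameVec Z x) with hW
  have h1 : ∀ t : ℝ, u (expG (t • (Z : so1 (n + 2))) * g) = u (g * expG (t • W)) := fun t => by
    rw [hg, ← map_smul, expG_mLie_mul_expG_Nm, Matrix.mulVec_smul, hW,
      ← map_smul Nm s (frameVec Z x)]
    rfl
  have h2 := hu.1.deriv_deriv_left (Z : so1 (n + 2)) g 0
  simp only [h1] at h2
  rw [hu.1.deriv_deriv_right W g 0, zero_smul, zero_smul, expG_zero, mul_one, one_mul] at h2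
  rw [← h2]
  have hZ0 : lieD (Z : so1 (n + 2)) u = fun _ => 0 := lieD_eq_zero_of_mem_K hu.2 Z.2.1
  have h0 : ∀ X : so1 (n + 2), lieBilin hu.1 g X (Z : so1 (n + 2)) = 0 := fun X => by
    rw [lieBilin_apply, hZ0, lieD_zero_fun]
  have hc := lieD_comm hu.1 (X := (Z : so1 (n + 2))) (Y := Nm (frameVec Z x))
    (mLie_Nm Z (frameVec Z x)).symm g
  have hbr : Nm (blk ((Z : so1 (n + 2)) : Mat (n + 2)) *ᵥ frameVec Z x) = κ • Nm x := by
    rw [← map_smul, ← hκ]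
    rfl
  rw [hbr, lieD_smul hu.1, hZ0, lieD_zero_fun, sub_zero] at hc
  rw [← lieBilin_apply hu.1, hW]
  simp only [map_add, map_smul, LinearMap.add_apply, LinearMap.smul_apply, h0, smul_zero, zero_add]
  rw [lieBilin_apply, lieBilin_apply, hc]
  simp only [Complex.real_smul]
  ring

lemma Nm_eq_sum (y : Fin (n + 1) → ℝ) : Nm y = ∑ i, y i • Nm (Pi.single i 1) := by
  simp only [Nm_single]
  simp [Nm, Fintype.linearCombination_apply]

/-- The sum over the standard basis of `𝔫` becomes `4(l-1)(X₁² + ∑ Y_j²)` in the orthonormal frame,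
and the left derivatives along the `Z_j` replace the `Y_j²`. The identity is kept multiplied by
`s²`, so no restriction on `s` is needed. -/
lemma radial_equation (hu : IsSmoothOnX u) {μ E : ℂ} (he : ∀ g, casimir u g = μ * u g)
    (hA : IsLeftAInvariant u) (hx : Btheta (Nm x : Mat (n + 2)) (Nm x) = 1)
    (hZ : IsFrame (l := n + 2) (Nm x) Z) {s : ℝ}
    (hE : ∑ j, leftD (Z j : so1 (n + 2)) (leftD (Z j : so1 (n + 2)) u) (expG (s • Nm x)) =
      E * u (expG (s • Nm x))) :
    2 * ((n : ℂ) + 1) * μ * s ^ 2 * u (expG (s • Nm x)) =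
      s ^ 2 * (s ^ 2 * lieD (Nm x) (lieD (Nm x) u) (expG (s • Nm x)) +
        (n + 2) * s * lieD (Nm x) u (expG (s • Nm x))) +
      4 * (n + 1) * (s ^ 2 * lieD (Nm x) (lieD (Nm x) u) (expG (s • Nm x)) +
        n * s * lieD (Nm x) u (expG (s • Nm x)) + E * u (expG (s • Nm x))) := by
  set g := expG (s • Nm x) with hg
  have hs : Real.sqrt (4 * ((n : ℝ) + 1)) * Real.sqrt (4 * (n + 1)) = 4 * (n + 1) :=
    Real.mul_self_sqrt (by positivity)
  have h1 := casimir_radial hu g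
  rw [he, (lieD_H0_slice hu.1 hA s).1, (lieD_H0_slice hu.1 hA s).2] at h1
  have h2 := sum_orthogonal_change (hZ.frameMatrix_orthogonal hx) (lieBilin hu.1 g)
    fun i => Nm (Pi.single i 1)
  simp only [← Nm_eq_sum] at h2
  rw [Fin.sum_univ_succ] at h2
  have h3 : ∀ y : Fin (n + 1) → ℝ, lieBilin hu.1 g (Nm (Real.sqrt (4 * (n + 1)) • y))
      (Nm (Real.sqrt (4 * (n + 1)) • y)) = 4 * ((n : ℂ) + 1) * lieD (Nm y) (lieD (Nm y) u) g := fun y => by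
    rw [map_smul, map_smul, map_smul, LinearMap.smul_apply, smul_smul, hs, lieBilin_apply,
      Complex.real_smul]
    push_cast
    rfl
  -- `Z_j` is the rotation by a quarter turn in the plane of `x` and `y_j`, which have equal length.
  -- Its square there is `-1`.
  have hκ : ∀ j, frameVec (Z j) (frameVec (Z j) x) = (-1 : ℝ) • x := fun j => by
    have h4 : ∀ v, frameVec (Z j) v = (4 * ((n : ℝ) + 1)) • frameVec (wedge (frameVec (Z j) x) x) v :=
      fun v => by
        conv_lhs => rw [hZ.eq_wedge hx j]
        exact Matrix.smul_mulVec (4 * ((n : ℝ) + 1)) (blk ((wedge (frameVec (Z j) x) x : so1 (n + 2)) : Mat (n + 2))) v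
    rw [h4, frameVec, wedge_mulVec, smul_sub, smul_smul, smul_smul, hZ.dotProduct, if_pos rfl]
    have h5 := frameVec_dotProduct (Z j) x x
    rw [show x ⬝ᵥ frameVec (Z j) x = 0 by rw [dotProduct_comm] at h5; linarith]
    simp
  have h6 : ∑ j : Fin n, (s : ℂ) ^ 2 * lieD (Nm (frameVec (Z j) x)) (lieD (Nm (frameVec (Z j) x)) u) g =
      E * u g + n * s * lieD (Nm x) u g := by
    rw [← hE]
    simp only [hg, leftD_sq_slice hu _ (hκ _), Finset.sum_add_distrib, Finset.sum_const, Finset.card_univ,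
      Fintype.card_fin, nsmul_eq_mul]
    push_cast
    ring
  rw [← Finset.mul_sum] at h6
  simp only [lieBilin_apply, frameMatrix_zero, frameMatrix_succ] at h2 h3
  simp only [h3, ← Finset.mul_sum] at h2
  rw [← h2] at h1
  linear_combination (s : ℂ) ^ 2 * h1 + 4 * ((n : ℂ) + 1) * h6

end Slice

/-! ### The components of a left `A`-invariant eigenfunction -/

section Components

variable {π : IrrRep (n + 2)} {N : ℕ}

lemma HasLevel.hasDerivAt_trace (h : HasLevel π N) (Z : mLie (n + 2))
    (A : Matrix (Fin π.dim) (Fin π.dim) ℂ) (t : ℝ) :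
    HasDerivAt (fun t : ℝ => (π.rmat (expM (t • Z)) * A).trace)
      ((π.rmat (expM (t • Z)) * (drmat π Z * A)).trace) t := by
  rw [← Matrix.mul_assoc]
  simp only [Matrix.trace, Matrix.diag_apply, Matrix.mul_apply (N := A)]
  exact HasDerivAt.fun_sum fun i _ => HasDerivAt.fun_sum fun j _ =>
    (h.hasDerivAt_rmat Z i j t).mul_const _

variable (dm : Measure (M (n + 2))) [dm.IsHaarMeasure] [IsProbabilityMeasure dm] {I : SOo (n + 2) → ℂ}
  {x : Fin (n + 1) → ℝ} {Z : Fin n → mLie (n + 2)}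

lemma HasLevel.leftD_leftD_comp (h : HasLevel π N) (hI : IsSmoothOnX I) (Z : mLie (n + 2))
    (g : SOo (n + 2)) : leftD (Z : so1 (n + 2)) (leftD (Z : so1 (n + 2)) (comp dm π I)) g =
      (drmat π Z * (drmat π Z * piProj dm π I g)).trace := by
  have h1 : ∀ t : ℝ, comp dm π I (expG (t • (Z : so1 (n + 2))) * g) =
      (π.rmat (expM (t • Z)) * piProj dm π I g).trace := fun t => comp_mul_left dm π hI.1 (expM (t • Z)) g
  have h2 := (isSmoothOnX_comp dm π hI).1.deriv_deriv_left (Z : so1 (n + 2)) g 0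
  rw [zero_smul, expG_zero, one_mul] at h2
  rw [← h2, show (fun t : ℝ => comp dm π I (expG (t • (Z : so1 (n + 2))) * g)) = _ from funext h1,
    show deriv (fun t : ℝ => (π.rmat (expM (t • Z)) * piProj dm π I g).trace) = _ from
      funext fun t => (h.hasDerivAt_trace Z _ t).deriv, (h.hasDerivAt_trace Z _ 0).deriv,
    show (0 : ℝ) • Z = 0 from zero_smul ℝ Z, expM_zero, π.rmat_one, Matrix.one_mul]

/-- An element of `Z_M(S)` can be moved past `exp(sX₁)` and is then absorbed by right
`K`-invariance. This yields the vanishing on the slice when `V_π^{Z_M(S)} = 0`, and otherwise it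
lets `∑ π(Z_j)²` act as a scalar. -/
lemma piProj_col_mem_fixedSpace (hI : IsSmoothOnX I) (s : ℝ) (j : Fin π.dim) :
    (fun i => piProj dm π I (expG (s • Nm x)) i j) ∈ fixedSpace π (Nm x) := by
  intro m hm
  have h1 := piProj_mul_left dm π hI.1 m (expG (s • Nm x))
  rw [hm s, piProj_mul_right dm π fun g => hI.2 g _ m.2.1] at h1
  rw [← π.rmat_mulVec]
  funext i
  have h2 := congrFun (congrFun h1 i) j
  rw [Matrix.mul_apply] at h2
  exact h2.symm

lemma comp_slice_eq_zero (hI : IsSmoothOnX I) (h : fixedSpace π (Nm x) = {0}) (s : ℝ) :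
    comp dm π I (expG (s • Nm x)) = 0 := by
  rw [comp_eq_trace dm π hI.1, Matrix.trace]
  refine Finset.sum_eq_zero fun i _ => ?_
  have h1 := piProj_col_mem_fixedSpace (x := x) (π := π) dm hI s i
  rw [h] at h1
  exact congrFun h1 i

lemma HasLevel.sum_leftD_comp (h : HasLevel π N) (hI : IsSmoothOnX I)
    (hx : Btheta (Nm x : Mat (n + 2)) (Nm x) = 1) (hZ : IsFrame (l := n + 2) (Nm x) Z) (s : ℝ) :
    ∑ j, leftD (Z j : so1 (n + 2)) (leftD (Z j : so1 (n + 2)) (comp dm π I)) (expG (s • Nm x)) =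
      -((N : ℂ) * (N + n - 1)) * comp dm π I (expG (s • Nm x)) := by
  simp only [h.leftD_leftD_comp dm hI, comp_eq_trace dm π hI.1]
  rw [← Matrix.trace_sum, ← smul_eq_mul, ← Matrix.trace_smul]
  congr 1
  ext i j
  have h1 := congrFun (hZ.sum_drmat_sq hx h (piProj_col_mem_fixedSpace dm hI s j)) i
  simp only [Finset.sum_apply, Matrix.sum_apply] at h1 ⊢
  exact h1

lemma HasLevel.level_mul_nonneg (h : HasLevel π N) : (0 : ℝ) ≤ (N : ℝ) * (N + n - 1) := by
  rcases Nat.eq_zero_or_pos N with rfl | hN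
  · simp
  · have : (1 : ℝ) ≤ N := by exact_mod_cast hN
    have : (0 : ℝ) ≤ n := Nat.cast_nonneg n
    exact mul_nonneg (by linarith) (by linarith)

lemma HasLevel.satisfiesRadialODE (h : HasLevel π N) (hI : IsSmoothOnX I) {μ : ℂ}
    (he : ∀ g, casimir I g = μ * I g) (hA : IsLeftAInvariant I)
    (hx : Btheta (Nm x : Mat (n + 2)) (Nm x) = 1) (hZ : IsFrame (l := n + 2) (Nm x) Z) :
    SatisfiesRadialODE (n + 2) (-((N : ℝ) * (N + n - 1))) μ fun s => comp dm π I (expG (s • Nm x)) := by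
  intro s hs
  have hu := isSmoothOnX_comp dm π hI
  have h1 := radial_equation hu (casimir_comp dm π hI.1 he) (isLeftAInvariant_comp dm π hA) hx hZ
    (h.sum_leftD_comp dm hI hx hZ s)
  have hd : deriv (fun s : ℝ => comp dm π I (expG (s • Nm x))) = fun s =>
      lieD (Nm x) (comp dm π I) (expG (s • Nm x)) := funext fun s => (hasDerivAt_slice hu.1 _ s).deriv
  rw [hd, (hasDerivAt_slice (hu.1.lieD _) _ s).deriv]
  have hs0 : (s : ℂ) ≠ 0 := by exact_mod_cast hs.ne'
  have hn : (n : ℂ) + 1 ≠ 0 := by exact_mod_cast Nat.succ_ne_zero n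
  push_cast
  rw [show (2 : ℂ) * ((n : ℂ) + 2 - 1) = 2 * (n + 1) by ring]
  field_simp
  linear_combination (-4 : ℂ) * h1

end Components

end RealHyp

namespace RealHyp

open scoped Topology ContDiff Matrix.Norms.Operator Matrix ComplexConjugate

/-! ### The hypergeometric function on `ℂ ∖ [1, ∞)` -/

section Hypergeometric

open Polynomial in
/-- The coefficients of the hypergeometric series. -/
def hgCoeff (a b c : ℂ) (n : ℕ) : ℂ :=
  ((n.factorial : ℂ))⁻¹ * (ascPochhammer ℂ n).eval a * (ascPochhammer ℂ n).eval b *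
    ((ascPochhammer ℂ n).eval c)⁻¹

/-- The domain `ℂ ∖ [1, ∞)`. -/
def hgDomain : Set ℂ := {z | ¬ (z.im = 0 ∧ 1 ≤ z.re)}

/-- `F` is the analytic continuation of the hypergeometric series to `ℂ ∖ [1, ∞)`. -/
def IsGauss (a b c : ℂ) (F : ℂ → ℂ) : Prop :=
  DifferentiableOn ℂ F hgDomain ∧ ∀ z : ℂ, ‖z‖ < 1 → HasSum (fun n => hgCoeff a b c n * z ^ n) (F z)

lemma isOpen_hgDomain : IsOpen hgDomain := by
  have h1 : IsClosed {z : ℂ | z.im = 0} := isClosed_eq Complex.continuous_im continuous_const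
  have h2 : IsClosed {z : ℂ | 1 ≤ z.re} := isClosed_le continuous_const Complex.continuous_re
  exact (h1.inter h2).isOpen_compl

lemma ball_subset_hgDomain : Metric.ball (0 : ℂ) 1 ⊆ hgDomain := by
  rintro z hz ⟨-, h⟩
  rw [mem_ball_zero_iff] at hz
  linarith [Complex.re_le_norm z]

lemma smul_mem_hgDomain {z : ℂ} (hz : z ∈ hgDomain) {t : ℝ} (h0 : 0 ≤ t) (h1 : t ≤ 1) :
    (t : ℂ) * z ∈ hgDomain := by
  rintro ⟨h2, h3⟩
  simp at h2 h3
  rcases h2 with rfl | h2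
  · simp at h3
    linarith
  · refine hz ⟨h2, ?_⟩
    by_contra hlt
    have h4 : t * z.re ≤ t := by nlinarith
    have h5 : t = 1 := by linarith
    rw [h5] at h3
    linarith

lemma isPreconnected_hgDomain : IsPreconnected hgDomain := by
  have h : StarConvex ℝ (0 : ℂ) hgDomain := by
    intro z hz s t hs ht hst
    rw [smul_zero, zero_add, Complex.real_smul]
    exact smul_mem_hgDomain hz ht (by linarith)
  exact (h.isPathConnected (ball_subset_hgDomain (by simp))).isConnected.isPreconnected

lemma one_sub_mem_slitPlane {z : ℂ} (hz : z ∈ hgDomain) : 1 - z ∈ Complex.slitPlane := by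
  rw [Complex.mem_slitPlane_iff]
  by_contra hcon
  push Not at hcon
  simp at hcon
  exact hz ⟨hcon.2, hcon.1⟩

lemma neg_sq_mem_hgDomain (s : ℝ) : -(s : ℂ) ^ 2 ∈ hgDomain := by
  rintro ⟨-, h⟩
  rw [show -(s : ℂ) ^ 2 = ((-s ^ 2 : ℝ) : ℂ) by push_cast; ring, Complex.ofReal_re] at h
  nlinarith [sq_nonneg s]

/-- `gauss2F1` takes the default value `0` unless a continuation exists. Once one does, the chosen
function has the required properties, with convergence of the series included. -/
lemma gauss2F1_spec {a b c : ℂ} (h : ∃ F, IsGauss a b c F) : IsGauss a b c (gauss2F1 a b c) := by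
  have h' : ∃ F : ℂ → ℂ, DifferentiableOn ℂ F {z | ¬ (z.im = 0 ∧ 1 ≤ z.re)} ∧
      ∀ z : ℂ, ‖z‖ < 1 → F z = ordinaryHypergeometric a b c z := by
    obtain ⟨F, h1, h2⟩ := h
    refine ⟨F, h1, fun z hz => ?_⟩
    rw [ordinaryHypergeometric_eq_tsum]
    exact (h2 z hz).tsum_eq.symm
  obtain ⟨F, h1, h2⟩ := h
  rw [gauss2F1, dif_pos h']
  refine ⟨h'.choose_spec.1, fun z hz => ?_⟩
  rw [h'.choose_spec.2 z hz, ordinaryHypergeometric_eq_tsum]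
  exact (h2 z hz).summable.hasSum

lemma hgCoeff_zero (a b c : ℂ) : hgCoeff a b c 0 = 1 := by simp [hgCoeff]

lemma hgCoeff_succ {a b c : ℂ} {n : ℕ} (hc : c + n ≠ 0) :
    (n + 1) * (c + n) * hgCoeff a b c (n + 1) = (a + n) * (b + n) * hgCoeff a b c n := by
  have hn : (n : ℂ) + 1 ≠ 0 := by exact_mod_cast Nat.succ_ne_zero n
  simp only [hgCoeff, ascPochhammer_succ_right, Polynomial.eval_mul, Polynomial.eval_add, Polynomial.eval_X,
    Polynomial.eval_natCast, Nat.factorial_succ, Nat.cast_mul, Nat.cast_add, Nat.cast_one, mul_inv]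
  field_simp

/-! ### Contiguous relations for the coefficients -/

lemma ascPochhammer_eval_succ_left (x : ℂ) (n : ℕ) :
    (ascPochhammer ℂ (n + 1)).eval x = x * (ascPochhammer ℂ n).eval (x + 1) := by
  rw [ascPochhammer_succ_left, Polynomial.eval_mul, Polynomial.eval_comp]
  simp

lemma ascPochhammer_eval_succ_right (x : ℂ) (n : ℕ) :
    (ascPochhammer ℂ (n + 1)).eval x = (ascPochhammer ℂ n).eval x * (x + n) := by
  rw [ascPochhammer_succ_right]
  simp

lemma ascPochhammer_eval_ne_zero {c : ℂ} (hc : ∀ n : ℕ, c + n ≠ 0) (n : ℕ) :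
    (ascPochhammer ℂ n).eval c ≠ 0 := by
  induction n with
  | zero => simp
  | succ n ih =>
    rw [ascPochhammer_eval_succ_right]
    exact mul_ne_zero ih (hc n)

lemma add_one_add_ne_zero {c : ℂ} (hc : ∀ n : ℕ, c + n ≠ 0) (n : ℕ) : c + 1 + n ≠ 0 := by
  have := hc (n + 1)
  push_cast at this
  rwa [add_assoc, add_comm 1]

/-- In terms of functions: `F(a,b;c) = F(a,b+1;c) - (a/c) z F(a+1,b+1;c+1)`. Both functions on the
right have `b` raised by one. -/
lemma hgCoeff_contiguous_b {a b c : ℂ} (hc : c ≠ 0) (n : ℕ) :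
    hgCoeff a b c (n + 1) = hgCoeff a (b + 1) c (n + 1) + -(a / c) * hgCoeff (a + 1) (b + 1) (c + 1) n := by
  have hn : (n : ℂ) + 1 ≠ 0 := by exact_mod_cast Nat.succ_ne_zero n
  simp only [hgCoeff]
  rw [ascPochhammer_eval_succ_right (b + 1)]
  simp only [ascPochhammer_eval_succ_left, Nat.factorial_succ, Nat.cast_mul, Nat.cast_add, Nat.cast_one, mul_inv]
  field_simp
  ring

/-- In terms of functions: `F(a,b;c) = F(a,b;c+1) + ab/(c(c+1)) z F(a+1,b+1;c+2)`. Both functions on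
the right have `c - b` raised by one. -/
lemma hgCoeff_contiguous_c {a b c : ℂ} (hc : ∀ n : ℕ, c + n ≠ 0) (n : ℕ) :
    hgCoeff a b c (n + 1) = hgCoeff a b (c + 1) (n + 1) +
      a * b / (c * (c + 1)) * hgCoeff (a + 1) (b + 1) (c + 1 + 1) n := by
  have hn : (n : ℂ) + 1 ≠ 0 := by exact_mod_cast Nat.succ_ne_zero n
  have h0 : c ≠ 0 := by simpa using hc 0
  have h1 : c + 1 ≠ 0 := by simpa using hc 1
  have h2 := add_one_add_ne_zero hc n
  have h3 := ascPochhammer_eval_ne_zero (add_one_add_ne_zero (add_one_add_ne_zero hc)) n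
  have h4 : (ascPochhammer ℂ n).eval (c + 1) = (c + 1) * (ascPochhammer ℂ n).eval (c + 1 + 1) / (c + 1 + n) := by
    rw [eq_div_iff h2, ← ascPochhammer_eval_succ_right, ascPochhammer_eval_succ_left]
  simp only [hgCoeff]
  simp only [ascPochhammer_eval_succ_left, Nat.factorial_succ, Nat.cast_mul, Nat.cast_add, Nat.cast_one, mul_inv]
  rw [h4]
  field_simp
  ring

/-! ### Existence of the continuation -/

lemma hasSum_shift {g g' : ℕ → ℂ} {z S : ℂ} (h : HasSum (fun n => g n * z ^ n) S) (h0 : g' 0 = 0)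
    (h1 : ∀ n, g' (n + 1) = g n) : HasSum (fun n => g' n * z ^ n) (z * S) := by
  rw [← hasSum_nat_add_iff' 1]
  simp only [h1, Finset.range_one, Finset.sum_singleton, h0, zero_mul, sub_zero]
  have h2 := h.mul_left z
  rwa [show (fun n => z * (g n * z ^ n)) = fun n => g n * z ^ (n + 1) from
    funext fun n => by rw [pow_succ]; ring] at h2

lemma IsGauss.combine {a₀ b₀ c₀ a₁ b₁ c₁ a₂ b₂ c₂ κ : ℂ} {F G : ℂ → ℂ} (hF : IsGauss a₁ b₁ c₁ F)
    (hG : IsGauss a₂ b₂ c₂ G)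
    (h : ∀ n, hgCoeff a₀ b₀ c₀ (n + 1) = hgCoeff a₁ b₁ c₁ (n + 1) + κ * hgCoeff a₂ b₂ c₂ n) :
    IsGauss a₀ b₀ c₀ fun z => F z + κ * (z * G z) := by
  refine ⟨hF.1.add ((differentiableOn_id.mul hG.1).const_mul κ), fun z hz => ?_⟩
  have h0 : HasSum (fun n => κ * hgCoeff a₂ b₂ c₂ n * z ^ n) (κ * G z) := by
    simpa only [mul_assoc] using (hG.2 z hz).mul_left κ
  have h1 := hasSum_shift (g' := fun n => hgCoeff a₀ b₀ c₀ n - hgCoeff a₁ b₁ c₁ n) h0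
    (by simp [hgCoeff_zero]) fun n => by rw [h]; ring
  have h2 := (hF.2 z hz).add h1
  rw [show (fun n => hgCoeff a₁ b₁ c₁ n * z ^ n + (hgCoeff a₀ b₀ c₀ n - hgCoeff a₁ b₁ c₁ n) * z ^ n) =
    fun n => hgCoeff a₀ b₀ c₀ n * z ^ n from funext fun n => by ring, mul_left_comm] at h2
  exact h2

/-! ### Euler's integral -/

section Euler

variable {a b c : ℂ}

/-- The weight `t^(b-1) (1-t)^(c-b-1)` of Euler's integral. -/
def eulerWeight (b c : ℂ) (t : ℝ) : ℂ := (t : ℂ) ^ (b - 1) * (1 - (t : ℂ)) ^ (c - b - 1)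

/-- The bounds are stronger than convergence of Euler's integral requires. They give both exponents
positive real part, so the weight has no endpoint singularity; the contiguous relations later remove
the restriction. -/
lemma continuous_eulerWeight (hb : 1 < b.re) (hc : b.re + 1 < c.re) : Continuous (eulerWeight b c) := by
  have h1 : Continuous fun t : ℝ => (t : ℂ) ^ (b - 1) :=
    Complex.continuous_ofReal_cpow_const (by simp; linarith)
  have h2 : Continuous fun t : ℝ => ((1 - t : ℝ) : ℂ) ^ (c - b - 1) :=
    (Complex.continuous_ofReal_cpow_const (by simp; linarith)).comp (continuous_const.sub continuous_id)
  refine (h1.mul h2).congr fun t => ?_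
  rw [eulerWeight]
  push_cast
  rfl

lemma betaIntegral_add_one_left {u v : ℂ} (hu : 0 < u.re) (hv : 0 < v.re) :
    (u + v) * Complex.betaIntegral (u + 1) v = u * Complex.betaIntegral u v := by
  have hu0 : u ≠ 0 := fun h => by simp [h] at hu
  have huv : u + v ≠ 0 := fun h => by
    have := congrArg Complex.re h
    simp at this
    linarith
  rw [Complex.betaIntegral_eq_Gamma_mul_div _ _ (by simp; linarith) hv,
    Complex.betaIntegral_eq_Gamma_mul_div _ _ hu hv, add_right_comm, Complex.Gamma_add_one _ hu0,
    Complex.Gamma_add_one _ huv]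
  have : Complex.Gamma (u + v) ≠ 0 := Complex.Gamma_ne_zero_of_re_pos (by simp; linarith)
  field_simp

lemma integral_pow_mul_eulerWeight (hb : 1 < b.re) (hc : b.re + 1 < c.re) (n : ℕ) :
    ∫ t in (0 : ℝ)..1, (t : ℂ) ^ n * eulerWeight b c t =
      (ascPochhammer ℂ n).eval b * ((ascPochhammer ℂ n).eval c)⁻¹ * Complex.betaIntegral b (c - b) := by
  have h1 : ∫ t in (0 : ℝ)..1, (t : ℂ) ^ n * eulerWeight b c t = Complex.betaIntegral (b + n) (c - b) := by
    refine intervalIntegral.integral_congr fun t ht => ?_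
    rw [Set.uIcc_of_le zero_le_one] at ht
    simp only [eulerWeight]
    rw [← mul_assoc]
    congr 1
    rcases eq_or_ne t 0 with rfl | h0
    · have hb1 : b - 1 ≠ 0 := fun h => by
        have := congrArg Complex.re h
        simp at this
        linarith
      have hb2 : b + n - 1 ≠ 0 := fun h => by
        have := congrArg Complex.re h
        simp at this
        have : (0 : ℝ) ≤ n := Nat.cast_nonneg n
        linarith
      rw [Complex.ofReal_zero, Complex.zero_cpow hb1, Complex.zero_cpow hb2, mul_zero]
    · rw [← Complex.cpow_natCast, ← Complex.cpow_add _ _ (by exact_mod_cast h0)]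
      congr 1
      ring
  rw [h1]
  clear h1
  induction n with
  | zero => simp
  | succ n ih =>
    have hbn : 0 < (b + n).re := by
      have : (0 : ℝ) ≤ n := Nat.cast_nonneg n
      simp
      linarith
    have hcn : c + n ≠ 0 := fun h => by
      have := congrArg Complex.re h
      have : (0 : ℝ) ≤ n := Nat.cast_nonneg n
      simp at *
      linarith
    have h2 := betaIntegral_add_one_left hbn (v := c - b) (by simp; linarith)
    rw [show b + n + (c - b) = c + n by ring] at h2
    have h3 : Complex.betaIntegral (b + n + 1) (c - b) =
        (b + n) * (c + n)⁻¹ * Complex.betaIntegral (b + n) (c - b) := by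
      field_simp
      linear_combination h2
    push_cast
    rw [← add_assoc, h3, ih, ascPochhammer_eval_succ_right, ascPochhammer_eval_succ_right, mul_inv]
    ring

lemma hasSum_one_sub_cpow (a : ℂ) {z : ℂ} (hz : ‖z‖ < 1) :
    HasSum (fun n => ((n.factorial : ℂ))⁻¹ * (ascPochhammer ℂ n).eval a * z ^ n) ((1 - z) ^ (-a)) := by
  have h := (Complex.one_div_one_sub_cpow_hasFPowerSeriesOnBall_zero a).hasSum (y := z) (by
    rw [Metric.mem_eball, edist_zero_right, ← ofReal_norm]
    exact ENNReal.ofReal_lt_one.2 hz)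
  simp only [zero_add, FormalMultilinearSeries.ofScalars_apply_eq, ← Ring.multichoose_eq] at h
  rw [one_div, ← Complex.cpow_neg] at h
  convert! h using 2 with n
  have h1 := Ring.factorial_nsmul_multichoose_eq_ascPochhammer a n
  rw [Polynomial.ascPochhammer_smeval_eq_eval, nsmul_eq_mul] at h1
  have h2 : (n.factorial : ℂ) ≠ 0 := by exact_mod_cast n.factorial_ne_zero
  rw [← h1, inv_mul_cancel_left₀ h2, smul_eq_mul]

/-- Euler's integral. -/
def eulerIntegral (a b c : ℂ) (z : ℂ) : ℂ :=
  ∫ t in (0 : ℝ)..1, (1 - t * z) ^ (-a) * eulerWeight b c t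

/-- Expand `(1 - tz)^{-a}` in a binomial series and integrate term by term against the weight. Its
moments are Beta values, which supply the quotients of Pochhammer symbols in `b` and `c`. -/
lemma hasSum_eulerIntegral (hb : 1 < b.re) (hc : b.re + 1 < c.re) {z : ℂ} (hz : ‖z‖ < 1) :
    HasSum (fun n => hgCoeff a b c n * z ^ n * Complex.betaIntegral b (c - b)) (eulerIntegral a b c z) := by
  have hw := continuous_eulerWeight hb hc
  obtain ⟨C, hC⟩ := (isCompact_Icc (a := (0 : ℝ)) (b := 1)).bddAbove_image hw.norm.continuousOn
  have hC' : ∀ t ∈ Set.Icc (0 : ℝ) 1, ‖eulerWeight b c t‖ ≤ C := fun t ht => hC ⟨t, ht, rfl⟩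
  have hs : Summable fun n => ‖((n.factorial : ℂ))⁻¹ * (ascPochhammer ℂ n).eval a‖ * ‖z‖ ^ n := by
    have := (hasSum_one_sub_cpow a (z := (‖z‖ : ℂ)) (by simpa using hz)).summable.norm
    refine this.congr fun n => ?_
    rw [norm_mul, norm_pow, Complex.norm_real, norm_norm]
  have hI : ∀ t : ℝ, t ∈ Set.uIoc (0 : ℝ) 1 → 0 < t ∧ t ≤ 1 := fun t ht => by
    rw [Set.uIoc_of_le zero_le_one] at ht
    exact ht
  have h := intervalIntegral.hasSum_integral_of_dominated_convergence (μ := volume) (a := 0) (b := 1)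
    (F := fun n (t : ℝ) => ((n.factorial : ℂ))⁻¹ * (ascPochhammer ℂ n).eval a * (t * z) ^ n * eulerWeight b c t)
    (f := fun t => (1 - t * z) ^ (-a) * eulerWeight b c t)
    (fun n _ => ‖((n.factorial : ℂ))⁻¹ * (ascPochhammer ℂ n).eval a‖ * ‖z‖ ^ n * C)
    (fun n => (by fun_prop : Continuous fun t : ℝ => _ * ((t : ℂ) * z) ^ n * eulerWeight b c t).aestronglyMeasurable)
    (fun n => Filter.Eventually.of_forall fun t ht => ?_)
    (Filter.Eventually.of_forall fun _ _ => hs.mul_right C) intervalIntegrable_const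
    (Filter.Eventually.of_forall fun t ht => ?_)
  · convert! h using 2 with n
    rw [show (fun t : ℝ => ((n.factorial : ℂ))⁻¹ * (ascPochhammer ℂ n).eval a * (t * z) ^ n * eulerWeight b c t) =
      fun t : ℝ => ((n.factorial : ℂ))⁻¹ * (ascPochhammer ℂ n).eval a * z ^ n * ((t : ℂ) ^ n * eulerWeight b c t)
      from funext fun t => by rw [mul_pow]; ring, intervalIntegral.integral_const_mul,
      integral_pow_mul_eulerWeight hb hc, hgCoeff]
    ring
  · obtain ⟨h0, h1⟩ := hI t ht
    rw [norm_mul _ (eulerWeight b c t), norm_mul _ (((t : ℂ) * z) ^ n), norm_pow, norm_mul (t : ℂ), Complex.norm_real,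
      Real.norm_of_nonneg h0.le]
    have h2 : (t * ‖z‖) ^ n ≤ ‖z‖ ^ n :=
      pow_le_pow_left₀ (by positivity) (mul_le_of_le_one_left (norm_nonneg z) h1) n
    have h3 := hC' t ⟨h0.le, h1⟩
    gcongr
  · obtain ⟨h0, h1⟩ := hI t ht
    refine (hasSum_one_sub_cpow a ?_).mul_right _
    rw [norm_mul, Complex.norm_real, Real.norm_of_nonneg h0.le]
    exact (mul_le_of_le_one_left (norm_nonneg z) h1).trans_lt hz

lemma differentiableOn_eulerIntegral (hb : 1 < b.re) (hc : b.re + 1 < c.re) :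
    DifferentiableOn ℂ (eulerIntegral a b c) hgDomain := by
  have hw := continuous_eulerWeight hb hc
  intro z hz
  obtain ⟨ε, hε, hball⟩ := Metric.nhds_basis_closedBall.mem_iff.1 (isOpen_hgDomain.mem_nhds hz)
  -- The domain is star-shaped about `0`, so `t x` stays in it for `0 ≤ t ≤ 1` and `1 - t x` avoids
  -- the cut of the complex power.
  have hslit : ∀ x ∈ Metric.closedBall z ε, ∀ t ∈ Set.Icc (0 : ℝ) 1, 1 - (t : ℂ) * x ∈ Complex.slitPlane :=
    fun x hx t ht => one_sub_mem_slitPlane (smul_mem_hgDomain (hball hx) ht.1 ht.2)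
  have hcont : ∀ κ : ℂ, ContinuousOn (fun q : ℂ × ℝ => (1 - (q.2 : ℂ) * q.1) ^ κ)
      (Metric.closedBall z ε ×ˢ Set.Icc (0 : ℝ) 1) := fun κ => by
    refine ContinuousOn.cpow (by fun_prop) continuousOn_const ?_
    exact fun q hq => hslit q.1 hq.1 q.2 hq.2
  have hcont' : ∀ κ : ℂ, ∀ x ∈ Metric.closedBall z ε,
      ContinuousOn (fun t : ℝ => (1 - (t : ℂ) * x) ^ κ) (Set.Icc (0 : ℝ) 1) := fun κ x hx =>
    (hcont κ).comp (f := fun t : ℝ => (x, t)) (by fun_prop) fun t ht => ⟨hx, ht⟩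
  have hF'c : ContinuousOn (fun q : ℂ × ℝ => a * (q.2 : ℂ) * (1 - (q.2 : ℂ) * q.1) ^ (-a - 1) *
      eulerWeight b c q.2) (Metric.closedBall z ε ×ˢ Set.Icc (0 : ℝ) 1) :=
    (ContinuousOn.mul (by fun_prop) (hcont _)).mul (hw.comp continuous_snd).continuousOn
  obtain ⟨C, hC⟩ := ((isCompact_closedBall z ε).prod isCompact_Icc).bddAbove_image hF'c.norm
  have hzε : z ∈ Metric.closedBall z ε := Metric.mem_closedBall_self hε.le
  have hsub : Set.uIoc (0 : ℝ) 1 ⊆ Set.Icc 0 1 := by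
    rw [Set.uIoc_of_le zero_le_one]
    exact Set.Ioc_subset_Icc_self
  have hint : ∀ x ∈ Metric.closedBall z ε, ContinuousOn (fun t : ℝ =>
      (1 - (t : ℂ) * x) ^ (-a) * eulerWeight b c t) (Set.Icc (0 : ℝ) 1) := fun x hx =>
    (hcont' _ x hx).mul hw.continuousOn
  refine (intervalIntegral.hasDerivAt_integral_of_dominated_loc_of_deriv_le (μ := volume) (a := 0) (b := 1)
    (F' := fun x t => a * (t : ℂ) * (1 - (t : ℂ) * x) ^ (-a - 1) * eulerWeight b c t)
    (bound := fun _ => C) (Metric.closedBall_mem_nhds z hε) ?_ ?_ ?_ ?_ ?_ ?_).2.differentiableAt.differentiableWithinAt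
  · filter_upwards [Metric.closedBall_mem_nhds z hε] with x hx
    exact ((hint x hx).mono hsub).aestronglyMeasurable measurableSet_uIoc
  · refine ContinuousOn.intervalIntegrable ?_
    rw [Set.uIcc_of_le zero_le_one]
    exact hint z hzε
  · refine ContinuousOn.aestronglyMeasurable ?_ measurableSet_uIoc
    exact (ContinuousOn.comp hF'c (f := fun t : ℝ => (z, t)) (by fun_prop) fun t ht => ⟨hzε, ht⟩).mono hsub
  · exact Filter.Eventually.of_forall fun t ht x hx => hC ⟨(x, t), ⟨hx, hsub ht⟩, rfl⟩
  · exact intervalIntegrable_const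
  · refine Filter.Eventually.of_forall fun t ht x hx => ?_
    have h1 : HasDerivAt (fun x : ℂ => 1 - (t : ℂ) * x) (-(t : ℂ)) x := by
      simpa using ((hasDerivAt_id x).const_mul (t : ℂ)).const_sub 1
    refine ((h1.cpow_const (c := -a) (hslit x hx t (hsub ht))).mul_const (eulerWeight b c t)).congr_deriv ?_
    ring

lemma exists_isGauss_euler (hb : 1 < b.re) (hc : b.re + 1 < c.re) : ∃ F, IsGauss a b c F := by
  have hB : Complex.betaIntegral b (c - b) ≠ 0 := by
    have h1 : 0 < b.re := by linarith
    have h2 : 0 < (c - b).re := by simp; linarith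
    have h3 := Complex.Gamma_mul_Gamma_eq_betaIntegral h1 h2
    intro h
    rw [h, mul_zero] at h3
    exact mul_ne_zero (Complex.Gamma_ne_zero_of_re_pos h1) (Complex.Gamma_ne_zero_of_re_pos h2) h3
  refine ⟨fun z => eulerIntegral a b c z * (Complex.betaIntegral b (c - b))⁻¹,
    (differentiableOn_eulerIntegral hb hc).mul_const _, fun z hz => ?_⟩
  have h := (hasSum_eulerIntegral (a := a) hb hc hz).mul_right (Complex.betaIntegral b (c - b))⁻¹
  simpa only [mul_inv_cancel_right₀ hB] using h

end Euler

/-- Existence of the analytic continuation of the hypergeometric series. -/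
lemma exists_isGauss {a b c : ℂ} (hc : ∀ n : ℕ, c + n ≠ 0) : ∃ F, IsGauss a b c F := by
  -- Here `k` counts how often `c - b` has to be raised before Euler's integral applies. In `key2`
  -- it counts how often `b` has to be raised.
  have key1 : ∀ (k : ℕ) (a b c : ℂ), (∀ n : ℕ, c + n ≠ 0) → 1 < b.re → b.re + 1 < c.re + k →
      ∃ F, IsGauss a b c F := by
    intro k
    induction k with
    | zero => exact fun a b c _ hb h => exists_isGauss_euler hb (by simpa using h)
    | succ k ih =>
      intro a b c hc hb h
      push_cast at h
      have hc1 := add_one_add_ne_zero hc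
      obtain ⟨F, hF⟩ := ih a b (c + 1) hc1 hb (by simp; linarith)
      obtain ⟨G, hG⟩ := ih (a + 1) (b + 1) (c + 1 + 1) (add_one_add_ne_zero hc1) (by simp; linarith)
        (by simp; linarith)
      exact ⟨_, hF.combine hG (hgCoeff_contiguous_c hc)⟩
  have key2 : ∀ (k : ℕ) (a b c : ℂ), (∀ n : ℕ, c + n ≠ 0) → 1 < b.re + k → ∃ F, IsGauss a b c F := by
    intro k
    induction k with
    | zero =>
      intro a b c hc hb
      obtain ⟨m, hm⟩ := exists_nat_gt (b.re + 1 - c.re)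
      exact key1 m a b c hc (by simpa using hb) (by linarith)
    | succ k ih =>
      intro a b c hc hb
      push_cast at hb
      obtain ⟨F, hF⟩ := ih a (b + 1) c hc (by simp; linarith)
      obtain ⟨G, hG⟩ := ih (a + 1) (b + 1) (c + 1) (add_one_add_ne_zero hc) (by simp; linarith)
      exact ⟨_, hF.combine hG (hgCoeff_contiguous_b (by simpa using hc 0))⟩
  obtain ⟨m, hm⟩ := exists_nat_gt (1 - b.re)
  exact key2 m a b c hc (by linarith)

end Hypergeometric

end RealHyp

namespace RealHyp

open scoped Topology ContDiff Matrix.Norms.Operator Matrix ComplexConjugate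

/-! ### The hypergeometric equation -/

lemma hasSum_deriv_of_hasSum {g : ℕ → ℂ} {F : ℂ → ℂ}
    (h : ∀ z : ℂ, ‖z‖ < 1 → HasSum (fun n => g n * z ^ n) (F z)) {z : ℂ} (hz : ‖z‖ < 1) :
    HasSum (fun n : ℕ => ((n : ℂ) + 1) * g (n + 1) * z ^ n) (deriv F z) := by
  obtain ⟨ρ, hρ, hρ1⟩ := exists_between hz
  have hρ0 : 0 ≤ ρ := (norm_nonneg z).trans hρ.le
  have hs := (h ρ (by rwa [Complex.norm_real, Real.norm_of_nonneg hρ0])).summable.norm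
  have h1 := Complex.hasSum_deriv_of_summable_norm (U := Metric.ball 0 ρ) (F := fun n w => g n * w ^ n) hs
    (fun n => by fun_prop) Metric.isOpen_ball (fun n w hw => ?_) (mem_ball_zero_iff.2 hρ)
  · have h2 : deriv (fun w => ∑' n, g n * w ^ n) z = deriv F z := by
      apply Filter.EventuallyEq.deriv_eq
      filter_upwards [Metric.isOpen_ball.mem_nhds (mem_ball_zero_iff.2 hρ)] with w hw
      exact (h w ((mem_ball_zero_iff.1 hw).trans hρ1)).tsum_eq
    have h3 : ∀ n : ℕ, deriv (fun w => g (n + 1) * w ^ (n + 1)) z = ((n : ℂ) + 1) * g (n + 1) * z ^ n :=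
      fun n => by
        rw [deriv_const_mul _ (by fun_prop), deriv_pow_field, Nat.cast_add, Nat.cast_one, Nat.add_sub_cancel]
        ring
    rw [h2, ← hasSum_nat_add_iff' 1, Finset.sum_range_one] at h1
    simpa only [h3, pow_zero, mul_one, deriv_const, sub_zero] using h1
  · rw [norm_mul, norm_mul, norm_pow, norm_pow, Complex.norm_real, Real.norm_of_nonneg hρ0]
    have := (mem_ball_zero_iff.1 hw).le
    gcongr

/-- On the unit disc the equation is the recurrence of the coefficients, term by term. The identity
theorem extends it to the connected domain. -/
lemma IsGauss.ode {a b c : ℂ} {F : ℂ → ℂ} (hF : IsGauss a b c F) (hc : ∀ n : ℕ, c + n ≠ 0) {z : ℂ}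
    (hz : z ∈ hgDomain) :
    z * (1 - z) * deriv (deriv F) z + (c - (a + b + 1) * z) * deriv F z - a * b * F z = 0 := by
  have hd1 := hF.1.deriv isOpen_hgDomain
  have hd2 := hd1.deriv isOpen_hgDomain
  set P : ℂ → ℂ := fun z =>
    z * (1 - z) * deriv (deriv F) z + (c - (a + b + 1) * z) * deriv F z - a * b * F z with hP
  have hPd : DifferentiableOn ℂ P hgDomain :=
    (((differentiableOn_id.mul (differentiableOn_id.const_sub 1)).mul hd2).add
      (((differentiableOn_id.const_mul _).const_sub c).mul hd1)).sub (hF.1.const_mul _)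
  have h0 : P =ᶠ[𝓝 0] fun _ => 0 := by
    filter_upwards [Metric.isOpen_ball.mem_nhds (Metric.mem_ball_self (x := (0 : ℂ)) one_pos)] with z hz
    rw [mem_ball_zero_iff] at hz
    have e0 := hF.2 z hz
    have e1 := hasSum_deriv_of_hasSum hF.2 hz
    have e2 := hasSum_deriv_of_hasSum (fun z hz => hasSum_deriv_of_hasSum hF.2 hz) hz
    have e1' := hasSum_shift (g' := fun n => n * hgCoeff a b c n) e1 (by simp) fun n => by push_cast; ring
    have e2' := hasSum_shift (g' := fun n => n * ((n + 1) * hgCoeff a b c (n + 1))) e2 (by simp)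
      fun n => by push_cast; ring
    have e2'' := hasSum_shift (g' := fun n => (n - 1) * (n * hgCoeff a b c n)) e2' (by simp)
      fun n => by push_cast; ring
    have e := ((e2'.sub e2'').add ((e1.mul_left c).sub (e1'.mul_left (a + b + 1)))).sub (e0.mul_left (a * b))
    have hzero : ∀ n : ℕ, (n : ℂ) * ((n + 1) * hgCoeff a b c (n + 1)) * z ^ n -
        (n - 1) * (n * hgCoeff a b c n) * z ^ n + (c * ((n + 1) * hgCoeff a b c (n + 1) * z ^ n) -
        (a + b + 1) * (n * hgCoeff a b c n * z ^ n)) - a * b * (hgCoeff a b c n * z ^ n) = 0 := fun n => by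
      linear_combination z ^ n * hgCoeff_succ (a := a) (b := b) (hc n)
    simp only [hzero] at e
    rw [← e.unique hasSum_zero, hP]
    ring
  exact (hPd.analyticOnNhd isOpen_hgDomain).eqOn_of_preconnected_of_eventuallyEq
    (analyticOnNhd_const (v := (0 : ℂ))) isPreconnected_hgDomain (ball_subset_hgDomain (by simp)) h0 hz

/-! ### Real solutions -/

section Real

variable {a b c : ℂ} {F : ℂ → ℂ}

lemma hasDerivAt_comp_neg_sq (hF : DifferentiableOn ℂ F hgDomain) (s : ℝ) :
    HasDerivAt (fun s : ℝ => F (-(s : ℂ) ^ 2)) (-2 * s * deriv F (-(s : ℂ) ^ 2)) s := by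
  have h1 : HasDerivAt (fun s : ℝ => -(s : ℂ) ^ 2) (-(2 * s)) s := by
    exact (((hasDerivAt_id s).ofReal_comp.pow 2).neg).congr_deriv (by simp)
  have h2 := (hF.differentiableAt (isOpen_hgDomain.mem_nhds (neg_sq_mem_hgDomain s))).hasDerivAt
  exact (h2.comp s h1).congr_deriv (by ring)

/-- `F(-s²)` solves a linear differential equation on the real line. -/
lemma IsGauss.hasDerivAt_real (hF : IsGauss a b c F) (s : ℝ) :
    HasDerivAt (fun s : ℝ => F (-(s : ℂ) ^ 2)) (-2 * s * deriv F (-(s : ℂ) ^ 2)) s ∧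
    HasDerivAt (fun s : ℝ => -2 * (s : ℂ) * deriv F (-(s : ℂ) ^ 2))
      (-2 * deriv F (-(s : ℂ) ^ 2) + 4 * s ^ 2 * deriv (deriv F) (-(s : ℂ) ^ 2)) s := by
  refine ⟨hasDerivAt_comp_neg_sq hF.1 s, ?_⟩
  have h1 : HasDerivAt (fun s : ℝ => -2 * (s : ℂ)) (-2) s := by
    simpa using (hasDerivAt_id s).ofReal_comp.const_mul (-2 : ℂ)
  exact (h1.mul (hasDerivAt_comp_neg_sq (hF.1.deriv isOpen_hgDomain) s)).congr_deriv (by ring)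

/-- The function `s^N F(-s²)`, its first and its second derivative. -/
lemma IsGauss.hasDerivAt_pow_mul (hF : IsGauss a b c F) (N : ℕ) {s : ℝ} (hs : s ≠ 0) :
    HasDerivAt (fun s : ℝ => (s : ℂ) ^ N * F (-(s : ℂ) ^ 2))
      ((s : ℂ) ^ N * (N / s * F (-(s : ℂ) ^ 2) + -2 * s * deriv F (-(s : ℂ) ^ 2))) s ∧
    HasDerivAt (fun s : ℝ => (s : ℂ) ^ N * (N / s * F (-(s : ℂ) ^ 2) + -2 * s * deriv F (-(s : ℂ) ^ 2)))
      ((s : ℂ) ^ N * (N * (N - 1) / s ^ 2 * F (-(s : ℂ) ^ 2) + 2 * N / s * (-2 * s * deriv F (-(s : ℂ) ^ 2)) +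
        (-2 * deriv F (-(s : ℂ) ^ 2) + 4 * s ^ 2 * deriv (deriv F) (-(s : ℂ) ^ 2)))) s := by
  have hs' : (s : ℂ) ≠ 0 := by exact_mod_cast hs
  have hpow : HasDerivAt (fun s : ℝ => (s : ℂ) ^ N) ((s : ℂ) ^ N * (N / s)) s := by
    have h := (hasDerivAt_id s).ofReal_comp.pow N
    refine h.congr_deriv ?_
    cases N with
    | zero => simp
    | succ N => simp [pow_succ]; field_simp
  have hinv : HasDerivAt (fun s : ℝ => (N : ℂ) / s) (-(N / s ^ 2)) s := by
    have h := ((hasDerivAt_id s).ofReal_comp.inv hs').const_mul (N : ℂ)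
    simp only [div_eq_mul_inv]
    refine h.congr_deriv ?_
    simp
    ring
  obtain ⟨h1, h2⟩ := hF.hasDerivAt_real s
  refine ⟨(hpow.mul h1).congr_deriv (by ring), (hpow.mul ((hinv.mul h1).add h2)).congr_deriv ?_⟩
  simp only [Pi.mul_apply, Pi.add_apply]
  ring

end Real

/-! ### Uniqueness for linear equations of order two -/

/-- Grönwall's inequality for the first-order system satisfied by `(y, y')`, with zero initial value
and coefficients bounded on compact intervals. -/
lemma eq_zero_of_linear_ode {y y' p q : ℝ → ℂ} {s₀ : ℝ} (hp : ContinuousOn p (Set.Ici s₀))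
    (hq : ContinuousOn q (Set.Ici s₀)) (hy : ∀ t, s₀ ≤ t → HasDerivAt y (y' t) t)
    (hy' : ∀ t, s₀ ≤ t → HasDerivAt y' (p t * y' t + q t * y t) t) (h0 : y s₀ = 0) (h0' : y' s₀ = 0)
    {t : ℝ} (ht : s₀ ≤ t) : y t = 0 := by
  have hsub : Set.Icc s₀ t ⊆ Set.Ici s₀ := fun u hu => hu.1
  obtain ⟨C, hC⟩ := isCompact_Icc.bddAbove_image (hp.mono hsub).norm
  obtain ⟨C', hC'⟩ := isCompact_Icc.bddAbove_image (hq.mono hsub).norm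
  have hv : ∀ u, s₀ ≤ u → HasDerivAt (fun t => (y t, y' t)) (y' u, p u * y' u + q u * y u) u :=
    fun u hu => (hy u hu).prodMk (hy' u hu)
  have h := norm_le_gronwallBound_of_norm_deriv_right_le (f := fun t => (y t, y' t))
    (f' := fun u => (y' u, p u * y' u + q u * y u)) (δ := 0) (ε := 0) (K := max 1 (C + C')) (a := s₀) (b := t)
    (fun u hu => (hv u hu.1).continuousAt.continuousWithinAt) (fun u hu => (hv u hu.1).hasDerivWithinAt)
    (by simp [h0, h0']) (fun u hu => ?_) t ⟨ht, le_rfl⟩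
  · rw [gronwallBound_ε0_δ0, norm_le_zero_iff] at h
    exact congrArg Prod.fst h
  · have h1 : ‖p u‖ ≤ C := hC ⟨u, ⟨hu.1, hu.2.le⟩, rfl⟩
    have h2 : ‖q u‖ ≤ C' := hC' ⟨u, ⟨hu.1, hu.2.le⟩, rfl⟩
    have h3 := norm_fst_le (y u, y' u)
    have h4 := norm_snd_le (y u, y' u)
    simp only at h3 h4
    rw [add_zero, Prod.norm_def]
    refine max_le ?_ ?_
    · calc ‖y' u‖ ≤ 1 * ‖(y u, y' u)‖ := by rwa [one_mul]
        _ ≤ _ := by gcongr; exact le_max_left _ _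
    · calc ‖p u * y' u + q u * y u‖ ≤ ‖p u‖ * ‖y' u‖ + ‖q u‖ * ‖y u‖ := by
            rw [← norm_mul, ← norm_mul]; exact norm_add_le _ _
        _ ≤ C * ‖(y u, y' u)‖ + C' * ‖(y u, y' u)‖ := by
            gcongr
            exact (norm_nonneg _).trans h1
            exact (norm_nonneg _).trans h2
        _ = (C + C') * ‖(y u, y' u)‖ := by ring
        _ ≤ _ := by gcongr; exact le_max_right _ _

end RealHyp

namespace RealHyp

open scoped Topology ContDiff Matrix.Norms.Operator Matrix ComplexConjugate

/-! ### Solutions of the radial equation -/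

lemma iteratedDeriv_pow_mul_zero (N : ℕ) {y : ℝ → ℂ} (hy : ContDiff ℝ ∞ y) :
    iteratedDeriv N (fun s : ℝ => (s : ℂ) ^ N * y s) 0 = (N.factorial : ℂ) * y 0 := by
  induction N generalizing y with
  | zero => simp
  | succ N ih =>
    have hd : Differentiable ℝ y := hy.differentiable (by simp)
    have hy' : ContDiff ℝ ∞ (deriv y) := (contDiff_infty_iff_deriv.1 hy).2
    have h1 : deriv (fun s : ℝ => (s : ℂ) ^ (N + 1) * y s) =
        fun s : ℝ => (s : ℂ) ^ N * (((N : ℂ) + 1) * y s + s * deriv y s) := by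
      funext s
      have h2 : HasDerivAt (fun s : ℝ => (s : ℂ) ^ (N + 1)) (((N : ℂ) + 1) * s ^ N) s := by
        refine ((hasDerivAt_id s).ofReal_comp.pow (N + 1)).congr_deriv ?_
        simp
      refine (h2.mul (hd s).hasDerivAt).deriv.trans ?_
      ring
    have h3 : ContDiff ℝ ∞ fun s : ℝ => (s : ℂ) := Complex.ofRealCLM.contDiff
    rw [iteratedDeriv_succ', h1, ih ((contDiff_const.mul hy).add (h3.mul hy')), Nat.factorial_succ]
    push_cast
    ring

section Ode

variable {a b : ℂ} {n N : ℕ} {f f' f'' : ℝ → ℂ} {G : ℂ → ℂ}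

lemma IsGauss.apply_zero {c : ℂ} (hG : IsGauss a b c G) : G 0 = 1 := by
  have h := hG.2 0 (by simp)
  have h1 := hasSum_single (f := fun n => hgCoeff a b c n * (0 : ℂ) ^ n) 0 fun n hn => by simp [hn]
  rw [h.unique h1, hgCoeff_zero]
  simp

lemma IsGauss.contDiff_real {c : ℂ} (hG : IsGauss a b c G) : ContDiff ℝ ∞ fun s : ℝ => G (-(s : ℂ) ^ 2) := by
  rw [contDiff_iff_contDiffAt]
  intro s
  have h1 : ContDiffAt ℂ ∞ G (-(s : ℂ) ^ 2) :=
    (hG.1.analyticAt (isOpen_hgDomain.mem_nhds (neg_sq_mem_hgDomain s))).contDiffAt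
  have h2 : ContDiff ℝ ∞ fun s : ℝ => -(s : ℂ) ^ 2 := (Complex.ofRealCLM.contDiff.pow 2).neg
  exact ContDiffAt.comp (g := G) s (h1.restrict_scalars ℝ) h2.contDiffAt

/-- `s^N F(-s²)` solves the radial equation. -/
lemma IsGauss.radial (hab : a + b = ((n : ℂ) + 1) / 2)
    (hG : IsGauss (a + N / 2) (b + N / 2) (((n : ℂ) + 1) / 2 + N) G) {s : ℝ} (hs : 0 < s) :
    (s : ℂ) ^ 2 * (1 + s ^ 2) * ((s : ℂ) ^ N * (N * (N - 1) / s ^ 2 * G (-(s : ℂ) ^ 2) +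
      2 * N / s * (-2 * s * deriv G (-(s : ℂ) ^ 2)) +
        (-2 * deriv G (-(s : ℂ) ^ 2) + 4 * s ^ 2 * deriv (deriv G) (-(s : ℂ) ^ 2)))) +
      ((n + 2) * s ^ 3 + n * s) *
        ((s : ℂ) ^ N * (N / s * G (-(s : ℂ) ^ 2) + -2 * s * deriv G (-(s : ℂ) ^ 2))) +
      (-(N * (N + n - 1)) + 4 * a * b * s ^ 2) * ((s : ℂ) ^ N * G (-(s : ℂ) ^ 2)) = 0 := by
  have hs' : (s : ℂ) ≠ 0 := by exact_mod_cast hs.ne'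
  have hc : ∀ m : ℕ, ((n : ℂ) + 1) / 2 + N + m ≠ 0 := fun m h => by
    have h1 : (((((n : ℝ) + 1) / 2 + N + m : ℝ)) : ℂ) = 0 := by push_cast; exact h
    have h2 : ((n : ℝ) + 1) / 2 + N + m = 0 := by exact_mod_cast h1
    have : (0 : ℝ) < ((n : ℝ) + 1) / 2 + N + m := by positivity
    linarith
  have h := hG.ode hc (neg_sq_mem_hgDomain s)
  obtain rfl : b = ((n : ℂ) + 1) / 2 - a := by rw [← hab]; ring
  field_simp
  linear_combination (-8 * (s : ℂ) ^ 2 * (s : ℂ) ^ N) * h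

/-- A solution of the radial equation that is regular at `0` is a multiple of the hypergeometric one. -/
lemma exists_eq_mul_gauss (hn : 1 ≤ n) (hab : a + b = ((n : ℂ) + 1) / 2)
    (hG : IsGauss (a + N / 2) (b + N / 2) (((n : ℂ) + 1) / 2 + N) G)
    (hf : ∀ s, HasDerivAt f (f' s) s) (hf' : ∀ s, HasDerivAt f' (f'' s) s)
    (hode : ∀ s : ℝ, 0 < s → (s : ℂ) ^ 2 * (1 + s ^ 2) * f'' s + ((n + 2) * s ^ 3 + n * s) * f' s +
      (-(N * (N + n - 1)) + 4 * a * b * s ^ 2) * f s = 0) :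
    ∃ κ : ℂ, ∀ s : ℝ, 0 < s → f s = κ * ((s : ℂ) ^ N * G (-(s : ℂ) ^ 2)) := by
  set g : ℝ → ℂ := fun s => (s : ℂ) ^ N * G (-(s : ℂ) ^ 2) with hg_def
  set g' : ℝ → ℂ := fun s => (s : ℂ) ^ N * (N / s * G (-(s : ℂ) ^ 2) + -2 * s * deriv G (-(s : ℂ) ^ 2))
    with hg'_def
  obtain ⟨g'', hg, hg', hgode⟩ : ∃ g'' : ℝ → ℂ, (∀ s, 0 < s → HasDerivAt g (g' s) s) ∧
      (∀ s, 0 < s → HasDerivAt g' (g'' s) s) ∧ ∀ s : ℝ, 0 < s →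
      (s : ℂ) ^ 2 * (1 + s ^ 2) * g'' s + ((n + 2) * s ^ 3 + n * s) * g' s +
      (-(N * (N + n - 1)) + 4 * a * b * s ^ 2) * g s = 0 :=
    ⟨_, fun s hs => (hG.hasDerivAt_pow_mul N hs.ne').1, fun s hs => (hG.hasDerivAt_pow_mul N hs.ne').2,
      fun s hs => hG.radial hab hs⟩
  have hne : ∀ s : ℝ, 0 < s → (s : ℂ) ≠ 0 := fun s hs => by exact_mod_cast hs.ne'
  have hne1 : ∀ s : ℝ, (1 : ℂ) + s ^ 2 ≠ 0 := fun s => by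
    have : (1 : ℝ) + s ^ 2 ≠ 0 := by positivity
    exact_mod_cast this
  -- the Wronskian
  have hcoe : ∀ s : ℝ, HasDerivAt (fun s : ℝ => (s : ℂ)) 1 s := fun s => (hasDerivAt_id s).ofReal_comp
  obtain ⟨m, rfl⟩ : ∃ m, n = m + 1 := ⟨n - 1, by omega⟩
  have hKd : ∀ s : ℝ, 0 < s → HasDerivAt
      (fun s : ℝ => (s : ℂ) ^ (m + 1) * (1 + (s : ℂ) ^ 2) * (f s * g' s - f' s * g s)) 0 s := fun s hs => by
    have h1 : HasDerivAt (fun s : ℝ => (s : ℂ) ^ (m + 1) * (1 + (s : ℂ) ^ 2))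
        (((m : ℂ) + 1) * (s : ℂ) ^ m * (1 + (s : ℂ) ^ 2) + (s : ℂ) ^ (m + 1) * (2 * (s : ℂ))) s := by
      refine (((hcoe s).pow (m + 1)).mul (((hcoe s).pow 2).const_add 1)).congr_deriv ?_
      simp
    refine (h1.mul (((hf s).mul (hg' s hs)).sub ((hf' s).mul (hg s hs)))).congr_deriv ?_
    have h2 := hode s hs
    have h3 := hgode s hs
    push_cast at h2 h3
    refine mul_left_cancel₀ (hne s hs) ?_
    simp only [Pi.mul_apply, Pi.sub_apply]
    linear_combination (s : ℂ) ^ m * (f s * h3 - g s * h2)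
  -- By Abel's identity the Wronskian times `s^n (1 + s²)` is constant. `Kt` is its continuous
  -- extension to `s = 0`, obtained by cancelling the negative power of `s` in `g'`. It vanishes
  -- there because `f` is regular at `0` and `n ≥ 1`.
  have hW : ∀ s : ℝ, 0 < s → f s * g' s - f' s * g s = 0 := by
    set Kt : ℝ → ℂ := fun s => (1 + (s : ℂ) ^ 2) * (f s * (s : ℂ) ^ m * (s : ℂ) ^ N *
      (N * G (-(s : ℂ) ^ 2) - 2 * (s : ℂ) ^ 2 * deriv G (-(s : ℂ) ^ 2)) -
        (s : ℂ) ^ (m + 1) * f' s * ((s : ℂ) ^ N * G (-(s : ℂ) ^ 2))) with hKt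
    have hKt0 : Kt 0 = 0 := by
      rcases Nat.eq_zero_or_pos N with rfl | hN
      · simp [hKt]
      · simp [hKt, hN.ne']
    have hKe : ∀ s : ℝ, 0 < s →
        (s : ℂ) ^ (m + 1) * (1 + (s : ℂ) ^ 2) * (f s * g' s - f' s * g s) = Kt s := fun s hs => by
      have := hne s hs
      simp only [hKt, hg_def, hg'_def]
      field_simp
      ring
    have hKc : Continuous Kt := by
      have c1 : Continuous fun s : ℝ => G (-(s : ℂ) ^ 2) :=
        continuous_iff_continuousAt.2 fun s => (hG.hasDerivAt_real s).1.continuousAt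
      have c2 : Continuous fun s : ℝ => -2 * (s : ℂ) * deriv G (-(s : ℂ) ^ 2) :=
        continuous_iff_continuousAt.2 fun s => (hG.hasDerivAt_real s).2.continuousAt
      have c3 : Continuous fun s : ℝ => 2 * (s : ℂ) ^ 2 * deriv G (-(s : ℂ) ^ 2) :=
        (Complex.continuous_ofReal.neg.mul c2).congr fun s => by
          show -(s : ℂ) * (-2 * (s : ℂ) * deriv G (-(s : ℂ) ^ 2)) = _
          ring
      have c4 : Continuous f := continuous_iff_continuousAt.2 fun s => (hf s).continuousAt
      have c5 : Continuous f' := continuous_iff_continuousAt.2 fun s => (hf' s).continuousAt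
      have c0 := Complex.continuous_ofReal
      exact (continuous_const.add (c0.pow 2)).mul
        ((((c4.mul (c0.pow m)).mul (c0.pow N)).mul ((continuous_const.mul c1).sub c3)).sub
          (((c0.pow (m + 1)).mul c5).mul ((c0.pow N).mul c1)))
    have hconst : ∀ s : ℝ, 0 < s → ∀ t : ℝ, 0 < t → Kt s = Kt t := fun s hs t ht => by
      rw [← hKe s hs, ← hKe t ht]
      exact isOpen_Ioi.is_const_of_deriv_eq_zero isPreconnected_Ioi
        (fun x hx => (hKd x hx).differentiableAt.differentiableWithinAt)
        (fun x hx => (hKd x hx).deriv) hs ht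
    intro s hs
    have h1 : Filter.Tendsto Kt (𝓝[>] 0) (𝓝 (Kt s)) :=
      tendsto_const_nhds.congr' (by filter_upwards [self_mem_nhdsWithin] with t ht using hconst s hs t ht)
    have h2 : Kt s = 0 := tendsto_nhds_unique h1 (hKt0 ▸ (hKc.tendsto 0).mono_left nhdsWithin_le_nhds)
    rw [← hKe s hs] at h2
    exact (mul_eq_zero.1 h2).resolve_left (mul_ne_zero (pow_ne_zero _ (hne s hs)) (hne1 s))
  -- `g` does not vanish near `0`
  obtain ⟨ε, hε, hgne⟩ : ∃ ε > 0, ∀ s : ℝ, 0 < s → s < ε → g s ≠ 0 := by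
    have c1 : ContinuousAt (fun s : ℝ => G (-(s : ℂ) ^ 2)) 0 := (hG.hasDerivAt_real 0).1.continuousAt
    have h1 : ∀ᶠ s : ℝ in 𝓝 0, G (-(s : ℂ) ^ 2) ≠ 0 :=
      c1.eventually_ne (by simp [hG.apply_zero])
    obtain ⟨ε, hε, h2⟩ := Metric.eventually_nhds_iff.1 h1
    exact ⟨ε, hε, fun s hs hsε => mul_ne_zero (pow_ne_zero _ (hne s hs))
      (h2 (by rwa [Real.dist_eq, sub_zero, abs_of_pos hs]))⟩
  -- `g` is known to be nonzero only near `0`, so the quotient is formed at such a `σ`. With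
  -- vanishing Wronskian, `f - (f σ / g σ) g` has zero Cauchy data at `σ`, and uniqueness propagates
  -- this to all `s ≥ σ`.
  have hprop : ∀ σ : ℝ, 0 < σ → σ < ε → ∀ s, σ ≤ s → f s = f σ / g σ * g s := by
    intro σ hσ hσε s hs
    have hgσ := hgne σ hσ hσε
    have hden : ∀ t : ℝ, t ∈ Set.Ici σ → (t : ℂ) ^ 2 * (1 + (t : ℂ) ^ 2) ≠ 0 := fun t ht =>
      mul_ne_zero (pow_ne_zero _ (hne t (hσ.trans_le ht))) (hne1 t)
    have key := eq_zero_of_linear_ode (s₀ := σ) (y := fun t => f t - f σ / g σ * g t)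
      (y' := fun t => f' t - f σ / g σ * g' t)
      (p := fun t => -(((m : ℂ) + 1 + 2) * (t : ℂ) ^ 3 + ((m : ℂ) + 1) * t) / ((t : ℂ) ^ 2 * (1 + (t : ℂ) ^ 2)))
      (q := fun t => -(-(N * (N + ((m : ℂ) + 1) - 1)) + 4 * a * b * (t : ℂ) ^ 2) /
        ((t : ℂ) ^ 2 * (1 + (t : ℂ) ^ 2)))
      (ContinuousOn.div (by fun_prop) (by fun_prop) hden) (ContinuousOn.div (by fun_prop) (by fun_prop) hden)
      (fun t ht => (hf t).sub ((hg t (hσ.trans_le ht)).const_mul _))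
      (fun t ht => by
        refine ((hf' t).sub ((hg' t (hσ.trans_le ht)).const_mul _)).congr_deriv ?_
        have h2 := hode t (hσ.trans_le ht)
        have h3 := hgode t (hσ.trans_le ht)
        push_cast at h2 h3
        have h4 := hden t ht
        generalize f σ / g σ = c
        rw [div_mul_eq_mul_div, div_mul_eq_mul_div, ← add_div, eq_div_iff h4]
        linear_combination h2 - c * h3)
      (by simp [hgσ])
      (by
        have h5 := hW σ hσ
        show f' σ - f σ / g σ * g' σ = 0
        field_simp
        linear_combination -h5) hs
    exact sub_eq_zero.1 key
  refine ⟨f (ε / 2) / g (ε / 2), fun s hs => ?_⟩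
  rcases le_or_gt (ε / 2) s with h | h
  · exact hprop _ (by positivity) (by linarith) s h
  · have h1 := hprop s hs (by linarith) (ε / 2) h.le
    have h2 := hgne (ε / 2) (by positivity) (by linarith)
    have h3 := hgne s hs (by linarith)
    change f s = f (ε / 2) / g (ε / 2) * g s
    rw [h1]
    field_simp

/-- The multiple is determined by a derivative at `0`. -/
lemma eq_iteratedDeriv_mul_gauss (hn : 1 ≤ n) (hab : a + b = ((n : ℂ) + 1) / 2)
    (hG : IsGauss (a + N / 2) (b + N / 2) (((n : ℂ) + 1) / 2 + N) G) (hfs : ContDiff ℝ ∞ f)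
    (hf : ∀ s, HasDerivAt f (f' s) s) (hf' : ∀ s, HasDerivAt f' (f'' s) s)
    (hode : ∀ s : ℝ, 0 < s → (s : ℂ) ^ 2 * (1 + s ^ 2) * f'' s + ((n + 2) * s ^ 3 + n * s) * f' s +
      (-(N * (N + n - 1)) + 4 * a * b * s ^ 2) * f s = 0) {s : ℝ} (hs : 0 < s) :
    f s = iteratedDeriv N f 0 / N.factorial * (s : ℂ) ^ N * G (-(s : ℂ) ^ 2) := by
  obtain ⟨κ, hκ⟩ := exists_eq_mul_gauss hn hab hG hf hf' hode
  have h3 : ContDiff ℝ ∞ fun s : ℝ => (s : ℂ) := Complex.ofRealCLM.contDiff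
  have hgs : ContDiff ℝ ∞ fun s : ℝ => (s : ℂ) ^ N * (κ * G (-(s : ℂ) ^ 2)) :=
    (h3.pow N).mul (contDiff_const.mul hG.contDiff_real)
  -- The two functions are known to agree only for `s > 0`. Their `N`-th derivatives agree there,
  -- and continuity carries the equality to `0`.
  have h1 : Set.EqOn (iteratedDeriv N f) (iteratedDeriv N fun s : ℝ => (s : ℂ) ^ N * (κ * G (-(s : ℂ) ^ 2)))
      (Set.Ioi 0) := fun t ht => by
    refine Filter.EventuallyEq.iteratedDeriv_eq N ?_
    filter_upwards [isOpen_Ioi.mem_nhds ht] with x hx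
    rw [hκ x hx]
    ring
  have h2 : iteratedDeriv N f 0 = iteratedDeriv N (fun s : ℝ => (s : ℂ) ^ N * (κ * G (-(s : ℂ) ^ 2))) 0 := by
    refine (h1.closure (hfs.continuous_iteratedDeriv N (by exact_mod_cast le_top))
      (hgs.continuous_iteratedDeriv N (by exact_mod_cast le_top))) ?_
    rw [closure_Ioi]
    exact Set.self_mem_Ici
  have h4 := iteratedDeriv_pow_mul_zero N (contDiff_const.mul hG.contDiff_real : ContDiff ℝ ∞
    fun s : ℝ => κ * G (-(s : ℂ) ^ 2))
  have h5 : (N.factorial : ℂ) ≠ 0 := by exact_mod_cast N.factorial_ne_zero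
  rw [h2, h4, hκ s hs]
  simp only [Complex.ofReal_zero, ne_eq, OfNat.ofNat_ne_zero, not_false_eq_true, zero_pow, neg_zero,
    hG.apply_zero]
  field_simp

/-- The case of dimension two, in which the radial equation is regular at `0`. -/
lemma eq_add_gauss {G₀ G₁ : ℂ → ℂ} (hab : a + b = 1 / 2) (hG₀ : IsGauss a b (1 / 2) G₀)
    (hG₁ : IsGauss (a + 1 / 2) (b + 1 / 2) (3 / 2) G₁)
    (hf : ∀ s, HasDerivAt f (f' s) s) (hf' : ∀ s, HasDerivAt f' (f'' s) s) (hf'' : Continuous f'')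
    (hode : ∀ s : ℝ, 0 < s → (1 + (s : ℂ) ^ 2) * f'' s + 2 * s * f' s + 4 * a * b * f s = 0)
    {s : ℝ} (hs : 0 < s) :
    f s = f 0 * G₀ (-(s : ℂ) ^ 2) + f' 0 * s * G₁ (-(s : ℂ) ^ 2) := by
  have c0 := Complex.continuous_ofReal
  have cf : Continuous f := continuous_iff_continuousAt.2 fun s => (hf s).continuousAt
  have cf' : Continuous f' := continuous_iff_continuousAt.2 fun s => (hf' s).continuousAt
  -- For `l = 2` the equation has no singularity at `0`, so it extends there by continuity. This is
  -- what allows the uniqueness argument to start at `0`.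
  have hode0 : ∀ s : ℝ, 0 ≤ s → (1 + (s : ℂ) ^ 2) * f'' s + 2 * s * f' s + 4 * a * b * f s = 0 := by
    have h1 : Set.EqOn (fun s : ℝ => (1 + (s : ℂ) ^ 2) * f'' s + 2 * s * f' s + 4 * a * b * f s)
        (fun _ => 0) (Set.Ioi 0) := fun s hs => hode s hs
    intro s hs
    refine h1.closure (by fun_prop) (by fun_prop) ?_
    rwa [closure_Ioi]
  have hne1 : ∀ s : ℝ, (1 : ℂ) + s ^ 2 ≠ 0 := fun s => by
    have : (1 : ℝ) + s ^ 2 ≠ 0 := by positivity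
    exact_mod_cast this
  have hcoe : ∀ s : ℝ, HasDerivAt (fun s : ℝ => (s : ℂ)) 1 s := fun s => (hasDerivAt_id s).ofReal_comp
  have hc0 : ∀ m : ℕ, (1 / 2 : ℂ) + m ≠ 0 := fun m h => by
    have h1 : (((1 / 2 + m : ℝ)) : ℂ) = 0 := by push_cast; exact h
    have h2 : (1 / 2 + m : ℝ) = 0 := by exact_mod_cast h1
    have : (0 : ℝ) < 1 / 2 + m := by positivity
    linarith
  have hc1 : ∀ m : ℕ, (3 / 2 : ℂ) + m ≠ 0 := fun m h => by
    have h1 : (((3 / 2 + m : ℝ)) : ℂ) = 0 := by push_cast; exact h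
    have h2 : (3 / 2 + m : ℝ) = 0 := by exact_mod_cast h1
    have : (0 : ℝ) < 3 / 2 + m := by positivity
    linarith
  obtain rfl : b = 1 / 2 - a := by rw [← hab]; ring
  have key := eq_zero_of_linear_ode (s₀ := 0)
    (y := fun t => f t - f 0 * G₀ (-(t : ℂ) ^ 2) - f' 0 * (t * G₁ (-(t : ℂ) ^ 2)))
    (y' := fun t => f' t - f 0 * (-2 * t * deriv G₀ (-(t : ℂ) ^ 2)) -
      f' 0 * (1 * G₁ (-(t : ℂ) ^ 2) + t * (-2 * t * deriv G₁ (-(t : ℂ) ^ 2))))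
    (p := fun t => -(2 * t) / (1 + (t : ℂ) ^ 2)) (q := fun t => -(4 * a * (1 / 2 - a)) / (1 + (t : ℂ) ^ 2))
    (ContinuousOn.div (by fun_prop) (by fun_prop) fun t _ => hne1 t)
    (ContinuousOn.div (by fun_prop) (by fun_prop) fun t _ => hne1 t)
    (fun t ht => ((hf t).sub ((hG₀.hasDerivAt_real t).1.const_mul _)).sub
      (((hcoe t).mul (hG₁.hasDerivAt_real t).1).const_mul _))
    (fun t ht => by
      refine (((hf' t).sub ((hG₀.hasDerivAt_real t).2.const_mul _)).sub
        ((((hG₁.hasDerivAt_real t).1.const_mul 1).add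
          ((hcoe t).mul (hG₁.hasDerivAt_real t).2)).const_mul _)).congr_deriv ?_
      have h2 := hode0 t ht
      have h3 := hG₀.ode hc0 (neg_sq_mem_hgDomain t)
      have h4 := hG₁.ode hc1 (neg_sq_mem_hgDomain t)
      rw [div_mul_eq_mul_div, div_mul_eq_mul_div, ← add_div, eq_div_iff (hne1 t)]
      linear_combination h2 + 4 * f 0 * h3 + 4 * f' 0 * t * h4)
    (by simp [hG₀.apply_zero])
    (by simp [hG₁.apply_zero]) hs.le
  linear_combination key

end Ode

end RealHyp

namespace RealHyp

open scoped Topology ContDiff Matrix.Norms.Operator Matrix ComplexConjugate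

variable {n : ℕ}

/-! ### The rescaled radial equation -/

section Rescaled

variable {l : ℕ} {u : SOo l → ℂ}

lemma hasDerivAt_scaled_slice (hu : IsSmooth u) (X : so1 l) (c s : ℝ) :
    HasDerivAt (fun s : ℝ => u (expG ((c * s) • X))) (c * lieD X u (expG ((c * s) • X))) s := by
  have h1 : HasDerivAt (fun s : ℝ => c * s) c s := ((hasDerivAt_id s).const_mul c).congr_deriv (mul_one c)
  exact ((hasDerivAt_slice hu X (c * s)).scomp s h1).congr_deriv (Complex.real_smul ..)

lemma IsSmooth.lieD_iterate (hu : IsSmooth u) (X : so1 l) (k : ℕ) : IsSmooth ((RealHyp.lieD X)^[k] u) := by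
  induction k with
  | zero => exact hu
  | succ k ih => rw [Function.iterate_succ_apply']; exact ih.lieD X

lemma iteratedDeriv_scaled_slice (hu : IsSmooth u) (X : so1 l) (c : ℝ) (k : ℕ) :
    iteratedDeriv k (fun s : ℝ => u (expG ((c * s) • X))) =
      fun s => (c : ℂ) ^ k * (lieD X)^[k] u (expG ((c * s) • X)) := by
  induction k with
  | zero => simp
  | succ k ih =>
    rw [iteratedDeriv_succ, ih]
    funext s
    rw [((hasDerivAt_scaled_slice (hu.lieD_iterate X k) X c s).const_mul _).deriv]
    rw [Function.iterate_succ_apply']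
    ring

lemma contDiff_scaled_slice (hu : IsSmooth u) (X : so1 l) (c : ℝ) :
    ContDiff ℝ ∞ fun s : ℝ => u (expG ((c * s) • X)) := by
  refine contDiff_of_differentiable_iteratedDeriv fun k _ => ?_
  rw [iteratedDeriv_scaled_slice hu]
  exact fun s => ((hasDerivAt_scaled_slice (hu.lieD_iterate X k) X c s).const_mul _).differentiableAt

end Rescaled

section Formulas

variable {x : Fin (n + 1) → ℝ} {Z : Fin n → mLie (n + 2)} {u : SOo (n + 2) → ℂ}

/-- Replacing `s` by `c s` with `c² = 4(l-1)` removes the dimension from the leading coefficient,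
which becomes `s²(1 + s²)`. The equation then matches the hypergeometric one in the variable `-s²`.
-/
lemma radial_equation_rescaled (hu : IsSmoothOnX u) {μ a b E : ℂ} (he : ∀ g, casimir u g = μ * u g)
    (hA : IsLeftAInvariant u) (hx : Btheta (Nm x : Mat (n + 2)) (Nm x) = 1)
    (hZ : IsFrame (l := n + 2) (Nm x) Z)
    (hE : ∀ s : ℝ, ∑ j, leftD (Z j : so1 (n + 2)) (leftD (Z j : so1 (n + 2)) u) (expG (s • Nm x)) =
      E * u (expG (s • Nm x))) (hab : 4 * a * b = -(2 * ((n : ℂ) + 1) * μ))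
    {c : ℝ} (hc : c ^ 2 = 4 * ((n : ℝ) + 1)) (s : ℝ) :
    (s : ℂ) ^ 2 * (1 + s ^ 2) * (c * (c * lieD (Nm x) (lieD (Nm x) u) (expG ((c * s) • Nm x)))) +
      ((n + 2) * s ^ 3 + n * s) * (c * lieD (Nm x) u (expG ((c * s) • Nm x))) +
      (E + 4 * a * b * s ^ 2) * u (expG ((c * s) • Nm x)) = 0 := by
  have h := radial_equation hu he hA hx hZ (hE (c * s))
  have hc' : (c : ℂ) ^ 2 = 4 * ((n : ℂ) + 1) := by exact_mod_cast hc
  have hc0 : (c : ℂ) ^ 2 ≠ 0 := by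
    rw [hc']
    exact mul_ne_zero (by norm_num) (by exact_mod_cast Nat.succ_ne_zero n)
  push_cast at h
  rw [← hc'] at h
  rw [hab]
  refine mul_left_cancel₀ hc0 ?_
  linear_combination -h

end Formulas

/-! ### The integral over the closed geodesic -/

section Geodesic

/-- The geodesic is parametrized by the unit vector `H_1 = H_0 / √(2(l-1))`. The change of variable
to `a_t` produces the square root. -/
lemma geodesicIntegral_eq {Γ : Subgroup (SOo (n + 2))} {γ : SOo (n + 2)} (D : GeodesicData Γ γ)
    (f : SOo (n + 2) → ℂ) :
    geodesicIntegral D f = (Real.sqrt (2 * ((n : ℝ) + 1)) : ℂ) * weightA D f 1 := by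
  have hl : 2 * (((n + 2 : ℕ) : ℝ) - 1) = 2 * ((n : ℝ) + 1) := by push_cast; ring
  have hc : Real.sqrt (2 * ((n : ℝ) + 1)) ≠ 0 := (Real.sqrt_pos.2 (by positivity)).ne'
  rw [geodesicIntegral, weightA, hl]
  set c := Real.sqrt (2 * ((n : ℝ) + 1)) with hcdef
  have h := intervalIntegral.integral_comp_div (a := 0) (b := c * D.L₀)
    (fun t => f (D.α⁻¹ * a t * 1)) hc
  rw [zero_div, mul_div_cancel_left₀ _ hc, Complex.real_smul] at h
  rw [← h]
  refine intervalIntegral.integral_congr fun t _ => ?_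
  show f _ = f _
  rw [mul_one, H1, hl, ← hcdef, smul_smul]
  rfl

lemma weight_two {Γ : Subgroup (SOo (0 + 2))} {γ : SOo (0 + 2)} (D : GeodesicData Γ γ)
    (dz : Measure D.cent) [IsProbabilityMeasure dz] (φ : SOo (0 + 2) → ℂ) :
    weight D dz φ = weightA D φ := by
  funext x
  simp only [weight, weightA, eq_one_of_M_two, Subgroup.coe_one, mul_one]
  simp

end Geodesic

/-! ### The components on the slices -/

section Slices

variable (dm : Measure (M (n + 2))) [dm.IsHaarMeasure] [IsProbabilityMeasure dm]
  {Γ : Subgroup (SOo (n + 2))} {γ : SOo (n + 2)} (D : GeodesicData Γ γ) {φ I : SOo (n + 2) → ℂ} {μ r : ℂ}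
  {x : Fin (n + 1) → ℝ} {Z : Fin n → mLie (n + 2)} {π : IrrRep (n + 2)} {N : ℕ}

lemma half_add_nat_ne_zero (n N m : ℕ) : ((n : ℂ) + 1) / 2 + N + m ≠ 0 := fun h => by
  have h1 : (((((n : ℝ) + 1) / 2 + N + m : ℝ)) : ℂ) = 0 := by push_cast; exact h
  have h2 : ((n : ℝ) + 1) / 2 + N + m = 0 := by exact_mod_cast h1
  have : (0 : ℝ) < ((n : ℝ) + 1) / 2 + N + m := by positivity
  linarith

lemma HasLevel.comp_slice_eq (h : HasLevel π N) (hn : 1 ≤ n) (hI : IsSmoothOnX I)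
    (he : ∀ g, casimir I g = μ * I g) (hA : IsLeftAInvariant I)
    (hx : Btheta (Nm x : Mat (n + 2)) (Nm x) = 1) (hZ : IsFrame (l := n + 2) (Nm x) Z)
    {a b : ℂ} (hab : a + b = ((n : ℂ) + 1) / 2) (hab' : 4 * a * b = -(2 * ((n : ℂ) + 1) * μ))
    {c : ℝ} (hc : c ^ 2 = 4 * ((n : ℝ) + 1)) {s : ℝ} (hs : 0 < s) :
    comp dm π I (expG ((c * s) • Nm x)) =
      (c : ℂ) ^ N * (lieD (Nm x))^[N] (comp dm π I) 1 / N.factorial * (s : ℂ) ^ N *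
        gauss2F1 (a + N / 2) (b + N / 2) (((n : ℂ) + 1) / 2 + N) (-(s : ℂ) ^ 2) := by
  have hu := isSmoothOnX_comp dm π hI
  have hG := gauss2F1_spec (exists_isGauss (a := a + N / 2) (b := b + N / 2)
    (half_add_nat_ne_zero n N))
  have key := eq_iteratedDeriv_mul_gauss hn hab hG (contDiff_scaled_slice hu.1 (Nm x) c)
    (hasDerivAt_scaled_slice hu.1 (Nm x) c)
    (fun s => (hasDerivAt_scaled_slice (hu.1.lieD (Nm x)) (Nm x) c s).const_mul (c : ℂ))
    (fun s _ => radial_equation_rescaled hu (casimir_comp dm π hI.1 he) (isLeftAInvariant_comp dm π hA)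
      hx hZ (h.sum_leftD_comp dm hI hx hZ) hab' hc s) hs
  rw [key, iteratedDeriv_scaled_slice hu.1]
  simp only [mul_zero, zero_smul, expG_zero]

lemma slice_two {Γ : Subgroup (SOo (0 + 2))} {γ : SOo (0 + 2)} (D : GeodesicData Γ γ)
    {φ : SOo (0 + 2) → ℂ} {x : Fin (0 + 1) → ℝ} (hφ : IsSmoothOnX φ)
    (he : ∀ g, casimir (weightA D φ) g = μ * weightA D φ g) (hA : IsLeftAInvariant (weightA D φ))
    (hx : Btheta (Nm x : Mat (0 + 2)) (Nm x) = 1)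
    {a b : ℂ} (hab : a + b = 1 / 2) (hab' : 4 * a * b = -(2 * μ)) {s : ℝ} (hs : 0 < s) :
    weightA D φ (expG ((2 * s) • Nm x)) =
      ((Real.sqrt 2)⁻¹ : ℝ) * geodesicIntegral D φ * gauss2F1 a b (1 / 2) (-(s : ℂ) ^ 2) +
        (Real.sqrt 2 : ℝ) * geodesicIntegral D (lieD (Nm x) φ) * s *
          gauss2F1 (a + 1 / 2) (b + 1 / 2) (3 / 2) (-(s : ℂ) ^ 2) := by
  have hu := isSmoothOnX_weightA D hφ
  have hG₀ := gauss2F1_spec (exists_isGauss (a := a) (b := b) (c := 1 / 2) fun m => by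
    simpa using half_add_nat_ne_zero 0 0 m)
  have hG₁ := gauss2F1_spec (exists_isGauss (a := a + 1 / 2) (b := b + 1 / 2) (c := 3 / 2) fun m => by
    have h := half_add_nat_ne_zero 0 1 m
    rw [show ((0 : ℕ) + 1 : ℂ) / 2 + (1 : ℕ) = 3 / 2 by norm_num] at h
    exact h)
  have hZ : IsFrame (l := 0 + 2) (Nm x) (fun j : Fin 0 => j.elim0) := ⟨fun j => j.elim0, fun i => i.elim0⟩
  have hf'' : Continuous fun s : ℝ => ((2 : ℝ) : ℂ) * (((2 : ℝ) : ℂ) *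
      lieD (Nm x) (lieD (Nm x) (weightA D φ)) (expG (((2 : ℝ) * s) • Nm x))) :=
    continuous_const.mul (continuous_const.mul
      (contDiff_scaled_slice ((hu.1.lieD (Nm x)).lieD (Nm x)) (Nm x) 2).continuous)
  have key := eq_add_gauss hab hG₀ hG₁
    (hasDerivAt_scaled_slice hu.1 (Nm x) 2)
    (fun s => (hasDerivAt_scaled_slice (hu.1.lieD (Nm x)) (Nm x) 2 s).const_mul ((2 : ℝ) : ℂ)) hf''
    (fun s hs => by
      have h := radial_equation_rescaled hu he hA hx hZ (E := 0) (a := a) (b := b) (c := 2)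
        (fun s => by simp) (by simpa using hab') (by norm_num) s
      have hs0 : (s : ℂ) ^ 2 ≠ 0 := pow_ne_zero _ (by exact_mod_cast hs.ne')
      refine mul_left_cancel₀ hs0 ?_
      simp only [Nat.cast_zero] at h
      linear_combination h) hs
  have h2 : ((Real.sqrt 2 : ℝ) : ℂ) * (Real.sqrt 2 : ℝ) = 2 := by
    rw [← Complex.ofReal_mul, Real.mul_self_sqrt (by norm_num)]; norm_num
  have h20 : ((Real.sqrt 2 : ℝ) : ℂ) ≠ 0 := fun h => by simp [h] at h2
  -- The geodesic integral is `√2` times the value at the identity. This gives the coefficient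
  -- `1/√2` for the value, and `2/√2 = √2` for the derivative, where `2` is the chain-rule factor of
  -- the rescaling.
  rw [key, lieD_weightA D hφ.1, geodesicIntegral_eq, geodesicIntegral_eq]
  simp only [mul_zero, zero_smul, expG_zero, Nat.cast_zero, zero_add, mul_one, Complex.ofReal_inv,
    ← mul_assoc, inv_mul_cancel₀ h20, one_mul, h2, Complex.ofReal_ofNat]

lemma hasSliceFormulas (hφ : IsSmoothOnX φ) (hI : IsSmoothOnX I) (he : ∀ g, casimir I g = μ * I g)
    (hA : IsLeftAInvariant I) (h0 : n = 0 → I = weightA D φ)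
    (hr : μ = -(((((n + 2 : ℕ) : ℂ) - 1) / 2) ^ 2 + r ^ 2) / (4 * ((((n + 2 : ℕ) : ℂ) - 1) / 2))) :
    HasSliceFormulas dm D φ I μ r := by
  intro π X₁ hX₁ hX₁' ρ₀ a b F
  obtain ⟨x, rfl⟩ := exists_Nm_of_mem_nLie hX₁
  have hn1 : (n : ℂ) + 1 ≠ 0 := by exact_mod_cast Nat.succ_ne_zero n
  have hρ : ρ₀ = ((n : ℝ) + 1) / 2 := by simp only [ρ₀]; push_cast; ring
  have hab : a + b = ((n : ℂ) + 1) / 2 := by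
    simp only [a, b, hρ]; push_cast; ring
  -- `ab = (ρ₀² + r²)/4 = -ρ₀ μ` with `2ρ₀ = n + 1`. Together with `a + b = ρ₀`, these are the only
  -- facts about `a` and `b` needed below.
  have hab' : 4 * a * b = -(2 * ((n : ℂ) + 1) * μ) := by
    simp only [a, b, hρ, hr]
    push_cast
    rw [show (n : ℂ) + 2 - 1 = n + 1 by ring]
    field_simp
    linear_combination (-64 * r ^ 2) * Complex.I_sq
  refine ⟨fun h s _ => comp_slice_eq_zero dm hI h s, fun h Z hZ => ?_, fun hl s hs => ?_⟩
  · obtain ⟨N, hN⟩ := exists_hasLevel dm (isClassOne_of_fixedSpace h)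
    refine ⟨-((N : ℝ) * (N + n - 1)), neg_nonpos.2 hN.level_mul_nonneg, fun v hv => ?_,
      hN.satisfiesRadialODE dm hI he hA hX₁' hZ, ?_⟩
    · have h1 := hZ.sum_drmat_sq hX₁' hN hv
      simp only [hN.drmat_mulVec] at h1
      push_cast
      exact h1
    intro hl d w p
    have hn : 1 ≤ n := by omega
    have hn' : (1 : ℝ) ≤ n := by exact_mod_cast hn
    -- With `E = -N(N+n-1)` the radicand is a perfect square, and `n ≥ 1` makes the root given here
    -- nonnegative. Then `p = N/2`, so the integer `2p` is the level `N`.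
    have hw : w = ((n : ℝ) - 1 + 2 * N) / 4 := by
      have h1 : (1 - ρ₀) ^ 2 / 4 - d = (((n : ℝ) - 1 + 2 * N) / 4) ^ 2 := by
        simp only [d, hρ]; ring
      simp only [w]
      rw [h1, Real.sqrt_sq]
      have : (0 : ℝ) ≤ N := Nat.cast_nonneg N
      linarith
    have hp : p = (N : ℝ) / 2 := by simp only [p, hw, hρ]; ring
    refine ⟨N, by rw [hp]; ring, fun s hs => ?_⟩
    have hl1 : ((n + 2 : ℕ) : ℝ) - 1 = (n : ℝ) + 1 := by push_cast; ring
    have hpos : (0 : ℝ) ≤ (n : ℝ) + 1 := by positivity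
    have hc : (2 * Real.sqrt ((n : ℝ) + 1)) ^ 2 = 4 * ((n : ℝ) + 1) := by
      rw [mul_pow, Real.sq_sqrt hpos]; norm_num
    have hcp : (4 * ((n : ℝ) + 1)) ^ p = (2 * Real.sqrt ((n : ℝ) + 1)) ^ N := by
      rw [← hc, ← Real.rpow_natCast _ 2, ← Real.rpow_mul (by positivity), ← Real.rpow_natCast, hp]
      congr 1
      push_cast
      ring
    have key := hN.comp_slice_eq dm hn hI he hA hX₁' hZ hab hab' hc hs
    have e1 : (p : ℂ) = (N : ℂ) / 2 := by rw [hp]; push_cast; ring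
    have e2 : ((1 + 2 * w : ℝ) : ℂ) = ((n : ℂ) + 1) / 2 + N := by rw [hw]; push_cast; ring
    rw [hl1, hcp, e1, e2]
    change comp dm π I _ = _
    rw [key]
    push_cast
    ring
  · obtain rfl : n = 0 := by omega
    obtain rfl := h0 rfl
    have h1 := slice_two D hφ he hA hX₁' (a := a) (b := b) (by rw [hab]; simp) (by rw [hab']; simp) hs
    change comp dm π _ _ = _
    rw [comp_two]
    exact h1

end Slices

end RealHyp

end

/-! ### Assembly of the theorem for the two weights -/

open RealHyp in
theorem mainTheorem4 (l : ℕ) (hl : 2 ≤ l)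
    (Γ : Subgroup (SOo l)) (hdiscrete : DiscreteTopology Γ)
    (hcocompact : CompactSpace (Quotient (QuotientGroup.rightRel Γ)))
    (htorsionfree : ∀ δ ∈ Γ, IsOfFinOrder δ → δ = 1)
    (γ : SOo l) (hγ : γ ∈ Γ) (hγ1 : γ ≠ 1) (D : GeodesicData Γ γ)
    (dm : MeasureTheory.Measure (M l)) (hdm : dm.IsHaarMeasure)
    (hdm1 : MeasureTheory.IsProbabilityMeasure dm)
    (dz : MeasureTheory.Measure D.cent) (hdz : dz.IsHaarMeasure)
    (hdz1 : MeasureTheory.IsProbabilityMeasure dz)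
    (φ : SOo l → ℂ) (μ r : ℂ) (hφ : IsAutomorphicEigenfunction Γ φ μ)
    (hr : μ = -((((l : ℂ) - 1) / 2) ^ 2 + r ^ 2) / (4 * (((l : ℂ) - 1) / 2))) :
    (DecomposesInto dm (weight D dz φ) μ ∧
      HasSliceFormulas dm D φ (weight D dz φ) μ r) ∧
    (DecomposesInto dm (weightA D φ) μ ∧
      (IntegrandPeriodic D φ → HasSliceFormulas dm D φ (weightA D φ) μ r)) := by
  obtain ⟨n, rfl⟩ : ∃ n, l = n + 2 := ⟨l - 2, by omega⟩
  have hw := isSmoothOnX_weight D dz hφ.smooth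
  have hwA := isSmoothOnX_weightA D hφ.smooth
  refine ⟨⟨decomposesInto dm hw (casimir_weight D dz hφ),
    hasSliceFormulas dm D hφ.smooth hw (casimir_weight D dz hφ) (isLeftAInvariant_weight D dz hφ) ?_ hr⟩,
    decomposesInto dm hwA (casimir_weightA D hφ), fun hp =>
      hasSliceFormulas dm D hφ.smooth hwA (casimir_weightA D hφ) (isLeftAInvariant_weightA D hp)
        (fun _ => rfl) hr⟩
  rintro rfl
  exact weight_two D dz φ
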